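/- Let $k\ge 1$ be an integer, $0<\alpha\le 1$, $0<p<1$, and let $\mathcal D$ be the closed unit disc of the $(u,v)$-plane. **Function spaces.** Near $\partial\mathcal D$ use the flattened coordinates $z=1-r$ and $y=$ polar angle, and the parabolic hyperbolic distance $s=\sqrt{|\ln z_1-\ln z_2|^2+|y_1-y_2|^2}+\sqrt{|t_1-t_2|}$. Let $C^{\alpha}_s$ be the Hölder space for $s$. For a function $f(z,y,t)$ put $f^\circ(y,t)=\lim_{z\to0^+}f(z,y,t)$ and $\|f\|_{C^{\alpha,p}_s}=\|f^\circ\|_{C^\alpha}+\|z^{-p}(f-f^\circ)\|_{C^\alpha_s}$. The norms of $C^{m+\alpha}_s$ and $C^{m+\alpha,p}_s$ are the sums of the $C^\alpha_s$, respectively $C^{\alpha,p}_s$, norms of $z^iD_z^iD_y^jD_t^lf$ over $i+j+2l\le m$. The space $C^{m+\alpha,p}_s(\mathcal D\times[0,\tau])$ consists of the continuous functions on $\mathcal D\times[0,\tau]$ that have continuous derivatives of parabolic order $\le m$ in the interior, are of class $C^{m+\alpha}$ (parabolic) on $\{r<3/4\}\times(0,\tau)$, and in flattened coordinates are of class $C^{m+\alpha,p}_s$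 on $\{0<z<1/2\}\times(0,\tau)$; its norm is the sum of the two norms. $C^{m+\alpha,p}_s(\mathcal D)$ is the subspace of functions constant in $t$. **Initial surface.** Let $\Sigma_0=\partial B$, where $B\subset\{z\ge0\}\subset\mathbb R^3$ is a compact convex set with non-empty interior whose flat side $\Sigma_1=B\cap\{z=0\}$ has non-empty interior in the plane $z=0$. Let $\Gamma$ be the boundary of $\Sigma_1$ in that plane and $\Sigma_2=\Sigma_0\cap\{z>0\}$. Condition $(\star)$: the lower part of $\Sigma_0$ is a graph $z=h(x,y)$ over a neighbourhood of $\Sigma_1$; the function $g=h^p$ is $C^2$ off $\Sigma_1$; $Dg$ and $g_{\tau\tau}$ (the second derivative in the direction tangential to the level sets of $g$) extend continuously to $\Gamma$; and there $|Dg|\ge\lambda$ and $g_{\tau\tau}\ge\lambda$ for some $\lambda>0$. **Coordinates.** Let $S:\mathcal D\to\mathbb R^3$ be smooth up to the boundary, with $S_3=0$ exactly on $\partial\mathcal D$, let $T:\mathcal D\to\mathbb R^3$ be a smooth vector field with $T_3=0$ near $\partial\mathcal D$, and let $\eta>0$ be such that $\Phi(u,v,w)=S(u,v)+wT(u,v)$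 is injective with non-vanishing Jacobian on $\mathcal D\times[-\eta,\eta]$. We say that $\Sigma_0$ is of class $C^{k+2+\alpha,p}_s$ if $\Sigma_2=\{\Phi(u,v,w_0(u,v)):u^2+v^2<1\}$ for some $w_0\in C^{k+2+\alpha,p}_s(\mathcal D)$ with $|w_0|\le\eta$, and $\Sigma_2$ is strictly convex ($K>0$, so that both principal curvatures are positive). **Nonlinearity.** Let $F(u,v,w,Dw,D^2w)=\dfrac{K/H}{\langle T,N\rangle}$, where $K$, $H=\lambda_1+\lambda_2$ and the unit normal $N$ are those of the parametrized surface $(u,v)\mapsto S+wT$, expressed through $w$, $Dw$, $D^2w$. Put $Mw=w_t-F(u,v,w,Dw,D^2w)$. **Theorem.** Assume that $\Sigma_0$ is of class $C^{k+2+\alpha,p}_s$ and satisfies $(\star)$. Then: 1. For every $\tau>0$ and every $w\in C^{k+2+\alpha,p}_s(\mathcal D\times[0,\tau])$ with $|w|\le\eta$ such that the surfaces $\Sigma_2(t)=\{\Phi(u,v,w(u,v,t)):u^2+v^2<1\}$, $0<t<\tau$, have $K>0$, the following are equivalent: * $\Sigma_2(t)$ evolves by the harmonic mean curvature flow (normal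 velocity $K/H$ at every point, $0<t<\tau$) and $\Sigma_2(0)=\Sigma_2$; * $Mw=0$ on $\{u^2+v^2<1\}\times(0,\tau)$ and $w(\cdot,0)=w_0$ on $\mathcal D$. 2. $w_0\in C^{k+2+\alpha,p}_s(\mathcal D)$. 3. There are $\lambda>0$ and $\mu>0$ such that for every $\tau>0$ and every $\bar w\in C^{k+2+\alpha,p}_s(\mathcal D\times[0,\tau])$ with $\|\bar w-w_0\|_{C^{k+2+\alpha,p}_s(\mathcal D\times[0,\tau])}\le\mu$ the linearization $\frac{d}{d\sigma}M(\bar w+\sigma v)|_{\sigma=0}$, computed pointwise in the interior for all $v\in C^{k+2+\alpha,p}_s(\mathcal D\times[0,\tau])$, exists and has the form $v_t-(a^{ij}v_{ij}+b^iv_i+cv)$, where * $a^{ij},b^i,c$ are of class $C^{k+\alpha}$ on $\{r<r_0\}\times(0,\tau)$ for every $r_0<1$, and $a^{ij}\xi_i\xi_j\ge\lambda|\xi|^2$ for $r<3/4$; * for $0<z<1/2$ the flattened coordinates turn $a^{ij}v_{ij}+b^iv_i+cv$ into $z^2\tilde a_{11}\tilde v_{zz}+2z\tilde a_{12}\tilde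 v_{zy}+\tilde a_{22}\tilde v_{yy}+z\tilde b_1\tilde v_z+\tilde b_2\tilde v_y+\tilde c\tilde v$ with $\tilde a_{ij},\tilde b_i,\tilde c\in C^{k+\alpha}_s$, with $\tilde a_{22},\tilde b_2,\tilde c\in C^{k+\alpha,p}_s$, and $\tilde a_{ij}\xi_i\xi_j\ge\lambda|\xi|^2$. -/

import Mathlib

open Set Filter Topology Matrix
open scoped ENNReal ContDiff

noncomputable section

/-- Three-dimensional space.  Lengths and angles are always taken with the dot product, never with
the sup norm. -/
abbrev R3 : Type := Fin 3 → ℝ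

/-! ### Partial derivatives

A map of `(u, v)` is a map on `ℝ × ℝ`; a map of `(t, u, v)` is curried, `f t (u, v)`. -/

section PartialDerivatives

variable {E : Type*} [NormedAddCommGroup E] [NormedSpace ℝ E]

/-- First partial derivative of a map of two variables. -/
def pd1 (f : ℝ × ℝ → E) (q : ℝ × ℝ) : E := deriv (fun s => f (s, q.2)) q.1

/-- Second partial derivative of a map of two variables. -/
def pd2 (f : ℝ × ℝ → E) (q : ℝ × ℝ) : E := deriv (fun s => f (q.1, s)) q.2

/-- Derivative in time. -/
def Dt (f : ℝ → ℝ × ℝ → E) : ℝ → ℝ × ℝ → E := fun t q => deriv (fun s => f s q) t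

/-- Derivative in the first space variable. -/
def D1 (f : ℝ → ℝ × ℝ → E) : ℝ → ℝ × ℝ → E := fun t => pd1 (f t)

/-- Derivative in the second space variable. -/
def D2 (f : ℝ → ℝ × ℝ → E) : ℝ → ℝ × ℝ → E := fun t => pd2 (f t)

/-- `f` has, on the open set `U` of points `(t, (x, y))`, continuous derivatives
`D_x^i D_y^j D_t^l f` for all `i + j + 2 l ≤ m` (in every order of differentiation). -/
def IsParabolicC : ℕ → Set (ℝ × ℝ × ℝ) → (ℝ → ℝ × ℝ → E) → Prop
  | 0, U, f => ContinuousOn (fun P : ℝ × ℝ × ℝ => f P.1 P.2) U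
  | 1, U, f =>
      ContinuousOn (fun P : ℝ × ℝ × ℝ => f P.1 P.2) U ∧
      (∀ P ∈ U, DifferentiableAt ℝ (fun s => f P.1 (s, P.2.2)) P.2.1) ∧
      (∀ P ∈ U, DifferentiableAt ℝ (fun s => f P.1 (P.2.1, s)) P.2.2) ∧
      IsParabolicC 0 U (D1 f) ∧ IsParabolicC 0 U (D2 f)
  | m + 2, U, f =>
      ContinuousOn (fun P : ℝ × ℝ × ℝ => f P.1 P.2) U ∧
      (∀ P ∈ U, DifferentiableAt ℝ (fun s => f P.1 (s, P.2.2)) P.2.1) ∧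
      (∀ P ∈ U, DifferentiableAt ℝ (fun s => f P.1 (P.2.1, s)) P.2.2) ∧
      (∀ P ∈ U, DifferentiableAt ℝ (fun s => f s P.2) P.1) ∧
      IsParabolicC (m + 1) U (D1 f) ∧ IsParabolicC (m + 1) U (D2 f) ∧ IsParabolicC m U (Dt f)

end PartialDerivatives

/-! ### Hölder spaces -/

/-- Parabolic Euclidean distance. -/
def euclideanDist (P P' : ℝ × ℝ × ℝ) : ℝ :=
  Real.sqrt ((P.2.1 - P'.2.1) ^ 2 + (P.2.2 - P'.2.2) ^ 2) + Real.sqrt |P.1 - P'.1|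

/-- Parabolic hyperbolic distance `s`, for points `(t, (z, y))` with `0 < z ≤ 1`:
`√(|ln z₁ - ln z₂|² + |y₁ - y₂|²) + √|t₁ - t₂|`. -/
def hyperbolicDist (P P' : ℝ × ℝ × ℝ) : ℝ :=
  Real.sqrt ((Real.log P.2.1 - Real.log P'.2.1) ^ 2 + (P.2.2 - P'.2.2) ^ 2)
    + Real.sqrt |P.1 - P'.1|

/-- The norm `sup |f| + sup |f(P) - f(P')| / d(P, P')^α` on `U`; it is `∞` when `f` is not in the
Hölder space. -/
def holderNorm (d : ℝ × ℝ × ℝ → ℝ × ℝ × ℝ → ℝ) (α : ℝ) (U : Set (ℝ × ℝ × ℝ))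
    (f : ℝ → ℝ × ℝ → ℝ) : ℝ≥0∞ :=
  (⨆ P ∈ U, ‖f P.1 P.2‖ₑ) +
    ⨆ P ∈ U, ⨆ P' ∈ U, ‖f P.1 P.2 - f P'.1 P'.2‖ₑ / ENNReal.ofReal (d P P' ^ α)

/-- The boundary value `f°(t, y) = lim_{z → 0⁺} f(t, z, y)`, regarded as a function of
`(t, (z, y))` that does not depend on `z`. -/
def boundaryValue (f : ℝ → ℝ × ℝ → ℝ) : ℝ → ℝ × ℝ → ℝ :=
  fun t q => limUnder (𝓝[>] (0 : ℝ)) (fun z => f t (z, q.2))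

/-- The norm of `C_s^{α,p}`: the Hölder norm of `f°` plus the Hölder norm of
`f~ = z^{-p} (f - f°)` in the coordinates `(ln z, y, t)`, that is, with respect to the hyperbolic
distance.  On a function that does not depend on `z` the hyperbolic Hölder norm is the Hölder norm
with respect to `|y - y'| + √|t - t'|`.  If the norm is finite, then `f - f° = O(z^p)`, so that the
limit defining `f°` exists. -/
def holderNormP (p α : ℝ) (U : Set (ℝ × ℝ × ℝ)) (f : ℝ → ℝ × ℝ → ℝ) : ℝ≥0∞ :=
  holderNorm hyperbolicDist α U (boundaryValue f) +
    holderNorm hyperbolicDist α U (fun t q => q.1 ^ (-p) * (f t q - boundaryValue f t q))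

/-- `D_x^i D_y^j D_t^l f`. -/
def mixedD (i j l : ℕ) (f : ℝ → ℝ × ℝ → ℝ) : ℝ → ℝ × ℝ → ℝ := D1^[i] (D2^[j] (Dt^[l] f))

/-- Sum over all multi-indices with `i + j + 2 l ≤ m`. -/
def sumMultiIndex (m : ℕ) (N : ℕ → ℕ → ℕ → ℝ≥0∞) : ℝ≥0∞ :=
  ∑ i ∈ Finset.range (m + 1), ∑ j ∈ Finset.range (m - i + 1),
    ∑ l ∈ Finset.range ((m - i - j) / 2 + 1), N i j l

/-- The classical parabolic norm of `C^{m+α}(U)`. -/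
def classicalNorm (m : ℕ) (α : ℝ) (U : Set (ℝ × ℝ × ℝ)) (f : ℝ → ℝ × ℝ → ℝ) : ℝ≥0∞ :=
  sumMultiIndex m fun i j l => holderNorm euclideanDist α U (mixedD i j l f)

/-- The norm of `C_s^{m+α}(U)`: the Hölder norms, for the hyperbolic distance, of
`z^i D_z^i D_y^j D_t^l f`. -/
def sNorm (m : ℕ) (α : ℝ) (U : Set (ℝ × ℝ × ℝ)) (f : ℝ → ℝ × ℝ → ℝ) : ℝ≥0∞ :=
  sumMultiIndex m fun i j l =>
    holderNorm hyperbolicDist α U (fun t q => q.1 ^ i * mixedD i j l f t q)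

/-- The norm of `C_s^{m+α,p}(U)`: the `C_s^{α,p}` norms of `z^i D_z^i D_y^j D_t^l f`. -/
def spNorm (m : ℕ) (α p : ℝ) (U : Set (ℝ × ℝ × ℝ)) (f : ℝ → ℝ × ℝ → ℝ) : ℝ≥0∞ :=
  sumMultiIndex m fun i j l =>
    holderNormP p α U (fun t q => q.1 ^ i * mixedD i j l f t q)

/-- `f ∈ C^{m+α}(U)`. -/
def MemClassical (m : ℕ) (α : ℝ) (U : Set (ℝ × ℝ × ℝ)) (f : ℝ → ℝ × ℝ → ℝ) : Prop :=
  IsParabolicC m U f ∧ classicalNorm m α U f < ⊤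

/-- `f ∈ C_s^{m+α}(U)`. -/
def MemS (m : ℕ) (α : ℝ) (U : Set (ℝ × ℝ × ℝ)) (f : ℝ → ℝ × ℝ → ℝ) : Prop :=
  IsParabolicC m U f ∧ sNorm m α U f < ⊤

/-- `f ∈ C_s^{m+α,p}(U)`. -/
def MemSP (m : ℕ) (α p : ℝ) (U : Set (ℝ × ℝ × ℝ)) (f : ℝ → ℝ × ℝ → ℝ) : Prop :=
  IsParabolicC m U f ∧ spNorm m α p U f < ⊤

/-! ### The unit disc

The disc is covered by the concentric disc of radius `3/4` and by the collar `1/2 < r ≤ 1`.  The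
boundary is flattened by polar coordinates `z = 1 - r`, `y = ` angle, which serve around all
boundary points at once.  Hölder norms are taken over the interior of the space-time domain:
a Hölder function has only one continuous extension to the closure. -/

/-- The closed unit disc `𝒟`. -/
def closedDisc : Set (ℝ × ℝ) := {q | q.1 ^ 2 + q.2 ^ 2 ≤ 1}

/-- The open disc of radius `r` around the origin. -/
def openDisc (r : ℝ) : Set (ℝ × ℝ) := {q | q.1 ^ 2 + q.2 ^ 2 < r ^ 2}

/-- The chart that flattens the boundary; `z = 0` goes to the unit circle. -/
def polarChart (q : ℝ × ℝ) : ℝ × ℝ := ((1 - q.1) * Real.cos q.2, (1 - q.1) * Real.sin q.2)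

/-- The collar `0 < z < 1/2` in flattened coordinates, times `(0, τ)`. -/
def collar (τ : ℝ) : Set (ℝ × ℝ × ℝ) := Ioo 0 τ ×ˢ (Ioo (0 : ℝ) (1 / 2) ×ˢ univ)

/-- A function on the disc, in flattened coordinates. -/
def flatten (w : ℝ → ℝ × ℝ → ℝ) : ℝ → ℝ × ℝ → ℝ := fun t q => w t (polarChart q)

/-- The norm of `C_s^{m+α,p}(𝒟 × [0, τ])`. -/
def discNorm (m : ℕ) (α p τ : ℝ) (w : ℝ → ℝ × ℝ → ℝ) : ℝ≥0∞ :=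
  classicalNorm m α (Ioo 0 τ ×ˢ openDisc (3 / 4)) w + spNorm m α p (collar τ) (flatten w)

/-- `w ∈ C_s^{m+α,p}(𝒟 × [0, τ])`. -/
def MemDisc (m : ℕ) (α p τ : ℝ) (w : ℝ → ℝ × ℝ → ℝ) : Prop :=
  ContinuousOn (fun P : ℝ × ℝ × ℝ => w P.1 P.2) (Icc 0 τ ×ˢ closedDisc) ∧
    IsParabolicC m (Ioo 0 τ ×ˢ openDisc 1) w ∧ discNorm m α p τ w < ⊤

/-- `w ∈ C_s^{m+α,p}(𝒟)`, for a function of the space variables only: it is regarded as a function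
on `𝒟 × [0, 1]` that is constant in time. -/
def MemDiscStationary (m : ℕ) (α p : ℝ) (w : ℝ × ℝ → ℝ) : Prop :=
  MemDisc m α p 1 (fun _ => w)

/-! ### Degenerate parabolic operators on the disc -/

/-- Coefficients, depending on time and on two space variables, of a linear operator
`L w = w_t - (a₁₁ w₁₁ + 2 a₁₂ w₁₂ + a₂₂ w₂₂ + b₁ w₁ + b₂ w₂ + c w)`. -/
structure LinCoeff where
  a11 : ℝ → ℝ × ℝ → ℝ
  a12 : ℝ → ℝ × ℝ → ℝ
  a22 : ℝ → ℝ × ℝ → ℝ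
  b1 : ℝ → ℝ × ℝ → ℝ
  b2 : ℝ → ℝ × ℝ → ℝ
  c : ℝ → ℝ × ℝ → ℝ

/-- `a₁₁ w₁₁ + 2 a₁₂ w₁₂ + a₂₂ w₂₂ + b₁ w₁ + b₂ w₂ + c w`. -/
def LinCoeff.spatial (A : LinCoeff) (w : ℝ → ℝ × ℝ → ℝ) (t : ℝ) (q : ℝ × ℝ) : ℝ :=
  A.a11 t q * D1 (D1 w) t q + 2 * A.a12 t q * D1 (D2 w) t q + A.a22 t q * D2 (D2 w) t q
    + A.b1 t q * D1 w t q + A.b2 t q * D2 w t q + A.c t q * w t q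

/-- `z² a₁₁ w_zz + 2 z a₁₂ w_zy + a₂₂ w_yy + z b₁ w_z + b₂ w_y + c w`. -/
def LinCoeff.degenerate (A : LinCoeff) (w : ℝ → ℝ × ℝ → ℝ) (t : ℝ) (q : ℝ × ℝ) : ℝ :=
  q.1 ^ 2 * A.a11 t q * D1 (D1 w) t q + 2 * q.1 * A.a12 t q * D1 (D2 w) t q
    + A.a22 t q * D2 (D2 w) t q + q.1 * A.b1 t q * D1 w t q + A.b2 t q * D2 w t q
    + A.c t q * w t q

/-- The matrix `(a_ij)` is bounded below by `lam` on `U`. -/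
def LinCoeff.EllipticOn (A : LinCoeff) (lam : ℝ) (U : Set (ℝ × ℝ × ℝ)) : Prop :=
  ∀ P ∈ U, ∀ x y : ℝ, lam * (x ^ 2 + y ^ 2) ≤
    A.a11 P.1 P.2 * x ^ 2 + 2 * A.a12 P.1 P.2 * (x * y) + A.a22 P.1 P.2 * y ^ 2

/-- The conditions on the operator `w_t - (a^{ij} w_ij + b^i w_i + c w)` on `𝒟 × [0, τ]`, with
ellipticity constant `lam`: the coefficients are of class `C^{k+α}` in the interior of the disc and
the operator is uniformly elliptic there; flattening the boundary turns the operator into a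
degenerate one whose coefficients are in `C_s^{k+α}`, with `a₂₂`, `b₂`, `c` in `C_s^{k+α,p}`, and
whose matrix is uniformly elliptic. -/
def IsDegenerateParabolic (k : ℕ) (α p τ lam : ℝ) (A : LinCoeff) : Prop :=
  (∀ r : ℝ, 0 < r → r < 1 →
    MemClassical k α (Ioo 0 τ ×ˢ openDisc r) A.a11 ∧
    MemClassical k α (Ioo 0 τ ×ˢ openDisc r) A.a12 ∧
    MemClassical k α (Ioo 0 τ ×ˢ openDisc r) A.a22 ∧
    MemClassical k α (Ioo 0 τ ×ˢ openDisc r) A.b1 ∧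
    MemClassical k α (Ioo 0 τ ×ˢ openDisc r) A.b2 ∧
    MemClassical k α (Ioo 0 τ ×ˢ openDisc r) A.c) ∧
  A.EllipticOn lam (Ioo 0 τ ×ˢ openDisc (3 / 4)) ∧
  ∃ A' : LinCoeff,
    (∀ v : ℝ × ℝ → ℝ, ContDiffOn ℝ 2 v (openDisc 1) → ∀ P ∈ collar τ,
      A.spatial (fun _ => v) P.1 (polarChart P.2)
        = A'.degenerate (flatten fun _ => v) P.1 P.2) ∧
    MemS k α (collar τ) A'.a11 ∧ MemS k α (collar τ) A'.a12 ∧ MemS k α (collar τ) A'.a22 ∧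
    MemS k α (collar τ) A'.b1 ∧ MemS k α (collar τ) A'.b2 ∧ MemS k α (collar τ) A'.c ∧
    MemSP k α p (collar τ) A'.a22 ∧ MemSP k α p (collar τ) A'.b2 ∧
    MemSP k α p (collar τ) A'.c ∧
    A'.EllipticOn lam (collar τ)

/-- The type of a nonlinearity `F(t, (u, v), w, (w₁, w₂), (w₁₁, w₁₂, w₂₂))`. -/
abbrev Nonlinearity : Type := ℝ → ℝ × ℝ → ℝ → ℝ × ℝ → ℝ × ℝ × ℝ → ℝ

/-- The operator `M w = w_t - F(t, u, v, w, Dw, D²w)`. -/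
def nonlinearOp (F : Nonlinearity) (w : ℝ → ℝ × ℝ → ℝ) (t : ℝ) (q : ℝ × ℝ) : ℝ :=
  Dt w t q - F t q (w t q) (D1 w t q, D2 w t q)
    (D1 (D1 w) t q, D1 (D2 w) t q, D2 (D2 w) t q)

/-- The operator with coefficients `A` is the linearization `DM(w)` of `M`:
`d/ds M(w + s v) = v_t - (a^{ij} v_ij + b^i v_i + c v)` at `s = 0`, for every direction `v` in
`C_s^{m+α,p}(𝒟 × [0, τ])`, at every interior point. -/
def IsLinearizationAt (m : ℕ) (α p τ : ℝ) (F : Nonlinearity) (w : ℝ → ℝ × ℝ → ℝ)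
    (A : LinCoeff) : Prop :=
  ∀ v : ℝ → ℝ × ℝ → ℝ, MemDisc m α p τ v → ∀ t ∈ Ioo 0 τ, ∀ q ∈ openDisc 1,
    HasDerivAt (fun s : ℝ => nonlinearOp F (fun t' q' => w t' q' + s * v t' q') t q)
      (Dt v t q - A.spatial v t q) 0

/-- At every `w ∈ C_s^{k+2+α,p}(𝒟 × [0, τ])` with `‖w - w₀‖ ≤ μ`, the linearization of
`M w = w_t - F(t, u, v, w, Dw, D²w)` exists and satisfies the conditions on linear operators, with
ellipticity constant `lam`. -/
def LinearizationAdmissible (k : ℕ) (α p τ lam μ : ℝ) (F : Nonlinearity) (w₀ : ℝ × ℝ → ℝ) :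
    Prop :=
  ∀ w : ℝ → ℝ × ℝ → ℝ, MemDisc (k + 2) α p τ w →
    discNorm (k + 2) α p τ (fun t q => w t q - w₀ q) ≤ ENNReal.ofReal μ →
    ∃ A : LinCoeff, IsLinearizationAt (k + 2) α p τ F w A ∧ IsDegenerateParabolic k α p τ lam A

/-! ### Curvature and harmonic mean curvature flow -/

/-- Unit normal of a parametrized surface, from its first derivatives. -/
def unitNormal (Xu Xv : R3) : R3 :=
  (Real.sqrt ((Xu ⨯₃ Xv) ⬝ᵥ (Xu ⨯₃ Xv)))⁻¹ • (Xu ⨯₃ Xv)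

/-- Gauss curvature `K = λ₁ λ₂` of a parametrized surface. -/
def gaussCurv (Xu Xv Xuu Xuv Xvv : R3) : ℝ :=
  ((Xuu ⬝ᵥ unitNormal Xu Xv) * (Xvv ⬝ᵥ unitNormal Xu Xv) - (Xuv ⬝ᵥ unitNormal Xu Xv) ^ 2) /
    ((Xu ⬝ᵥ Xu) * (Xv ⬝ᵥ Xv) - (Xu ⬝ᵥ Xv) ^ 2)

/-- Mean curvature `H = λ₁ + λ₂` of a parametrized surface, with respect to `unitNormal`. -/
def meanCurv (Xu Xv Xuu Xuv Xvv : R3) : ℝ :=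
  ((Xu ⬝ᵥ Xu) * (Xvv ⬝ᵥ unitNormal Xu Xv) - 2 * (Xu ⬝ᵥ Xv) * (Xuv ⬝ᵥ unitNormal Xu Xv)
      + (Xv ⬝ᵥ Xv) * (Xuu ⬝ᵥ unitNormal Xu Xv)) /
    ((Xu ⬝ᵥ Xu) * (Xv ⬝ᵥ Xv) - (Xu ⬝ᵥ Xv) ^ 2)

/-- Gauss curvature of the surface `Y t` at the parameter `q`. -/
def gaussCurvAt (Y : ℝ → ℝ × ℝ → R3) (t : ℝ) (q : ℝ × ℝ) : ℝ :=
  gaussCurv (D1 Y t q) (D2 Y t q) (D1 (D1 Y) t q) (D1 (D2 Y) t q) (D2 (D2 Y) t q)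

/-- Mean curvature of the surface `Y t` at the parameter `q`. -/
def meanCurvAt (Y : ℝ → ℝ × ℝ → R3) (t : ℝ) (q : ℝ × ℝ) : ℝ :=
  meanCurv (D1 Y t q) (D2 Y t q) (D1 (D1 Y) t q) (D1 (D2 Y) t q) (D2 (D2 Y) t q)

/-- The moving surface `A t`, `t ∈ I`, is strictly convex (`K > 0`) and evolves by the harmonic
mean curvature flow: near each of its points it has a regular parametrization `Y`, of class `C²` in
space and `C¹` in time, whose velocity has normal component `K / H`.  The equation
`⟨Y_t, N⟩ = K / H` does not change if `N` is replaced by `-N`, because `H` changes sign too. -/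
def SolvesHMCF (A : ℝ → Set R3) (I : Set ℝ) : Prop :=
  ∀ t₀ ∈ I, ∀ P₀ ∈ A t₀, ∃ (Y : ℝ → ℝ × ℝ → R3) (q₀ : ℝ × ℝ),
    Y t₀ q₀ = P₀ ∧
    (∀ᶠ z in 𝓝 (t₀, q₀), Y z.1 z.2 ∈ A z.1) ∧
    (∀ V ∈ 𝓝 q₀, ∀ᶠ z in 𝓝 (t₀, P₀), z.2 ∈ A z.1 → ∃ q ∈ V, Y z.1 q = z.2) ∧
    (∃ U : Set (ℝ × ℝ × ℝ), IsOpen U ∧ (t₀, q₀) ∈ U ∧ IsParabolicC 2 U Y) ∧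
    D1 Y t₀ q₀ ⨯₃ D2 Y t₀ q₀ ≠ 0 ∧
    0 < gaussCurvAt Y t₀ q₀ ∧
    Dt Y t₀ q₀ ⬝ᵥ unitNormal (D1 Y t₀ q₀) (D2 Y t₀ q₀) = gaussCurvAt Y t₀ q₀ / meanCurvAt Y t₀ q₀

/-! ### The initial surface

The weakly convex surface `Σ₀` is the boundary of a convex body `B` in the half space `z ≥ 0`. -/

/-- The flat side of `∂B` in the plane `z = 0`, as a set in the `(x, y)`-plane. -/
def flatSide (B : Set R3) : Set (ℝ × ℝ) := {q | ![q.1, q.2, 0] ∈ B}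

/-- The part `Σ₂` of the surface `Σ₀ = ∂B` above the plane `z = 0`. -/
def upperPart (B : Set R3) : Set R3 := {P | P ∈ frontier B ∧ 0 < P 2}

/-- `B` is a convex body in `z ≥ 0` whose boundary has a flat side in the plane `z = 0`. -/
structure IsConvexBodyWithFlatSide (B : Set R3) : Prop where
  isCompact : IsCompact B
  convex : Convex ℝ B
  interior_nonempty : (interior B).Nonempty
  half_space : ∀ P ∈ B, 0 ≤ P 2
  flat_nonempty : (interior (flatSide B)).Nonempty

/-- Projection of `B` to the `(x, y)`-plane. -/
def shadow (B : Set R3) : Set (ℝ × ℝ) := {q | ∃ z : ℝ, ![q.1, q.2, z] ∈ B}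

/-- The function `h` whose graph is the lower part of `∂B`. -/
def lowerGraph (B : Set R3) (q : ℝ × ℝ) : ℝ := sInf {z : ℝ | ![q.1, q.2, z] ∈ B}

/-- `g = h^p`. -/
def pressure (p : ℝ) (B : Set R3) (q : ℝ × ℝ) : ℝ := lowerGraph B q ^ p

/-- Second derivative `g_ττ` in the direction tangential to the level sets of `g`, that is, in the
direction of the unit vector `τ = (-g_y, g_x) / |Dg|`. -/
def tangentialSecondDeriv (g : ℝ × ℝ → ℝ) (q : ℝ × ℝ) : ℝ :=
  (pd1 (pd1 g) q * pd2 g q ^ 2 - 2 * pd1 (pd2 g) q * pd1 g q * pd2 g q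
      + pd2 (pd2 g) q * pd1 g q ^ 2) / (pd1 g q ^ 2 + pd2 g q ^ 2)

/-- The non-degeneracy condition: the lower part of `∂B` is a graph around the flat side, `g` is
`C²` off the flat side, and `Dg` and `g_ττ` extend continuously to the boundary `Γ` of the flat
side, with `|Dg| ≥ lam` and `g_ττ ≥ lam` on `Γ`, for some `lam > 0`. -/
def NonDegenerate (p : ℝ) (B : Set R3) : Prop :=
  ∃ U : Set (ℝ × ℝ), IsOpen U ∧ flatSide B ⊆ U ∧ U ⊆ shadow B ∧
    ContDiffOn ℝ 2 (pressure p B) (U \ flatSide B) ∧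
    ∃ lam : ℝ, 0 < lam ∧ ∀ P ∈ frontier (flatSide B), ∃ d₁ d₂ e : ℝ,
      Tendsto (pd1 (pressure p B)) (𝓝[(flatSide B)ᶜ] P) (𝓝 d₁) ∧
      Tendsto (pd2 (pressure p B)) (𝓝[(flatSide B)ᶜ] P) (𝓝 d₂) ∧
      Tendsto (tangentialSecondDeriv (pressure p B)) (𝓝[(flatSide B)ᶜ] P) (𝓝 e) ∧
      lam ≤ Real.sqrt (d₁ ^ 2 + d₂ ^ 2) ∧ lam ≤ e

/-! ### The global change of coordinates -/

/-- `Φ(u, v, w) = S(u, v) + w T(u, v)`. -/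
def coordChange (S T : ℝ × ℝ → R3) (q : ℝ × ℝ) (w : ℝ) : R3 := S q + w • T q

/-- `S` parametrizes a smooth surface over the closed disc, the unit circle corresponding to its
points in the plane `z = 0`; `T` is a smooth transverse field, horizontal near the circle; `Φ` is a
change of coordinates on `𝒟 × [-η, η]`: it is injective and its Jacobian does not vanish.  A map
that is smooth up to the boundary of the disc is the restriction of a smooth map of the plane. -/
structure IsCoordChange (S T : ℝ × ℝ → R3) (η : ℝ) : Prop where
  smooth_S : ContDiff ℝ ∞ S
  smooth_T : ContDiff ℝ ∞ T
  η_pos : 0 < η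
  boundary : ∀ q ∈ closedDisc, S q 2 = 0 ↔ q.1 ^ 2 + q.2 ^ 2 = 1
  horizontal : ∃ δ : ℝ, 0 < δ ∧ δ < 1 ∧ ∀ q ∈ closedDisc \ openDisc (1 - δ), T q 2 = 0
  injective : InjOn (fun z : (ℝ × ℝ) × ℝ => coordChange S T z.1 z.2) (closedDisc ×ˢ Icc (-η) η)
  jacobian : ∀ q ∈ closedDisc, ∀ w ∈ Icc (-η) η,
    (pd1 (fun q' => coordChange S T q' w) q ⨯₃ pd2 (fun q' => coordChange S T q' w) q)
      ⬝ᵥ T q ≠ 0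

/-- The moving surface with coordinate function `w`, parametrized by the disc:
`(t, u, v) ↦ Φ(u, v, w(t, u, v))`. -/
def graphMap (S T : ℝ × ℝ → R3) (w : ℝ → ℝ × ℝ → ℝ) (t : ℝ) (q : ℝ × ℝ) : R3 :=
  coordChange S T q (w t q)

/-- The surface at time `t` with coordinate function `w`, over the open disc. -/
def graphSurface (S T : ℝ × ℝ → R3) (w : ℝ → ℝ × ℝ → ℝ) (t : ℝ) : Set R3 :=
  graphMap S T w t '' openDisc 1

/-- The nonlinearity `F` of the flow in the coordinates `Φ`: `K / H` divided by `⟨T, N⟩`, where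
`K`, `H`, `N` belong to the surface `S + w T` and are expressed through `w`, `Dw`, `D²w`. -/
def hmcfNonlinearity (S T : ℝ × ℝ → R3) : Nonlinearity := fun _ q w d e =>
  let Xu := pd1 S q + w • pd1 T q + d.1 • T q
  let Xv := pd2 S q + w • pd2 T q + d.2 • T q
  let Xuu := pd1 (pd1 S) q + w • pd1 (pd1 T) q + (2 * d.1) • pd1 T q + e.1 • T q
  let Xuv := pd1 (pd2 S) q + w • pd1 (pd2 T) q + d.1 • pd2 T q + d.2 • pd1 T q + e.2.1 • T q
  let Xvv := pd2 (pd2 S) q + w • pd2 (pd2 T) q + (2 * d.2) • pd2 T q + e.2.2 • T q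
  gaussCurv Xu Xv Xuu Xuv Xvv / meanCurv Xu Xv Xuu Xuv Xvv / (T q ⬝ᵥ unitNormal Xu Xv)

/-- The surface `Σ₀ = ∂B` is of class `C_s^{m+α,p}`, with coordinate function `w₀`: its part above
the plane `z = 0` is the graph of `w₀ ∈ C_s^{m+α,p}(𝒟)` in the coordinates `Φ`, and is strictly
convex, `K > 0`.  (As `B` is convex, this means that both principal curvatures are positive.) -/
structure IsOfHolderClass (m : ℕ) (α p : ℝ) (B : Set R3) (S T : ℝ × ℝ → R3) (η : ℝ)
    (w₀ : ℝ × ℝ → ℝ) : Prop where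
  bound : ∀ q ∈ closedDisc, |w₀ q| ≤ η
  graph : graphSurface S T (fun _ => w₀) 0 = upperPart B
  regular : MemDiscStationary m α p w₀
  strictlyConvex : ∀ q ∈ openDisc 1, 0 < gaussCurvAt (graphMap S T fun _ => w₀) 0 q

end

/-! The difficulty is entirely at the boundary circle. In flattened coordinates a function of
`C_s^{k+2+α,p}` behaves like `w° + z^p w~`, so `w_z` blows up like `z^{p-1}`, while the curvatures
of the surface are rational expressions in `w`, `Dw`, `D²w`. The remedy is to pass to the normalized
jet `(w, w_y, w_yy, z^{1-p} w_z, z^{1-p} w_zy, z^{2-p} w_zz)`. All six entries are Hölder for the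
hyperbolic distance: a function `f` with boundary values in the `C^{α,p}` sense, for which `z f_z`
also has boundary values, has `(z f_z)° = 0`, so that `z^{-p} z f_z` is Hölder
(`boundaryValue_mul_D1`, `Cls.rpow_neg_mul_D1`, `cls_polarJet`).

Since `K / H / ⟨T, N⟩` does not depend on the parametrization (`geoVal_reparam`), it can be computed
in either chart, and after cancelling powers of `z` it is a rational function `nfVal` of the
normalized jet and of a frame of Hölder coefficients. The cancellation uses that `S` and `T` are
horizontal along the circle: the third components of `S_y`, `S_yy`, `T`, `T_y`, `T_yy` are divisible
by `z`, which pays for the singular factor `w_z` (`geo_eq_nf`). Division with remainder gives `nfVal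
= nfVal0 + z^p nfVal1` (`nfVal_eq`), where `nfVal0` sees only `w, w_y, w_yy`. Differentiating this
identity yields exactly the required operator (`exists_coeffs`): normal derivatives of the direction
come only from `z^p nfVal1` and so carry the weights `z² v_zz`, `z v_zy`, `z v_z`, while the
coefficients of `v_yy`, `v_y`, `v` are a `C^{α,p}` function plus `z^p` times a Hölder function,
hence again `C^{α,p}`. Interior regularity is glued from the disc of radius `3/4` and annuli, on
which the two kinds of Hölder norms are comparable (`cls_disc_of_collar`).

The principal part is the first fundamental form evaluated on a linear image of the covector, the
linear map having the normalized determinant of the second fundamental form as its determinant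
(`hasDerivAt_nfVal_second`, `nfForm_pos`). Thus ellipticity holds on the open set `nfGood` of jets
and frames with nonzero Jacobian, trace and determinants. The jets of `w₀` stay in a compact subset
of `nfGood` (`IsOfHolderClass.exists_isCompact`); a thickening of it gives `λ` and `μ`, both
independent of `τ`.

That the limits of these jets at the circle are still in `nfGood` is where condition `(⋆)` enters
(`BoundaryPoint.mem_nfGood`). Differentiating `g = (height)^p` along the surface, the first
derivatives force the limit `L` of `z^{1-p} w_z` to be nonzero; the Hölder bound in `ln z` forces `z
D_z (z^{1-p} w_z) → 0`, so `z^{2-p} w_zz → -(1-p) L ≠ 0`; and the second derivatives along level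
curves, with `g_ττ > 0`, make the tangential entry of the second fundamental form nonzero.

The equivalence with the flow is geometric. The graph over the disc moves with velocity `w_t T`, and
`⟨w_t T, N⟩ = K / H` says `M w = 0`. Any other admissible local parametrization of the moving
surface factors through the graph by the inverse of `Φ`, and the normal velocity equation is
invariant under such time-dependent reparametrization (`normal_velocity_reparam`, `solvesHMCF_iff`).
-/

noncomputable section

/-! ### Partial derivatives on open sets of space-time -/

section Slices

variable {E : Type*} {U : Set (ℝ × ℝ × ℝ)}

theorem IsOpen.eventually_slice_time (hU : IsOpen U) {P : ℝ × ℝ × ℝ} (hP : P ∈ U) :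
    ∀ᶠ s in 𝓝 P.1, (s, P.2) ∈ U :=
  (by fun_prop : Continuous fun s : ℝ => (s, P.2)).continuousAt.eventually (hU.mem_nhds hP)

theorem IsOpen.eventually_slice_fst (hU : IsOpen U) {P : ℝ × ℝ × ℝ} (hP : P ∈ U) :
    ∀ᶠ s in 𝓝 P.2.1, (P.1, s, P.2.2) ∈ U :=
  (by fun_prop : Continuous fun s : ℝ => (P.1, s, P.2.2)).continuousAt.eventually
    (hU.mem_nhds hP)

theorem IsOpen.eventually_slice_snd (hU : IsOpen U) {P : ℝ × ℝ × ℝ} (hP : P ∈ U) :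
    ∀ᶠ s in 𝓝 P.2.2, (P.1, P.2.1, s) ∈ U :=
  (by fun_prop : Continuous fun s : ℝ => (P.1, P.2.1, s)).continuousAt.eventually
    (hU.mem_nhds hP)

theorem IsOpen.eventually_slice_space (hU : IsOpen U) {P : ℝ × ℝ × ℝ} (hP : P ∈ U) :
    ∀ᶠ q in 𝓝 P.2, (P.1, q) ∈ U :=
  (by fun_prop : Continuous fun q : ℝ × ℝ => (P.1, q)).continuousAt.eventually
    (hU.mem_nhds hP)

variable [NormedAddCommGroup E] [NormedSpace ℝ E] {f g : ℝ → ℝ × ℝ → E}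

theorem D1_congr (hU : IsOpen U) (h : ∀ P ∈ U, f P.1 P.2 = g P.1 P.2) :
    ∀ P ∈ U, D1 f P.1 P.2 = D1 g P.1 P.2 := fun P hP =>
  EventuallyEq.deriv_eq <| (hU.eventually_slice_fst hP).mono fun s hs => h (P.1, s, P.2.2) hs

theorem D2_congr (hU : IsOpen U) (h : ∀ P ∈ U, f P.1 P.2 = g P.1 P.2) :
    ∀ P ∈ U, D2 f P.1 P.2 = D2 g P.1 P.2 := fun P hP =>
  EventuallyEq.deriv_eq <| (hU.eventually_slice_snd hP).mono fun s hs => h (P.1, P.2.1, s) hs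

theorem Dt_congr (hU : IsOpen U) (h : ∀ P ∈ U, f P.1 P.2 = g P.1 P.2) :
    ∀ P ∈ U, Dt f P.1 P.2 = Dt g P.1 P.2 := fun P hP =>
  EventuallyEq.deriv_eq <| (hU.eventually_slice_time hP).mono fun s hs => h (s, P.2) hs

theorem diff1_congr (hU : IsOpen U) (h : ∀ P ∈ U, f P.1 P.2 = g P.1 P.2) {P : ℝ × ℝ × ℝ}
    (hP : P ∈ U) (hf : DifferentiableAt ℝ (fun s => f P.1 (s, P.2.2)) P.2.1) :
    DifferentiableAt ℝ (fun s => g P.1 (s, P.2.2)) P.2.1 :=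
  hf.congr_of_eventuallyEq <|
    (hU.eventually_slice_fst hP).mono fun s hs => (h (P.1, s, P.2.2) hs).symm

theorem diff2_congr (hU : IsOpen U) (h : ∀ P ∈ U, f P.1 P.2 = g P.1 P.2) {P : ℝ × ℝ × ℝ}
    (hP : P ∈ U) (hf : DifferentiableAt ℝ (fun s => f P.1 (P.2.1, s)) P.2.2) :
    DifferentiableAt ℝ (fun s => g P.1 (P.2.1, s)) P.2.2 :=
  hf.congr_of_eventuallyEq <|
    (hU.eventually_slice_snd hP).mono fun s hs => (h (P.1, P.2.1, s) hs).symm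

theorem difft_congr (hU : IsOpen U) (h : ∀ P ∈ U, f P.1 P.2 = g P.1 P.2) {P : ℝ × ℝ × ℝ}
    (hP : P ∈ U) (hf : DifferentiableAt ℝ (fun s => f s P.2) P.1) :
    DifferentiableAt ℝ (fun s => g s P.2) P.1 :=
  hf.congr_of_eventuallyEq <|
    (hU.eventually_slice_time hP).mono fun s hs => (h (s, P.2) hs).symm

end Slices

/-! ### Function algebras and the recursive classes of differentiable functions over them. -/

/-- Real functions of `(t, (x, y))`, curried. -/
abbrev STFn : Type := ℝ → ℝ × ℝ → ℝ

/-- A class of functions on `U` that is closed under the operations of a rational calculus. -/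
structure FnAlg (U : Set (ℝ × ℝ × ℝ)) (C : STFn → Prop) : Prop where
  congr : ∀ {f g : STFn}, (∀ P ∈ U, f P.1 P.2 = g P.1 P.2) → C f → C g
  const : ∀ c : ℝ, C fun _ _ => c
  add : ∀ {f g : STFn}, C f → C g → C fun t q => f t q + g t q
  mul : ∀ {f g : STFn}, C f → C g → C fun t q => f t q * g t q
  inv : ∀ {f : STFn}, C f → (∃ c : ℝ, 0 < c ∧ ∀ P ∈ U, c ≤ |f P.1 P.2|) →
    C fun t q => (f t q)⁻¹

namespace FnAlg

variable {U : Set (ℝ × ℝ × ℝ)} {C : STFn → Prop}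

theorem neg (h : FnAlg U C) {f : STFn} (hf : C f) : C fun t q => -f t q :=
  h.congr (fun P _ => by ring) (h.mul (h.const (-1)) hf)

theorem sub (h : FnAlg U C) {f g : STFn} (hf : C f) (hg : C g) : C fun t q => f t q - g t q :=
  h.congr (fun P _ => by ring) (h.add hf (h.neg hg))

theorem cmul (h : FnAlg U C) (c : ℝ) {f : STFn} (hf : C f) : C fun t q => c * f t q :=
  h.mul (h.const c) hf

end FnAlg

/-- Functions `f` on `U` whose derivatives `(ρ D_x)^i D_y^j D_t^l f`, `i + j + 2 l ≤ m`, exist, are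
continuous and belong to the class `B`. -/
def Cls (ρ : ℝ × ℝ → ℝ) (U : Set (ℝ × ℝ × ℝ)) (B : STFn → Prop) : ℕ → STFn → Prop
  | 0, f => ContinuousOn (fun P : ℝ × ℝ × ℝ => f P.1 P.2) U ∧ B f
  | 1, f =>
      ContinuousOn (fun P : ℝ × ℝ × ℝ => f P.1 P.2) U ∧
      (∀ P ∈ U, DifferentiableAt ℝ (fun s => f P.1 (s, P.2.2)) P.2.1) ∧
      (∀ P ∈ U, DifferentiableAt ℝ (fun s => f P.1 (P.2.1, s)) P.2.2) ∧
      B f ∧ Cls ρ U B 0 (fun t q => ρ q * D1 f t q) ∧ Cls ρ U B 0 (D2 f)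
  | m + 2, f =>
      ContinuousOn (fun P : ℝ × ℝ × ℝ => f P.1 P.2) U ∧
      (∀ P ∈ U, DifferentiableAt ℝ (fun s => f P.1 (s, P.2.2)) P.2.1) ∧
      (∀ P ∈ U, DifferentiableAt ℝ (fun s => f P.1 (P.2.1, s)) P.2.2) ∧
      (∀ P ∈ U, DifferentiableAt ℝ (fun s => f s P.2) P.1) ∧
      B f ∧ Cls ρ U B (m + 1) (fun t q => ρ q * D1 f t q) ∧ Cls ρ U B (m + 1) (D2 f) ∧
      Cls ρ U B m (Dt f)

section ClsBasic

variable {ρ : ℝ × ℝ → ℝ} {U : Set (ℝ × ℝ × ℝ)} {B : STFn → Prop} {m : ℕ} {f g : STFn}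

/-- A time derivative costs two orders, so the recursion branches at 0, 1 and `m + 2`. This form
unifies the last two branches: the time clause is empty when `m = 0`. Closure properties are then
proved by strong induction, with a single successor step. -/
theorem cls_succ : Cls ρ U B (m + 1) f ↔
    ContinuousOn (fun P : ℝ × ℝ × ℝ => f P.1 P.2) U ∧
    (∀ P ∈ U, DifferentiableAt ℝ (fun s => f P.1 (s, P.2.2)) P.2.1) ∧
    (∀ P ∈ U, DifferentiableAt ℝ (fun s => f P.1 (P.2.1, s)) P.2.2) ∧
    B f ∧ Cls ρ U B m (fun t q => ρ q * D1 f t q) ∧ Cls ρ U B m (D2 f) ∧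
    ∀ n, m = n + 1 →
      (∀ P ∈ U, DifferentiableAt ℝ (fun s => f s P.2) P.1) ∧ Cls ρ U B n (Dt f) := by
  rcases m with _ | m
  · simp [Cls]
  · simp only [Cls, Nat.add_right_cancel_iff]
    constructor
    · rintro ⟨h1, h2, h3, h4, h5, h6, h7, h8⟩
      exact ⟨h1, h2, h3, h5, h6, h7, fun n hn => hn ▸ ⟨h4, h8⟩⟩
    · rintro ⟨h1, h2, h3, h5, h6, h7, h8⟩
      exact ⟨h1, h2, h3, (h8 m rfl).1, h5, h6, h7, (h8 m rfl).2⟩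

theorem Cls.continuousOn (h : Cls ρ U B m f) :
    ContinuousOn (fun P : ℝ × ℝ × ℝ => f P.1 P.2) U := by
  rcases m with _ | m
  · exact h.1
  · exact (cls_succ.1 h).1

theorem Cls.base (h : Cls ρ U B m f) : B f := by
  rcases m with _ | m
  · exact h.2
  · exact (cls_succ.1 h).2.2.2.1

theorem Cls.diff1 (h : Cls ρ U B (m + 1) f) {P : ℝ × ℝ × ℝ} (hP : P ∈ U) :
    DifferentiableAt ℝ (fun s => f P.1 (s, P.2.2)) P.2.1 := (cls_succ.1 h).2.1 P hP

theorem Cls.diff2 (h : Cls ρ U B (m + 1) f) {P : ℝ × ℝ × ℝ} (hP : P ∈ U) :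
    DifferentiableAt ℝ (fun s => f P.1 (P.2.1, s)) P.2.2 := (cls_succ.1 h).2.2.1 P hP

theorem Cls.difft (h : Cls ρ U B (m + 2) f) {P : ℝ × ℝ × ℝ} (hP : P ∈ U) :
    DifferentiableAt ℝ (fun s => f s P.2) P.1 := h.2.2.2.1 P hP

theorem Cls.D1 (h : Cls ρ U B (m + 1) f) : Cls ρ U B m (fun t q => ρ q * D1 f t q) :=
  (cls_succ.1 h).2.2.2.2.1

theorem Cls.D2 (h : Cls ρ U B (m + 1) f) : Cls ρ U B m (D2 f) :=
  (cls_succ.1 h).2.2.2.2.2.1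

theorem Cls.Dt (h : Cls ρ U B (m + 2) f) : Cls ρ U B m (Dt f) := h.2.2.2.2.2.2.2

theorem Cls.of_succ (h : Cls ρ U B (m + 1) f) : Cls ρ U B m f := by
  induction m using Nat.strong_induction_on generalizing f with
  | _ m ih =>
    rcases m with _ | m
    · exact ⟨h.continuousOn, h.base⟩
    · obtain ⟨h1, h2, h3, h4, h5, h6, h7⟩ := cls_succ.1 h
      refine cls_succ.2 ⟨h1, h2, h3, h4, ih m (by omega) h5, ih m (by omega) h6, ?_⟩
      rintro n rfl
      exact ⟨(h7 _ rfl).1, ih n (by omega) (h7 _ rfl).2⟩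

theorem Cls.of_le {n : ℕ} (h : Cls ρ U B m f) (hn : n ≤ m) : Cls ρ U B n f := by
  induction m, hn using Nat.le_induction with
  | base => exact h
  | succ k _ ih => exact ih h.of_succ

theorem Cls.congr (hU : IsOpen U)
    (hB : ∀ {f g : STFn}, (∀ P ∈ U, f P.1 P.2 = g P.1 P.2) → B f → B g)
    (hfg : ∀ P ∈ U, f P.1 P.2 = g P.1 P.2) (h : Cls ρ U B m f) : Cls ρ U B m g := by
  induction m using Nat.strong_induction_on generalizing f g with
  | _ m ih =>
    have hc : ContinuousOn (fun P : ℝ × ℝ × ℝ => g P.1 P.2) U :=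
      h.continuousOn.congr fun P hP => (hfg P hP).symm
    rcases m with _ | m
    · exact ⟨hc, hB hfg h.base⟩
    · obtain ⟨h1, h2, h3, h4, h5, h6, h7⟩ := cls_succ.1 h
      refine cls_succ.2 ⟨hc, fun P hP => diff1_congr hU hfg hP (h2 P hP),
        fun P hP => diff2_congr hU hfg hP (h3 P hP), hB hfg h4,
        ih m (by omega) (fun P hP => by rw [D1_congr hU hfg P hP]) h5,
        ih m (by omega) (D2_congr hU hfg) h6, ?_⟩
      rintro n rfl
      exact ⟨fun P hP => difft_congr hU hfg hP ((h7 n rfl).1 P hP),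
        ih n (by omega) (Dt_congr hU hfg) (h7 n rfl).2⟩

/-- Restriction to a smaller set, with a larger base class. -/
theorem Cls.mono {V : Set (ℝ × ℝ × ℝ)} {B' : STFn → Prop} (hV : V ⊆ U)
    (hB : ∀ f : STFn, B f → B' f) (h : Cls ρ U B m f) : Cls ρ V B' m f := by
  induction m using Nat.strong_induction_on generalizing f with
  | _ m ih =>
    rcases m with _ | m
    · exact ⟨h.1.mono hV, hB _ h.2⟩
    · obtain ⟨h1, h2, h3, h4, h5, h6, h7⟩ := cls_succ.1 h
      refine cls_succ.2 ⟨h1.mono hV, fun P hP => h2 P (hV hP), fun P hP => h3 P (hV hP), hB _ h4,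
        ih m (by omega) h5, ih m (by omega) h6, ?_⟩
      rintro n rfl
      exact ⟨fun P hP => (h7 n rfl).1 P (hV hP), ih n (by omega) (h7 n rfl).2⟩

end ClsBasic

section ClsAlg

variable {ρ : ℝ × ℝ → ℝ} {U : Set (ℝ × ℝ × ℝ)} {B : STFn → Prop} {m : ℕ} {f g : STFn}

theorem Cls.const' (hB : FnAlg U B) (c : ℝ) : Cls ρ U B m (fun _ _ => c) := by
  induction m using Nat.strong_induction_on generalizing c with
  | _ m ih =>
    rcases m with _ | m
    · exact ⟨continuousOn_const, hB.const c⟩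
    · have e1 : (fun t q => ρ q * _root_.D1 (fun _ _ => c) t q : STFn) = fun _ _ => 0 := by
        funext t q; simp [_root_.D1, pd1]
      have e2 : _root_.D2 (fun _ _ => c : STFn) = fun _ _ => 0 := by
        funext t q; simp [_root_.D2, pd2]
      have e3 : _root_.Dt (fun _ _ => c : STFn) = fun _ _ => 0 := by
        funext t q; simp [_root_.Dt]
      refine cls_succ.2 ⟨continuousOn_const, fun P _ => differentiableAt_const c,
        fun P _ => differentiableAt_const c, hB.const c, e1 ▸ ih m (by omega) 0,
        e2 ▸ ih m (by omega) 0, ?_⟩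
      rintro n rfl
      exact ⟨fun P _ => differentiableAt_const c, e3 ▸ ih n (by omega) 0⟩

theorem Cls.add' (hU : IsOpen U) (hB : FnAlg U B) (hf : Cls ρ U B m f) (hg : Cls ρ U B m g) :
    Cls ρ U B m (fun t q => f t q + g t q) := by
  induction m using Nat.strong_induction_on generalizing f g with
  | _ m ih =>
    rcases m with _ | m
    · exact ⟨hf.1.add hg.1, hB.add hf.2 hg.2⟩
    · refine cls_succ.2 ⟨hf.continuousOn.add hg.continuousOn,
        fun P hP => (hf.diff1 hP).add (hg.diff1 hP), fun P hP => (hf.diff2 hP).add (hg.diff2 hP),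
        hB.add hf.base hg.base, ?_, ?_, ?_⟩
      · refine Cls.congr hU hB.congr (fun P hP => ?_) (ih m (by omega) hf.D1 hg.D1)
        change _ = ρ P.2 * deriv (fun s => f P.1 (s, P.2.2) + g P.1 (s, P.2.2)) P.2.1
        rw [deriv_fun_add (hf.diff1 hP) (hg.diff1 hP), mul_add]; rfl
      · refine Cls.congr hU hB.congr (fun P hP => ?_) (ih m (by omega) hf.D2 hg.D2)
        exact (deriv_fun_add (hf.diff2 hP) (hg.diff2 hP)).symm
      · rintro n rfl
        refine ⟨fun P hP => (hf.difft hP).add (hg.difft hP), ?_⟩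
        refine Cls.congr hU hB.congr (fun P hP => ?_) (ih n (by omega) hf.Dt hg.Dt)
        exact (deriv_fun_add (hf.difft hP) (hg.difft hP)).symm

theorem Cls.mul' (hU : IsOpen U) (hB : FnAlg U B) (hf : Cls ρ U B m f) (hg : Cls ρ U B m g) :
    Cls ρ U B m (fun t q => f t q * g t q) := by
  induction m using Nat.strong_induction_on generalizing f g with
  | _ m ih =>
    rcases m with _ | m
    · exact ⟨hf.1.mul hg.1, hB.mul hf.2 hg.2⟩
    · refine cls_succ.2 ⟨hf.continuousOn.mul hg.continuousOn,
        fun P hP => (hf.diff1 hP).mul (hg.diff1 hP), fun P hP => (hf.diff2 hP).mul (hg.diff2 hP),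
        hB.mul hf.base hg.base, ?_, ?_, ?_⟩
      · refine Cls.congr hU hB.congr (fun P hP => ?_)
          (Cls.add' hU hB (ih m (by omega) hf.D1 hg.of_succ) (ih m (by omega) hf.of_succ hg.D1))
        change _ = ρ P.2 * deriv (fun s => f P.1 (s, P.2.2) * g P.1 (s, P.2.2)) P.2.1
        rw [deriv_fun_mul (hf.diff1 hP) (hg.diff1 hP)]
        change ρ P.2 * deriv _ _ * g P.1 P.2 + f P.1 P.2 * (ρ P.2 * deriv _ _) = _
        ring
      · refine Cls.congr hU hB.congr (fun P hP => ?_)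
          (Cls.add' hU hB (ih m (by omega) hf.D2 hg.of_succ) (ih m (by omega) hf.of_succ hg.D2))
        exact (deriv_fun_mul (hf.diff2 hP) (hg.diff2 hP)).symm
      · rintro n rfl
        refine ⟨fun P hP => (hf.difft hP).mul (hg.difft hP), ?_⟩
        refine Cls.congr hU hB.congr (fun P hP => ?_) (Cls.add' hU hB
          (ih n (by omega) hf.Dt hg.of_succ.of_succ) (ih n (by omega) hf.of_succ.of_succ hg.Dt))
        exact (deriv_fun_mul (hf.difft hP) (hg.difft hP)).symm

theorem Cls.inv' (hU : IsOpen U) (hB : FnAlg U B) (hf : Cls ρ U B m f)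
    (h0 : ∃ c : ℝ, 0 < c ∧ ∀ P ∈ U, c ≤ |f P.1 P.2|) :
    Cls ρ U B m (fun t q => (f t q)⁻¹) := by
  have hne : ∀ P ∈ U, f P.1 P.2 ≠ 0 := fun P hP h => by
    obtain ⟨c, hc, h0⟩ := h0
    have := h0 P hP
    rw [h, abs_zero] at this
    linarith
  induction m using Nat.strong_induction_on with
  | _ m ih =>
    rcases m with _ | m
    · exact ⟨hf.1.inv₀ hne, hB.inv hf.2 h0⟩
    -- Each derivative of `1/f` is `-h f⁻²`, where `h` is the same derivative of `f`; the induction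
    -- hypothesis supplies `1/f` at the lower order.
    · have key : ∀ n, n < m + 1 → ∀ h : STFn, Cls ρ U B n h →
          Cls ρ U B n fun t q => -1 * (h t q * ((f t q)⁻¹ * (f t q)⁻¹)) := by
        intro n hn h hh
        have hi := ih n hn (hf.of_le hn.le)
        exact Cls.mul' hU hB (Cls.const' hB _) (Cls.mul' hU hB hh (Cls.mul' hU hB hi hi))
      refine cls_succ.2 ⟨hf.continuousOn.inv₀ hne,
        fun P hP => (hf.diff1 hP).inv (hne P hP), fun P hP => (hf.diff2 hP).inv (hne P hP),
        hB.inv hf.base h0, ?_, ?_, ?_⟩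
      · refine Cls.congr hU hB.congr (fun P hP => ?_) (key m (by omega) _ hf.D1)
        change _ = ρ P.2 * deriv (fun s => (f P.1 (s, P.2.2))⁻¹) P.2.1
        rw [deriv_fun_inv'' (hf.diff1 hP) (hne P hP)]
        change -1 * (ρ P.2 * deriv (fun s => f P.1 (s, P.2.2)) P.2.1 *
          ((f P.1 P.2)⁻¹ * (f P.1 P.2)⁻¹)) = ρ P.2 *
            (-deriv (fun s => f P.1 (s, P.2.2)) P.2.1 / (f P.1 P.2) ^ 2)
        have := hne P hP
        field_simp
      · refine Cls.congr hU hB.congr (fun P hP => ?_) (key m (by omega) _ hf.D2)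
        change _ = deriv (fun s => (f P.1 (P.2.1, s))⁻¹) P.2.2
        rw [deriv_fun_inv'' (hf.diff2 hP) (hne P hP)]
        change -1 * (deriv (fun s => f P.1 (P.2.1, s)) P.2.2 *
          ((f P.1 P.2)⁻¹ * (f P.1 P.2)⁻¹)) =
            (-deriv (fun s => f P.1 (P.2.1, s)) P.2.2 / (f P.1 P.2) ^ 2)
        have := hne P hP
        field_simp
      · rintro n rfl
        refine ⟨fun P hP => (hf.difft hP).inv (hne P hP), ?_⟩
        refine Cls.congr hU hB.congr (fun P hP => ?_) (key n (by omega) _ hf.Dt)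
        change _ = deriv (fun s => (f s P.2)⁻¹) P.1
        rw [deriv_fun_inv'' (hf.difft hP) (hne P hP)]
        change -1 * (deriv (fun s => f s P.2) P.1 *
          ((f P.1 P.2)⁻¹ * (f P.1 P.2)⁻¹)) = (-deriv (fun s => f s P.2) P.1 / (f P.1 P.2) ^ 2)
        have := hne P hP
        field_simp

theorem FnAlg.cls (hU : IsOpen U) (hB : FnAlg U B) (m : ℕ) : FnAlg U (Cls ρ U B m) where
  congr := Cls.congr hU hB.congr
  const := Cls.const' hB
  add := Cls.add' hU hB
  mul := Cls.mul' hU hB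
  inv := Cls.inv' hU hB

end ClsAlg

/-! ### The class of functions with continuous parabolic derivatives -/

theorem FnAlg.trivial (U : Set (ℝ × ℝ × ℝ)) : FnAlg U fun _ => True :=
  ⟨fun _ _ => ⟨⟩, fun _ => ⟨⟩, fun _ _ => ⟨⟩, fun _ _ => ⟨⟩, fun _ _ => ⟨⟩⟩

/-- With weight one and no condition on the derivatives, the recursive class is plain parabolic
differentiability; closure under sums and products is inherited this way. -/
theorem isParabolicC_iff_cls {m : ℕ} {U : Set (ℝ × ℝ × ℝ)} {f : STFn} :
    IsParabolicC m U f ↔ Cls (fun _ => 1) U (fun _ => True) m f := by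
  induction m using Nat.strong_induction_on generalizing f with
  | _ m ih =>
    match m with
    | 0 => simp [IsParabolicC, Cls]
    | 1 => simp [IsParabolicC, Cls]
    | m + 2 =>
      simp only [IsParabolicC, Cls, one_mul]
      rw [ih (m + 1) (by omega), ih (m + 1) (by omega), ih m (by omega)]
      simp only [true_and]

section IsParabolicC

variable {E : Type*} [NormedAddCommGroup E] [NormedSpace ℝ E]
  {U : Set (ℝ × ℝ × ℝ)} {m : ℕ} {f g : ℝ → ℝ × ℝ → E}

theorem isParabolicC_succ : IsParabolicC (m + 1) U f ↔
    ContinuousOn (fun P : ℝ × ℝ × ℝ => f P.1 P.2) U ∧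
    (∀ P ∈ U, DifferentiableAt ℝ (fun s => f P.1 (s, P.2.2)) P.2.1) ∧
    (∀ P ∈ U, DifferentiableAt ℝ (fun s => f P.1 (P.2.1, s)) P.2.2) ∧
    IsParabolicC m U (D1 f) ∧ IsParabolicC m U (D2 f) ∧
    ∀ n, m = n + 1 →
      (∀ P ∈ U, DifferentiableAt ℝ (fun s => f s P.2) P.1) ∧ IsParabolicC n U (Dt f) := by
  rcases m with _ | m
  · simp [IsParabolicC]
  · simp only [IsParabolicC, Nat.add_right_cancel_iff]
    constructor
    · rintro ⟨h1, h2, h3, h4, h6, h7, h8⟩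
      exact ⟨h1, h2, h3, h6, h7, fun n hn => hn ▸ ⟨h4, h8⟩⟩
    · rintro ⟨h1, h2, h3, h6, h7, h8⟩
      exact ⟨h1, h2, h3, (h8 m rfl).1, h6, h7, (h8 m rfl).2⟩

namespace IsParabolicC

theorem continuousOn (h : IsParabolicC m U f) :
    ContinuousOn (fun P : ℝ × ℝ × ℝ => f P.1 P.2) U := by
  rcases m with _ | m
  · exact h
  · exact (isParabolicC_succ.1 h).1

theorem diff1 (h : IsParabolicC (m + 1) U f) {P : ℝ × ℝ × ℝ} (hP : P ∈ U) :
    DifferentiableAt ℝ (fun s => f P.1 (s, P.2.2)) P.2.1 := (isParabolicC_succ.1 h).2.1 P hP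

theorem diff2 (h : IsParabolicC (m + 1) U f) {P : ℝ × ℝ × ℝ} (hP : P ∈ U) :
    DifferentiableAt ℝ (fun s => f P.1 (P.2.1, s)) P.2.2 := (isParabolicC_succ.1 h).2.2.1 P hP

theorem difft (h : IsParabolicC (m + 2) U f) {P : ℝ × ℝ × ℝ} (hP : P ∈ U) :
    DifferentiableAt ℝ (fun s => f s P.2) P.1 := h.2.2.2.1 P hP

theorem D1 (h : IsParabolicC (m + 1) U f) : IsParabolicC m U (D1 f) :=
  (isParabolicC_succ.1 h).2.2.2.1

theorem D2 (h : IsParabolicC (m + 1) U f) : IsParabolicC m U (D2 f) :=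
  (isParabolicC_succ.1 h).2.2.2.2.1

theorem Dt (h : IsParabolicC (m + 2) U f) : IsParabolicC m U (Dt f) := h.2.2.2.2.2.2

theorem of_succ (h : IsParabolicC (m + 1) U f) : IsParabolicC m U f := by
  induction m using Nat.strong_induction_on generalizing f with
  | _ m ih =>
    rcases m with _ | m
    · exact h.continuousOn
    · obtain ⟨h1, h2, h3, h5, h6, h7⟩ := isParabolicC_succ.1 h
      refine isParabolicC_succ.2 ⟨h1, h2, h3, ih m (by omega) h5, ih m (by omega) h6, ?_⟩
      rintro n rfl
      exact ⟨(h7 _ rfl).1, ih n (by omega) (h7 _ rfl).2⟩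

theorem of_le {n : ℕ} (h : IsParabolicC m U f) (hn : n ≤ m) : IsParabolicC n U f := by
  induction m, hn using Nat.le_induction with
  | base => exact h
  | succ k _ ih => exact ih h.of_succ

theorem mono {V : Set (ℝ × ℝ × ℝ)} (hV : V ⊆ U) (h : IsParabolicC m U f) :
    IsParabolicC m V f := by
  induction m using Nat.strong_induction_on generalizing f with
  | _ m ih =>
    rcases m with _ | m
    · exact ContinuousOn.mono h hV
    · obtain ⟨h1, h2, h3, h5, h6, h7⟩ := isParabolicC_succ.1 h
      refine isParabolicC_succ.2 ⟨h1.mono hV, fun P hP => h2 P (hV hP), fun P hP => h3 P (hV hP),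
        ih m (by omega) h5, ih m (by omega) h6, ?_⟩
      rintro n rfl
      exact ⟨fun P hP => (h7 n rfl).1 P (hV hP), ih n (by omega) (h7 n rfl).2⟩

theorem congr (hU : IsOpen U) (hfg : ∀ P ∈ U, f P.1 P.2 = g P.1 P.2) (h : IsParabolicC m U f) :
    IsParabolicC m U g := by
  induction m using Nat.strong_induction_on generalizing f g with
  | _ m ih =>
    have hc : ContinuousOn (fun P : ℝ × ℝ × ℝ => g P.1 P.2) U :=
      h.continuousOn.congr fun P hP => (hfg P hP).symm
    rcases m with _ | m
    · exact hc
    · obtain ⟨h1, h2, h3, h5, h6, h7⟩ := isParabolicC_succ.1 h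
      refine isParabolicC_succ.2 ⟨hc, fun P hP => diff1_congr hU hfg hP (h2 P hP),
        fun P hP => diff2_congr hU hfg hP (h3 P hP),
        ih m (by omega) (D1_congr hU hfg) h5, ih m (by omega) (D2_congr hU hfg) h6, ?_⟩
      rintro n rfl
      exact ⟨fun P hP => difft_congr hU hfg hP ((h7 n rfl).1 P hP),
        ih n (by omega) (Dt_congr hU hfg) (h7 n rfl).2⟩

/-- A map into a finite product has continuous derivatives when its components have. -/
theorem pi {ι : Type*} [Fintype ι] {F : ℝ → ℝ × ℝ → ι → ℝ} (hU : IsOpen U)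
    (h : ∀ i, IsParabolicC m U fun t q => F t q i) : IsParabolicC m U F := by
  induction m using Nat.strong_induction_on generalizing F with
  | _ m ih =>
    have hc : ContinuousOn (fun P : ℝ × ℝ × ℝ => F P.1 P.2) U :=
      continuousOn_pi.2 fun i => (h i).continuousOn
    rcases m with _ | m
    · exact hc
    · refine isParabolicC_succ.2 ⟨hc, fun P hP => differentiableAt_pi.2 fun i => (h i).diff1 hP,
        fun P hP => differentiableAt_pi.2 fun i => (h i).diff2 hP, ih m (by omega) fun i => ?_,
        ih m (by omega) fun i => ?_, ?_⟩
      · refine (h i).D1.congr hU fun P hP => ?_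
        exact (congr_fun (deriv_pi fun i => (h i).diff1 hP) i).symm
      · refine (h i).D2.congr hU fun P hP => ?_
        exact (congr_fun (deriv_pi fun i => (h i).diff2 hP) i).symm
      · rintro n rfl
        refine ⟨fun P hP => differentiableAt_pi.2 fun i => (h i).difft hP,
          ih n (by omega) fun i => ?_⟩
        refine (h i).Dt.congr hU fun P hP => ?_
        exact (congr_fun (deriv_pi fun i => (h i).difft hP) i).symm

/-- Joint strict differentiability from continuous partial derivatives. -/
theorem hasFDerivAt_space (hU : IsOpen U) (h : IsParabolicC (m + 1) U f) {P : ℝ × ℝ × ℝ}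
    (hP : P ∈ U) :
    HasFDerivAt (f P.1) ((ContinuousLinearMap.toSpanSingleton ℝ (_root_.D1 f P.1 P.2)).coprod
      (ContinuousLinearMap.toSpanSingleton ℝ (_root_.D2 f P.1 P.2))) P.2 := by
  have hev := hU.eventually_slice_space hP
  have hcont : ∀ {k : ℝ → ℝ × ℝ → E}, IsParabolicC m U k → ContinuousAt (fun q => k P.1 q) P.2 :=
    fun {k} hk => (hk.continuousOn.continuousAt (hU.mem_nhds hP)).comp
      (f := fun q : ℝ × ℝ => (P.1, q)) (by fun_prop)
  exact (hasStrictFDerivAt_uncurry_coprod (𝕜 := ℝ) (u := P.2) (f := fun x y => f P.1 (x, y))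
    (f₁ := fun x y => ContinuousLinearMap.toSpanSingleton ℝ (_root_.D1 f P.1 (x, y)))
    (f₂ := fun x y => ContinuousLinearMap.toSpanSingleton ℝ (_root_.D2 f P.1 (x, y)))
    (hev.mono fun q hq => (h.diff1 hq).hasDerivAt.hasFDerivAt)
    (hev.mono fun q hq => (h.diff2 hq).hasDerivAt.hasFDerivAt)
    (((ContinuousLinearMap.toSpanSingletonCLE (𝕜 := ℝ) (E := E)).continuous.continuousAt).comp
      (hcont h.D1))
    (((ContinuousLinearMap.toSpanSingletonCLE (𝕜 := ℝ) (E := E)).continuous.continuousAt).comp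
      (hcont h.D2))).hasFDerivAt

end IsParabolicC

end IsParabolicC

/-! ### Equality of mixed partial derivatives -/

/-- The mean value theorem is applied twice: in the first variable to `F(·, y + h) - F(·, y)`, then
in the second variable to the derivative found. -/
theorem exists_mixed_deriv_eq_second_difference {F : ℝ → ℝ → ℝ} {x y h : ℝ} (hh : 0 < h)
    (h1 : ∀ a ∈ Icc x (x + h), ∀ b ∈ Icc y (y + h), DifferentiableAt ℝ (fun s => F s b) a)
    (h2 : ∀ a ∈ Icc x (x + h), ∀ b ∈ Icc y (y + h),
      DifferentiableAt ℝ (fun s => deriv (fun r => F r s) a) b) :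
    ∃ a ∈ Ioo x (x + h), ∃ b ∈ Ioo y (y + h),
      F (x + h) (y + h) - F (x + h) y - F x (y + h) + F x y
        = deriv (fun s => deriv (fun r => F r s) a) b * h * h := by
  have hx : x < x + h := by linarith
  have hy : y < y + h := by linarith
  have d1 : ∀ a ∈ Icc x (x + h), ∀ b ∈ Icc y (y + h),
      HasDerivAt (fun s => F s b) (deriv (fun s => F s b) a) a :=
    fun a ha b hb => (h1 a ha b hb).hasDerivAt
  have hyl := left_mem_Icc.2 hy.le
  have hyr := right_mem_Icc.2 hy.le
  obtain ⟨a, ha, ha'⟩ := exists_hasDerivAt_eq_slope (fun s => F s (y + h) - F s y)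
    (fun s => deriv (fun r => F r (y + h)) s - deriv (fun r => F r y) s) hx
    (fun s hs => ((d1 s hs _ hyr).sub (d1 s hs _ hyl)).continuousAt.continuousWithinAt)
    (fun s hs => (d1 s (Ioo_subset_Icc_self hs) _ hyr).sub (d1 s (Ioo_subset_Icc_self hs) _ hyl))
  have d2 : ∀ b ∈ Icc y (y + h), HasDerivAt (fun s => deriv (fun r => F r s) a)
      (deriv (fun s => deriv (fun r => F r s) a) b) b :=
    fun b hb => (h2 a (Ioo_subset_Icc_self ha) b hb).hasDerivAt
  obtain ⟨b, hb, hb'⟩ := exists_hasDerivAt_eq_slope (fun s => deriv (fun r => F r s) a)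
    (fun b => deriv (fun s => deriv (fun r => F r s) a) b) hy
    (fun s hs => (d2 s hs).continuousAt.continuousWithinAt)
    (fun s hs => d2 s (Ioo_subset_Icc_self hs))
  refine ⟨a, ha, b, hb, ?_⟩
  have e : ∀ c : ℝ, c + h - c = h := fun c => by ring
  rw [e] at ha' hb'
  rw [hb', div_mul_cancel₀ _ hh.ne', ha', div_mul_cancel₀ _ hh.ne']
  ring

/-- The second difference is symmetric in the two variables, so both mixed derivatives take a common
value at (different) points arbitrarily close to `(x, y)`, and continuity finishes. Only partial
derivatives are assumed because, in the pair of a space variable and time, a parabolic class does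
not provide a second Fréchet derivative. -/
theorem mixed_deriv_comm {F : ℝ → ℝ → ℝ} {x y : ℝ}
    (h1 : ∀ᶠ p in 𝓝 (x, y), DifferentiableAt ℝ (fun s => F s p.2) p.1)
    (h2 : ∀ᶠ p in 𝓝 (x, y), DifferentiableAt ℝ (fun s => F p.1 s) p.2)
    (h12 : ∀ᶠ p in 𝓝 (x, y), DifferentiableAt ℝ (fun s => deriv (fun r => F r s) p.1) p.2)
    (h21 : ∀ᶠ p in 𝓝 (x, y), DifferentiableAt ℝ (fun s => deriv (fun r => F s r) p.2) p.1)
    (c12 : ContinuousAt (fun p : ℝ × ℝ => deriv (fun s => deriv (fun r => F r s) p.1) p.2) (x, y))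
    (c21 : ContinuousAt (fun p : ℝ × ℝ => deriv (fun s => deriv (fun r => F s r) p.2) p.1)
      (x, y)) :
    deriv (fun s => deriv (fun r => F r s) x) y = deriv (fun s => deriv (fun r => F s r) y) x := by
  refine eq_of_forall_dist_le fun ε hε => ?_
  have e12 := Metric.continuousAt_iff'.1 c12 (ε / 2) (by positivity)
  have e21 := Metric.continuousAt_iff'.1 c21 (ε / 2) (by positivity)
  obtain ⟨r, hr, hball⟩ := Metric.eventually_nhds_iff_ball.1
    ((h1.and h2).and ((h12.and h21).and (e12.and e21)))
  have hmem : ∀ a ∈ Icc x (x + r / 2), ∀ b ∈ Icc y (y + r / 2),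
      (a, b) ∈ Metric.ball (x, y) r := by
    intro a ha b hb
    rw [Metric.mem_ball, Prod.dist_eq, max_lt_iff, Real.dist_eq, Real.dist_eq, abs_lt, abs_lt]
    simp only [mem_Icc] at ha hb
    refine ⟨⟨?_, ?_⟩, ?_, ?_⟩ <;> linarith
  obtain ⟨a, ha, b, hb, hab⟩ := exists_mixed_deriv_eq_second_difference (F := F) (half_pos hr)
    (fun a ha b hb => (hball _ (hmem a ha b hb)).1.1)
    (fun a ha b hb => (hball _ (hmem a ha b hb)).2.1.1)
  obtain ⟨b', hb', a', ha', hab'⟩ := exists_mixed_deriv_eq_second_difference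
    (F := fun y x => F x y) (x := y) (y := x) (half_pos hr)
    (fun b hb a ha => (hball _ (hmem a ha b hb)).1.2)
    (fun b hb a ha => (hball _ (hmem a ha b hb)).2.1.2)
  have m1 := hmem a (Ioo_subset_Icc_self ha) b (Ioo_subset_Icc_self hb)
  have m2 := hmem a' (Ioo_subset_Icc_self ha') b' (Ioo_subset_Icc_self hb')
  have q1 := (hball _ m1).2.2.1
  have q2 := (hball _ m2).2.2.2
  have heq : deriv (fun s => deriv (fun r => F r s) a) b
      = deriv (fun s => deriv (fun r => F s r) b') a' := by
    have : (0 : ℝ) < r / 2 * (r / 2) := by positivity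
    refine mul_right_cancel₀ this.ne' ?_
    rw [← mul_assoc, ← mul_assoc, ← hab, ← hab']
    ring
  calc dist _ _ ≤ dist (deriv (fun s => deriv (fun r => F r s) x) y)
        (deriv (fun s => deriv (fun r => F r s) a) b) +
        dist (deriv (fun s => deriv (fun r => F r s) a) b)
          (deriv (fun s => deriv (fun r => F s r) y) x) := dist_triangle _ _ _
    _ ≤ ε / 2 + ε / 2 := by
        gcongr
        · rw [dist_comm]; exact q1.le
        · rw [heq]; exact q2.le
    _ = ε := by ring

namespace IsParabolicC

variable {U : Set (ℝ × ℝ × ℝ)} {m : ℕ} {f : STFn}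

theorem D1_D2_comm (hU : IsOpen U) (h : IsParabolicC (m + 2) U f) :
    ∀ P ∈ U, _root_.D1 (_root_.D2 f) P.1 P.2 = _root_.D2 (_root_.D1 f) P.1 P.2 := by
  rintro ⟨t, x, y⟩ hP
  have hev := hU.eventually_slice_space hP
  have hcont : ∀ {k : STFn}, IsParabolicC m U k → ContinuousAt (fun q => k t q) (x, y) :=
    fun {k} hk => (hk.continuousOn.continuousAt (hU.mem_nhds hP)).comp
      (f := fun q : ℝ × ℝ => (t, q)) (by fun_prop)
  exact (mixed_deriv_comm (F := fun x y => f t (x, y))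
    (hev.mono fun q hq => h.diff1 hq) (hev.mono fun q hq => h.diff2 hq)
    (hev.mono fun q hq => h.D1.diff2 hq) (hev.mono fun q hq => h.D2.diff1 hq)
    (hcont h.D1.D2) (hcont h.D2.D1)).symm

theorem D1_Dt_comm (hU : IsOpen U) (h : IsParabolicC (m + 3) U f) :
    ∀ P ∈ U, _root_.D1 (_root_.Dt f) P.1 P.2 = _root_.Dt (_root_.D1 f) P.1 P.2 := by
  rintro ⟨t, x, y⟩ hP
  have hg : ContinuousAt (fun p : ℝ × ℝ => (p.2, p.1, y)) (x, t) := by fun_prop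
  have hev : ∀ᶠ p : ℝ × ℝ in 𝓝 (x, t), (p.2, p.1, y) ∈ U := hg.eventually (hU.mem_nhds hP)
  have hcont : ∀ {k : STFn}, IsParabolicC m U k →
      ContinuousAt (fun p : ℝ × ℝ => k p.2 (p.1, y)) (x, t) := fun {k} hk =>
    ContinuousAt.comp (g := fun P : ℝ × ℝ × ℝ => k P.1 P.2) (f := fun p : ℝ × ℝ => (p.2, p.1, y))
      (hk.continuousOn.continuousAt (hU.mem_nhds hP)) hg
  exact (mixed_deriv_comm (F := fun x t => f t (x, y))
    (hev.mono fun q hq => h.diff1 hq) (hev.mono fun q hq => h.difft hq)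
    (hev.mono fun q hq => h.D1.difft hq) (hev.mono fun q hq => h.Dt.diff1 hq)
    (hcont h.D1.Dt) (hcont h.Dt.D1)).symm

theorem D2_Dt_comm (hU : IsOpen U) (h : IsParabolicC (m + 3) U f) :
    ∀ P ∈ U, _root_.D2 (_root_.Dt f) P.1 P.2 = _root_.Dt (_root_.D2 f) P.1 P.2 := by
  rintro ⟨t, x, y⟩ hP
  have hg : ContinuousAt (fun p : ℝ × ℝ => (p.2, x, p.1)) (y, t) := by fun_prop
  have hev : ∀ᶠ p : ℝ × ℝ in 𝓝 (y, t), (p.2, x, p.1) ∈ U := hg.eventually (hU.mem_nhds hP)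
  have hcont : ∀ {k : STFn}, IsParabolicC m U k →
      ContinuousAt (fun p : ℝ × ℝ => k p.2 (x, p.1)) (y, t) := fun {k} hk =>
    ContinuousAt.comp (g := fun P : ℝ × ℝ × ℝ => k P.1 P.2) (f := fun p : ℝ × ℝ => (p.2, x, p.1))
      (hk.continuousOn.continuousAt (hU.mem_nhds hP)) hg
  exact (mixed_deriv_comm (F := fun y t => f t (x, y))
    (hev.mono fun q hq => h.diff2 hq) (hev.mono fun q hq => h.difft hq)
    (hev.mono fun q hq => h.D2.difft hq) (hev.mono fun q hq => h.Dt.diff2 hq)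
    (hcont h.D2.Dt) (hcont h.Dt.D2)).symm

/-! Iterated derivatives of functions in the class. -/

theorem iterate_Dt {l : ℕ} (h : IsParabolicC (m + 2 * l) U f) :
    IsParabolicC m U (_root_.Dt^[l] f) := by
  induction l generalizing f with
  | zero => exact h
  | succ l ih =>
    exact ih (f := _root_.Dt f) (IsParabolicC.Dt (m := m + 2 * l) (by convert h using 1; ring))

theorem iterate_D2 {j : ℕ} (h : IsParabolicC (m + j) U f) :
    IsParabolicC m U (_root_.D2^[j] f) := by
  induction j generalizing f with
  | zero => exact h
  | succ l ih => exact ih (f := _root_.D2 f) (IsParabolicC.D2 (m := m + l) h)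

theorem iterate_D1 {j : ℕ} (h : IsParabolicC (m + j) U f) :
    IsParabolicC m U (_root_.D1^[j] f) := by
  induction j generalizing f with
  | zero => exact h
  | succ l ih => exact ih (f := _root_.D1 f) (IsParabolicC.D1 (m := m + l) h)

end IsParabolicC

/-! ### Commutation of iterated derivatives. -/

section Iterates

variable {U : Set (ℝ × ℝ × ℝ)} {m : ℕ} {f g : STFn}

theorem iterate_D1_congr (hU : IsOpen U) (h : ∀ P ∈ U, f P.1 P.2 = g P.1 P.2) (i : ℕ) :
    ∀ P ∈ U, D1^[i] f P.1 P.2 = D1^[i] g P.1 P.2 := by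
  induction i generalizing f g with
  | zero => exact h
  | succ i ih => exact ih (D1_congr hU h)

theorem iterate_D2_congr (hU : IsOpen U) (h : ∀ P ∈ U, f P.1 P.2 = g P.1 P.2) (i : ℕ) :
    ∀ P ∈ U, D2^[i] f P.1 P.2 = D2^[i] g P.1 P.2 := by
  induction i generalizing f g with
  | zero => exact h
  | succ i ih => exact ih (D2_congr hU h)

theorem iterate_Dt_congr (hU : IsOpen U) (h : ∀ P ∈ U, f P.1 P.2 = g P.1 P.2) (i : ℕ) :
    ∀ P ∈ U, Dt^[i] f P.1 P.2 = Dt^[i] g P.1 P.2 := by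
  induction i generalizing f g with
  | zero => exact h
  | succ i ih => exact ih (Dt_congr hU h)

theorem iterate_Dt_D1 (hU : IsOpen U) {l : ℕ} (h : IsParabolicC (1 + 2 * l) U f) :
    ∀ P ∈ U, Dt^[l] (D1 f) P.1 P.2 = D1 (Dt^[l] f) P.1 P.2 := by
  induction l generalizing f with
  | zero => exact fun _ _ => rfl
  | succ l ih =>
    intro P hP
    have h' : IsParabolicC (2 * l + 3) U f := by convert h using 1; omega
    rw [Function.iterate_succ_apply, Function.iterate_succ_apply,
      ← iterate_Dt_congr hU (h'.D1_Dt_comm hU) l P hP]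
    exact ih (f := Dt f) (by convert h'.Dt using 1; omega) P hP

theorem iterate_Dt_D2 (hU : IsOpen U) {l : ℕ} (h : IsParabolicC (1 + 2 * l) U f) :
    ∀ P ∈ U, Dt^[l] (D2 f) P.1 P.2 = D2 (Dt^[l] f) P.1 P.2 := by
  induction l generalizing f with
  | zero => exact fun _ _ => rfl
  | succ l ih =>
    intro P hP
    have h' : IsParabolicC (2 * l + 3) U f := by convert h using 1; omega
    rw [Function.iterate_succ_apply, Function.iterate_succ_apply,
      ← iterate_Dt_congr hU (h'.D2_Dt_comm hU) l P hP]
    exact ih (f := Dt f) (by convert h'.Dt using 1; omega) P hP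

theorem iterate_D2_D1 (hU : IsOpen U) {j : ℕ} (h : IsParabolicC (1 + j) U f) :
    ∀ P ∈ U, D2^[j] (D1 f) P.1 P.2 = D1 (D2^[j] f) P.1 P.2 := by
  induction j generalizing f with
  | zero => exact fun _ _ => rfl
  | succ j ih =>
    intro P hP
    have h' : IsParabolicC (j + 2) U f := by convert h using 1; omega
    rw [Function.iterate_succ_apply, Function.iterate_succ_apply,
      ← iterate_D2_congr hU (h'.D1_D2_comm hU) j P hP]
    exact ih (f := D2 f) (by convert h'.D2 using 1; omega) P hP

/-- `D_y^j D_t^l` commutes with `D_x`. -/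
theorem mixedD_D1 (hU : IsOpen U) {i j l : ℕ} (h : IsParabolicC (1 + j + 2 * l) U f) :
    ∀ P ∈ U, mixedD i j l (D1 f) P.1 P.2 = mixedD (i + 1) j l f P.1 P.2 := by
  intro P hP
  have e1 : ∀ P ∈ U, D2^[j] (Dt^[l] (D1 f)) P.1 P.2 = D1 (D2^[j] (Dt^[l] f)) P.1 P.2 := by
    intro P hP
    rw [iterate_D2_congr hU (iterate_Dt_D1 hU (h.of_le (by omega))) j P hP]
    exact iterate_D2_D1 hU h.iterate_Dt P hP
  exact iterate_D1_congr hU e1 i P hP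

theorem mixedD_D2 (hU : IsOpen U) {i j l : ℕ} (h : IsParabolicC (1 + 2 * l) U f) :
    ∀ P ∈ U, mixedD i j l (D2 f) P.1 P.2 = mixedD i (j + 1) l f P.1 P.2 := fun P hP =>
  iterate_D1_congr hU (iterate_D2_congr hU (iterate_Dt_D2 hU h) j) i P hP

end Iterates

/-! ### Classes described by all mixed derivatives -/

section AllMixed

variable {ρ : ℝ × ℝ → ℝ} {U : Set (ℝ × ℝ × ℝ)} {B : STFn → Prop} {m : ℕ} {f g : STFn} {e : ℝ}

/-- A weight for the first space derivative: it has constant slope `e` in the first variable and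
does not depend on the second. -/
structure IsWeight (ρ : ℝ × ℝ → ℝ) (e : ℝ) (U : Set (ℝ × ℝ × ℝ)) : Prop where
  hasDerivAt : ∀ q : ℝ × ℝ, HasDerivAt (fun s => ρ (s, q.2)) e q.1
  indep : ∀ x y y' : ℝ, ρ (x, y) = ρ (x, y')
  continuous : Continuous ρ
  ne_zero : ∀ P ∈ U, ρ P.2 ≠ 0
  inv : ∀ m, IsParabolicC m U fun _ q => (ρ q)⁻¹

theorem IsWeight.isParabolicC (hU : IsOpen U) (h : IsWeight ρ e U) (m : ℕ) :
    IsParabolicC m U fun _ q => ρ q := by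
  have hc : ContinuousOn (fun P : ℝ × ℝ × ℝ => ρ P.2) U :=
    (h.continuous.comp continuous_snd).continuousOn
  rcases m with _ | m
  · exact hc
  · have hconst : ∀ (c : ℝ) (n : ℕ), IsParabolicC n U fun _ _ => c := fun c n =>
      isParabolicC_iff_cls.2 (Cls.const' (FnAlg.trivial U) c)
    have e2 : ∀ q : ℝ × ℝ, (fun s => ρ (q.1, s)) = fun _ => ρ q := fun q => by
      funext s; exact h.indep _ _ _
    refine isParabolicC_succ.2 ⟨hc, fun P _ => (h.hasDerivAt P.2).differentiableAt, fun P _ => ?_,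
      (hconst e m).congr hU fun P _ => (h.hasDerivAt P.2).deriv.symm,
      (hconst 0 m).congr hU fun P _ => ?_, ?_⟩
    · rw [e2]; exact differentiableAt_const _
    · simp only [D2, pd2, e2]; simp
    · rintro n rfl
      exact ⟨fun P _ => differentiableAt_const _,
        (hconst 0 n).congr hU fun P _ => by simp [Dt]⟩

theorem isParabolicC_mul (hU : IsOpen U) (hf : IsParabolicC m U f) (hg : IsParabolicC m U g) :
    IsParabolicC m U fun t q => f t q * g t q :=
  isParabolicC_iff_cls.2 (Cls.mul' hU (FnAlg.trivial U) (isParabolicC_iff_cls.1 hf)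
    (isParabolicC_iff_cls.1 hg))

theorem isParabolicC_add (hU : IsOpen U) (hf : IsParabolicC m U f) (hg : IsParabolicC m U g) :
    IsParabolicC m U fun t q => f t q + g t q :=
  isParabolicC_iff_cls.2 (Cls.add' hU (FnAlg.trivial U) (isParabolicC_iff_cls.1 hf)
    (isParabolicC_iff_cls.1 hg))

/-- `f` has continuous parabolic derivatives up to order `m` on `U`, and the weighted ones
`ρ^i D_x^i D_y^j D_t^l f` belong to `B`. -/
def AllMixed (ρ : ℝ × ℝ → ℝ) (U : Set (ℝ × ℝ × ℝ)) (B : STFn → Prop) (m : ℕ) (f : STFn) : Prop :=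
  IsParabolicC m U f ∧
    ∀ i j l, i + j + 2 * l ≤ m → B fun t q => ρ q ^ i * mixedD i j l f t q

/-- Leibniz' rule stops after one correction, because the weight is affine in the first variable
with slope `e`. -/
theorem iterate_D1_weight_mul (hU : IsOpen U) (h : IsWeight ρ e U) {i : ℕ}
    (hg : IsParabolicC (i + 1) U g) :
    ∀ P ∈ U, D1^[i] (fun t q => ρ q * D1 g t q) P.1 P.2
      = ρ P.2 * D1^[i + 1] g P.1 P.2 + i * e * D1^[i] g P.1 P.2 := by
  induction i with
  | zero => intro P _; simp
  | succ i ih =>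
    intro P hP
    have hi := ih hg.of_succ
    rw [Function.iterate_succ_apply', D1_congr hU
      (g := fun t q => ρ q * D1^[i + 1] g t q + i * e * D1^[i] g t q) hi P hP]
    have c1 : IsParabolicC 1 U (D1^[i] g) := IsParabolicC.iterate_D1 (by
      refine hg.of_le ?_; omega)
    have c2 : IsParabolicC 1 U (D1^[i + 1] g) := IsParabolicC.iterate_D1 (by
      refine hg.of_le ?_; omega)
    have d1 : HasDerivAt (fun s => D1^[i] g P.1 (s, P.2.2)) (D1^[i + 1] g P.1 P.2) P.2.1 := by
      rw [Function.iterate_succ_apply']; exact (c1.diff1 hP).hasDerivAt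
    have d2 : HasDerivAt (fun s => D1^[i + 1] g P.1 (s, P.2.2)) (D1^[i + 1 + 1] g P.1 P.2)
        P.2.1 := by
      rw [Function.iterate_succ_apply' _ (i + 1)]; exact (c2.diff1 hP).hasDerivAt
    refine (((h.hasDerivAt P.2).mul d2).add (d1.const_mul (i * e))).deriv.trans ?_
    simp only [Prod.mk.eta]
    push_cast
    ring

/-- The norms are stated with `ρ^i D_x^i`, whereas products and inverses are handled by iterating `ρ
D_x`. The two families differ by a triangular change with constant coefficients, so they generate
the same class. -/
theorem AllMixed.cls (hU : IsOpen U) (h : IsWeight ρ e U) (hB : FnAlg U B)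
    (hf : AllMixed ρ U B m f) : Cls ρ U B m f := by
  induction m using Nat.strong_induction_on generalizing f with
  | _ m ih =>
    have hbase : B f := hB.congr (fun P _ => by simp [mixedD]) (hf.2 0 0 0 (by omega))
    rcases m with _ | m
    · exact ⟨hf.1, hbase⟩
    · obtain ⟨h1, h2, h3, h4, h5, h6⟩ := isParabolicC_succ.1 hf.1
      refine cls_succ.2 ⟨h1, h2, h3, hbase, ?_, ?_, ?_⟩
      · refine ih m (by omega) ⟨isParabolicC_mul hU (h.isParabolicC hU m) h4, fun i j l hl => ?_⟩
        have e1 : mixedD i j l (fun t q => ρ q * D1 f t q)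
            = D1^[i] (fun t q => ρ q * (D2^[j] (Dt^[l] (D1 f))) t q) := by
          have a1 : ∀ (l : ℕ) (k : STFn),
              Dt^[l] (fun t q => ρ q * k t q) = fun t q => ρ q * (Dt^[l] k) t q := by
            intro l
            induction l with
            | zero => intro k; rfl
            | succ l ihl =>
              intro k
              rw [Function.iterate_succ_apply, Function.iterate_succ_apply, ← ihl]
              congr 1
              funext t q
              exact deriv_const_mul_field (ρ q)
          have a2 : ∀ (l : ℕ) (k : STFn),
              D2^[l] (fun t q => ρ q * k t q) = fun t q => ρ q * (D2^[l] k) t q := by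
            intro l
            induction l with
            | zero => intro k; rfl
            | succ l ihl =>
              intro k
              rw [Function.iterate_succ_apply, Function.iterate_succ_apply, ← ihl]
              congr 1
              funext t q
              have : (fun s => ρ (q.1, s) * k t (q.1, s)) = fun s => ρ q * k t (q.1, s) := by
                funext s; rw [h.indep q.1 s q.2]
              simp only [D2, pd2, this]
              exact deriv_const_mul_field (ρ q)
          rw [mixedD, a1, a2]
        have e2 : ∀ P ∈ U, D2^[j] (Dt^[l] (D1 f)) P.1 P.2 = D1 (D2^[j] (Dt^[l] f)) P.1 P.2 :=
          mixedD_D1 (i := 0) hU (hf.1.of_le (by omega))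
        have e3 : ∀ P ∈ U, ρ P.2 * (D2^[j] (Dt^[l] (D1 f))) P.1 P.2
            = ρ P.2 * D1 (D2^[j] (Dt^[l] f)) P.1 P.2 := fun P hP => by rw [e2 P hP]
        have e4 := iterate_D1_congr hU (f := fun t q => ρ q * (D2^[j] (Dt^[l] (D1 f))) t q)
          (g := fun t q => ρ q * D1 (D2^[j] (Dt^[l] f)) t q) e3 i
        have hg : IsParabolicC (i + 1) U (D2^[j] (Dt^[l] f)) :=
          IsParabolicC.iterate_D2 (IsParabolicC.iterate_Dt (hf.1.of_le (by omega)))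
        have e5 := iterate_D1_weight_mul hU h hg
        refine hB.congr (fun P hP => ?_) (hB.add (hf.2 (i + 1) j l (by omega))
          (hB.cmul (i * e) (hf.2 i j l (by omega))))
        rw [e1, e4 P hP, e5 P hP, mixedD, mixedD]
        ring
      · refine ih m (by omega) ⟨h5, fun i j l hl => ?_⟩
        refine hB.congr (fun P hP => ?_) (hf.2 i (j + 1) l (by omega))
        rw [mixedD_D2 hU (hf.1.of_le (by omega)) P hP]
      · rintro n rfl
        refine ⟨(h6 n rfl).1, ih n (by omega) ⟨(h6 n rfl).2, fun i j l hl => ?_⟩⟩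
        exact hf.2 i j (l + 1) (by omega)

theorem Cls.isParabolicC (hU : IsOpen U) (h : IsWeight ρ e U) (hf : Cls ρ U B m f) :
    IsParabolicC m U f := by
  induction m using Nat.strong_induction_on generalizing f with
  | _ m ih =>
    rcases m with _ | m
    · exact hf.1
    · obtain ⟨h1, h2, h3, h4, h5, h6, h7⟩ := cls_succ.1 hf
      refine isParabolicC_succ.2 ⟨h1, h2, h3, ?_, ih m (by omega) h6, ?_⟩
      · refine (isParabolicC_mul hU (h.inv m) (ih m (by omega) h5)).congr hU fun P hP => ?_
        have := h.ne_zero P hP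
        field_simp
      · rintro n rfl
        exact ⟨(h7 n rfl).1, ih n (by omega) (h7 n rfl).2⟩

theorem Cls.iterate_Dt {l : ℕ} (h : Cls ρ U B (m + 2 * l) f) : Cls ρ U B m (_root_.Dt^[l] f) := by
  induction l generalizing f with
  | zero => exact h
  | succ l ih =>
    exact ih (f := _root_.Dt f) (Cls.Dt (m := m + 2 * l) (by convert h using 1; ring))

theorem Cls.iterate_D2 {j : ℕ} (h : Cls ρ U B (m + j) f) : Cls ρ U B m (_root_.D2^[j] f) := by
  induction j generalizing f with
  | zero => exact h
  | succ l ih => exact ih (f := _root_.D2 f) (Cls.D2 (m := m + l) h)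

/-- Induction on `ρ^{i+1} D^{i+1} f = ρ D (ρ^i D^i f) - i e ρ^i D^i f`. -/
theorem Cls.weighted_iterate_D1 (hU : IsOpen U) (h : IsWeight ρ e U) (hB : FnAlg U B) {i : ℕ}
    (hf : Cls ρ U B (m + i) f) : Cls ρ U B m (fun t q => ρ q ^ i * _root_.D1^[i] f t q) := by
  induction i generalizing m with
  | zero => exact Cls.congr hU hB.congr (fun P _ => by simp) hf
  | succ i ih =>
    have h1 : Cls ρ U B (m + 1) (fun t q => ρ q ^ i * _root_.D1^[i] f t q) :=
      ih (by convert hf using 1; ring)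
    refine Cls.congr hU hB.congr (fun P hP => ?_) ((hB.cls hU m).sub h1.D1
      ((hB.cls hU m).cmul (i * e) h1.of_succ))
    have c1 : IsParabolicC 1 U (_root_.D1^[i] f) := IsParabolicC.iterate_D1
      ((hf.isParabolicC hU h).of_le (by omega))
    have d1 : HasDerivAt (fun s => _root_.D1^[i] f P.1 (s, P.2.2)) (_root_.D1^[i + 1] f P.1 P.2) P.2.1 := by
      rw [Function.iterate_succ_apply']; exact (c1.diff1 hP).hasDerivAt
    have d2 : _root_.D1 (fun t q => ρ q ^ i * _root_.D1^[i] f t q) P.1 P.2 = _ :=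
      (((h.hasDerivAt P.2).fun_pow i).fun_mul d1).deriv
    rw [d2]
    simp only [Prod.mk.eta]
    rcases i with _ | i
    · simp
    · push_cast
      ring

theorem Cls.allMixed (hU : IsOpen U) (h : IsWeight ρ e U) (hB : FnAlg U B)
    (hf : Cls ρ U B m f) : AllMixed ρ U B m f := by
  refine ⟨hf.isParabolicC hU h, fun i j l hl => ?_⟩
  have h1 : Cls ρ U B (i + j + 2 * l) f := hf.of_le hl
  have h2 : Cls ρ U B (0 + i) (_root_.D2^[j] (_root_.Dt^[l] f)) := by
    rw [zero_add]; exact (h1.iterate_Dt).iterate_D2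
  exact (h2.weighted_iterate_D1 hU h hB).base

theorem cls_iff_allMixed (hU : IsOpen U) (h : IsWeight ρ e U) (hB : FnAlg U B) :
    Cls ρ U B m f ↔ AllMixed ρ U B m f :=
  ⟨fun hf => hf.allMixed hU h hB, fun hf => hf.cls hU h hB⟩

theorem isWeight_one (hU : IsOpen U) : IsWeight (fun _ => 1) 0 U where
  hasDerivAt _ := hasDerivAt_const _ _
  indep _ _ _ := rfl
  continuous := continuous_const
  ne_zero _ _ := one_ne_zero
  inv m := isParabolicC_iff_cls.2 (Cls.congr hU (fun _ _ => ⟨⟩) (fun P _ => by simp)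
    (Cls.const' (FnAlg.trivial U) 1))

theorem isParabolicC_rpow (hU : IsOpen U) (hpos : ∀ P ∈ U, 0 < P.2.1) (s : ℝ) (m : ℕ) :
    IsParabolicC m U fun _ q => q.1 ^ s := by
  induction m using Nat.strong_induction_on generalizing s with
  | _ m ih =>
    have hc : ContinuousOn (fun P : ℝ × ℝ × ℝ => P.2.1 ^ s) U :=
      ContinuousOn.rpow_const (by fun_prop) fun P hP => Or.inl (hpos P hP).ne'
    have hconst : ∀ (c : ℝ) (n : ℕ), IsParabolicC n U fun _ _ => c := fun c n =>
      isParabolicC_iff_cls.2 (Cls.const' (FnAlg.trivial U) c)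
    rcases m with _ | m
    · exact hc
    · have hd : ∀ P ∈ U, HasDerivAt (fun x : ℝ => x ^ s) (s * P.2.1 ^ (s - 1)) P.2.1 :=
        fun P hP => Real.hasDerivAt_rpow_const (Or.inl (hpos P hP).ne')
      refine isParabolicC_succ.2 ⟨hc, fun P hP => (hd P hP).differentiableAt,
        fun P _ => differentiableAt_const (P.2.1 ^ s),
        (isParabolicC_mul hU (hconst s m) (ih m (by omega) (s - 1))).congr hU
          fun P hP => (hd P hP).deriv.symm,
        (hconst 0 m).congr hU fun P _ => by simp [D2, pd2], ?_⟩
      rintro n rfl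
      exact ⟨fun P _ => differentiableAt_const _,
        (hconst 0 n).congr hU fun P _ => by simp [Dt]⟩

theorem isWeight_fst (hU : IsOpen U) (hpos : ∀ P ∈ U, 0 < P.2.1) : IsWeight Prod.fst 1 U where
  hasDerivAt _ := hasDerivAt_id' _
  indep _ _ _ := rfl
  continuous := continuous_fst
  ne_zero P hP := (hpos P hP).ne'
  inv m := (isParabolicC_rpow hU hpos (-1) m).congr hU fun P _ => by rw [Real.rpow_neg_one]

end AllMixed

/-! ### Hölder classes -/

/-- `f` is bounded and `α`-Hölder on `U` with respect to `d`. -/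
def HB (d : ℝ × ℝ × ℝ → ℝ × ℝ × ℝ → ℝ) (α : ℝ) (U : Set (ℝ × ℝ × ℝ)) (f : STFn) : Prop :=
  ∃ C : ℝ, 0 ≤ C ∧ (∀ P ∈ U, |f P.1 P.2| ≤ C) ∧
    ∀ P ∈ U, ∀ P' ∈ U, |f P.1 P.2 - f P'.1 P'.2| ≤ C * d P P' ^ α

section HB

variable {d : ℝ × ℝ × ℝ → ℝ × ℝ × ℝ → ℝ} {α : ℝ} {U : Set (ℝ × ℝ × ℝ)} {f g : STFn}

theorem abs_le_of_holderNorm_le {μ : ℝ} (hμ : 0 ≤ μ) (h : holderNorm d α U f ≤ ENNReal.ofReal μ)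
    {P : ℝ × ℝ × ℝ} (hP : P ∈ U) : |f P.1 P.2| ≤ μ := by
  have h1 : ‖f P.1 P.2‖ₑ ≤ ENNReal.ofReal μ :=
    (le_iSup₂ (f := fun P (_ : P ∈ U) => ‖f P.1 P.2‖ₑ) P hP).trans (le_self_add.trans h)
  rw [← ofReal_norm] at h1
  exact (ENNReal.ofReal_le_ofReal_iff hμ).1 h1

theorem holderNorm_lt_top_iff (hd : ∀ P P', 0 ≤ d P P') :
    holderNorm d α U f < ⊤ ↔ HB d α U f := by
  constructor
  · intro h
    set C := (holderNorm d α U f).toReal with hC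
    have hle : holderNorm d α U f ≤ ENNReal.ofReal C := by rw [hC, ENNReal.ofReal_toReal h.ne]
    have hC0 : 0 ≤ C := ENNReal.toReal_nonneg
    refine ⟨C, hC0, fun P hP => abs_le_of_holderNorm_le hC0 hle hP, fun P hP P' hP' => ?_⟩
    have h1 : ‖f P.1 P.2 - f P'.1 P'.2‖ₑ / ENNReal.ofReal (d P P' ^ α) ≤ ENNReal.ofReal C :=
      (le_iSup₂ (f := fun P' (_ : P' ∈ U) =>
        ‖f P.1 P.2 - f P'.1 P'.2‖ₑ / ENNReal.ofReal (d P P' ^ α)) P' hP').trans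
        ((le_iSup₂ (f := fun P (_ : P ∈ U) => ⨆ P' ∈ U,
          ‖f P.1 P.2 - f P'.1 P'.2‖ₑ / ENNReal.ofReal (d P P' ^ α)) P hP).trans
          (le_add_self.trans hle))
    have hdα : 0 ≤ d P P' ^ α := Real.rpow_nonneg (hd P P') α
    rcases hdα.eq_or_lt with h0 | h0
    -- At distance zero a nonzero numerator would make the quotient `⊤`; finiteness therefore forces
    -- the two values to agree.
    · rw [← h0, ENNReal.ofReal_zero] at h1
      by_cases hz : f P.1 P.2 - f P'.1 P'.2 = 0
      · rw [hz, abs_zero]; exact mul_nonneg hC0 hdα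
      · rw [ENNReal.div_zero (by simpa using hz)] at h1
        simp at h1
    · rw [ENNReal.div_le_iff (by simpa using h0) ENNReal.ofReal_ne_top,
        ← ENNReal.ofReal_mul hC0, ← ofReal_norm] at h1
      exact (ENNReal.ofReal_le_ofReal_iff (mul_nonneg hC0 hdα)).1 h1
  · rintro ⟨C, hC, h1, h2⟩
    refine ENNReal.add_lt_top.2 ⟨?_, ?_⟩
    · refine lt_of_le_of_lt (iSup₂_le fun P hP => ?_) (ENNReal.ofReal_lt_top (r := C))
      rw [← ofReal_norm]
      exact ENNReal.ofReal_le_ofReal (h1 P hP)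
    · refine lt_of_le_of_lt (iSup₂_le fun P hP => iSup₂_le fun P' hP' => ?_)
        (ENNReal.ofReal_lt_top (r := C))
      have hdα : 0 ≤ d P P' ^ α := Real.rpow_nonneg (hd P P') α
      refine ENNReal.div_le_of_le_mul ?_
      rw [← ENNReal.ofReal_mul hC, ← ofReal_norm]
      exact ENNReal.ofReal_le_ofReal (h2 P hP P' hP')

theorem HB.congr (h : ∀ P ∈ U, f P.1 P.2 = g P.1 P.2) (hf : HB d α U f) : HB d α U g := by
  obtain ⟨C, hC, h1, h2⟩ := hf
  exact ⟨C, hC, fun P hP => h P hP ▸ h1 P hP, fun P hP P' hP' => h P hP ▸ h P' hP' ▸ h2 P hP P' hP'⟩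

theorem HB.mono {V : Set (ℝ × ℝ × ℝ)} (hV : V ⊆ U) (hf : HB d α U f) : HB d α V f := by
  obtain ⟨C, hC, h1, h2⟩ := hf
  exact ⟨C, hC, fun P hP => h1 P (hV hP), fun P hP P' hP' => h2 P (hV hP) P' (hV hP')⟩

theorem fnAlg_HB (hd : ∀ P P', 0 ≤ d P P') : FnAlg U (HB d α U) where
  congr := HB.congr
  const c := ⟨|c|, abs_nonneg c, fun _ _ => le_rfl, fun P _ P' _ => by
    rw [sub_self, abs_zero]; exact mul_nonneg (abs_nonneg c) (Real.rpow_nonneg (hd P P') α)⟩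
  add := by
    rintro f g ⟨C, hC, h1, h2⟩ ⟨C', hC', h1', h2'⟩
    refine ⟨C + C', by positivity, fun P hP => (abs_add_le _ _).trans
      (add_le_add (h1 P hP) (h1' P hP)), fun P hP P' hP' => ?_⟩
    rw [add_sub_add_comm, add_mul]
    exact (abs_add_le _ _).trans (add_le_add (h2 P hP P' hP') (h2' P hP P' hP'))
  mul := by
    rintro f g ⟨C, hC, h1, h2⟩ ⟨C', hC', h1', h2'⟩
    refine ⟨2 * C * C', by positivity, fun P hP => ?_, fun P hP P' hP' => ?_⟩
    · rw [abs_mul]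
      nlinarith [h1 P hP, h1' P hP, abs_nonneg (f P.1 P.2), abs_nonneg (g P.1 P.2),
        mul_le_mul (h1 P hP) (h1' P hP) (abs_nonneg _) hC]
    · have e : f P.1 P.2 * g P.1 P.2 - f P'.1 P'.2 * g P'.1 P'.2
          = (f P.1 P.2 - f P'.1 P'.2) * g P.1 P.2 + f P'.1 P'.2 * (g P.1 P.2 - g P'.1 P'.2) := by
        ring
      rw [e]
      refine (abs_add_le _ _).trans ?_
      rw [abs_mul, abs_mul]
      have hd' : 0 ≤ d P P' ^ α := Real.rpow_nonneg (hd P P') α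
      have a1 := mul_le_mul (h2 P hP P' hP') (h1' P hP) (abs_nonneg _) (mul_nonneg hC hd')
      have a2 := mul_le_mul (h1 P' hP') (h2' P hP P' hP') (abs_nonneg _) hC
      nlinarith
  inv := by
    rintro f ⟨C, hC, h1, h2⟩ ⟨c, hc, h0⟩
    have hne : ∀ P ∈ U, f P.1 P.2 ≠ 0 := fun P hP h => by
      have := h0 P hP
      rw [h, abs_zero] at this
      linarith
    refine ⟨max c⁻¹ (C / (c * c)), le_max_of_le_left (inv_nonneg.2 hc.le), fun P hP => ?_,
      fun P hP P' hP' => ?_⟩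
    · rw [abs_inv]
      exact (inv_anti₀ hc (h0 P hP)).trans (le_max_left _ _)
    · have hd' : 0 ≤ d P P' ^ α := Real.rpow_nonneg (hd P P') α
      have e : (f P.1 P.2)⁻¹ - (f P'.1 P'.2)⁻¹
          = -(f P.1 P.2 - f P'.1 P'.2) / (f P.1 P.2 * f P'.1 P'.2) := by
        have := hne P hP
        have := hne P' hP'
        field_simp
        ring
      rw [e, abs_div, abs_neg, abs_mul]
      calc _ ≤ C * d P P' ^ α / (c * c) := by
            gcongr
            · exact h2 P hP P' hP'
            · exact h0 P hP
            · exact h0 P' hP'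
        _ = C / (c * c) * d P P' ^ α := by ring
        _ ≤ _ := by gcongr; exact le_max_right _ _

/-- For `s ≤ 1` one has `s ≤ s^α`, and for `s ≥ 1` one has `1 ≤ s^α`; so bounded Lipschitz functions
are Hölder. -/
theorem le_mul_rpow_of_le {C x s : ℝ} (hC : 0 ≤ C) (hα : 0 < α) (hα' : α ≤ 1) (hs : 0 ≤ s)
    (h1 : x ≤ C) (h2 : x ≤ C * s) : x ≤ C * s ^ α := by
  rcases le_total s 1 with h | h
  · refine h2.trans (mul_le_mul_of_nonneg_left ?_ hC)
    rcases hs.eq_or_lt with rfl | hs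
    · exact Real.rpow_nonneg le_rfl α
    · simpa using Real.rpow_le_rpow_of_exponent_ge hs h hα'
  · exact h1.trans (le_mul_of_one_le_right hC (Real.one_le_rpow h hα.le))

theorem HB.of_lipschitz (hα : 0 < α) (hα' : α ≤ 1) (hd : ∀ P P', 0 ≤ d P P') {C : ℝ} (hC : 0 ≤ C)
    (h1 : ∀ P ∈ U, |f P.1 P.2| ≤ C)
    (h2 : ∀ P ∈ U, ∀ P' ∈ U, |f P.1 P.2 - f P'.1 P'.2| ≤ C * d P P') : HB d α U f := by
  refine ⟨2 * C, by positivity, fun P hP => (h1 P hP).trans (by linarith), fun P hP P' hP' => ?_⟩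
  refine le_mul_rpow_of_le (by positivity) hα hα' (hd P P') ?_ ?_
  · refine (abs_sub _ _).trans ?_
    linarith [h1 P hP, h1 P' hP']
  · refine (h2 P hP P' hP').trans ?_
    have := mul_nonneg hC (hd P P')
    linarith

end HB

theorem euclideanDist_nonneg (P P' : ℝ × ℝ × ℝ) : 0 ≤ euclideanDist P P' := by
  unfold euclideanDist; positivity

theorem hyperbolicDist_nonneg (P P' : ℝ × ℝ × ℝ) : 0 ≤ hyperbolicDist P P' := by
  unfold hyperbolicDist; positivity

/-! ### Norms as sums over multi-indices -/

theorem sumMultiIndex_lt_top_iff {m : ℕ} {N : ℕ → ℕ → ℕ → ℝ≥0∞} :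
    sumMultiIndex m N < ⊤ ↔ ∀ i j l, i + j + 2 * l ≤ m → N i j l < ⊤ := by
  simp only [sumMultiIndex, ENNReal.sum_lt_top, Finset.mem_range]
  constructor
  · intro h i j l hl
    exact h i (by omega) j (by omega) l (by omega)
  · intro h i hi j hj l hl
    exact h i j l (by omega)

theorem le_sumMultiIndex {m : ℕ} {N : ℕ → ℕ → ℕ → ℝ≥0∞} {i j l : ℕ} (h : i + j + 2 * l ≤ m) :
    N i j l ≤ sumMultiIndex m N := by
  unfold sumMultiIndex
  refine le_trans ?_ (Finset.single_le_sum (f := fun i => ∑ j ∈ Finset.range (m - i + 1),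
    ∑ l ∈ Finset.range ((m - i - j) / 2 + 1), N i j l) (fun _ _ => zero_le)
    (Finset.mem_range.2 (by omega : i < m + 1)))
  refine le_trans ?_ (Finset.single_le_sum (f := fun j =>
    ∑ l ∈ Finset.range ((m - i - j) / 2 + 1), N i j l) (fun _ _ => zero_le)
    (Finset.mem_range.2 (by omega : j < m - i + 1)))
  exact Finset.single_le_sum (f := fun l => N i j l) (fun _ _ => zero_le)
    (Finset.mem_range.2 (by omega))

section Mem

variable {U : Set (ℝ × ℝ × ℝ)} {m : ℕ} {α : ℝ} {f : STFn}

theorem memClassical_iff_cls (hU : IsOpen U) :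
    MemClassical m α U f ↔ Cls (fun _ => 1) U (HB euclideanDist α U) m f := by
  rw [cls_iff_allMixed hU (isWeight_one hU) (fnAlg_HB euclideanDist_nonneg), MemClassical, AllMixed,
    classicalNorm, sumMultiIndex_lt_top_iff]
  simp only [holderNorm_lt_top_iff euclideanDist_nonneg, one_pow, one_mul]

theorem memS_iff_cls (hU : IsOpen U) (hpos : ∀ P ∈ U, 0 < P.2.1) :
    MemS m α U f ↔ Cls Prod.fst U (HB hyperbolicDist α U) m f := by
  rw [cls_iff_allMixed hU (isWeight_fst hU hpos) (fnAlg_HB hyperbolicDist_nonneg), MemS, AllMixed,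
    sNorm, sumMultiIndex_lt_top_iff]
  simp only [holderNorm_lt_top_iff hyperbolicDist_nonneg]

end Mem

/-! ### Functions on the collar -/

theorem isOpen_collar (τ : ℝ) : IsOpen (collar τ) :=
  isOpen_Ioo.prod (isOpen_Ioo.prod isOpen_univ)

theorem collar_pos {τ : ℝ} : ∀ P ∈ collar τ, 0 < P.2.1 := fun _ hP => hP.2.1.1

theorem mem_collar {τ t z y : ℝ} : (t, z, y) ∈ collar τ ↔ (0 < t ∧ t < τ) ∧ 0 < z ∧ z < 1 / 2 := by
  simp [collar]

theorem collar_lt_one {τ : ℝ} {P : ℝ × ℝ × ℝ} (hP : P ∈ collar τ) : P.2.1 < 1 :=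
  hP.2.1.2.trans (by norm_num)

/-- A bounded function of `(z, y)` with bounded `z φ_z` and `φ_y` is hyperbolically Hölder. -/
theorem hb_collar_of_bounds {α : ℝ} (hα : 0 < α) (hα' : α ≤ 1) (τ : ℝ) {φ a b : ℝ × ℝ → ℝ} {C : ℝ}
    (h0 : ∀ q : ℝ × ℝ, q.1 ∈ Ioo (0 : ℝ) (1 / 2) → |φ q| ≤ C)
    (h1 : ∀ q : ℝ × ℝ, q.1 ∈ Ioo (0 : ℝ) (1 / 2) →
      HasDerivAt (fun s => φ (s, q.2)) (a q) q.1 ∧ |q.1 * a q| ≤ C)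
    (h2 : ∀ q : ℝ × ℝ, q.1 ∈ Ioo (0 : ℝ) (1 / 2) →
      HasDerivAt (fun s => φ (q.1, s)) (b q) q.2 ∧ |b q| ≤ C) :
    HB hyperbolicDist α (collar τ) (fun _ => φ) := by
  have hC : 0 ≤ C := (abs_nonneg _).trans (h0 (1 / 4, 0) (by norm_num))
  refine HB.of_lipschitz (C := 2 * C) hα hα' hyperbolicDist_nonneg (by positivity)
    (fun P hP => (h0 P.2 hP.2.1).trans (by linarith)) fun P hP P' hP' => ?_
  have e1 : |φ (P.2.1, P.2.2) - φ (P'.2.1, P.2.2)|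
      ≤ C * |Real.log P.2.1 - Real.log P'.2.1| := by
    -- In the variable `s = ln z` the derivative of `φ` is `z φ_z`, which is bounded; hence `φ` is
    -- Lipschitz in `ln z`.
    have hs : Convex ℝ (Iio (Real.log (1 / 2))) := convex_Iio _
    have hmem : ∀ s ∈ Iio (Real.log (1 / 2)), Real.exp s ∈ Ioo (0 : ℝ) (1 / 2) := fun s hs =>
      ⟨Real.exp_pos s, (Real.lt_log_iff_exp_lt (by norm_num)).1 hs⟩
    have := hs.norm_image_sub_le_of_norm_hasDerivWithin_le
      (f := fun s => φ (Real.exp s, P.2.2)) (f' := fun s => a (Real.exp s, P.2.2) * Real.exp s)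
      (C := C) (x := Real.log P'.2.1) (y := Real.log P.2.1)
      (fun s hs => (HasDerivAt.comp (h₂ := fun r => φ (r, P.2.2)) s
        (h1 (Real.exp s, P.2.2) (hmem s hs)).1 (Real.hasDerivAt_exp s)).hasDerivWithinAt)
      (fun s hs => by
        rw [mul_comm]; exact (h1 (Real.exp s, P.2.2) (hmem s hs)).2)
      (Real.log_lt_log hP'.2.1.1 hP'.2.1.2) (Real.log_lt_log hP.2.1.1 hP.2.1.2)
    simpa only [Real.exp_log hP.2.1.1, Real.exp_log hP'.2.1.1, Real.norm_eq_abs] using this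
  have e2 : |φ (P'.2.1, P.2.2) - φ (P'.2.1, P'.2.2)| ≤ C * |P.2.2 - P'.2.2| := by
    have := (convex_univ (𝕜 := ℝ) (E := ℝ)).norm_image_sub_le_of_norm_hasDerivWithin_le
      (f := fun s => φ (P'.2.1, s)) (f' := fun s => b (P'.2.1, s))
      (C := C) (x := P'.2.2) (y := P.2.2)
      (fun s _ => (h2 (P'.2.1, s) hP'.2.1).1.hasDerivWithinAt)
      (fun s _ => (h2 (P'.2.1, s) hP'.2.1).2) (mem_univ _) (mem_univ _)
    simpa only [Real.norm_eq_abs] using this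
  have e3 : |Real.log P.2.1 - Real.log P'.2.1| ≤ hyperbolicDist P P' := by
    refine le_trans ?_ (le_add_of_nonneg_right (Real.sqrt_nonneg _))
    rw [← Real.sqrt_sq_eq_abs]
    exact Real.sqrt_le_sqrt (by nlinarith [sq_nonneg (P.2.2 - P'.2.2)])
  have e4 : |P.2.2 - P'.2.2| ≤ hyperbolicDist P P' := by
    refine le_trans ?_ (le_add_of_nonneg_right (Real.sqrt_nonneg _))
    rw [← Real.sqrt_sq_eq_abs]
    exact Real.sqrt_le_sqrt (by nlinarith [sq_nonneg (Real.log P.2.1 - Real.log P'.2.1)])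
  have e5 := abs_sub_le (φ (P.2.1, P.2.2)) (φ (P'.2.1, P.2.2)) (φ (P'.2.1, P'.2.2))
  have e6 := mul_le_mul_of_nonneg_left e3 hC
  have e7 := mul_le_mul_of_nonneg_left e4 hC
  simp only [Prod.mk.eta] at e5
  simp only [Prod.mk.eta] at e1 e2
  linarith

theorem hb_rpow {α : ℝ} (hα : 0 < α) (hα' : α ≤ 1) (τ : ℝ) {s : ℝ} (hs : 0 ≤ s) :
    HB hyperbolicDist α (collar τ) (fun _ q => q.1 ^ s) := by
  have hle : ∀ q : ℝ × ℝ, q.1 ∈ Ioo (0 : ℝ) (1 / 2) → |q.1 ^ s| ≤ 1 := fun q hq => by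
    rw [abs_of_nonneg (Real.rpow_nonneg hq.1.le s)]
    exact Real.rpow_le_one hq.1.le (by linarith [hq.2]) hs
  refine hb_collar_of_bounds hα hα' τ (C := 1 + s) (a := fun q => s * q.1 ^ (s - 1))
    (b := fun _ => 0) (fun q hq => (hle q hq).trans (by linarith)) (fun q hq => ⟨?_, ?_⟩)
    fun q hq => ⟨hasDerivAt_const q.2 (q.1 ^ s), by simp; linarith⟩
  · exact Real.hasDerivAt_rpow_const (Or.inl hq.1.ne')
  · have : q.1 * (s * q.1 ^ (s - 1)) = s * q.1 ^ s := by
      rw [Real.rpow_sub_one hq.1.ne']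
      have := hq.1.ne'
      field_simp
    rw [this, abs_mul, abs_of_nonneg hs]
    nlinarith [hle q hq]

theorem cls_rpow {α : ℝ} (hα : 0 < α) (hα' : α ≤ 1) (τ : ℝ) {s : ℝ} (hs : 0 ≤ s) (m : ℕ) :
    Cls Prod.fst (collar τ) (HB hyperbolicDist α (collar τ)) m (fun _ q => q.1 ^ s) := by
  have hB : FnAlg (collar τ) (HB hyperbolicDist α (collar τ)) := fnAlg_HB hyperbolicDist_nonneg
  have hU := isOpen_collar τ
  induction m using Nat.strong_induction_on with
  | _ m ih =>
    have hpar := isParabolicC_rpow hU collar_pos s m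
    rcases m with _ | m
    · exact ⟨hpar, hb_rpow hα hα' τ hs⟩
    · refine cls_succ.2 ⟨hpar.continuousOn, fun P hP => hpar.diff1 hP, fun P hP => hpar.diff2 hP,
        hb_rpow hα hα' τ hs, ?_, ?_, ?_⟩
      · refine Cls.congr hU hB.congr (fun P hP => ?_)
          ((hB.cls hU m).cmul s (ih m (by omega)))
        have hd : D1 (fun _ q => q.1 ^ s : STFn) P.1 P.2 = s * P.2.1 ^ (s - 1) :=
          (Real.hasDerivAt_rpow_const (Or.inl (collar_pos P hP).ne')).deriv
        have := (collar_pos P hP).ne'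
        rw [hd, Real.rpow_sub_one this]
        field_simp
      · exact Cls.congr hU hB.congr (fun P _ => by simp [D2, pd2]) ((hB.cls hU m).const 0)
      · rintro n rfl
        exact ⟨fun P _ => differentiableAt_const _,
          Cls.congr hU hB.congr (fun P _ => by simp [Dt]) ((hB.cls hU n).const 0)⟩

/-! ### The weighted class with boundary values -/

/-- `f = a + z^p b` with Hölder functions `a`, `b`, where `a` does not depend on `z`. -/
def HBP (p α τ : ℝ) (f : STFn) : Prop :=
  ∃ a b : STFn, HB hyperbolicDist α (collar τ) a ∧ HB hyperbolicDist α (collar τ) b ∧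
    (∀ t z z' y, a t (z, y) = a t (z', y)) ∧
    ∀ P ∈ collar τ, f P.1 P.2 = a P.1 P.2 + P.2.1 ^ p * b P.1 P.2

section HBP

variable {p α τ : ℝ} {f g : STFn}

/-- Since `b` is bounded and `p > 0`, the term `z^p b` disappears in the limit; the part `a` of any
decomposition is therefore forced to be the boundary value. -/
theorem tendsto_of_eq_add_rpow (hp : 0 < p) {a b : STFn} {C t y : ℝ} (ht : t ∈ Ioo 0 τ)
    (hb : ∀ P ∈ collar τ, |b P.1 P.2| ≤ C) (ha : ∀ t z z' y, a t (z, y) = a t (z', y))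
    (hf : ∀ P ∈ collar τ, f P.1 P.2 = a P.1 P.2 + P.2.1 ^ p * b P.1 P.2) :
    Tendsto (fun z => f t (z, y)) (𝓝[>] 0) (𝓝 (a t (0, y))) := by
  have hev : ∀ᶠ z : ℝ in 𝓝[>] 0, (t, z, y) ∈ collar τ := by
    filter_upwards [Ioo_mem_nhdsGT (show (0 : ℝ) < 1 / 2 by norm_num)] with z hz
    exact mem_collar.2 ⟨ht, hz⟩
  have h0 : Tendsto (fun z : ℝ => z ^ p) (𝓝[>] 0) (𝓝 0) := by
    have := (Real.continuousAt_rpow_const 0 p (Or.inr hp.le)).tendsto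
    rw [Real.zero_rpow hp.ne'] at this
    exact this.mono_left nhdsWithin_le_nhds
  have h1 : Tendsto (fun z : ℝ => z ^ p * b t (z, y)) (𝓝[>] 0) (𝓝 0) :=
    h0.zero_mul_isBoundedUnder_le (isBoundedUnder_of_eventually_le (a := C)
      (hev.mono fun z hz => hb (t, z, y) hz))
  have h2 : Tendsto (fun z : ℝ => a t (0, y) + z ^ p * b t (z, y)) (𝓝[>] 0)
      (𝓝 (a t (0, y) + 0)) := tendsto_const_nhds.add h1
  rw [add_zero] at h2
  refine h2.congr' (hev.mono fun z hz => ?_)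
  have e := hf (t, z, y) hz
  dsimp only at e ⊢
  rw [e, ha t 0 z y]

theorem boundaryValue_of_eq_add_rpow (hp : 0 < p) {a b : STFn} {C : ℝ}
    (hb : ∀ P ∈ collar τ, |b P.1 P.2| ≤ C) (ha : ∀ t z z' y, a t (z, y) = a t (z', y))
    (hf : ∀ P ∈ collar τ, f P.1 P.2 = a P.1 P.2 + P.2.1 ^ p * b P.1 P.2) :
    ∀ P ∈ collar τ, boundaryValue f P.1 P.2 = a P.1 P.2 := by
  rintro ⟨t, z, y⟩ hP
  rw [ha t z 0 y]
  exact (tendsto_of_eq_add_rpow hp hP.1 hb ha hf).limUnder_eq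

/-- The decomposition `a + z^p b` is unique on the collar, so merely asking for its existence is
equivalent to finiteness of the norm. The existential form avoids the limit operator and is visibly
stable under algebra. -/
theorem holderNormP_lt_top_iff (hp : 0 < p) :
    holderNormP p α (collar τ) f < ⊤ ↔ HBP p α τ f := by
  rw [holderNormP, ENNReal.add_lt_top, holderNorm_lt_top_iff hyperbolicDist_nonneg,
    holderNorm_lt_top_iff hyperbolicDist_nonneg]
  constructor
  · rintro ⟨h1, h2⟩
    refine ⟨_, _, h1, h2, fun _ _ _ _ => rfl, fun P hP => ?_⟩
    have hz := collar_pos P hP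
    rw [← mul_assoc, ← Real.rpow_add hz, add_neg_cancel, Real.rpow_zero]
    ring
  · rintro ⟨a, b, ha, hb, hi, hf⟩
    obtain ⟨C, _, hbC, _⟩ := id hb
    have hbv := boundaryValue_of_eq_add_rpow hp hbC hi hf
    refine ⟨ha.congr fun P hP => (hbv P hP).symm, hb.congr fun P hP => ?_⟩
    have hz := collar_pos P hP
    rw [hbv P hP, hf P hP, add_sub_cancel_left, ← mul_assoc, ← Real.rpow_add hz, neg_add_cancel,
      Real.rpow_zero, one_mul]

theorem HBP.hb (hα : 0 < α) (hα' : α ≤ 1) (hp : 0 < p) (h : HBP p α τ f) :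
    HB hyperbolicDist α (collar τ) f := by
  obtain ⟨a, b, ha, hb, -, hf⟩ := h
  have hB : FnAlg (collar τ) (HB hyperbolicDist α (collar τ)) := fnAlg_HB hyperbolicDist_nonneg
  exact hB.congr (fun P hP => (hf P hP).symm) (hB.add ha (hB.mul (hb_rpow hα hα' τ hp.le) hb))

theorem HB.hbp (h : HB hyperbolicDist α (collar τ) f) : HBP p α τ (fun t q => q.1 ^ p * f t q) :=
  ⟨fun _ _ => 0, f, (fnAlg_HB hyperbolicDist_nonneg).const 0, h, fun _ _ _ _ => rfl,
    fun P _ => by simp⟩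

theorem fnAlg_HBP (hα : 0 < α) (hα' : α ≤ 1) (hp : 0 < p) : FnAlg (collar τ) (HBP p α τ) := by
  have hB : FnAlg (collar τ) (HB hyperbolicDist α (collar τ)) := fnAlg_HB hyperbolicDist_nonneg
  have hz := hb_rpow hα hα' τ hp.le
  refine ⟨?_, ?_, ?_, ?_, ?_⟩
  · rintro f g hfg ⟨a, b, ha, hb, hi, hf⟩
    exact ⟨a, b, ha, hb, hi, fun P hP => hfg P hP ▸ hf P hP⟩
  · intro c
    exact ⟨fun _ _ => c, fun _ _ => 0, hB.const c, hB.const 0, fun _ _ _ _ => rfl,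
      fun P _ => by simp⟩
  · rintro f g ⟨a, b, ha, hb, hi, hf⟩ ⟨a', b', ha', hb', hi', hf'⟩
    refine ⟨_, _, hB.add ha ha', hB.add hb hb', fun t z z' y => ?_, fun P hP => ?_⟩
    · simp only [hi t z z' y, hi' t z z' y]
    · dsimp only; rw [hf P hP, hf' P hP]; ring
  · rintro f g ⟨a, b, ha, hb, hi, hf⟩ ⟨a', b', ha', hb', hi', hf'⟩
    -- `(a + z^p b)(a' + z^p b') = a a' + z^p (a b' + b a' + z^p b b')`.
    refine ⟨_, _, hB.mul ha ha', hB.add (hB.add (hB.mul ha hb') (hB.mul hb ha'))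
      (hB.mul hz (hB.mul hb hb')), fun t z z' y => ?_, fun P hP => ?_⟩
    · simp only [hi t z z' y, hi' t z z' y]
    · dsimp only; rw [hf P hP, hf' P hP]; ring
  · rintro f hfP ⟨c, hc, h0⟩
    have hfB := hfP.hb hα hα' hp
    obtain ⟨a, b, ha, hb, hi, hf⟩ := hfP
    obtain ⟨C, _, hbC, _⟩ := id hb
    -- The lower bound for `f` passes to the boundary value.
    have ha0 : ∀ P ∈ collar τ, c ≤ |a P.1 P.2| := by
      rintro ⟨t, z, y⟩ hP
      rw [hi t z 0 y]
      have ht := (tendsto_of_eq_add_rpow hp (y := y) hP.1 hbC hi hf).abs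
      refine ge_of_tendsto ht ?_
      filter_upwards [Ioo_mem_nhdsGT (show (0 : ℝ) < 1 / 2 by norm_num)] with z hz
      exact h0 (t, z, y) (mem_collar.2 ⟨hP.1, hz⟩)
    -- `1/f - 1/a = -z^p b / (a f)`.
    refine ⟨_, _, hB.inv ha ⟨c, hc, ha0⟩, hB.neg (hB.mul hb (hB.mul (hB.inv ha ⟨c, hc, ha0⟩)
      (hB.inv hfB ⟨c, hc, h0⟩))), fun t z z' y => ?_, fun P hP => ?_⟩
    · simp only [hi t z z' y]
    · have h1 : f P.1 P.2 ≠ 0 := abs_pos.1 (hc.trans_le (h0 P hP))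
      have h2 : a P.1 P.2 ≠ 0 := abs_pos.1 (hc.trans_le (ha0 P hP))
      field_simp
      linarith [hf P hP]

theorem memSP_iff_cls (hα : 0 < α) (hα' : α ≤ 1) (hp : 0 < p) {m : ℕ} :
    MemSP m α p (collar τ) f ↔ Cls Prod.fst (collar τ) (HBP p α τ) m f := by
  rw [cls_iff_allMixed (isOpen_collar τ) (isWeight_fst (isOpen_collar τ) collar_pos)
    (fnAlg_HBP hα hα' hp), MemSP, AllMixed, spNorm, sumMultiIndex_lt_top_iff]
  simp only [holderNormP_lt_top_iff hp]

theorem Cls.toHB (hα : 0 < α) (hα' : α ≤ 1) (hp : 0 < p) {m : ℕ}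
    (h : Cls Prod.fst (collar τ) (HBP p α τ) m f) :
    Cls Prod.fst (collar τ) (HB hyperbolicDist α (collar τ)) m f :=
  h.mono Subset.rfl fun _ hf => hf.hb hα hα' hp

/-- Multiplication by `z^p` maps the unweighted class into the weighted one. -/
theorem Cls.rpow_mul (hα : 0 < α) (hα' : α ≤ 1) (hp : 0 < p) {m : ℕ}
    (h : Cls Prod.fst (collar τ) (HB hyperbolicDist α (collar τ)) m f) :
    Cls Prod.fst (collar τ) (HBP p α τ) m (fun t q => q.1 ^ p * f t q) := by
  have hB : FnAlg (collar τ) (HBP p α τ) := fnAlg_HBP hα hα' hp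
  have hU := isOpen_collar τ
  induction m using Nat.strong_induction_on generalizing f with
  | _ m ih =>
    have hz := isParabolicC_rpow hU collar_pos p m
    have hfp := h.isParabolicC hU (isWeight_fst hU collar_pos)
    have hpar := isParabolicC_mul hU hz hfp
    rcases m with _ | m
    · exact ⟨hpar, h.base.hbp⟩
    · refine cls_succ.2 ⟨hpar.continuousOn, fun P hP => hpar.diff1 hP, fun P hP => hpar.diff2 hP,
        h.base.hbp, ?_, ?_, ?_⟩
      · refine Cls.congr hU hB.congr (fun P hP => ?_) ((hB.cls hU m).add
          ((hB.cls hU m).cmul p (ih m (by omega) h.of_succ)) (ih m (by omega) h.D1))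
        have hne := (collar_pos P hP).ne'
        have hd : _root_.D1 (fun t q => q.1 ^ p * f t q) P.1 P.2 = _ :=
          ((Real.hasDerivAt_rpow_const (Or.inl hne)).fun_mul (h.diff1 hP).hasDerivAt).deriv
        rw [hd, Real.rpow_sub_one hne]
        simp only [_root_.D1, pd1, Prod.mk.eta]
        field_simp
      · refine Cls.congr hU hB.congr (fun P hP => ?_) (ih m (by omega) h.D2)
        exact (deriv_const_mul_field (P.2.1 ^ p)).symm
      · rintro n rfl
        refine ⟨fun P hP => hpar.difft hP, ?_⟩
        refine Cls.congr hU hB.congr (fun P hP => ?_) (ih n (by omega) h.Dt)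
        exact (deriv_const_mul_field (P.2.1 ^ p)).symm

/-- If `f` and `z f_z` have limits as `z → 0⁺`, then the second limit is zero. -/
theorem tendsto_mul_deriv_eq_zero {φ φ' : ℝ → ℝ} {a b : ℝ}
    (hφ : ∀ᶠ z in 𝓝[>] (0 : ℝ), HasDerivAt φ (φ' z) z) (h0 : Tendsto φ (𝓝[>] 0) (𝓝 a))
    (h1 : Tendsto (fun z => z * φ' z) (𝓝[>] 0) (𝓝 b)) : b = 0 := by
  obtain ⟨r, hr, hd⟩ := mem_nhdsGT_iff_exists_Ioo_subset.1 hφ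
  simp only [mem_Ioi] at hr
  -- The mean value theorem on `[z, 2z]` gives a point `x` with `|x φ'(x)| ≤ 2 |φ(2z) - φ(z)|`, and
  -- the right-hand side tends to zero. As `x → 0⁺`, the limit of `z φ'` along these points must be
  -- zero.
  have hx : ∀ z : ℝ, ∃ x, 0 < z ∧ 2 * z < r → x ∈ Ioo z (2 * z) ∧ φ (2 * z) - φ z = φ' x * z := by
    intro z
    by_cases hz : 0 < z ∧ 2 * z < r
    · have hdz : ∀ x ∈ Icc z (2 * z), HasDerivAt φ (φ' x) x := fun x hx =>
        hd ⟨hz.1.trans_le hx.1, hx.2.trans_lt hz.2⟩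
      obtain ⟨x, hx, he⟩ := exists_hasDerivAt_eq_slope φ φ' (by linarith : z < 2 * z)
        (fun x hx => (hdz x hx).continuousAt.continuousWithinAt)
        (fun x hx => hdz x (Ioo_subset_Icc_self hx))
      refine ⟨x, fun _ => ⟨hx, ?_⟩⟩
      rw [he, show 2 * z - z = z by ring, div_mul_cancel₀ _ hz.1.ne']
    · exact ⟨0, fun h => absurd h hz⟩
  choose x hx using hx
  have hev : ∀ᶠ z in 𝓝[>] (0 : ℝ), 0 < z ∧ 2 * z < r := by
    filter_upwards [Ioo_mem_nhdsGT (half_pos hr)] with z hz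
    exact ⟨hz.1, by linarith [hz.2]⟩
  have hxt : Tendsto x (𝓝[>] 0) (𝓝[>] 0) := by
    refine tendsto_nhdsWithin_iff.2 ⟨?_, hev.mono fun z hz => hz.1.trans (hx z hz).1.1⟩
    refine tendsto_of_tendsto_of_tendsto_of_le_of_le' (g := fun _ => 0) (h := fun z => 2 * z)
      tendsto_const_nhds ?_ (hev.mono fun z hz => (hz.1.trans (hx z hz).1.1).le)
      (hev.mono fun z hz => (hx z hz).1.2.le)
    have : Tendsto (fun z : ℝ => 2 * z) (𝓝 0) (𝓝 (2 * 0)) :=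
      Continuous.tendsto (by fun_prop) 0
    rw [mul_zero] at this
    exact this.mono_left nhdsWithin_le_nhds
  have h2 : Tendsto (fun z : ℝ => 2 * z) (𝓝[>] 0) (𝓝[>] 0) := by
    refine tendsto_nhdsWithin_iff.2 ⟨?_, hev.mono fun z hz => by simp [hz.1]⟩
    have : Tendsto (fun z : ℝ => 2 * z) (𝓝 0) (𝓝 (2 * 0)) :=
      Continuous.tendsto (by fun_prop) 0
    rw [mul_zero] at this
    exact this.mono_left nhdsWithin_le_nhds
  have h3 : Tendsto (fun z => φ (2 * z) - φ z) (𝓝[>] 0) (𝓝 0) := by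
    simpa using (h0.comp h2).sub h0
  have h4 : Tendsto (fun z => |φ (2 * z) - φ z| * 2) (𝓝[>] 0) (𝓝 0) := by
    simpa using h3.abs.mul_const 2
  have h5 : Tendsto (fun z => |x z * φ' (x z)|) (𝓝[>] 0) (𝓝 |b|) := (h1.comp hxt).abs
  have h6 : |b| ≤ 0 := by
    refine le_of_tendsto_of_tendsto h5 h4 (hev.mono fun z hz => ?_)
    obtain ⟨hxz, he⟩ := hx z hz
    dsimp only
    rw [he, abs_mul, abs_mul, abs_of_pos hz.1, abs_of_pos (hz.1.trans hxz.1)]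
    nlinarith [abs_nonneg (φ' (x z)), hxz.2]
  exact abs_eq_zero.1 (le_antisymm h6 (abs_nonneg b))

/-- The boundary value of `z f_z` vanishes. -/
theorem boundaryValue_mul_D1 (hp : 0 < p) (hf : HBP p α τ f)
    (hd : ∀ P ∈ collar τ, DifferentiableAt ℝ (fun s => f P.1 (s, P.2.2)) P.2.1)
    (hg : HBP p α τ fun t q => q.1 * D1 f t q) :
    ∀ P ∈ collar τ, boundaryValue (fun t q => q.1 * D1 f t q) P.1 P.2 = 0 := by
  obtain ⟨a, b, _, ⟨C, _, hb, _⟩, hi, hf⟩ := hf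
  obtain ⟨a', b', _, ⟨C', _, hb', _⟩, hi', hg⟩ := hg
  rintro ⟨t, z, y⟩ hP
  rw [boundaryValue_of_eq_add_rpow hp hb' hi' hg _ hP, hi' t z 0 y]
  refine tendsto_mul_deriv_eq_zero (φ := fun z => f t (z, y)) (φ' := fun z => D1 f t (z, y)) ?_
    (tendsto_of_eq_add_rpow hp (y := y) hP.1 hb hi hf)
    (tendsto_of_eq_add_rpow (f := fun t q => q.1 * D1 f t q) hp (y := y) hP.1 hb' hi' hg)
  filter_upwards [Ioo_mem_nhdsGT (show (0 : ℝ) < 1 / 2 by norm_num)] with z hz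
  exact (hd (t, z, y) (mem_collar.2 ⟨hP.1, hz⟩)).hasDerivAt

/-- With zero boundary value only the part `z^p b` remains. Applied to `g = z f_z`, this makes
`z^{1-p} f_z` Hölder, which is the source of the normalized jets. -/
theorem hb_rpow_neg_mul (hp : 0 < p) (hg : HBP p α τ g)
    (h0 : ∀ P ∈ collar τ, boundaryValue g P.1 P.2 = 0) :
    HB hyperbolicDist α (collar τ) fun t q => q.1 ^ (-p) * g t q := by
  obtain ⟨a, b, _, hb, hi, hg⟩ := hg
  obtain ⟨C, _, hbC, _⟩ := id hb
  refine hb.congr fun P hP => ?_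
  have ha : a P.1 P.2 = 0 := by
    rw [← boundaryValue_of_eq_add_rpow hp hbC hi hg _ hP, h0 P hP]
  rw [hg P hP, ha, zero_add, ← mul_assoc, ← Real.rpow_add (collar_pos P hP), neg_add_cancel,
    Real.rpow_zero, one_mul]

/-- `z^{-p} z f_z` is one order less regular than `f`, in the unweighted class. -/
theorem Cls.rpow_neg_mul_D1 (hp : 0 < p) {m : ℕ}
    (h : Cls Prod.fst (collar τ) (HBP p α τ) (m + 1) f) :
    Cls Prod.fst (collar τ) (HB hyperbolicDist α (collar τ)) m
      (fun t q => q.1 ^ (-p) * (q.1 * _root_.D1 f t q)) := by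
  have hB : FnAlg (collar τ) (HB hyperbolicDist α (collar τ)) := fnAlg_HB hyperbolicDist_nonneg
  have hU := isOpen_collar τ
  induction m using Nat.strong_induction_on generalizing f with
  | _ m ih =>
    have hz := isParabolicC_rpow hU collar_pos (-p) m
    have hw := isWeight_fst hU (collar_pos (τ := τ))
    have hfp := h.isParabolicC hU hw
    have hpar := isParabolicC_mul hU hz (h.D1.isParabolicC hU hw)
    have hbase : HB hyperbolicDist α (collar τ) (fun t q => q.1 ^ (-p) * (q.1 * _root_.D1 f t q)) :=
      hb_rpow_neg_mul hp h.D1.base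
        (boundaryValue_mul_D1 hp h.base (fun P hP => h.diff1 hP) h.D1.base)
    rcases m with _ | m
    · exact ⟨hpar, hbase⟩
    · refine cls_succ.2 ⟨hpar.continuousOn, fun P hP => hpar.diff1 hP, fun P hP => hpar.diff2 hP,
        hbase, ?_, ?_, ?_⟩
      -- `z D_z (z^{-p} z f_z) = -p z^{-p} z f_z + z^{-p} z D_z (z f_z)`: the induction hypothesis
      -- is used for `f` at one order less and for `z f_z`.
      · refine Cls.congr hU hB.congr (fun P hP => ?_) ((hB.cls hU m).add
          ((hB.cls hU m).cmul (-p) (ih m (by omega) h.of_succ)) (ih m (by omega) h.D1))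
        have hne := (collar_pos P hP).ne'
        have hd : _root_.D1 (fun t q => q.1 ^ (-p) * (q.1 * _root_.D1 f t q)) P.1 P.2 = _ :=
          ((Real.hasDerivAt_rpow_const (Or.inl hne)).fun_mul (h.D1.diff1 hP).hasDerivAt).deriv
        rw [hd, Real.rpow_sub_one hne]
        have hd2 : _root_.D1 (fun t q => q.1 * _root_.D1 f t q) P.1 P.2
          = deriv (fun s => (s, P.2.2).1 * _root_.D1 f P.1 (s, P.2.2)) P.2.1 := rfl
        simp only [hd2, Prod.mk.eta]
        field_simp
      · refine Cls.congr hU hB.congr (fun P hP => ?_) (ih m (by omega) h.D2)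
        have hd : _root_.D2 (fun t q => q.1 ^ (-p) * (q.1 * _root_.D1 f t q)) P.1 P.2
            = P.2.1 ^ (-p) * (P.2.1 * _root_.D2 (_root_.D1 f) P.1 P.2) :=
          (deriv_const_mul_field (P.2.1 ^ (-p))).trans
            (congrArg _ (deriv_const_mul_field P.2.1))
        rw [hd, hfp.D1_D2_comm hU P hP]
      · rintro n rfl
        refine ⟨fun P hP => hpar.difft hP, ?_⟩
        refine Cls.congr hU hB.congr (fun P hP => ?_) (ih n (by omega) h.Dt)
        have hd : _root_.Dt (fun t q => q.1 ^ (-p) * (q.1 * _root_.D1 f t q)) P.1 P.2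
            = P.2.1 ^ (-p) * (P.2.1 * _root_.Dt (_root_.D1 f) P.1 P.2) :=
          (deriv_const_mul_field (P.2.1 ^ (-p))).trans
            (congrArg _ (deriv_const_mul_field P.2.1))
        rw [hd, hfp.D1_Dt_comm hU P hP]

end HBP

/-! ### Smooth functions of the space variables -/

section Smooth

variable {E : Type*} [NormedAddCommGroup E] [NormedSpace ℝ E] {g : ℝ × ℝ → E}

theorem hasDerivAt_pd1_of_hasFDerivAt {L : ℝ × ℝ →L[ℝ] E} {q : ℝ × ℝ} (h : HasFDerivAt g L q) :
    HasDerivAt (fun s => g (s, q.2)) (L (1, 0)) q.1 := by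
  have h1 : HasDerivAt (fun s : ℝ => (s, q.2)) ((1 : ℝ), (0 : ℝ)) q.1 :=
    (hasDerivAt_id q.1).prodMk (hasDerivAt_const q.1 q.2)
  exact h.comp_hasDerivAt (f := fun s : ℝ => (s, q.2)) q.1 h1

theorem hasDerivAt_pd2_of_hasFDerivAt {L : ℝ × ℝ →L[ℝ] E} {q : ℝ × ℝ} (h : HasFDerivAt g L q) :
    HasDerivAt (fun s => g (q.1, s)) (L (0, 1)) q.2 := by
  have h1 : HasDerivAt (fun s : ℝ => (q.1, s)) ((0 : ℝ), (1 : ℝ)) q.2 :=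
    (hasDerivAt_const q.2 q.1).prodMk (hasDerivAt_id q.2)
  exact h.comp_hasDerivAt (f := fun s : ℝ => (q.1, s)) q.2 h1

theorem DifferentiableAt.pd1_eq {q : ℝ × ℝ} (h : DifferentiableAt ℝ g q) :
    pd1 g q = fderiv ℝ g q (1, 0) := (hasDerivAt_pd1_of_hasFDerivAt h.hasFDerivAt).deriv

theorem DifferentiableAt.pd2_eq {q : ℝ × ℝ} (h : DifferentiableAt ℝ g q) :
    pd2 g q = fderiv ℝ g q (0, 1) := (hasDerivAt_pd2_of_hasFDerivAt h.hasFDerivAt).deriv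

theorem DifferentiableAt.hasDerivAt_pd1 {q : ℝ × ℝ} (h : DifferentiableAt ℝ g q) :
    HasDerivAt (fun s => g (s, q.2)) (pd1 g q) q.1 :=
  (hasDerivAt_pd1_of_hasFDerivAt h.hasFDerivAt).differentiableAt.hasDerivAt

theorem DifferentiableAt.hasDerivAt_pd2 {q : ℝ × ℝ} (h : DifferentiableAt ℝ g q) :
    HasDerivAt (fun s => g (q.1, s)) (pd2 g q) q.2 :=
  (hasDerivAt_pd2_of_hasFDerivAt h.hasFDerivAt).differentiableAt.hasDerivAt

theorem ContDiff.pd1 (h : ContDiff ℝ ∞ g) : ContDiff ℝ ∞ (pd1 g) := by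
  have e : _root_.pd1 g = fun q => fderiv ℝ g q (1, 0) := by
    funext q; exact ((h.differentiable (by simp)) q).pd1_eq
  rw [e]
  exact (h.fderiv_right (m := ∞) le_rfl).clm_apply contDiff_const

theorem ContDiff.pd2 (h : ContDiff ℝ ∞ g) : ContDiff ℝ ∞ (pd2 g) := by
  have e : _root_.pd2 g = fun q => fderiv ℝ g q (0, 1) := by
    funext q; exact ((h.differentiable (by simp)) q).pd2_eq
  rw [e]
  exact (h.fderiv_right (m := ∞) le_rfl).clm_apply contDiff_const

theorem ContDiff.hasDerivAt_pd1 (h : ContDiff ℝ ∞ g) (q : ℝ × ℝ) :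
    HasDerivAt (fun s => g (s, q.2)) (_root_.pd1 g q) q.1 :=
  ((h.differentiable (by simp)) q).hasDerivAt_pd1

theorem ContDiff.hasDerivAt_pd2 (h : ContDiff ℝ ∞ g) (q : ℝ × ℝ) :
    HasDerivAt (fun s => g (q.1, s)) (_root_.pd2 g q) q.2 :=
  ((h.differentiable (by simp)) q).hasDerivAt_pd2

end Smooth

/-- A family of smooth functions closed under `ρ ∂₁` and `∂₂` lies in every class `Cls ρ U B m`
whose base class contains it. -/
theorem cls_of_family {ρ : ℝ × ℝ → ℝ} {U : Set (ℝ × ℝ × ℝ)} {B : STFn → Prop}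
    (hU : IsOpen U) (hB : FnAlg U B) {G : (ℝ × ℝ → ℝ) → Prop} (hs : ∀ g, G g → ContDiff ℝ ∞ g)
    (h1 : ∀ g, G g → G fun q => ρ q * pd1 g q) (h2 : ∀ g, G g → G (pd2 g))
    (hb : ∀ g, G g → B fun _ => g) (m : ℕ) (g : ℝ × ℝ → ℝ) (hg : G g) :
    Cls ρ U B m fun _ => g := by
  induction m using Nat.strong_induction_on generalizing g with
  | _ m ih =>
    have hc : ContinuousOn (fun P : ℝ × ℝ × ℝ => g P.2) U :=
      ((hs g hg).continuous.comp continuous_snd).continuousOn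
    rcases m with _ | m
    · exact ⟨hc, hb g hg⟩
    · refine cls_succ.2 ⟨hc, fun P _ => ((hs g hg).hasDerivAt_pd1 P.2).differentiableAt,
        fun P _ => ((hs g hg).hasDerivAt_pd2 P.2).differentiableAt, hb g hg,
        ih m (by omega) _ (h1 g hg), ih m (by omega) _ (h2 g hg), ?_⟩
      rintro n rfl
      exact ⟨fun P _ => differentiableAt_const _,
        Cls.congr hU hB.congr (fun P _ => by simp [Dt]) ((hB.cls hU n).const 0)⟩

theorem ContDiff.isParabolicC {U : Set (ℝ × ℝ × ℝ)} (hU : IsOpen U) {g : ℝ × ℝ → ℝ}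
    (hg : ContDiff ℝ ∞ g) (m : ℕ) : IsParabolicC m U fun _ => g :=
  isParabolicC_iff_cls.2 (cls_of_family hU (FnAlg.trivial U) (G := ContDiff ℝ ∞) (fun _ h => h)
    (fun _ h => by simpa using h.pd1) (fun _ h => h.pd2) (fun _ _ => ⟨⟩) m g hg)

theorem isOpen_openDisc (r : ℝ) : IsOpen (openDisc r) :=
  isOpen_lt (by fun_prop) continuous_const

theorem isClosed_closedDisc : IsClosed closedDisc := isClosed_le (by fun_prop) continuous_const

theorem isCompact_closedDisc : IsCompact closedDisc := by
  refine Metric.isCompact_of_isClosed_isBounded isClosed_closedDisc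
    ((Metric.isBounded_closedBall (x := (0 : ℝ × ℝ)) (r := 1)).subset fun q hq => ?_)
  simp only [closedDisc, mem_ofPred_eq] at hq
  rw [mem_closedBall_zero_iff, Prod.norm_def, max_le_iff, Real.norm_eq_abs, Real.norm_eq_abs]
  exact ⟨abs_le_of_sq_le_sq (by nlinarith [sq_nonneg q.2]) (by norm_num),
    abs_le_of_sq_le_sq (by nlinarith [sq_nonneg q.1]) (by norm_num)⟩

theorem openDisc_mono {r r' : ℝ} (hr : r ^ 2 ≤ r' ^ 2) : openDisc r ⊆ openDisc r' :=
  fun q hq => by simp only [openDisc, mem_ofPred_eq] at *; linarith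

theorem ContDiff.hb_disc {α : ℝ} (hα : 0 < α) (hα' : α ≤ 1) {τ r : ℝ} (hr : r ^ 2 ≤ 1)
    {g : ℝ × ℝ → ℝ} (hg : ContDiff ℝ ∞ g) :
    HB euclideanDist α (Ioo 0 τ ×ˢ openDisc r) fun _ => g := by
  set K : Set (ℝ × ℝ) := Metric.closedBall 0 1 with hK
  have hKc : IsCompact K := isCompact_closedBall _ _
  have hsub : openDisc r ⊆ K := fun q hq => by
    simp only [openDisc, mem_ofPred_eq] at hq
    rw [hK, mem_closedBall_zero_iff, Prod.norm_def, max_le_iff, Real.norm_eq_abs, Real.norm_eq_abs]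
    exact ⟨abs_le_of_sq_le_sq (by nlinarith [sq_nonneg q.2]) (by norm_num),
      abs_le_of_sq_le_sq (by nlinarith [sq_nonneg q.1]) (by norm_num)⟩
  obtain ⟨C1, h1⟩ := hKc.exists_bound_of_continuousOn hg.continuous.continuousOn
  obtain ⟨C2, h2⟩ := hKc.exists_bound_of_continuousOn
    (hg.continuous_fderiv (by simp)).continuousOn
  have hC : 0 ≤ max C1 C2 := le_max_of_le_left
    ((norm_nonneg _).trans (h1 0 (Metric.mem_closedBall_self zero_le_one)))
  refine HB.of_lipschitz hα hα' euclideanDist_nonneg hC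
    (fun P hP => (h1 P.2 (hsub hP.2)).trans (le_max_left _ _)) fun P hP P' hP' => ?_
  have h3 := (convex_closedBall (0 : ℝ × ℝ) 1).norm_image_sub_le_of_norm_fderiv_le
    (fun q _ => hg.differentiable (by simp) q) h2 (hsub hP'.2) (hsub hP.2)
  have h4 : ‖P.2 - P'.2‖ ≤ euclideanDist P P' := by
    refine le_trans ?_ (le_add_of_nonneg_right (Real.sqrt_nonneg _))
    rw [Prod.norm_def, max_le_iff, Real.norm_eq_abs, Real.norm_eq_abs]
    exact ⟨Real.abs_le_sqrt (le_add_of_nonneg_right (sq_nonneg _)),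
      Real.abs_le_sqrt (le_add_of_nonneg_left (sq_nonneg _))⟩
  exact h3.trans (mul_le_mul (le_max_right _ _) h4 (norm_nonneg _) hC)

theorem ContDiff.cls_disc {α : ℝ} (hα : 0 < α) (hα' : α ≤ 1) {τ r : ℝ} (hr : r ^ 2 ≤ 1)
    {g : ℝ × ℝ → ℝ} (hg : ContDiff ℝ ∞ g) (m : ℕ) :
    Cls (fun _ => 1) (Ioo 0 τ ×ˢ openDisc r) (HB euclideanDist α (Ioo 0 τ ×ˢ openDisc r)) m
      fun _ => g :=
  cls_of_family (isOpen_Ioo.prod (isOpen_openDisc r)) (fnAlg_HB euclideanDist_nonneg)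
    (G := ContDiff ℝ ∞) (fun _ h => h) (fun _ h => by simpa using h.pd1) (fun _ h => h.pd2)
    (fun _ h => h.hb_disc hα hα' hr) m g hg

/-! ### Smooth functions in flattened coordinates -/

/-- Smooth functions of `(z, y)` that are `2π`-periodic in `y`. -/
structure IsChartFn (g : ℝ × ℝ → ℝ) : Prop where
  smooth : ContDiff ℝ ∞ g
  periodic : ∀ z y, g (z, y + 2 * Real.pi) = g (z, y)

namespace IsChartFn

variable {g h : ℝ × ℝ → ℝ}

theorem mul (hg : IsChartFn g) (hh : IsChartFn h) : IsChartFn fun q => g q * h q :=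
  ⟨hg.smooth.mul hh.smooth, fun z y => by rw [hg.periodic, hh.periodic]⟩

theorem sub (hg : IsChartFn g) (hh : IsChartFn h) : IsChartFn fun q => g q - h q :=
  ⟨hg.smooth.sub hh.smooth, fun z y => by rw [hg.periodic, hh.periodic]⟩

theorem pd1 (hg : IsChartFn g) : IsChartFn (pd1 g) :=
  ⟨hg.smooth.pd1, fun z y => by simp only [_root_.pd1, hg.periodic]⟩

theorem pd2 (hg : IsChartFn g) : IsChartFn (pd2 g) :=
  ⟨hg.smooth.pd2, fun z y => by
    simp only [_root_.pd2]
    rw [← deriv_comp_add_const]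
    simp only [hg.periodic]⟩

theorem fst : IsChartFn Prod.fst := ⟨contDiff_fst, fun _ _ => rfl⟩

theorem cos : IsChartFn fun q => Real.cos q.2 :=
  ⟨Real.contDiff_cos.comp contDiff_snd, fun _ y => Real.cos_add_two_pi y⟩

theorem sin : IsChartFn fun q => Real.sin q.2 :=
  ⟨Real.contDiff_sin.comp contDiff_snd, fun _ y => Real.sin_add_two_pi y⟩

theorem const (c : ℝ) : IsChartFn fun _ => c := ⟨contDiff_const, fun _ _ => rfl⟩

theorem at_zero (hg : IsChartFn g) : IsChartFn fun q => g (0, q.2) :=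
  ⟨hg.smooth.comp (contDiff_const.prodMk contDiff_snd), fun _ y => hg.periodic 0 y⟩

/-- Periodicity in the angle reduces the unbounded strip to a compact rectangle. -/
theorem bounded (hg : IsChartFn g) : ∃ C : ℝ, ∀ q : ℝ × ℝ, q.1 ∈ Icc (0 : ℝ) (1 / 2) → |g q| ≤ C := by
  obtain ⟨C, hC⟩ := (isCompact_Icc.prod isCompact_Icc :
    IsCompact (Icc (0 : ℝ) (1 / 2) ×ˢ Icc 0 (2 * Real.pi))).exists_bound_of_continuousOn
    hg.smooth.continuous.continuousOn
  refine ⟨C, fun q hq => ?_⟩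
  have hper : Function.Periodic (fun y => g (q.1, y)) (2 * Real.pi) := fun y => hg.periodic q.1 y
  obtain ⟨y, hy, he⟩ := hper.exists_mem_Ico₀ Real.two_pi_pos q.2
  have : g q = g (q.1, y) := he
  rw [this]
  exact hC (q.1, y) ⟨hq, Ico_subset_Icc_self hy⟩

theorem hb {α : ℝ} (hα : 0 < α) (hα' : α ≤ 1) (τ : ℝ) (hg : IsChartFn g) :
    HB hyperbolicDist α (collar τ) fun _ => g := by
  obtain ⟨C0, h0⟩ := hg.bounded
  obtain ⟨C1, h1⟩ := hg.pd1.bounded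
  obtain ⟨C2, h2⟩ := hg.pd2.bounded
  refine hb_collar_of_bounds hα hα' τ (C := max C0 (max C1 C2))
    (fun q hq => (h0 q (Ioo_subset_Icc_self hq)).trans (le_max_left _ _))
    (fun q hq => ⟨hg.smooth.hasDerivAt_pd1 q, ?_⟩)
    (fun q hq => ⟨hg.smooth.hasDerivAt_pd2 q, (h2 q (Ioo_subset_Icc_self hq)).trans
      ((le_max_right _ _).trans (le_max_right _ _))⟩)
  refine le_trans ?_ ((le_max_left _ _).trans (le_max_right C0 _))
  rw [abs_mul, abs_of_pos hq.1]
  refine le_trans ?_ (h1 q (Ioo_subset_Icc_self hq))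
  exact mul_le_of_le_one_left (abs_nonneg _) (by linarith [hq.2])

/-- A smooth function vanishing at `z = 0` is `O(z)`. -/
theorem exists_abs_le_mul (hg : IsChartFn g) (h0 : ∀ y, g (0, y) = 0) :
    ∃ C : ℝ, ∀ q : ℝ × ℝ, q.1 ∈ Icc (0 : ℝ) (1 / 2) → |g q| ≤ C * q.1 := by
  obtain ⟨C, hC⟩ := hg.pd1.bounded
  refine ⟨C, fun q hq => ?_⟩
  have := (convex_Icc (0 : ℝ) (1 / 2)).norm_image_sub_le_of_norm_hasDerivWithin_le
    (f := fun s => g (s, q.2)) (f' := fun s => _root_.pd1 g (s, q.2)) (C := C) (x := 0) (y := q.1)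
    (fun s _ => (hg.smooth.hasDerivAt_pd1 (s, q.2)).hasDerivWithinAt)
    (fun s hs => hC (s, q.2) hs) (by norm_num) hq
  simpa [h0, abs_of_nonneg hq.1] using this

/-- Both `g` and `g_y` vanish at `z = 0`, hence are `O(z)`, and `z D_z (g / z) = g_z - g / z` is
bounded. -/
theorem hb_div {α : ℝ} (hα : 0 < α) (hα' : α ≤ 1) (τ : ℝ) (hg : IsChartFn g)
    (h0 : ∀ y, g (0, y) = 0) : HB hyperbolicDist α (collar τ) fun _ q => g q / q.1 := by
  have h0' : ∀ y, _root_.pd2 g (0, y) = 0 := fun y => by simp [_root_.pd2, h0]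
  obtain ⟨C0, h0⟩ := hg.exists_abs_le_mul h0
  obtain ⟨C1, h1⟩ := hg.pd1.bounded
  obtain ⟨C2, h2⟩ := hg.pd2.exists_abs_le_mul h0'
  have hdiv : ∀ (k : ℝ × ℝ → ℝ) (C : ℝ), (∀ q : ℝ × ℝ, q.1 ∈ Icc (0 : ℝ) (1 / 2) →
      |k q| ≤ C * q.1) → ∀ q : ℝ × ℝ, q.1 ∈ Ioo (0 : ℝ) (1 / 2) → |k q / q.1| ≤ C := by
    intro k C hk q hq
    rw [abs_div, abs_of_pos hq.1, div_le_iff₀ hq.1]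
    exact hk q (Ioo_subset_Icc_self hq)
  have hq4 : ((1 / 4 : ℝ), (0 : ℝ)).1 ∈ Ioo (0 : ℝ) (1 / 2) := by norm_num
  have p0 : 0 ≤ C0 := (abs_nonneg _).trans (hdiv g C0 h0 _ hq4)
  have p1 : 0 ≤ C1 := (abs_nonneg _).trans (h1 _ (Ioo_subset_Icc_self hq4))
  have p2 : 0 ≤ C2 := (abs_nonneg _).trans (hdiv _ C2 h2 _ hq4)
  refine hb_collar_of_bounds hα hα' τ (C := C0 + C1 + C2)
    (a := fun q => (_root_.pd1 g q * q.1 - g q * 1) / q.1 ^ 2) (b := fun q => _root_.pd2 g q / q.1)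
    (fun q hq => (hdiv g C0 h0 q hq).trans (by linarith))
    (fun q hq => ⟨(hg.smooth.hasDerivAt_pd1 q).fun_div (hasDerivAt_id' q.1) hq.1.ne', ?_⟩)
    (fun q hq => ⟨(hg.smooth.hasDerivAt_pd2 q).div_const q.1,
      (hdiv _ C2 h2 q hq).trans (by linarith)⟩)
  have : q.1 * ((_root_.pd1 g q * q.1 - g q * 1) / q.1 ^ 2) = _root_.pd1 g q - g q / q.1 := by
    have := hq.1.ne'
    field_simp
  rw [this]
  refine (abs_sub _ _).trans ?_
  linarith [h1 q (Ioo_subset_Icc_self hq), hdiv g C0 h0 q hq]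

/-- Smooth functions lie in the weighted class because `p < 1`: the remainder `g - g(0, ·)` equals
`z^p` times `z^{1-p} (g - g(0, ·)) / z`. -/
theorem hbp {α p : ℝ} (hα : 0 < α) (hα' : α ≤ 1) (hp' : p < 1) (τ : ℝ)
    (hg : IsChartFn g) : HBP p α τ fun _ => g := by
  have hB : FnAlg (collar τ) (HB hyperbolicDist α (collar τ)) := fnAlg_HB hyperbolicDist_nonneg
  refine ⟨fun _ q => g (0, q.2), _, hg.at_zero.hb hα hα' τ,
    hB.mul (hb_rpow hα hα' τ (sub_nonneg.2 hp'.le)) ((hg.sub hg.at_zero).hb_div hα hα' τ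
      fun y => sub_self _), fun _ _ _ _ => rfl, fun P hP => ?_⟩
  have hz := collar_pos P hP
  dsimp only
  rw [← mul_assoc, ← Real.rpow_add hz, add_sub_cancel, Real.rpow_one]
  field_simp
  ring

theorem cls {τ : ℝ} {B : STFn → Prop} (hB : FnAlg (collar τ) B)
    (hb : ∀ g, IsChartFn g → B fun _ => g) (m : ℕ) (hg : IsChartFn g) :
    Cls Prod.fst (collar τ) B m fun _ => g :=
  cls_of_family (isOpen_collar τ) hB (fun _ h => h.smooth) (fun _ h => fst.mul h.pd1)
    (fun _ h => h.pd2) hb m g hg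

theorem cls_hb {α : ℝ} (hα : 0 < α) (hα' : α ≤ 1) (τ : ℝ) (m : ℕ) (hg : IsChartFn g) :
    Cls Prod.fst (collar τ) (HB hyperbolicDist α (collar τ)) m fun _ => g :=
  hg.cls (fnAlg_HB hyperbolicDist_nonneg) (fun _ h => h.hb hα hα' τ) m

theorem cls_hbp {α p : ℝ} (hα : 0 < α) (hα' : α ≤ 1) (hp : 0 < p) (hp' : p < 1) (τ : ℝ) (m : ℕ)
    (hg : IsChartFn g) : Cls Prod.fst (collar τ) (HBP p α τ) m fun _ => g :=
  hg.cls (fnAlg_HBP hα hα' hp) (fun _ h => h.hbp hα hα' hp' τ) m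

/-- The induction closes because `z D_z (g / z) = g_z - g / z` and `D_y (g / z) = g_y / z`, with
`g_y` again vanishing at `z = 0`. -/
theorem cls_div {α : ℝ} (hα : 0 < α) (hα' : α ≤ 1) (τ : ℝ) (m : ℕ) (hg : IsChartFn g)
    (h0 : ∀ y, g (0, y) = 0) :
    Cls Prod.fst (collar τ) (HB hyperbolicDist α (collar τ)) m fun _ q => g q / q.1 := by
  have hB : FnAlg (collar τ) (HB hyperbolicDist α (collar τ)) := fnAlg_HB hyperbolicDist_nonneg
  have hU := isOpen_collar τ
  induction m using Nat.strong_induction_on generalizing g with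
  | _ m ih =>
    have hc : ContinuousOn (fun P : ℝ × ℝ × ℝ => g P.2 / P.2.1) (collar τ) :=
      ContinuousOn.div ((hg.smooth.continuous.comp continuous_snd).continuousOn) (by fun_prop)
        fun P hP => (collar_pos P hP).ne'
    rcases m with _ | m
    · exact ⟨hc, hg.hb_div hα hα' τ h0⟩
    · have d1 : ∀ P ∈ collar τ, HasDerivAt (fun s => g (s, P.2.2) / s)
          ((_root_.pd1 g P.2 * P.2.1 - g P.2 * 1) / P.2.1 ^ 2) P.2.1 := fun P hP =>
        (hg.smooth.hasDerivAt_pd1 P.2).fun_div (hasDerivAt_id' _) (collar_pos P hP).ne'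
      have d2 : ∀ P ∈ collar τ, HasDerivAt (fun s => g (P.2.1, s) / P.2.1)
          (_root_.pd2 g P.2 / P.2.1) P.2.2 := fun P _ =>
        (hg.smooth.hasDerivAt_pd2 P.2).div_const _
      refine cls_succ.2 ⟨hc, fun P hP => (d1 P hP).differentiableAt,
        fun P hP => (d2 P hP).differentiableAt, hg.hb_div hα hα' τ h0, ?_, ?_, ?_⟩
      · refine Cls.congr hU hB.congr (fun P hP => ?_)
          ((hB.cls hU m).sub (hg.pd1.cls_hb hα hα' τ m) (ih m (by omega) hg h0))
        have e : D1 (fun _ q => g q / q.1 : STFn) P.1 P.2 = _ := (d1 P hP).deriv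
        have := (collar_pos P hP).ne'
        rw [e]
        field_simp
      · refine Cls.congr hU hB.congr (fun P hP => ?_)
          (ih m (by omega) hg.pd2 fun y => by simp [_root_.pd2, h0])
        exact (d2 P hP).deriv.symm
      · rintro n rfl
        exact ⟨fun P _ => differentiableAt_const _,
          Cls.congr hU hB.congr (fun P _ => by simp [Dt]) ((hB.cls hU n).const 0)⟩

end IsChartFn

/-! ### Flattening -/

theorem contDiff_polarChart : ContDiff ℝ ∞ polarChart :=
  ((contDiff_const.sub contDiff_fst).mul (Real.contDiff_cos.comp contDiff_snd)).prodMk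
    ((contDiff_const.sub contDiff_fst).mul (Real.contDiff_sin.comp contDiff_snd))

theorem polarChart_sq (q : ℝ × ℝ) :
    (polarChart q).1 ^ 2 + (polarChart q).2 ^ 2 = (1 - q.1) ^ 2 := by
  simp only [polarChart]
  have := Real.sin_sq_add_cos_sq q.2
  linear_combination (1 - q.1) ^ 2 * this

theorem polarChart_periodic (z y : ℝ) :
    polarChart (z, y + 2 * Real.pi) = polarChart (z, y) := by
  simp [polarChart, Real.cos_add_two_pi, Real.sin_add_two_pi]

theorem isChartFn_comp_polarChart {g : ℝ × ℝ → ℝ} (hg : ContDiff ℝ ∞ g) :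
    IsChartFn fun q => g (polarChart q) :=
  ⟨hg.comp contDiff_polarChart, fun z y => by rw [polarChart_periodic]⟩

theorem hasDerivAt_polarChart_fst (q : ℝ × ℝ) :
    HasDerivAt (fun s => polarChart (s, q.2)) (-Real.cos q.2, -Real.sin q.2) q.1 := by
  have h : HasDerivAt (fun s : ℝ => 1 - s) (-1) q.1 := by
    simpa using (hasDerivAt_id q.1).const_sub 1
  simpa [polarChart] using (h.mul_const (Real.cos q.2)).prodMk (h.mul_const (Real.sin q.2))

theorem hasDerivAt_polarChart_snd (q : ℝ × ℝ) :
    HasDerivAt (fun s => polarChart (q.1, s))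
      (-((1 - q.1) * Real.sin q.2), (1 - q.1) * Real.cos q.2) q.2 := by
  simpa [polarChart] using ((Real.hasDerivAt_cos q.2).const_mul (1 - q.1)).prodMk
    ((Real.hasDerivAt_sin q.2).const_mul (1 - q.1))

/-- The punctured open disc in flattened coordinates, times `(0, τ)`. -/
def wideCollar (τ : ℝ) : Set (ℝ × ℝ × ℝ) := Ioo 0 τ ×ˢ (Ioo (0 : ℝ) 1 ×ˢ univ)

theorem isOpen_wideCollar (τ : ℝ) : IsOpen (wideCollar τ) :=
  isOpen_Ioo.prod (isOpen_Ioo.prod isOpen_univ)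

theorem collar_subset_wideCollar (τ : ℝ) : collar τ ⊆ wideCollar τ := fun _ hP =>
  ⟨hP.1, ⟨hP.2.1.1, hP.2.1.2.trans (by norm_num)⟩, trivial⟩

theorem polarChart_mem_openDisc {q : ℝ × ℝ} (h : 0 < q.1) (h' : q.1 < 1) :
    polarChart q ∈ openDisc 1 := by
  rw [openDisc, mem_ofPred_eq, polarChart_sq]; nlinarith

theorem polarChart_mem_closedDisc {q : ℝ × ℝ} (h : 0 ≤ q.1) (h' : q.1 ≤ 1) :
    polarChart q ∈ closedDisc := by
  rw [closedDisc, mem_ofPred_eq, polarChart_sq]; nlinarith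

theorem polarChart_mem {τ : ℝ} {P : ℝ × ℝ × ℝ} (hP : P ∈ wideCollar τ) :
    (P.1, polarChart P.2) ∈ Ioo 0 τ ×ˢ openDisc 1 :=
  ⟨hP.1, polarChart_mem_openDisc hP.2.1.1 hP.2.1.2⟩

section Flatten

variable {τ : ℝ} {m : ℕ} {f : STFn}

theorem isOpen_stDisc (τ r : ℝ) : IsOpen (Ioo 0 τ ×ˢ openDisc r) :=
  isOpen_Ioo.prod (isOpen_openDisc r)

theorem hasDerivAt_flatten_fst (hf : IsParabolicC (m + 1) (Ioo 0 τ ×ˢ openDisc 1) f)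
    {P : ℝ × ℝ × ℝ} (hP : P ∈ wideCollar τ) :
    HasDerivAt (fun s => flatten f P.1 (s, P.2.2))
      (-Real.cos P.2.2 * flatten (D1 f) P.1 P.2 + -Real.sin P.2.2 * flatten (D2 f) P.1 P.2)
      P.2.1 := by
  have h := (hf.hasFDerivAt_space (isOpen_stDisc τ 1) (polarChart_mem hP)).comp_hasDerivAt
    (f := fun s => polarChart (s, P.2.2)) P.2.1 (hasDerivAt_polarChart_fst P.2)
  refine HasDerivAt.congr_deriv (f := fun s => flatten f P.1 (s, P.2.2)) h ?_
  simp [flatten]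

theorem hasDerivAt_flatten_snd (hf : IsParabolicC (m + 1) (Ioo 0 τ ×ˢ openDisc 1) f)
    {P : ℝ × ℝ × ℝ} (hP : P ∈ wideCollar τ) :
    HasDerivAt (fun s => flatten f P.1 (P.2.1, s))
      ((1 - P.2.1) * (-Real.sin P.2.2 * flatten (D1 f) P.1 P.2
        + Real.cos P.2.2 * flatten (D2 f) P.1 P.2)) P.2.2 := by
  have h := (hf.hasFDerivAt_space (isOpen_stDisc τ 1) (polarChart_mem hP)).comp_hasDerivAt
    (f := fun s => polarChart (P.2.1, s)) P.2.2 (hasDerivAt_polarChart_snd P.2)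
  refine HasDerivAt.congr_deriv (f := fun s => flatten f P.1 (P.2.1, s)) h ?_
  simp [flatten]
  ring

theorem isParabolicC_flatten (hf : IsParabolicC m (Ioo 0 τ ×ˢ openDisc 1) f) :
    IsParabolicC m (wideCollar τ) (flatten f) := by
  have hU := isOpen_wideCollar τ
  induction m using Nat.strong_induction_on generalizing f with
  | _ m ih =>
    have hc : ContinuousOn (fun P : ℝ × ℝ × ℝ => flatten f P.1 P.2) (wideCollar τ) :=
      hf.continuousOn.comp (f := fun P : ℝ × ℝ × ℝ => (P.1, polarChart P.2))
        (continuous_fst.prodMk (contDiff_polarChart.continuous.comp continuous_snd)).continuousOn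
        fun P hP => polarChart_mem hP
    rcases m with _ | m
    · exact hc
    · have d1 := fun P hP => hasDerivAt_flatten_fst hf (P := P) hP
      have d2 := fun P hP => hasDerivAt_flatten_snd hf (P := P) hP
      have c1 := ih m (by omega) hf.D1
      have c2 := ih m (by omega) hf.D2
      have cc : IsParabolicC m (wideCollar τ) fun _ q => Real.cos q.2 :=
        IsChartFn.cos.smooth.isParabolicC hU m
      have cs : IsParabolicC m (wideCollar τ) fun _ q => Real.sin q.2 :=
        IsChartFn.sin.smooth.isParabolicC hU m
      have cn : IsParabolicC m (wideCollar τ) fun _ _ => (-1 : ℝ) :=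
        (contDiff_const (c := (-1 : ℝ))).isParabolicC hU m
      have cz : IsParabolicC m (wideCollar τ) fun _ q => 1 - q.1 :=
        ContDiff.isParabolicC (g := fun q : ℝ × ℝ => 1 - q.1) hU
          (contDiff_const.sub contDiff_fst) m
      refine isParabolicC_succ.2 ⟨hc, fun P hP => (d1 P hP).differentiableAt,
        fun P hP => (d2 P hP).differentiableAt, ?_, ?_, ?_⟩
      · refine (isParabolicC_mul hU cn (isParabolicC_add hU (isParabolicC_mul hU cc c1)
          (isParabolicC_mul hU cs c2))).congr hU fun P hP => ?_
        rw [show D1 (flatten f) P.1 P.2 = _ from (d1 P hP).deriv]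
        ring
      · refine (isParabolicC_mul hU cz (isParabolicC_add hU (isParabolicC_mul hU cn
          (isParabolicC_mul hU cs c1)) (isParabolicC_mul hU cc c2))).congr hU fun P hP => ?_
        rw [show D2 (flatten f) P.1 P.2 = _ from (d2 P hP).deriv]
        ring
      · rintro n rfl
        exact ⟨fun P hP => hf.difft (polarChart_mem hP), ih n (by omega) hf.Dt⟩

end Flatten

/-! ### From the collar to an annulus -/

/-- The part `1 - r < z < 1/2` of the collar. -/
def innerCollar (τ r : ℝ) : Set (ℝ × ℝ × ℝ) := Ioo 0 τ ×ˢ (Ioo (1 - r) (1 / 2) ×ˢ univ)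

/-- The annulus `1/2 < |q| < r`, times `(0, τ)`. -/
def annulus (τ r : ℝ) : Set (ℝ × ℝ × ℝ) :=
  Ioo 0 τ ×ˢ {q | (1 / 2) ^ 2 < q.1 ^ 2 + q.2 ^ 2 ∧ q.1 ^ 2 + q.2 ^ 2 < r ^ 2}

theorem isOpen_innerCollar (τ r : ℝ) : IsOpen (innerCollar τ r) :=
  isOpen_Ioo.prod (isOpen_Ioo.prod isOpen_univ)

theorem isOpen_annulus (τ r : ℝ) : IsOpen (annulus τ r) := by
  have h1 : IsOpen {q : ℝ × ℝ | (1 / 2) ^ 2 < q.1 ^ 2 + q.2 ^ 2} :=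
    isOpen_lt continuous_const (by fun_prop)
  have h2 : IsOpen {q : ℝ × ℝ | q.1 ^ 2 + q.2 ^ 2 < r ^ 2} :=
    isOpen_lt (by fun_prop) continuous_const
  exact isOpen_Ioo.prod (h1.inter h2)

theorem innerCollar_subset {τ r : ℝ} (hr : r < 1) : innerCollar τ r ⊆ collar τ := fun _ hP =>
  ⟨hP.1, ⟨by linarith [hP.2.1.1], hP.2.1.2⟩, trivial⟩

/-- The second angle is taken as `arg c - arg (c / c')`, so that the two angles differ by the
geometric angle between `c` and `c'` and the branch cut plays no role. That angle is at most `π/2`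
times the chord of the unit vectors, and the chord is at most `2 ‖c - c'‖ / ‖c‖`. -/
theorem exists_polar_pair {c c' : ℂ} (hc : c ≠ 0) (hc' : c' ≠ 0) :
    ∃ y y' : ℝ, c = ‖c‖ * Complex.exp (y * Complex.I) ∧ c' = ‖c'‖ * Complex.exp (y' * Complex.I) ∧
      |y - y'| ≤ Real.pi * ‖c - c'‖ / ‖c‖ := by
  have n1 : (0 : ℝ) < ‖c‖ := norm_pos_iff.2 hc
  have n2 : (0 : ℝ) < ‖c'‖ := norm_pos_iff.2 hc'
  have n1' : (‖c‖ : ℂ) ≠ 0 := by exact_mod_cast n1.ne'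
  have n2' : (‖c'‖ : ℂ) ≠ 0 := by exact_mod_cast n2.ne'
  refine ⟨c.arg, c.arg - (c / c').arg, (Complex.norm_mul_exp_arg_mul_I c).symm, ?_, ?_⟩
  · have h := Complex.norm_mul_exp_arg_mul_I (c / c')
    have h1 := Complex.norm_mul_exp_arg_mul_I c
    push_cast
    rw [sub_mul, Complex.exp_sub]
    rw [norm_div, Complex.ofReal_div] at h
    have e1 : Complex.exp ((c / c').arg * Complex.I) = c / c' * ‖c'‖ / ‖c‖ := by
      rw [← div_div_eq_mul_div, eq_div_iff (div_ne_zero n1' n2'), mul_comm]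
      exact h
    have e2 : Complex.exp (c.arg * Complex.I) = c / ‖c‖ := by
      rw [eq_div_iff n1', mul_comm]; exact h1
    rw [e1, e2]
    field_simp
  · have e : c.arg - (c.arg - (c / c').arg) = (c / c').arg := by ring
    rw [e, ← Complex.angle_eq_abs_arg hc hc']
    have hu : ‖((‖c‖⁻¹ : ℝ) : ℂ) * c‖ = 1 := by
      rw [norm_mul, Complex.norm_real, norm_inv, norm_norm, inv_mul_cancel₀ n1.ne']
    have hu' : ‖((‖c'‖⁻¹ : ℝ) : ℂ) * c'‖ = 1 := by
      rw [norm_mul, Complex.norm_real, norm_inv, norm_norm, inv_mul_cancel₀ n2.ne']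
    have ha : InnerProductGeometry.angle c c' = InnerProductGeometry.angle
        (((‖c‖⁻¹ : ℝ) : ℂ) * c) (((‖c'‖⁻¹ : ℝ) : ℂ) * c') := by
      rw [← Complex.real_smul, ← Complex.real_smul,
        InnerProductGeometry.angle_smul_left_of_pos _ _ (inv_pos.2 n1),
        InnerProductGeometry.angle_smul_right_of_pos _ _ (inv_pos.2 n2)]
    rw [ha]
    refine (Complex.angle_le_mul_norm_sub hu hu').trans ?_
    have hd : ‖((‖c‖⁻¹ : ℝ) : ℂ) * c - ((‖c'‖⁻¹ : ℝ) : ℂ) * c'‖ ≤ 2 * ‖c - c'‖ / ‖c‖ := by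
      have e3 : ((‖c‖⁻¹ : ℝ) : ℂ) * c - ((‖c'‖⁻¹ : ℝ) : ℂ) * c'
          = ((‖c‖⁻¹ : ℝ) : ℂ) * (c - c') + (((‖c'‖ - ‖c‖) / (‖c‖ * ‖c'‖) : ℝ) : ℂ) * c' := by
        push_cast; field_simp; ring
      rw [e3]
      refine (norm_add_le _ _).trans ?_
      rw [norm_mul, norm_mul, Complex.norm_real, Complex.norm_real, norm_inv, norm_norm, norm_div,
        norm_mul, norm_norm, norm_norm]
      have h3 : ‖‖c'‖ - ‖c‖‖ ≤ ‖c - c'‖ := by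
        rw [← norm_neg (c - c'), neg_sub]; exact abs_norm_sub_norm_le _ _
      have h4 : ‖‖c'‖ - ‖c‖‖ / (‖c‖ * ‖c'‖) * ‖c'‖ = ‖‖c'‖ - ‖c‖‖ / ‖c‖ := by field_simp
      rw [h4]
      calc _ ≤ ‖c‖⁻¹ * ‖c - c'‖ + ‖c - c'‖ / ‖c‖ := by gcongr
        _ = _ := by ring
    calc Real.pi / 2 * _ ≤ Real.pi / 2 * (2 * ‖c - c'‖ / ‖c‖) := by
          gcongr
      _ = _ := by ring

/-- The constant 8 comes from `π ≤ 4` and a radius larger than `1/2`. -/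
theorem exists_polar_pair_annulus {q q' : ℝ × ℝ} (h : (1 / 2) ^ 2 < q.1 ^ 2 + q.2 ^ 2)
    (h' : (1 / 2) ^ 2 < q'.1 ^ 2 + q'.2 ^ 2) :
    ∃ z y z' y' : ℝ, z = 1 - Real.sqrt (q.1 ^ 2 + q.2 ^ 2) ∧
      z' = 1 - Real.sqrt (q'.1 ^ 2 + q'.2 ^ 2) ∧ q = polarChart (z, y) ∧ q' = polarChart (z', y') ∧
      |z - z'| ≤ Real.sqrt ((q.1 - q'.1) ^ 2 + (q.2 - q'.2) ^ 2) ∧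
      |y - y'| ≤ 8 * Real.sqrt ((q.1 - q'.1) ^ 2 + (q.2 - q'.2) ^ 2) := by
  set c : ℂ := ⟨q.1, q.2⟩ with hcd
  set c' : ℂ := ⟨q'.1, q'.2⟩ with hcd'
  have n : ‖c‖ = Real.sqrt (q.1 ^ 2 + q.2 ^ 2) := Complex.norm_eq_sqrt_sq_add_sq c
  have n' : ‖c'‖ = Real.sqrt (q'.1 ^ 2 + q'.2 ^ 2) := Complex.norm_eq_sqrt_sq_add_sq c'
  have nd : ‖c - c'‖ = Real.sqrt ((q.1 - q'.1) ^ 2 + (q.2 - q'.2) ^ 2) :=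
    Complex.norm_eq_sqrt_sq_add_sq (c - c')
  have hn : 1 / 2 < ‖c‖ := by rw [n]; exact Real.lt_sqrt_of_sq_lt h
  have hn' : 1 / 2 < ‖c'‖ := by rw [n']; exact Real.lt_sqrt_of_sq_lt h'
  obtain ⟨y, y', e, e', hy⟩ := exists_polar_pair (c := c) (c' := c')
    (norm_pos_iff.1 (by linarith)) (norm_pos_iff.1 (by linarith))
  refine ⟨1 - ‖c‖, y, 1 - ‖c'‖, y', by rw [n], by rw [n'], ?_, ?_, ?_, ?_⟩
  · have hr := congrArg Complex.re e
    have hi := congrArg Complex.im e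
    simp only [Complex.re_ofReal_mul, Complex.im_ofReal_mul, Complex.exp_ofReal_mul_I_re,
      Complex.exp_ofReal_mul_I_im] at hr hi
    ext
    · simpa [polarChart, hcd] using hr
    · simpa [polarChart, hcd] using hi
  · have hr := congrArg Complex.re e'
    have hi := congrArg Complex.im e'
    simp only [Complex.re_ofReal_mul, Complex.im_ofReal_mul, Complex.exp_ofReal_mul_I_re,
      Complex.exp_ofReal_mul_I_im] at hr hi
    ext
    · simpa [polarChart, hcd'] using hr
    · simpa [polarChart, hcd'] using hi
  · rw [← nd, show 1 - ‖c‖ - (1 - ‖c'‖) = ‖c'‖ - ‖c‖ by ring, ← norm_neg (c - c'), neg_sub]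
    exact abs_norm_sub_norm_le _ _
  · rw [← nd]
    refine hy.trans ?_
    rw [div_le_iff₀ (by linarith)]
    nlinarith [Real.pi_le_four, norm_nonneg (c - c'),
      mul_le_mul_of_nonneg_left Real.pi_le_four (norm_nonneg (c - c')),
      mul_le_mul_of_nonneg_left hn.le (norm_nonneg (c - c'))]

theorem abs_log_sub_log_le {a b c : ℝ} (hc : 0 < c) (ha : c ≤ a) (hb : c ≤ b) :
    |Real.log a - Real.log b| ≤ |a - b| / c := by
  have := (convex_Ici c).norm_image_sub_le_of_norm_hasDerivWithin_le
    (f := Real.log) (f' := fun s => s⁻¹) (C := c⁻¹) (x := b) (y := a)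
    (fun s hs => (Real.hasDerivAt_log (hc.trans_le hs).ne').hasDerivWithinAt)
    (fun s hs => by
      rw [Real.norm_eq_abs, abs_of_pos (inv_pos.2 (hc.trans_le hs))]
      exact inv_anti₀ hc hs) hb ha
  rw [div_eq_inv_mul]
  exact this

/-- Away from the circle the distances are comparable: for `z > 1 - r` the logarithm has Lipschitz
constant `1 / (1 - r)`, and suitably chosen angles contribute the factor 8. Hence the hyperbolic
distance is at most `K` times the Euclidean one. -/
theorem hb_annulus {α τ r : ℝ} (hα : 0 < α) (hr0 : 0 < r) (hr : r < 1) {f : STFn}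
    (h : HB hyperbolicDist α (innerCollar τ r) (flatten f)) :
    HB euclideanDist α (annulus τ r) f := by
  obtain ⟨C, hC, h1, h2⟩ := h
  set K : ℝ := 1 / (1 - r) + 8 with hK
  have hr' : 0 < 1 - r := by linarith
  have hK1 : 1 ≤ K := by
    have : 0 < 1 / (1 - r) := by positivity
    linarith
  have hmem : ∀ P ∈ annulus τ r, ∀ z : ℝ, z = 1 - Real.sqrt (P.2.1 ^ 2 + P.2.2 ^ 2) →
      1 - r < z ∧ z < 1 / 2 := by
    rintro P hP z rfl
    have a1 : 1 / 2 < Real.sqrt (P.2.1 ^ 2 + P.2.2 ^ 2) := Real.lt_sqrt_of_sq_lt hP.2.1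
    have a2 : Real.sqrt (P.2.1 ^ 2 + P.2.2 ^ 2) < r := (Real.sqrt_lt' hr0).2 hP.2.2
    constructor <;> linarith
  refine ⟨C * K ^ α, by positivity, fun P hP => ?_, fun P hP P' hP' => ?_⟩
  · obtain ⟨z, y, -, -, hz, -, hq, -, -, -⟩ := exists_polar_pair_annulus hP.2.1 hP.2.1
    have hz' := hmem P hP z hz
    have := h1 (P.1, z, y) ⟨hP.1, hz', trivial⟩
    rw [flatten, ← hq] at this
    exact this.trans (le_mul_of_one_le_right hC (Real.one_le_rpow hK1 hα.le))
  · obtain ⟨z, y, z', y', hz, hz', hq, hq', dz, dy⟩ := exists_polar_pair_annulus hP.2.1 hP'.2.1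
    have m := hmem P hP z hz
    have m' := hmem P' hP' z' hz'
    have := h2 (P.1, z, y) ⟨hP.1, m, trivial⟩ (P'.1, z', y') ⟨hP'.1, m', trivial⟩
    simp only [flatten] at this
    rw [← hq, ← hq'] at this
    refine this.trans ?_
    rw [mul_assoc, ← Real.mul_rpow (by positivity) (euclideanDist_nonneg _ _)]
    refine mul_le_mul_of_nonneg_left (Real.rpow_le_rpow (hyperbolicDist_nonneg _ _) ?_ hα.le) hC
    have dl := abs_log_sub_log_le hr' m.1.le m'.1.le
    set D := Real.sqrt ((P.2.1 - P'.2.1) ^ 2 + (P.2.2 - P'.2.2) ^ 2) with hD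
    have hD0 : 0 ≤ D := Real.sqrt_nonneg _
    have e1 : Real.sqrt ((Real.log z - Real.log z') ^ 2 + (y - y') ^ 2)
        ≤ |Real.log z - Real.log z'| + |y - y'| := by
      refine Real.sqrt_le_iff.2 ⟨by positivity, ?_⟩
      rw [← sq_abs (Real.log z - Real.log z'), ← sq_abs (y - y')]
      nlinarith [abs_nonneg (Real.log z - Real.log z'), abs_nonneg (y - y')]
    have e2 : |z - z'| / (1 - r) ≤ 1 / (1 - r) * D := by
      rw [div_eq_mul_one_div, mul_comm]; gcongr
    have e3 : Real.sqrt |P.1 - P'.1| ≤ K * Real.sqrt |P.1 - P'.1| :=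
      le_mul_of_one_le_left (Real.sqrt_nonneg _) hK1
    calc hyperbolicDist (P.1, z, y) (P'.1, z', y')
        = Real.sqrt ((Real.log z - Real.log z') ^ 2 + (y - y') ^ 2) + Real.sqrt |P.1 - P'.1| := rfl
      _ ≤ 1 / (1 - r) * D + 8 * D + K * Real.sqrt |P.1 - P'.1| := by linarith
      _ = K * euclideanDist P P' := by rw [euclideanDist]; ring

section Transfer

variable {α τ r : ℝ} {m : ℕ} {f : STFn}

/-- The chain rule for polar coordinates, inverted. The normal derivative is kept as `z D_z`, with
the compensating `z⁻¹` separate, since the collar classes control only `z D_z`. -/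
theorem flatten_D1_eq (hf : IsParabolicC (m + 1) (Ioo 0 τ ×ˢ openDisc 1) f)
    {P : ℝ × ℝ × ℝ} (hP : P ∈ wideCollar τ) :
    flatten (D1 f) P.1 P.2 = -(Real.cos P.2.2 * (P.2.1)⁻¹ * (P.2.1 * D1 (flatten f) P.1 P.2)
      + Real.sin P.2.2 * (1 - P.2.1)⁻¹ * D2 (flatten f) P.1 P.2) := by
  have hz : P.2.1 ≠ 0 := hP.2.1.1.ne'
  have hz' : 1 - P.2.1 ≠ 0 := by linarith [hP.2.1.2]
  rw [show D1 (flatten f) P.1 P.2 = _ from (hasDerivAt_flatten_fst hf hP).deriv,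
    show D2 (flatten f) P.1 P.2 = _ from (hasDerivAt_flatten_snd hf hP).deriv]
  field_simp
  linear_combination (-flatten (D1 f) P.1 P.2) * Real.sin_sq_add_cos_sq P.2.2

theorem flatten_D2_eq (hf : IsParabolicC (m + 1) (Ioo 0 τ ×ˢ openDisc 1) f)
    {P : ℝ × ℝ × ℝ} (hP : P ∈ wideCollar τ) :
    flatten (D2 f) P.1 P.2 = -(Real.sin P.2.2 * (P.2.1)⁻¹ * (P.2.1 * D1 (flatten f) P.1 P.2))
      + Real.cos P.2.2 * (1 - P.2.1)⁻¹ * D2 (flatten f) P.1 P.2 := by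
  have hz : P.2.1 ≠ 0 := hP.2.1.1.ne'
  have hz' : 1 - P.2.1 ≠ 0 := by linarith [hP.2.1.2]
  rw [show D1 (flatten f) P.1 P.2 = _ from (hasDerivAt_flatten_fst hf hP).deriv,
    show D2 (flatten f) P.1 P.2 = _ from (hasDerivAt_flatten_snd hf hP).deriv]
  field_simp
  linear_combination (-flatten (D2 f) P.1 P.2) * Real.sin_sq_add_cos_sq P.2.2

/-- Regularity in flattened coordinates gives regularity in an annulus. -/
theorem cls_annulus (hα : 0 < α) (hα' : α ≤ 1) (hr0 : 0 < r) (hr : r < 1)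
    (hf : IsParabolicC m (Ioo 0 τ ×ˢ openDisc 1) f)
    (h : Cls Prod.fst (innerCollar τ r) (HB hyperbolicDist α (innerCollar τ r)) m (flatten f)) :
    Cls (fun _ => 1) (annulus τ r) (HB euclideanDist α (annulus τ r)) m f := by
  have hU := isOpen_innerCollar τ r
  have hB : FnAlg (innerCollar τ r) (HB hyperbolicDist α (innerCollar τ r)) :=
    fnAlg_HB hyperbolicDist_nonneg
  have hsub : annulus τ r ⊆ Ioo 0 τ ×ˢ openDisc 1 := fun P hP => ⟨hP.1, by
    have := hP.2.2
    simp only [openDisc, mem_ofPred_eq]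
    nlinarith⟩
  have hchart : ∀ (m : ℕ) {g : ℝ × ℝ → ℝ}, IsChartFn g → Cls Prod.fst (innerCollar τ r)
      (HB hyperbolicDist α (innerCollar τ r)) m fun _ => g := fun m g hg =>
    (hg.cls_hb hα hα' τ m).mono (innerCollar_subset hr) fun _ h => h.mono (innerCollar_subset hr)
  have hw : innerCollar τ r ⊆ wideCollar τ :=
    (innerCollar_subset hr).trans (collar_subset_wideCollar τ)
  induction m using Nat.strong_induction_on generalizing f with
  | _ m ih =>
    have hf' := hf.mono hsub
    have hbase := hb_annulus hα hr0 hr h.base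
    rcases m with _ | m
    · exact ⟨hf', hbase⟩
    · have hz : Cls Prod.fst (innerCollar τ r) (HB hyperbolicDist α (innerCollar τ r)) m
          fun _ q => (q.1)⁻¹ :=
        (hB.cls hU m).inv (hchart m IsChartFn.fst) ⟨1 - r, by linarith, fun P hP => by
          rw [abs_of_pos (collar_pos P (innerCollar_subset hr hP))]; exact hP.2.1.1.le⟩
      have hz' : Cls Prod.fst (innerCollar τ r) (HB hyperbolicDist α (innerCollar τ r)) m
          fun _ q => (1 - q.1)⁻¹ :=
        (hB.cls hU m).inv (hchart m ((IsChartFn.const 1).sub IsChartFn.fst))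
          ⟨1 / 2, by norm_num, fun P hP => by
            refine le_trans ?_ (le_abs_self _)
            linarith [hP.2.1.2]⟩
      have A := hB.cls (ρ := Prod.fst) hU m
      have c1 := hchart m IsChartFn.cos
      have c2 := hchart m IsChartFn.sin
      refine cls_succ.2 ⟨hf'.continuousOn, fun P hP => hf'.diff1 hP, fun P hP => hf'.diff2 hP,
        hbase, ?_, ?_, ?_⟩
      · simp only [one_mul]
        refine ih m (by omega) hf.D1 (Cls.congr hU hB.congr
          (fun P hP => (flatten_D1_eq hf (hw hP)).symm)
          (A.neg (A.add (A.mul (A.mul c1 hz) h.D1) (A.mul (A.mul c2 hz') h.D2))))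
      · refine ih m (by omega) hf.D2 (Cls.congr hU hB.congr
          (fun P hP => (flatten_D2_eq hf (hw hP)).symm)
          (A.add (A.neg (A.mul (A.mul c2 hz) h.D1)) (A.mul (A.mul c1 hz') h.D2)))
      · rintro n rfl
        exact ⟨fun P hP => hf'.difft hP, ih n (by omega) hf.Dt h.Dt⟩

theorem Cls.union {ρ : ℝ × ℝ → ℝ} {U V : Set (ℝ × ℝ × ℝ)} {B B' B'' : STFn → Prop}
    (hU : IsOpen U) (hV : IsOpen V)
    (hB : ∀ f, B f → B' f → B'' f) (h : Cls ρ U B m f) (h' : Cls ρ V B' m f) :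
    Cls ρ (U ∪ V) B'' m f := by
  induction m using Nat.strong_induction_on generalizing f with
  | _ m ih =>
    have hc := h.continuousOn.union_of_isOpen h'.continuousOn hU hV
    have hb := hB f h.base h'.base
    rcases m with _ | m
    · exact ⟨hc, hb⟩
    · refine cls_succ.2 ⟨hc, fun P hP => hP.elim (fun hP => h.diff1 hP) fun hP => h'.diff1 hP,
        fun P hP => hP.elim (fun hP => h.diff2 hP) fun hP => h'.diff2 hP, hb,
        ih m (by omega) h.D1 h'.D1, ih m (by omega) h.D2 h'.D2, ?_⟩
      rintro n rfl
      exact ⟨fun P hP => hP.elim (fun hP => h.difft hP) fun hP => h'.difft hP,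
        ih n (by omega) h.Dt h'.Dt⟩

/-- Two points that lie in no common piece have radii at most `1/2` and at least `3/4`, so they are
at distance at least `1/4`. For such pairs the sup bound gives the Hölder estimate, at the price of
the factor `2 · 4^α`. -/
theorem hb_union (hα : 0 < α) {f : STFn}
    (h : HB euclideanDist α (Ioo 0 τ ×ˢ openDisc (3 / 4)) f)
    (h' : HB euclideanDist α (annulus τ r) f) :
    HB euclideanDist α (Ioo 0 τ ×ˢ openDisc (3 / 4) ∪ annulus τ r) f := by
  obtain ⟨C, hC, h1, h2⟩ := h
  obtain ⟨C', hC', h1', h2'⟩ := h'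
  have hb : ∀ P ∈ Ioo 0 τ ×ˢ openDisc (3 / 4) ∪ annulus τ r, |f P.1 P.2| ≤ max C C' :=
    fun P hP => hP.elim (fun hP => (h1 P hP).trans (le_max_left _ _))
      fun hP => (h1' P hP).trans (le_max_right _ _)
  have hM : 0 ≤ max C C' := le_max_of_le_left hC
  have h4 : (1 : ℝ) ≤ 4 ^ α := Real.one_le_rpow (by norm_num) hα.le
  have hfar : ∀ P P' : ℝ × ℝ × ℝ, Real.sqrt (P.2.1 ^ 2 + P.2.2 ^ 2) ≤ 1 / 2 →
      3 / 4 ≤ Real.sqrt (P'.2.1 ^ 2 + P'.2.2 ^ 2) → (1 / 4 : ℝ) ≤ euclideanDist P P' := by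
    intro P P' hP hP'
    refine le_trans ?_ (le_add_of_nonneg_right (Real.sqrt_nonneg _))
    have e : ∀ x y : ℝ, Real.sqrt (x ^ 2 + y ^ 2) = ‖(⟨x, y⟩ : ℂ)‖ := fun x y =>
      (Complex.norm_eq_sqrt_sq_add_sq ⟨x, y⟩).symm
    rw [e] at hP hP' ⊢
    have : (⟨P.2.1 - P'.2.1, P.2.2 - P'.2.2⟩ : ℂ) = ⟨P.2.1, P.2.2⟩ - ⟨P'.2.1, P'.2.2⟩ := rfl
    rw [this, norm_sub_rev]
    have := norm_sub_norm_le (⟨P'.2.1, P'.2.2⟩ : ℂ) ⟨P.2.1, P.2.2⟩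
    linarith
  have hloc : ∀ P : ℝ × ℝ × ℝ, P ∈ Ioo 0 τ ×ˢ openDisc (3 / 4) → P ∉ annulus τ r →
      (∃ P' : ℝ × ℝ × ℝ, P' ∈ annulus τ r ∧ P' ∉ Ioo 0 τ ×ˢ openDisc (3 / 4)) →
      Real.sqrt (P.2.1 ^ 2 + P.2.2 ^ 2) ≤ 1 / 2 := by
    rintro P hP hPn ⟨P', hP', hPn'⟩
    have a1 : P'.2.1 ^ 2 + P'.2.2 ^ 2 < r ^ 2 := hP'.2.2
    have a2 : ¬ P'.2.1 ^ 2 + P'.2.2 ^ 2 < (3 / 4) ^ 2 := fun h => hPn' ⟨hP'.1, h⟩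
    have a3 : P.2.1 ^ 2 + P.2.2 ^ 2 < (3 / 4) ^ 2 := hP.2
    refine Real.sqrt_le_iff.2 ⟨by norm_num, ?_⟩
    by_contra hlt
    exact hPn ⟨hP.1, not_le.1 hlt, by linarith⟩
  have hloc' : ∀ P : ℝ × ℝ × ℝ, P ∉ Ioo 0 τ ×ˢ openDisc (3 / 4) → P ∈ annulus τ r →
      3 / 4 ≤ Real.sqrt (P.2.1 ^ 2 + P.2.2 ^ 2) := fun P hPn hP =>
    Real.le_sqrt_of_sq_le (not_lt.1 fun h => hPn ⟨hP.1, h⟩)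
  refine ⟨2 * 4 ^ α * max C C', by positivity, fun P hP => (hb P hP).trans (by nlinarith),
    fun P hP P' hP' => ?_⟩
  have hd' : 0 ≤ euclideanDist P P' ^ α := Real.rpow_nonneg (euclideanDist_nonneg P P') α
  have hle : max C C' * euclideanDist P P' ^ α
      ≤ 2 * 4 ^ α * max C C' * euclideanDist P P' ^ α := by
    refine mul_le_mul_of_nonneg_right ?_ hd'
    nlinarith
  by_cases c1 : P ∈ Ioo 0 τ ×ˢ openDisc (3 / 4) ∧ P' ∈ Ioo 0 τ ×ˢ openDisc (3 / 4)
  · exact ((h2 P c1.1 P' c1.2).trans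
      (mul_le_mul_of_nonneg_right (le_max_left _ _) hd')).trans hle
  by_cases c2 : P ∈ annulus τ r ∧ P' ∈ annulus τ r
  · exact ((h2' P c2.1 P' c2.2).trans
      (mul_le_mul_of_nonneg_right (le_max_right _ _) hd')).trans hle
  have hdist : (1 / 4 : ℝ) ≤ euclideanDist P P' := by
    rcases hP with hP | hP
    · have p2 : P' ∉ Ioo 0 τ ×ˢ openDisc (3 / 4) := fun h => c1 ⟨hP, h⟩
      have p3 := hP'.resolve_left p2
      have p4 : P ∉ annulus τ r := fun h => c2 ⟨h, p3⟩
      exact hfar P P' (hloc P hP p4 ⟨P', p3, p2⟩) (hloc' P' p2 p3)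
    · have p2 : P' ∉ annulus τ r := fun h => c2 ⟨hP, h⟩
      have p3 := hP'.resolve_right p2
      have p4 : P ∉ Ioo 0 τ ×ˢ openDisc (3 / 4) := fun h => c1 ⟨h, p3⟩
      have := hfar P' P (hloc P' p3 p2 ⟨P, hP, p4⟩) (hloc' P p4 hP)
      rwa [show euclideanDist P P' = euclideanDist P' P by
        simp only [euclideanDist, abs_sub_comm P.1]; congr 2; ring]
  have h5 : 1 ≤ 4 ^ α * euclideanDist P P' ^ α := by
    rw [← Real.mul_rpow (by norm_num) (euclideanDist_nonneg _ _)]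
    exact Real.one_le_rpow (by linarith) hα.le
  calc |f P.1 P.2 - f P'.1 P'.2| ≤ |f P.1 P.2| + |f P'.1 P'.2| := abs_sub _ _
    _ ≤ 2 * max C C' := by linarith [hb P hP, hb P' hP']
    _ ≤ 2 * max C C' * (4 ^ α * euclideanDist P P' ^ α) :=
        le_mul_of_one_le_right (by positivity) h5
    _ = _ := by ring

theorem stDisc_eq_union (hr : 3 / 4 ≤ r) :
    Ioo 0 τ ×ˢ openDisc r = Ioo 0 τ ×ˢ openDisc (3 / 4) ∪ annulus τ r := by
  ext P
  simp only [openDisc, annulus, mem_prod, mem_union, mem_ofPred_eq, ← and_or_left]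
  refine and_congr_right fun _ => ⟨fun h => ?_, fun h => ?_⟩
  · by_cases h' : P.2.1 ^ 2 + P.2.2 ^ 2 < (3 / 4) ^ 2
    · exact Or.inl h'
    · exact Or.inr ⟨by nlinarith, h⟩
  · rcases h with h | h
    · nlinarith
    · exact h.2

/-- Classical regularity on every smaller disc, from the disc `|q| < 3/4` and the collar. -/
theorem cls_disc_of_collar (hα : 0 < α) (hα' : α ≤ 1) (hr0 : 3 / 4 ≤ r) (hr : r < 1)
    (hf : IsParabolicC m (Ioo 0 τ ×ˢ openDisc 1) f)
    (h : Cls (fun _ => 1) (Ioo 0 τ ×ˢ openDisc (3 / 4))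
      (HB euclideanDist α (Ioo 0 τ ×ˢ openDisc (3 / 4))) m f)
    (h' : Cls Prod.fst (collar τ) (HB hyperbolicDist α (collar τ)) m (flatten f)) :
    Cls (fun _ => 1) (Ioo 0 τ ×ˢ openDisc r) (HB euclideanDist α (Ioo 0 τ ×ˢ openDisc r)) m f := by
  rw [stDisc_eq_union hr0]
  exact h.union (isOpen_stDisc _ _) (isOpen_annulus _ _) (fun _ => hb_union hα)
    (cls_annulus hα hα' (by linarith) hr hf (h'.mono (innerCollar_subset hr)
      fun _ h => h.mono (innerCollar_subset hr)))

end Transfer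

/-! ### Curvature without normalization -/

/-- Determinant of the second fundamental form with respect to the normal `Xu × Xv`. -/
def secDet (Xu Xv Xuu Xuv Xvv : R3) : ℝ :=
  (Xuu ⬝ᵥ (Xu ⨯₃ Xv)) * (Xvv ⬝ᵥ (Xu ⨯₃ Xv)) - (Xuv ⬝ᵥ (Xu ⨯₃ Xv)) ^ 2

/-- Contraction of the second fundamental form with respect to the normal `Xu × Xv` and the
adjugate of the first fundamental form. -/
def secTr (Xu Xv Xuu Xuv Xvv : R3) : ℝ :=
  (Xu ⬝ᵥ Xu) * (Xvv ⬝ᵥ (Xu ⨯₃ Xv)) - 2 * (Xu ⬝ᵥ Xv) * (Xuv ⬝ᵥ (Xu ⨯₃ Xv))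
    + (Xv ⬝ᵥ Xv) * (Xuu ⬝ᵥ (Xu ⨯₃ Xv))

theorem cross_dot_cross_self (a b : R3) :
    (a ⨯₃ b) ⬝ᵥ (a ⨯₃ b) = (a ⬝ᵥ a) * (b ⬝ᵥ b) - (a ⬝ᵥ b) ^ 2 := by
  rw [cross_dot_cross, dotProduct_comm b a]; ring

theorem dotProduct_self_nonneg_R3 (a : R3) : 0 ≤ a ⬝ᵥ a := by
  simp only [dotProduct, Fin.sum_univ_three]
  nlinarith [sq_nonneg (a 0), sq_nonneg (a 1), sq_nonneg (a 2)]

theorem dotProduct_self_pos_R3 {a : R3} (h : a ≠ 0) : 0 < a ⬝ᵥ a :=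
  (dotProduct_self_nonneg_R3 a).lt_of_ne fun h' => h (dotProduct_self_eq_zero.1 h'.symm)

section Curvature

variable {Xu Xv Xuu Xuv Xvv : R3}

theorem gaussCurv_eq :
    gaussCurv Xu Xv Xuu Xuv Xvv = secDet Xu Xv Xuu Xuv Xvv / ((Xu ⨯₃ Xv) ⬝ᵥ (Xu ⨯₃ Xv)) ^ 2 := by
  have h0 := dotProduct_self_nonneg_R3 (Xu ⨯₃ Xv)
  rw [gaussCurv, ← cross_dot_cross_self, unitNormal, secDet]
  simp only [dotProduct_smul, smul_eq_mul]
  set n := (Xu ⨯₃ Xv) ⬝ᵥ (Xu ⨯₃ Xv)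
  have e : (Real.sqrt n)⁻¹ ^ 2 = n⁻¹ := by rw [inv_pow, Real.sq_sqrt h0]
  rw [show ∀ a b c r : ℝ, r * a * (r * b) - (r * c) ^ 2 = r ^ 2 * (a * b - c ^ 2) by
    intros; ring, e]
  ring

theorem gaussCurv_div_meanCurv (h : Xu ⨯₃ Xv ≠ 0) :
    gaussCurv Xu Xv Xuu Xuv Xvv / meanCurv Xu Xv Xuu Xuv Xvv
      = secDet Xu Xv Xuu Xuv Xvv / secTr Xu Xv Xuu Xuv Xvv
        * (Real.sqrt ((Xu ⨯₃ Xv) ⬝ᵥ (Xu ⨯₃ Xv)))⁻¹ := by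
  have h0 := dotProduct_self_pos_R3 h
  rw [gaussCurv_eq, meanCurv, ← cross_dot_cross_self, unitNormal, secTr]
  simp only [dotProduct_smul, smul_eq_mul]
  set n := (Xu ⨯₃ Xv) ⬝ᵥ (Xu ⨯₃ Xv)
  set r := Real.sqrt n with hr
  have hr0 : 0 < r := Real.sqrt_pos.2 h0
  have e : n = r ^ 2 := (Real.sq_sqrt h0.le).symm
  rw [e, show ∀ a b c d e f : ℝ, a * (r⁻¹ * b) - 2 * c * (r⁻¹ * d) + e * (r⁻¹ * f)
    = r⁻¹ * (a * b - 2 * c * d + e * f) by intros; ring]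
  generalize Xu ⬝ᵥ Xu * Xvv ⬝ᵥ Xu ⨯₃ Xv - 2 * Xu ⬝ᵥ Xv * Xuv ⬝ᵥ Xu ⨯₃ Xv
    + Xv ⬝ᵥ Xv * Xuu ⬝ᵥ Xu ⨯₃ Xv = Q
  -- If the trace vanishes, both quotients are zero by the convention for division.
  by_cases hQ : Q = 0
  · simp [hQ]
  · field_simp

/-- Multiplying by the length of `Xu × Xv` removes the square root, so the flow equation becomes
rational in the derivatives of the surface. -/
theorem dot_unitNormal_eq_iff (h : Xu ⨯₃ Xv ≠ 0) (V : R3) :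
    V ⬝ᵥ unitNormal Xu Xv = gaussCurv Xu Xv Xuu Xuv Xvv / meanCurv Xu Xv Xuu Xuv Xvv ↔
      V ⬝ᵥ (Xu ⨯₃ Xv) = secDet Xu Xv Xuu Xuv Xvv / secTr Xu Xv Xuu Xuv Xvv := by
  have h0 : 0 < Real.sqrt ((Xu ⨯₃ Xv) ⬝ᵥ (Xu ⨯₃ Xv)) := Real.sqrt_pos.2 (dotProduct_self_pos_R3 h)
  rw [gaussCurv_div_meanCurv h, unitNormal, dotProduct_smul, smul_eq_mul, mul_comm]
  exact mul_left_inj' (inv_ne_zero h0.ne')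

theorem gaussCurv_pos_iff (h : Xu ⨯₃ Xv ≠ 0) :
    0 < gaussCurv Xu Xv Xuu Xuv Xvv ↔ 0 < secDet Xu Xv Xuu Xuv Xvv := by
  have h0 := dotProduct_self_pos_R3 h
  rw [gaussCurv_eq, div_pos_iff_of_pos_right (by positivity)]

theorem cross_ne_zero_of_gaussCurv_pos (h : 0 < gaussCurv Xu Xv Xuu Xuv Xvv) : Xu ⨯₃ Xv ≠ 0 := by
  intro h0
  rw [gaussCurv_eq, h0] at h
  simp at h

/-- Definite second fundamental form: the trace does not vanish. -/
theorem secTr_ne_zero (h : Xu ⨯₃ Xv ≠ 0) (hD : 0 < secDet Xu Xv Xuu Xuv Xvv) :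
    secTr Xu Xv Xuu Xuv Xvv ≠ 0 := by
  have hI := dotProduct_self_pos_R3 h
  rw [cross_dot_cross_self] at hI
  have hG := dotProduct_self_nonneg_R3 Xv
  have hE := dotProduct_self_nonneg_R3 Xu
  unfold secTr
  unfold secDet at hD
  generalize Xuu ⬝ᵥ (Xu ⨯₃ Xv) = L at *
  generalize Xuv ⬝ᵥ (Xu ⨯₃ Xv) = M at *
  generalize Xvv ⬝ᵥ (Xu ⨯₃ Xv) = N at *
  generalize Xu ⬝ᵥ Xu = E at *
  generalize Xv ⬝ᵥ Xv = G at *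
  generalize Xu ⬝ᵥ Xv = F at *
  intro h0
  have hG' : 0 < G := by
    rcases hG.eq_or_lt with h | h
    · rw [← h] at hI; nlinarith [sq_nonneg F]
    · exact h
  have hL : L ≠ 0 := by
    rintro rfl
    nlinarith [sq_nonneg M]
  have h1 : 0 < L ^ 2 := by positivity
  -- The left-hand side is `G L` times the trace. Its first two terms are nonnegative and the last
  -- one is positive, so the trace cannot vanish.
  have h2 : (G * L - F * M) ^ 2 + (E * G - F ^ 2) * M ^ 2 + E * G * (L * N - M ^ 2) = 0 := by
    linear_combination (G * L) * h0
  have h3 : 0 < E * G := by nlinarith [sq_nonneg F]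
  nlinarith [sq_nonneg (G * L - F * M), mul_nonneg hI.le (sq_nonneg M), mul_pos h3 hD]

end Curvature

/-- `K / H` divided by `⟨T, N⟩`, from unnormalized quantities. -/
def geoVal (T Xu Xv Xuu Xuv Xvv : R3) : ℝ :=
  secDet Xu Xv Xuu Xuv Xvv / (secTr Xu Xv Xuu Xuv Xvv * (T ⬝ᵥ (Xu ⨯₃ Xv)))

/-- No regularity of the surface is needed: where `Xu × Xv = 0`, both sides are zero by convention.
-/
theorem geoVal_eq (T Xu Xv Xuu Xuv Xvv : R3) :
    gaussCurv Xu Xv Xuu Xuv Xvv / meanCurv Xu Xv Xuu Xuv Xvv / (T ⬝ᵥ unitNormal Xu Xv)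
      = geoVal T Xu Xv Xuu Xuv Xvv := by
  by_cases h : Xu ⨯₃ Xv = 0
  · simp [geoVal, unitNormal, h]
  · have h0 : 0 < Real.sqrt ((Xu ⨯₃ Xv) ⬝ᵥ (Xu ⨯₃ Xv)) :=
      Real.sqrt_pos.2 (dotProduct_self_pos_R3 h)
    rw [gaussCurv_div_meanCurv h, unitNormal, dotProduct_smul, smul_eq_mul, geoVal]
    field_simp

/-! ### Change of parameters -/

section Reparam

variable {Xu Xv Xuu Xuv Xvv : R3} {a b c d e₁ e₂ f₁ f₂ g₁ g₂ : ℝ}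

theorem cross_reparam :
    (a • Xu + b • Xv) ⨯₃ (c • Xu + d • Xv) = (a * d - b * c) • (Xu ⨯₃ Xv) := by
  ext i
  fin_cases i <;> simp [cross_apply] <;> ring

theorem dot_reparam (j : ℝ) :
    (a • Xuu + b • Xuv + c • Xvv + (e₁ • Xu + e₂ • Xv)) ⬝ᵥ (j • (Xu ⨯₃ Xv))
      = j * (a * (Xuu ⬝ᵥ (Xu ⨯₃ Xv)) + b * (Xuv ⬝ᵥ (Xu ⨯₃ Xv)) + c * (Xvv ⬝ᵥ (Xu ⨯₃ Xv))) := by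
  simp only [dotProduct_smul, add_dotProduct, smul_dotProduct, dot_self_cross, dot_cross_self,
    smul_eq_mul]
  ring

/-- The tangential parts of the second derivatives are orthogonal to `Xu × Xv`. The congruence by
the Jacobian matrix contributes the square of its determinant, and each of the two normals
contributes one more factor. For the trace below, the adjugate gives two factors and the single
normal a third. -/
theorem secDet_reparam :
    secDet (a • Xu + b • Xv) (c • Xu + d • Xv)
      (a ^ 2 • Xuu + (2 * a * b) • Xuv + b ^ 2 • Xvv + (e₁ • Xu + e₂ • Xv))
      ((a * c) • Xuu + (a * d + b * c) • Xuv + (b * d) • Xvv + (f₁ • Xu + f₂ • Xv))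
      (c ^ 2 • Xuu + (2 * c * d) • Xuv + d ^ 2 • Xvv + (g₁ • Xu + g₂ • Xv))
    = (a * d - b * c) ^ 4 * secDet Xu Xv Xuu Xuv Xvv := by
  unfold secDet
  rw [cross_reparam, dot_reparam, dot_reparam, dot_reparam]
  ring

theorem secTr_reparam :
    secTr (a • Xu + b • Xv) (c • Xu + d • Xv)
      (a ^ 2 • Xuu + (2 * a * b) • Xuv + b ^ 2 • Xvv + (e₁ • Xu + e₂ • Xv))
      ((a * c) • Xuu + (a * d + b * c) • Xuv + (b * d) • Xvv + (f₁ • Xu + f₂ • Xv))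
      (c ^ 2 • Xuu + (2 * c * d) • Xuv + d ^ 2 • Xvv + (g₁ • Xu + g₂ • Xv))
    = (a * d - b * c) ^ 3 * secTr Xu Xv Xuu Xuv Xvv := by
  unfold secTr
  rw [cross_reparam, dot_reparam, dot_reparam, dot_reparam]
  simp only [add_dotProduct, dotProduct_add, smul_dotProduct, dotProduct_smul, smul_eq_mul]
  rw [dotProduct_comm Xv Xu]
  ring

/-- The powers of the Jacobian determinant balance, `4 = 3 + 1`, including the sign, so orientation
does not matter either. -/
theorem geoVal_reparam (T : R3) (h : a * d - b * c ≠ 0) :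
    geoVal T (a • Xu + b • Xv) (c • Xu + d • Xv)
      (a ^ 2 • Xuu + (2 * a * b) • Xuv + b ^ 2 • Xvv + (e₁ • Xu + e₂ • Xv))
      ((a * c) • Xuu + (a * d + b * c) • Xuv + (b * d) • Xvv + (f₁ • Xu + f₂ • Xv))
      (c ^ 2 • Xuu + (2 * c * d) • Xuv + d ^ 2 • Xvv + (g₁ • Xu + g₂ • Xv))
    = geoVal T Xu Xv Xuu Xuv Xvv := by
  unfold geoVal
  rw [secDet_reparam, secTr_reparam, cross_reparam, dotProduct_smul, smul_eq_mul,
    show ∀ j q r : ℝ, j ^ 3 * q * (j * r) = j ^ 4 * (q * r) by intros; ring]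
  exact mul_div_mul_left _ _ (pow_ne_zero 4 h)

end Reparam

/-! ### Normalized jets

A jet `x` holds `w, w_y, w_yy, ω' w_z, ω' w_zy, z ω' w_zz`.  A frame `F` holds the first and second
derivatives of `S` and `T`: `S_z, S_y, S_zz, S_zy, S_yy, T, T_z, T_y, T_zz, T_zy, T_yy`, then
`S_y, S_yy, T, T_y, T_yy` with the third component divided by `z`, and finally `(z, ω, ω')`, where
`z = ω ω'`.  For the flattened coordinates `ω = z^p`; for Cartesian coordinates
`z = ω = ω' = 1`. -/

/-- The values of the normalized derivatives of `w`. -/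
abbrev Jet : Type := Fin 6 → ℝ

/-- The values of the coefficients of a coordinate change. -/
abbrev Frame : Type := Fin 17 → R3

section Normalized

/-- `X_y`. -/
def nfXy (F : Frame) (x : Jet) : R3 := F 1 + x 0 • F 7 + x 1 • F 5

/-- `X_yy`. -/
def nfXyy (F : Frame) (x : Jet) : R3 := F 4 + x 0 • F 10 + (2 * x 1) • F 7 + x 2 • F 5

/-- `S_z + w T_z`. -/
def nfC (F : Frame) (x : Jet) : R3 := F 0 + x 0 • F 6

/-- `⟨T, X_z × X_y⟩`. -/
def nfJ (F : Frame) (x : Jet) : ℝ := F 5 ⬝ᵥ (nfC F x ⨯₃ nfXy F x)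

/-- `ω' X_z`. -/
def nfXz (F : Frame) (x : Jet) : R3 := x 3 • F 5 + F 16 2 • nfC F x

/-- First fundamental form: the entry `ω'^2 ⟨X_z, X_z⟩`. -/
def nfE (F : Frame) (x : Jet) : ℝ := nfXz F x ⬝ᵥ nfXz F x

/-- First fundamental form: the entry `ω' ⟨X_z, X_y⟩`. -/
def nfF (F : Frame) (x : Jet) : ℝ := nfXz F x ⬝ᵥ nfXy F x

/-- First fundamental form: the entry `⟨X_y, X_y⟩`. -/
def nfG (F : Frame) (x : Jet) : ℝ := nfXy F x ⬝ᵥ nfXy F x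

/-- `X_y` with the third component divided by `z`. -/
def nfXyHat (F : Frame) (x : Jet) : R3 := F 11 + x 0 • F 14 + x 1 • F 13

/-- `X_yy` with the third component divided by `z`. -/
def nfXyyHat (F : Frame) (x : Jet) : R3 := F 12 + x 0 • F 15 + (2 * x 1) • F 14 + x 2 • F 13

/-- `⟨X_yy, (S_z + w T_z) × X_y⟩`. -/
def nfN0 (F : Frame) (x : Jet) : ℝ := nfXyy F x ⬝ᵥ (nfC F x ⨯₃ nfXy F x)

/-- `z⁻¹ ⟨X_yy, T × X_y⟩`. -/
def nfN1 (F : Frame) (x : Jet) : ℝ := nfXyyHat F x ⬝ᵥ (F 13 ⨯₃ nfXyHat F x)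

/-- Second fundamental form: the entry of `X_yy`. -/
def nfN (F : Frame) (x : Jet) : ℝ := nfN0 F x + F 16 1 * x 3 * nfN1 F x

/-- The part of `X_zy` without `w_z` and `w_zy`. -/
def nfm (F : Frame) (x : Jet) : R3 := F 3 + x 0 • F 9 + x 1 • F 6

/-- Second fundamental form: the entry of `X_zy`, times `ω'`. -/
def nfM (F : Frame) (x : Jet) : ℝ :=
  (F 16 2 • nfm F x + x 3 • F 7 + x 4 • F 5) ⬝ᵥ (nfC F x ⨯₃ nfXy F x)
    + x 3 * (nfm F x ⬝ᵥ (F 5 ⨯₃ nfXy F x))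
    + F 16 1 * (x 3 * x 3) * (F 14 ⬝ᵥ (F 13 ⨯₃ nfXyHat F x))

/-- The part of `X_zz` without `w_z` and `w_zz`. -/
def nfl (F : Frame) (x : Jet) : R3 := F 2 + x 0 • F 8

/-- Second fundamental form: the entry of `X_zz`, times `z ω'`. -/
def nfL (F : Frame) (x : Jet) : ℝ :=
  ((F 16 0 * F 16 2) • nfl F x + (2 * F 16 0 * x 3) • F 6 + x 5 • F 5) ⬝ᵥ (nfC F x ⨯₃ nfXy F x)
    + F 16 0 * x 3 * (nfl F x ⬝ᵥ (F 5 ⨯₃ nfXy F x))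
    + 2 * F 16 1 * (x 3 * x 3) * (F 6 ⬝ᵥ (F 5 ⨯₃ nfXy F x))

/-- The normalized determinant of the second fundamental form. -/
def nfDet (F : Frame) (x : Jet) : ℝ := nfL F x * nfN F x - F 16 1 * (nfM F x * nfM F x)

/-- The normalized trace of the second fundamental form. -/
def nfTr (F : Frame) (x : Jet) : ℝ :=
  nfG F x * nfL F x + F 16 1 * (nfE F x * nfN F x - 2 * (nfF F x * nfM F x))

/-- The nonlinearity as a function of the normalized jet. -/
def nfVal (F : Frame) (x : Jet) : ℝ := nfDet F x * (nfTr F x * nfJ F x)⁻¹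

/-- The part of the nonlinearity that survives at the boundary. -/
def nfVal0 (F : Frame) (x : Jet) : ℝ := nfN0 F x * (nfG F x * nfJ F x)⁻¹

/-- The remainder of the nonlinearity, divided by `ω`. -/
def nfVal1 (F : Frame) (x : Jet) : ℝ :=
  x 3 * nfN1 F x * (nfG F x * nfJ F x)⁻¹ -
    (nfE F x * (nfN F x * nfN F x) - 2 * (nfF F x * (nfM F x * nfN F x))
      + nfG F x * (nfM F x * nfM F x)) * (nfG F x * nfTr F x * nfJ F x)⁻¹

variable {F : Frame} {x : Jet}

/-- With determinant `L N - ω M²` and trace `G L + ω (E N - 2 F M)`, their quotient is `N / G - ω (E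
N² - 2 F M N + G M²) / (G · trace)`; moreover `N` differs from its tangential part by a multiple of
`ω`. At the boundary the speed therefore depends on tangential derivatives of `w` only. -/
theorem nfVal_eq (hG : nfG F x ≠ 0) (hT : nfTr F x ≠ 0) (hJ : nfJ F x ≠ 0) :
    nfVal F x = nfVal0 F x + F 16 1 * nfVal1 F x := by
  rw [nfVal, nfVal0, nfVal1]
  field_simp
  rw [nfTr, nfDet]
  rw [show nfN0 F x = nfN F x - F 16 1 * x 3 * nfN1 F x by rw [nfN]; ring]
  ring

/-- A vector whose third component is multiplied by `z`. -/
def unhat (z : ℝ) (v : R3) : R3 := ![v 0, v 1, z * v 2]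

/-- A triple product is a determinant, here with one row multiplied by `z`. -/
theorem dot_cross_unhat (z : ℝ) (a b c : R3) :
    unhat z a ⬝ᵥ (unhat z b ⨯₃ unhat z c) = z * (a ⬝ᵥ (b ⨯₃ c)) := by
  simp [unhat, cross_apply, dotProduct, Fin.sum_univ_three]
  ring

/-- The relations between the entries of a frame. -/
structure Frame.Valid (F : Frame) : Prop where
  z_eq : F 16 0 = F 16 1 * F 16 2
  Sy : F 1 = unhat (F 16 0) (F 11)
  Syy : F 4 = unhat (F 16 0) (F 12)
  T : F 5 = unhat (F 16 0) (F 13)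
  Ty : F 7 = unhat (F 16 0) (F 14)
  Tyy : F 10 = unhat (F 16 0) (F 15)

theorem unhat_add (z : ℝ) (a b : R3) : unhat z (a + b) = unhat z a + unhat z b := by
  ext i; fin_cases i <;> simp [unhat, mul_add]

theorem unhat_smul (z c : ℝ) (a : R3) : unhat z (c • a) = c • unhat z a := by
  ext i; fin_cases i <;> simp [unhat]; ring

theorem Frame.Valid.Xy (h : F.Valid) : nfXy F x = unhat (F 16 0) (nfXyHat F x) := by
  rw [nfXy, nfXyHat, h.Sy, h.Ty, h.T]; simp only [unhat_add, unhat_smul]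

theorem Frame.Valid.Xyy (h : F.Valid) : nfXyy F x = unhat (F 16 0) (nfXyyHat F x) := by
  rw [nfXyy, nfXyyHat, h.Syy, h.Tyy, h.Ty, h.T]; simp only [unhat_add, unhat_smul]

/-- The jet with given derivatives of `w`. -/
def mkJet (F : Frame) (w wz wy wzz wzy wyy : ℝ) : Jet :=
  ![w, wy, wyy, F 16 2 * wz, F 16 2 * wzy, F 16 0 * F 16 2 * wzz]

variable {w wz wy wzz wzy wyy : ℝ}

/-- Comparison of the unnormalized and the normalized quantities. -/
theorem geo_eq_nf (h : F.Valid) :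
    let x := mkJet F w wz wy wzz wzy wyy
    let Xz := F 0 + w • F 6 + wz • F 5
    let Xy := F 1 + w • F 7 + wy • F 5
    let Xzz := F 2 + w • F 8 + (2 * wz) • F 6 + wzz • F 5
    let Xzy := F 3 + w • F 9 + wz • F 7 + wy • F 6 + wzy • F 5
    let Xyy := F 4 + w • F 10 + (2 * wy) • F 7 + wyy • F 5
    (F 16 0 * F 16 2) * (Xzz ⬝ᵥ (Xz ⨯₃ Xy)) = nfL F x ∧
    F 16 2 * (Xzy ⬝ᵥ (Xz ⨯₃ Xy)) = nfM F x ∧ Xyy ⬝ᵥ (Xz ⨯₃ Xy) = nfN F x ∧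
    F 16 2 • Xz = nfXz F x ∧ Xy = nfXy F x ∧ F 5 ⬝ᵥ (Xz ⨯₃ Xy) = nfJ F x := by
  intro x Xz Xy Xzz Xzy Xyy
  have x0 : x 0 = w := rfl
  have x1 : x 1 = wy := rfl
  have x2 : x 2 = wyy := rfl
  have x3 : x 3 = F 16 2 * wz := rfl
  have x4 : x 4 = F 16 2 * wzy := rfl
  have x5 : x 5 = F 16 0 * F 16 2 * wzz := rfl
  have hXy : Xy = nfXy F x := by simp only [Xy, nfXy, x0, x1]
  have hXyy : Xyy = nfXyy F x := by simp only [Xyy, nfXyy, x0, x1, x2]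
  have hXz : Xz = nfC F x + wz • F 5 := by simp only [Xz, nfC, x0]
  have hXzz : Xzz = nfl F x + (2 * wz) • F 6 + wzz • F 5 := by simp only [Xzz, nfl, x0]
  have hXzy : Xzy = nfm F x + wz • F 7 + wzy • F 5 := by
    simp only [Xzy, nfm, x0, x1]; abel
  have hn : Xz ⨯₃ Xy = nfC F x ⨯₃ nfXy F x + wz • (F 5 ⨯₃ nfXy F x) := by
    rw [hXz, hXy, map_add, map_smul]; rfl
  -- This triple product stands next to the singular `w_z`. All three vectors have a third component
  -- divisible by `z`, and the factor gained turns `w_z` into `z w_z = ω · (ω' w_z)`, which is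
  -- bounded.
  have hN1 : nfXyy F x ⬝ᵥ (F 5 ⨯₃ nfXy F x) = F 16 0 * nfN1 F x := by
    rw [h.Xyy, h.Xy, h.T, dot_cross_unhat, nfN1]
  have hT2 : F 7 ⬝ᵥ (F 5 ⨯₃ nfXy F x) = F 16 0 * (F 14 ⬝ᵥ (F 13 ⨯₃ nfXyHat F x)) := by
    rw [h.Ty, h.Xy, h.T, dot_cross_unhat]
  refine ⟨?_, ?_, ?_, ?_, hXy, ?_⟩
  · rw [hn, hXzz, nfL, x3, x5, h.z_eq]
    simp only [dotProduct_add, dotProduct_smul, add_dotProduct, smul_dotProduct, smul_eq_mul,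
      dot_self_cross]
    ring
  · rw [hn, hXzy, nfM, x3, x4]
    simp only [dotProduct_add, dotProduct_smul, add_dotProduct, smul_dotProduct, smul_eq_mul,
      dot_self_cross, hT2]
    rw [h.z_eq]
    ring
  · rw [hn, hXyy, nfN, x3, nfN0]
    simp only [dotProduct_add, dotProduct_smul, smul_eq_mul, hN1]
    rw [h.z_eq]
    ring
  · rw [hXz, nfXz, x3, smul_add, smul_smul, add_comm]
  · rw [hn, nfJ]
    simp only [dotProduct_add, dotProduct_smul, smul_eq_mul, dot_self_cross]
    ring

theorem nfDet_eq_secDet (h : F.Valid) :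
    let x := mkJet F w wz wy wzz wzy wyy
    let Xz := F 0 + w • F 6 + wz • F 5
    let Xy := F 1 + w • F 7 + wy • F 5
    let Xzz := F 2 + w • F 8 + (2 * wz) • F 6 + wzz • F 5
    let Xzy := F 3 + w • F 9 + wz • F 7 + wy • F 6 + wzy • F 5
    let Xyy := F 4 + w • F 10 + (2 * wy) • F 7 + wyy • F 5
    nfDet F x = F 16 0 * F 16 2 * secDet Xz Xy Xzz Xzy Xyy ∧
    nfTr F x = F 16 0 * F 16 2 * secTr Xz Xy Xzz Xzy Xyy := by
  intro x Xz Xy Xzz Xzy Xyy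
  obtain ⟨hL, hM, hN, hXz, hXy, hJ⟩ := geo_eq_nf (w := w) (wz := wz) (wy := wy) (wzz := wzz)
    (wzy := wzy) (wyy := wyy) h
  have hω : F 16 1 * F 16 2 = F 16 0 := h.z_eq.symm
  constructor
  · rw [nfDet, ← hL, ← hM, ← hN, secDet]
    linear_combination (-F 16 2 * (Xzy ⬝ᵥ (Xz ⨯₃ Xy)) ^ 2) * hω
  · rw [nfTr, ← hL, ← hM, ← hN, secTr, nfE, nfF, nfG, ← hXz, ← hXy]
    simp only [smul_dotProduct, dotProduct_smul, smul_eq_mul]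
    linear_combination (F 16 2 * ((Xz ⬝ᵥ Xz) * (Xyy ⬝ᵥ (Xz ⨯₃ Xy))
      - 2 * (Xz ⬝ᵥ Xy) * (Xzy ⬝ᵥ (Xz ⨯₃ Xy)))) * hω

theorem nfVal_eq_geoVal (h : F.Valid) (h0 : F 16 0 ≠ 0) (h2 : F 16 2 ≠ 0) :
    nfVal F (mkJet F w wz wy wzz wzy wyy)
      = geoVal (F 5) (F 0 + w • F 6 + wz • F 5) (F 1 + w • F 7 + wy • F 5)
        (F 2 + w • F 8 + (2 * wz) • F 6 + wzz • F 5)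
        (F 3 + w • F 9 + wz • F 7 + wy • F 6 + wzy • F 5)
        (F 4 + w • F 10 + (2 * wy) • F 7 + wyy • F 5) := by
  obtain ⟨hD, hT⟩ := nfDet_eq_secDet (w := w) (wz := wz) (wy := wy) (wzz := wzz)
    (wzy := wzy) (wyy := wyy) h
  obtain ⟨-, -, -, -, -, hJ⟩ := geo_eq_nf (w := w) (wz := wz) (wy := wy) (wzz := wzz)
    (wzy := wzy) (wyy := wyy) h
  rw [nfVal, geoVal, hD, hT, ← hJ, ← div_eq_mul_inv, mul_assoc (F 16 0 * F 16 2)]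
  exact mul_div_mul_left _ _ (mul_ne_zero h0 h2)

/-! ### The principal part -/

/-- The quadratic form of the principal part, multiplied by the square of the trace. -/
def nfForm (F : Frame) (x : Jet) (ξ₁ ξ₂ : ℝ) : ℝ :=
  nfE F x * (nfN F x * ξ₁ - F 16 1 * nfM F x * ξ₂) ^ 2
    + 2 * nfF F x * ((nfN F x * ξ₁ - F 16 1 * nfM F x * ξ₂) * (-nfM F x * ξ₁ + nfL F x * ξ₂))
    + nfG F x * (-nfM F x * ξ₁ + nfL F x * ξ₂) ^ 2

/-- The derivative of the nonlinearity in the direction of the second derivatives `ξ ⊗ ξ`. -/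
theorem hasDerivAt_nfVal_second (ξ₁ ξ₂ : ℝ) (hω : F 16 1 ≠ 0) (hT : nfTr F x ≠ 0)
    (hJ : nfJ F x ≠ 0) :
    HasDerivAt (fun s : ℝ => nfVal F (x + s •
      ![0, 0, ξ₂ ^ 2, 0, ξ₁ * ξ₂ / F 16 1, ξ₁ ^ 2 / F 16 1]))
      (nfForm F x ξ₁ ξ₂ / nfTr F x ^ 2) 0 := by
  -- The division by `ω` compensates the factor `ω` in front of the normal coefficients of the
  -- linearization, so that the derivative in this direction is the principal form at `(ξ₁, ξ₂)`.
  set η : Jet := ![0, 0, ξ₂ ^ 2, 0, ξ₁ * ξ₂ / F 16 1, ξ₁ ^ 2 / F 16 1] with hη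
  have k0 : ∀ s : ℝ, (x + s • η) 0 = x 0 := fun s => by simp [hη]
  have k1 : ∀ s : ℝ, (x + s • η) 1 = x 1 := fun s => by simp [hη]
  have k2 : ∀ s : ℝ, (x + s • η) 2 = x 2 + s * ξ₂ ^ 2 := fun s => by simp [hη]
  have k3 : ∀ s : ℝ, (x + s • η) 3 = x 3 := fun s => by simp [hη]
  have k4 : ∀ s : ℝ, (x + s • η) 4 = x 4 + s * (ξ₁ * ξ₂ / F 16 1) := fun s => by simp [hη]
  have k5 : ∀ s : ℝ, (x + s • η) 5 = x 5 + s * (ξ₁ ^ 2 / F 16 1) := fun s => by simp [hη]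
  have hC : ∀ s : ℝ, nfC F (x + s • η) = nfC F x := fun s => by simp only [nfC, k0]
  have hXy : ∀ s : ℝ, nfXy F (x + s • η) = nfXy F x := fun s => by simp only [nfXy, k0, k1]
  have hXz : ∀ s : ℝ, nfXz F (x + s • η) = nfXz F x := fun s => by simp only [nfXz, k3, hC]
  have hm : ∀ s : ℝ, nfm F (x + s • η) = nfm F x := fun s => by simp only [nfm, k0, k1]
  have hl : ∀ s : ℝ, nfl F (x + s • η) = nfl F x := fun s => by simp only [nfl, k0]
  have hyh : ∀ s : ℝ, nfXyHat F (x + s • η) = nfXyHat F x := fun s => by simp only [nfXyHat, k0, k1]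
  have hJs : ∀ s : ℝ, nfJ F (x + s • η) = nfJ F x := fun s => by simp only [nfJ, hC, hXy]
  have hE : ∀ s : ℝ, nfE F (x + s • η) = nfE F x := fun s => by simp only [nfE, hXz]
  have hF : ∀ s : ℝ, nfF F (x + s • η) = nfF F x := fun s => by simp only [nfF, hXz, hXy]
  have hG : ∀ s : ℝ, nfG F (x + s • η) = nfG F x := fun s => by simp only [nfG, hXy]
  have hL : ∀ s : ℝ, nfL F (x + s • η) = nfL F x + s * (ξ₁ ^ 2 / F 16 1 * nfJ F x) := fun s => by
    simp only [nfL, k3, k5, hC, hXy, hl, nfJ, add_dotProduct, smul_dotProduct, smul_eq_mul]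
    ring
  have hM : ∀ s : ℝ, nfM F (x + s • η) = nfM F x + s * (ξ₁ * ξ₂ / F 16 1 * nfJ F x) := fun s => by
    simp only [nfM, k3, k4, hC, hXy, hm, hyh, nfJ, add_dotProduct, smul_dotProduct, smul_eq_mul]
    ring
  -- Changing `w_yy` adds a multiple of the rescaled `T` to the rescaled `X_yy`; its triple product
  -- with `T` itself vanishes.
  have hN1 : ∀ s : ℝ, nfN1 F (x + s • η) = nfN1 F x := fun s => by
    simp only [nfN1, nfXyyHat, k0, k1, k2, hyh, add_dotProduct, smul_dotProduct, smul_eq_mul,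
      dot_self_cross]
    ring
  have hN : ∀ s : ℝ, nfN F (x + s • η) = nfN F x + s * (ξ₂ ^ 2 * nfJ F x) := fun s => by
    simp only [nfN, hN1, nfN0, nfXyy, k0, k1, k2, k3, hC, hXy, nfJ, add_dotProduct,
      smul_dotProduct, smul_eq_mul]
    ring
  simp only [nfVal, nfDet, nfTr, hL, hM, hN, hE, hF, hG, hJs]
  simp only [nfForm]
  rw [nfTr] at hT
  generalize nfL F x = L at *
  generalize nfM F x = M at *
  generalize nfN F x = N at *
  generalize nfE F x = e at *
  generalize nfF F x = f at *
  generalize nfG F x = g at *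
  generalize nfJ F x = J at *
  generalize F 16 1 = o at *
  have d : ∀ a b : ℝ, HasDerivAt (fun s : ℝ => a + s * b) b 0 := fun a b => by
    simpa using ((hasDerivAt_id (0 : ℝ)).mul_const b).const_add a
  have dL := d L (ξ₁ ^ 2 / o * J)
  have dM := d M (ξ₁ * ξ₂ / o * J)
  have dN := d N (ξ₂ ^ 2 * J)
  have dD := (dL.mul dN).sub ((dM.mul dM).const_mul o)
  have dT := (((dL.const_mul g).add (((dN.const_mul e).sub
    ((dM.const_mul f).const_mul 2)).const_mul o)).mul_const J)
  have hne : (g * (L + 0 * (ξ₁ ^ 2 / o * J)) + o * (e * (N + 0 * (ξ₂ ^ 2 * J))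
      - 2 * (f * (M + 0 * (ξ₁ * ξ₂ / o * J))))) * J ≠ 0 := by
    simpa using ⟨hT, hJ⟩
  refine (dD.mul (dT.inv hne)).congr_deriv ?_
  simp only [Pi.mul_apply, Pi.add_apply, Pi.sub_apply, Pi.inv_apply, zero_mul, add_zero]
  field_simp
  ring

end Normalized

/-! ### Continuity and positivity -/

section Continuity

theorem Continuous.crossProduct {X : Type*} [TopologicalSpace X] {f g : X → R3}
    (hf : Continuous f) (hg : Continuous g) : Continuous fun x => f x ⨯₃ g x := by
  simp only [cross_apply]
  fun_prop

theorem continuous_nfXy : Continuous fun e : Jet × Frame => nfXy e.2 e.1 := by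
  unfold nfXy; fun_prop

theorem continuous_nfXyHat : Continuous fun e : Jet × Frame => nfXyHat e.2 e.1 := by
  unfold nfXyHat; fun_prop

theorem continuous_nfC : Continuous fun e : Jet × Frame => nfC e.2 e.1 := by
  unfold nfC; fun_prop

theorem continuous_nfXz : Continuous fun e : Jet × Frame => nfXz e.2 e.1 := by
  have := continuous_nfC
  unfold nfXz; fun_prop

theorem continuous_nfJ : Continuous fun e : Jet × Frame => nfJ e.2 e.1 := by
  have h := continuous_nfC.crossProduct continuous_nfXy
  exact Continuous.dotProduct (by fun_prop) h

theorem continuous_nfE : Continuous fun e : Jet × Frame => nfE e.2 e.1 :=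
  continuous_nfXz.dotProduct continuous_nfXz

theorem continuous_nfF : Continuous fun e : Jet × Frame => nfF e.2 e.1 :=
  continuous_nfXz.dotProduct continuous_nfXy

theorem continuous_nfG : Continuous fun e : Jet × Frame => nfG e.2 e.1 :=
  continuous_nfXy.dotProduct continuous_nfXy

theorem continuous_nfN : Continuous fun e : Jet × Frame => nfN e.2 e.1 := by
  have h := continuous_nfC.crossProduct continuous_nfXy
  have h' : Continuous fun e : Jet × Frame => e.2 13 ⨯₃ nfXyHat e.2 e.1 :=
    Continuous.crossProduct (by fun_prop) continuous_nfXyHat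
  have h0 : Continuous fun e : Jet × Frame => nfN0 e.2 e.1 :=
    Continuous.dotProduct (by unfold nfXyy; fun_prop) h
  have h1 : Continuous fun e : Jet × Frame => nfN1 e.2 e.1 :=
    Continuous.dotProduct (by unfold nfXyyHat; fun_prop) h'
  unfold nfN
  fun_prop

theorem continuous_nfM : Continuous fun e : Jet × Frame => nfM e.2 e.1 := by
  have h := continuous_nfC.crossProduct continuous_nfXy
  have h' : Continuous fun e : Jet × Frame => e.2 13 ⨯₃ nfXyHat e.2 e.1 :=
    Continuous.crossProduct (by fun_prop) continuous_nfXyHat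
  have h'' : Continuous fun e : Jet × Frame => e.2 5 ⨯₃ nfXy e.2 e.1 :=
    Continuous.crossProduct (by fun_prop) continuous_nfXy
  have hm : Continuous fun e : Jet × Frame => nfm e.2 e.1 := by unfold nfm; fun_prop
  unfold nfM
  refine .add (.add (.dotProduct (by fun_prop) h) (.mul (by fun_prop) (hm.dotProduct h'')))
    (.mul (by fun_prop) (.dotProduct (by fun_prop) h'))

theorem continuous_nfL : Continuous fun e : Jet × Frame => nfL e.2 e.1 := by
  have h := continuous_nfC.crossProduct continuous_nfXy
  have h'' : Continuous fun e : Jet × Frame => e.2 5 ⨯₃ nfXy e.2 e.1 :=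
    Continuous.crossProduct (by fun_prop) continuous_nfXy
  have hl : Continuous fun e : Jet × Frame => nfl e.2 e.1 := by unfold nfl; fun_prop
  unfold nfL
  refine .add (.add (.dotProduct (by fun_prop) h) (.mul (by fun_prop) (hl.dotProduct h'')))
    (.mul (by fun_prop) (.dotProduct (by fun_prop) h''))

theorem continuous_nfDet : Continuous fun e : Jet × Frame => nfDet e.2 e.1 := by
  have := continuous_nfL
  have := continuous_nfM
  have := continuous_nfN
  unfold nfDet; fun_prop

theorem continuous_nfTr : Continuous fun e : Jet × Frame => nfTr e.2 e.1 := by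
  have := continuous_nfL
  have := continuous_nfM
  have := continuous_nfN
  have := continuous_nfE
  have := continuous_nfF
  have := continuous_nfG
  unfold nfTr; fun_prop

end Continuity

/-- The set of jets and frames at which the principal part is elliptic. -/
def nfGood : Set (Jet × Frame) :=
  {e | nfJ e.2 e.1 ≠ 0 ∧ nfTr e.2 e.1 ≠ 0 ∧ nfDet e.2 e.1 ≠ 0 ∧
    nfE e.2 e.1 * nfG e.2 e.1 - nfF e.2 e.1 ^ 2 ≠ 0}

theorem isOpen_nfGood : IsOpen nfGood := by
  have hI : Continuous fun e : Jet × Frame =>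
      nfE e.2 e.1 * nfG e.2 e.1 - nfF e.2 e.1 ^ 2 :=
    (continuous_nfE.mul continuous_nfG).sub (continuous_nfF.pow 2)
  exact ((isOpen_ne_fun continuous_nfJ continuous_const).inter
    ((isOpen_ne_fun continuous_nfTr continuous_const).inter
    ((isOpen_ne_fun continuous_nfDet continuous_const).inter
    (isOpen_ne_fun hI continuous_const))))

theorem nfG_pos {e : Jet × Frame} (he : e ∈ nfGood) : 0 < nfG e.2 e.1 := by
  refine (dotProduct_self_nonneg_R3 _).lt_of_ne fun h => he.2.2.2 ?_
  have h0 : nfXy e.2 e.1 = 0 := dotProduct_self_eq_zero.1 h.symm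
  simp [nfG, nfF, h0]

/-- The form is the first fundamental form at `(N ξ₁ - ω M ξ₂, -M ξ₁ + L ξ₂)`. This linear map has
determinant `L N - ω M² ≠ 0`, so a nonzero covector has a nonzero image; completing the square gives
positivity. The sign of the determinant plays no role. -/
theorem nfForm_pos {e : Jet × Frame} (he : e ∈ nfGood) {ξ₁ ξ₂ : ℝ} (h : ξ₁ ≠ 0 ∨ ξ₂ ≠ 0) :
    0 < nfForm e.2 e.1 ξ₁ ξ₂ := by
  have hG := nfG_pos he
  obtain ⟨-, -, hD, hI⟩ := he
  have hI' : 0 < nfE e.2 e.1 * nfG e.2 e.1 - nfF e.2 e.1 ^ 2 := by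
    refine lt_of_le_of_ne ?_ hI.symm
    rw [nfE, nfG, nfF, ← cross_dot_cross_self]
    exact dotProduct_self_nonneg_R3 _
  rw [nfDet] at hD
  unfold nfForm
  generalize nfL e.2 e.1 = L at *
  generalize nfM e.2 e.1 = M at *
  generalize nfN e.2 e.1 = N at *
  generalize nfE e.2 e.1 = E at *
  generalize nfF e.2 e.1 = f at *
  generalize nfG e.2 e.1 = G at *
  generalize e.2 16 1 = o at *
  set a := N * ξ₁ - o * M * ξ₂ with ha
  set b := -M * ξ₁ + L * ξ₂ with hb
  have hab : a ≠ 0 ∨ b ≠ 0 := by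
    by_contra! h0
    have e1 : (L * N - o * (M * M)) * ξ₁ = 0 := by
      linear_combination L * h0.1 + o * M * h0.2
    have e2 : (L * N - o * (M * M)) * ξ₂ = 0 := by
      linear_combination M * h0.1 + N * h0.2
    simp only [mul_eq_zero, hD, false_or] at e1 e2
    rcases h with h | h
    · exact h e1
    · exact h e2
  have key : G * (E * a ^ 2 + 2 * f * (a * b) + G * b ^ 2)
      = (G * b + f * a) ^ 2 + (E * G - f ^ 2) * a ^ 2 := by ring
  have : 0 < (G * b + f * a) ^ 2 + (E * G - f ^ 2) * a ^ 2 := by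
    by_cases h0 : a = 0
    · have hb0 : b ≠ 0 := by tauto
      rw [h0]; simp only [mul_zero, add_zero]; positivity
    · have : 0 < a ^ 2 := by positivity
      nlinarith [sq_nonneg (G * b + f * a), mul_pos hI' this]
  rw [← key] at this
  exact (mul_pos_iff_of_pos_left hG).1 this

/-! ### Functions of a jet with coefficients in an algebra -/

/-- `φ` takes values in the algebra `C` along the jet `Ξ`, and so does its gradient, whose components
in `Z` vanish. -/
def HasRep (C : STFn → Prop) (U : Set (ℝ × ℝ × ℝ)) (Ξ : ℝ → ℝ × ℝ → Jet) (Z : Set (Fin 6))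
    (φ : ℝ → ℝ × ℝ → Jet → ℝ) : Prop :=
  C (fun t q => φ t q (Ξ t q)) ∧ ∃ g : Fin 6 → STFn, (∀ i, C (g i)) ∧
    (∀ i ∈ Z, g i = fun _ _ => 0) ∧ ∀ P ∈ U, ∀ η : Jet,
      HasDerivAt (fun s : ℝ => φ P.1 P.2 (Ξ P.1 P.2 + s • η)) (∑ i, g i P.1 P.2 * η i) 0

section Rep

variable {C : STFn → Prop} {U : Set (ℝ × ℝ × ℝ)} {Ξ : ℝ → ℝ × ℝ → Jet} {Z : Set (Fin 6)}
  {φ ψ : ℝ → ℝ × ℝ → Jet → ℝ}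

variable (hC : FnAlg U C)
include hC

theorem HasRep.coeff {f : STFn} (hf : C f) : HasRep C U Ξ Z (fun t q _ => f t q) := by
  refine ⟨hf, fun _ _ _ => 0, fun _ => hC.const 0, fun _ _ => rfl, fun P _ η => ?_⟩
  simpa using hasDerivAt_const (0 : ℝ) (f P.1 P.2)

theorem HasRep.coord {i : Fin 6} (hi : i ∉ Z) (hf : C (fun t q => Ξ t q i)) :
    HasRep C U Ξ Z (fun _ _ x => x i) := by
  refine ⟨hf, fun j _ _ => if j = i then 1 else 0, fun j => hC.const _, fun j hj => ?_,
    fun P _ η => ?_⟩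
  · have hne : j ≠ i := by rintro rfl; exact hi hj
    funext _ _; exact if_neg hne
  · simpa using ((hasDerivAt_id (0 : ℝ)).mul_const (η i)).const_add (Ξ P.1 P.2 i)

theorem HasRep.add (h : HasRep C U Ξ Z φ) (h' : HasRep C U Ξ Z ψ) :
    HasRep C U Ξ Z (fun t q x => φ t q x + ψ t q x) := by
  obtain ⟨h0, g, hg, hz, hd⟩ := h
  obtain ⟨h0', g', hg', hz', hd'⟩ := h'
  refine ⟨hC.add h0 h0', fun i t q => g i t q + g' i t q, fun i => hC.add (hg i) (hg' i),
    fun i hi => by simp [hz i hi, hz' i hi], fun P hP η => ?_⟩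
  refine ((hd P hP η).add (hd' P hP η)).congr_deriv ?_
  simp only [add_mul, Finset.sum_add_distrib]

theorem HasRep.mul (h : HasRep C U Ξ Z φ) (h' : HasRep C U Ξ Z ψ) :
    HasRep C U Ξ Z (fun t q x => φ t q x * ψ t q x) := by
  obtain ⟨h0, g, hg, hz, hd⟩ := h
  obtain ⟨h0', g', hg', hz', hd'⟩ := h'
  refine ⟨hC.mul h0 h0', fun i t q => g i t q * ψ t q (Ξ t q) + φ t q (Ξ t q) * g' i t q,
    fun i => hC.add (hC.mul (hg i) h0') (hC.mul h0 (hg' i)),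
    fun i hi => by simp [hz i hi, hz' i hi], fun P hP η => ?_⟩
  refine ((hd P hP η).mul (hd' P hP η)).congr_deriv ?_
  simp only [zero_smul, add_zero, add_mul, Finset.sum_add_distrib, Finset.sum_mul, Finset.mul_sum]
  congr 1 <;> exact Finset.sum_congr rfl fun i _ => by ring

theorem HasRep.cmul (c : ℝ) (h : HasRep C U Ξ Z φ) : HasRep C U Ξ Z (fun t q x => c * φ t q x) :=
  HasRep.mul hC (HasRep.coeff hC (hC.const c)) h

theorem HasRep.sub (h : HasRep C U Ξ Z φ) (h' : HasRep C U Ξ Z ψ) :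
    HasRep C U Ξ Z (fun t q x => φ t q x - ψ t q x) := by
  simpa only [neg_one_mul, ← sub_eq_add_neg] using HasRep.add hC h (HasRep.cmul hC (-1) h')

theorem HasRep.inv (h : HasRep C U Ξ Z φ)
    (hb : ∃ c, 0 < c ∧ ∀ P ∈ U, c ≤ |φ P.1 P.2 (Ξ P.1 P.2)|) :
    HasRep C U Ξ Z (fun t q x => (φ t q x)⁻¹) := by
  obtain ⟨h0, g, hg, hz, hd⟩ := h
  have hi := hC.inv h0 hb
  refine ⟨hi, fun i t q => -1 * g i t q * ((φ t q (Ξ t q))⁻¹ * (φ t q (Ξ t q))⁻¹),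
    fun i => hC.mul (hC.mul (hC.const _) (hg i)) (hC.mul hi hi),
    fun i hi => by simp [hz i hi], fun P hP η => ?_⟩
  obtain ⟨c, hc, hb⟩ := hb
  have hne : φ P.1 P.2 (Ξ P.1 P.2 + (0 : ℝ) • η) ≠ 0 := by
    rw [zero_smul, add_zero]; exact abs_pos.1 (hc.trans_le (hb P hP))
  refine ((hd P hP η).inv hne).congr_deriv ?_
  simp only [zero_smul, add_zero, div_eq_mul_inv, ← Finset.sum_neg_distrib, Finset.sum_mul]
  exact Finset.sum_congr rfl fun i _ => by rw [sq, mul_inv]; ring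

end Rep

/-- The components of a vector function of a jet have values in the algebra `C`. -/
def HasRepV (C : STFn → Prop) (U : Set (ℝ × ℝ × ℝ)) (Ξ : ℝ → ℝ × ℝ → Jet) (Z : Set (Fin 6))
    (φ : ℝ → ℝ × ℝ → Jet → R3) : Prop :=
  ∀ i, HasRep C U Ξ Z (fun t q x => φ t q x i)

section RepV

variable {C : STFn → Prop} {U : Set (ℝ × ℝ × ℝ)} {Ξ : ℝ → ℝ × ℝ → Jet} {Z : Set (Fin 6)}
  {φ ψ : ℝ → ℝ × ℝ → Jet → R3} {f : ℝ → ℝ × ℝ → Jet → ℝ}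

variable (hC : FnAlg U C)
include hC

theorem HasRepV.coeff {v : ℝ → ℝ × ℝ → R3} (hf : ∀ i, C (fun t q => v t q i)) :
    HasRepV C U Ξ Z (fun t q _ => v t q) := fun i => HasRep.coeff hC (hf i)

theorem HasRepV.add (h : HasRepV C U Ξ Z φ) (h' : HasRepV C U Ξ Z ψ) :
    HasRepV C U Ξ Z (fun t q x => φ t q x + ψ t q x) := fun i => HasRep.add hC (h i) (h' i)

theorem HasRepV.smul (h : HasRep C U Ξ Z f) (h' : HasRepV C U Ξ Z ψ) :
    HasRepV C U Ξ Z (fun t q x => f t q x • ψ t q x) := fun i => HasRep.mul hC h (h' i)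

theorem HasRepV.dot (h : HasRepV C U Ξ Z φ) (h' : HasRepV C U Ξ Z ψ) :
    HasRep C U Ξ Z (fun t q x => φ t q x ⬝ᵥ ψ t q x) := by
  simp only [dotProduct, Fin.sum_univ_three]
  exact HasRep.add hC (HasRep.add hC (HasRep.mul hC (h 0) (h' 0)) (HasRep.mul hC (h 1) (h' 1)))
    (HasRep.mul hC (h 2) (h' 2))

theorem HasRepV.cross (h : HasRepV C U Ξ Z φ) (h' : HasRepV C U Ξ Z ψ) :
    HasRepV C U Ξ Z (fun t q x => φ t q x ⨯₃ ψ t q x) := by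
  have k : ∀ i j, HasRep C U Ξ Z
      (fun t q x => φ t q x i * ψ t q x j - φ t q x j * ψ t q x i) := fun i j =>
    HasRep.sub hC (HasRep.mul hC (h i) (h' j)) (HasRep.mul hC (h j) (h' i))
  intro i
  simp only [cross_apply]
  fin_cases i
  · exact k 1 2
  · exact k 2 0
  · exact k 0 1

end RepV

/-! ### The linearized operator in normalized jets -/

section Linearized

variable {C C₀ : STFn → Prop} {U : Set (ℝ × ℝ × ℝ)} {Ξ : ℝ → ℝ × ℝ → Jet}
  {fr : ℝ → ℝ × ℝ → Frame}

/-- The part of the geometry which depends on `w, w_y, w_yy` only. -/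
theorem hasRep_tangential (hC : FnAlg U C) {Z : Set (Fin 6)} (hZ : ∀ i ∈ Z, 3 ≤ i)
    (hΞ : ∀ i < 3, C (fun t q => Ξ t q i))
    (hfr : ∀ j ∈ ({0, 1, 4, 5, 6, 7, 10} : Set (Fin 17)), ∀ i, C (fun t q => fr t q j i)) :
    HasRepV C U Ξ Z (fun t q x => nfC (fr t q) x) ∧ HasRepV C U Ξ Z (fun t q x => nfXy (fr t q) x) ∧
    HasRep C U Ξ Z (fun t q x => nfN0 (fr t q) x) ∧ HasRep C U Ξ Z (fun t q x => nfG (fr t q) x) ∧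
    HasRep C U Ξ Z (fun t q x => nfJ (fr t q) x) := by
  have hx : ∀ i < 3, HasRep C U Ξ Z (fun _ _ x => x i) := fun i hi =>
    HasRep.coord hC (fun h => (hZ i h).not_gt hi) (hΞ i hi)
  have hf : ∀ j ∈ ({0, 1, 4, 5, 6, 7, 10} : Set (Fin 17)),
    HasRepV C U Ξ Z (fun t q _ => fr t q j) := fun j hj => HasRepV.coeff hC (hfr j hj)
  have c : HasRepV C U Ξ Z (fun t q x => nfC (fr t q) x) :=
    HasRepV.add hC (hf 0 (by simp)) (HasRepV.smul hC (hx 0 (by decide)) (hf 6 (by simp)))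
  have y : HasRepV C U Ξ Z (fun t q x => nfXy (fr t q) x) :=
    HasRepV.add hC (HasRepV.add hC (hf 1 (by simp))
      (HasRepV.smul hC (hx 0 (by decide)) (hf 7 (by simp))))
      (HasRepV.smul hC (hx 1 (by decide)) (hf 5 (by simp)))
  have yy : HasRepV C U Ξ Z (fun t q x => nfXyy (fr t q) x) :=
    HasRepV.add hC (HasRepV.add hC (HasRepV.add hC (hf 4 (by simp))
      (HasRepV.smul hC (hx 0 (by decide)) (hf 10 (by simp))))
      (HasRepV.smul hC (HasRep.cmul hC 2 (hx 1 (by decide))) (hf 7 (by simp))))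
      (HasRepV.smul hC (hx 2 (by decide)) (hf 5 (by simp)))
  have n := HasRepV.cross hC c y
  exact ⟨c, y, HasRepV.dot hC yy n, HasRepV.dot hC y y, HasRepV.dot hC (hf 5 (by simp)) n⟩

/-- All ingredients are polynomial in the jet and the frame; the only denominators are products of
`nfG`, `nfTr` and `nfJ`, which are bounded away from zero. -/
theorem hasRep_nfVal1 (hC : FnAlg U C) (hΞ : ∀ i, C (fun t q => Ξ t q i))
    (hfr : ∀ j i, C (fun t q => fr t q j i))
    (hJ : ∃ c, 0 < c ∧ ∀ P ∈ U, c ≤ |nfJ (fr P.1 P.2) (Ξ P.1 P.2)|)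
    (hG : ∃ c, 0 < c ∧ ∀ P ∈ U, c ≤ |nfG (fr P.1 P.2) (Ξ P.1 P.2)|)
    (hT : ∃ c, 0 < c ∧ ∀ P ∈ U, c ≤ |nfTr (fr P.1 P.2) (Ξ P.1 P.2)|) :
    HasRep C U Ξ ∅ (fun t q x => nfVal1 (fr t q) x) := by
  have hx : ∀ i, HasRep C U Ξ ∅ (fun _ _ x => x i) := fun i => HasRep.coord hC (by simp) (hΞ i)
  have hf : ∀ j, HasRepV C U Ξ ∅ (fun t q _ => fr t q j) := fun j => HasRepV.coeff hC (hfr j)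
  have hs : ∀ j i, HasRep C U Ξ ∅ (fun t q _ => fr t q j i) := fun j i => HasRep.coeff hC (hfr j i)
  obtain ⟨c, y, n0, g, J⟩ := hasRep_tangential hC (Z := ∅) (by simp) (fun i _ => hΞ i)
    (fun j _ => hfr j)
  have n := HasRepV.cross hC c y
  have Ty := HasRepV.cross hC (hf 5) y
  have yh : HasRepV C U Ξ ∅ (fun t q x => nfXyHat (fr t q) x) :=
    HasRepV.add hC (HasRepV.add hC (hf 11) (HasRepV.smul hC (hx 0) (hf 14)))
      (HasRepV.smul hC (hx 1) (hf 13))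
  have yyh : HasRepV C U Ξ ∅ (fun t q x => nfXyyHat (fr t q) x) :=
    HasRepV.add hC (HasRepV.add hC (HasRepV.add hC (hf 12) (HasRepV.smul hC (hx 0) (hf 15)))
      (HasRepV.smul hC (HasRep.cmul hC 2 (hx 1)) (hf 14))) (HasRepV.smul hC (hx 2) (hf 13))
  have Tyh := HasRepV.cross hC (hf 13) yh
  have xz : HasRepV C U Ξ ∅ (fun t q x => nfXz (fr t q) x) :=
    HasRepV.add hC (HasRepV.smul hC (hx 3) (hf 5)) (HasRepV.smul hC (hs 16 2) c)
  have n1 : HasRep C U Ξ ∅ (fun t q x => nfN1 (fr t q) x) := HasRepV.dot hC yyh Tyh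
  have nn : HasRep C U Ξ ∅ (fun t q x => nfN (fr t q) x) :=
    HasRep.add hC n0 (HasRep.mul hC (HasRep.mul hC (hs 16 1) (hx 3)) n1)
  have m : HasRepV C U Ξ ∅ (fun t q x => nfm (fr t q) x) :=
    HasRepV.add hC (HasRepV.add hC (hf 3) (HasRepV.smul hC (hx 0) (hf 9)))
      (HasRepV.smul hC (hx 1) (hf 6))
  have l : HasRepV C U Ξ ∅ (fun t q x => nfl (fr t q) x) :=
    HasRepV.add hC (hf 2) (HasRepV.smul hC (hx 0) (hf 8))
  have x33 := HasRep.mul hC (hx 3) (hx 3)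
  have M : HasRep C U Ξ ∅ (fun t q x => nfM (fr t q) x) :=
    HasRep.add hC (HasRep.add hC (HasRepV.dot hC (HasRepV.add hC (HasRepV.add hC
      (HasRepV.smul hC (hs 16 2) m) (HasRepV.smul hC (hx 3) (hf 7)))
      (HasRepV.smul hC (hx 4) (hf 5))) n) (HasRep.mul hC (hx 3) (HasRepV.dot hC m Ty)))
      (HasRep.mul hC (HasRep.mul hC (hs 16 1) x33) (HasRepV.dot hC (hf 14) Tyh))
  have L : HasRep C U Ξ ∅ (fun t q x => nfL (fr t q) x) :=
    HasRep.add hC (HasRep.add hC (HasRepV.dot hC (HasRepV.add hC (HasRepV.add hC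
      (HasRepV.smul hC (HasRep.mul hC (hs 16 0) (hs 16 2)) l)
      (HasRepV.smul hC (HasRep.mul hC (HasRep.cmul hC 2 (hs 16 0)) (hx 3)) (hf 6)))
      (HasRepV.smul hC (hx 5) (hf 5))) n)
      (HasRep.mul hC (HasRep.mul hC (hs 16 0) (hx 3)) (HasRepV.dot hC l Ty)))
      (HasRep.mul hC (HasRep.mul hC (HasRep.cmul hC 2 (hs 16 1)) x33) (HasRepV.dot hC (hf 6) Ty))
  have E : HasRep C U Ξ ∅ (fun t q x => nfE (fr t q) x) := HasRepV.dot hC xz xz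
  have F : HasRep C U Ξ ∅ (fun t q x => nfF (fr t q) x) := HasRepV.dot hC xz y
  have tr : HasRep C U Ξ ∅ (fun t q x => nfTr (fr t q) x) :=
    HasRep.add hC (HasRep.mul hC g L) (HasRep.mul hC (hs 16 1) (HasRep.sub hC (HasRep.mul hC E nn)
      (HasRep.cmul hC 2 (HasRep.mul hC F M))))
  obtain ⟨cJ, hcJ, hJ⟩ := hJ
  obtain ⟨cG, hcG, hG⟩ := hG
  obtain ⟨cT, hcT, hT⟩ := hT
  have i1 := HasRep.inv hC (HasRep.mul hC g J) ⟨cG * cJ, by positivity, fun P hP => by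
    rw [abs_mul]; exact mul_le_mul (hG P hP) (hJ P hP) hcJ.le (abs_nonneg _)⟩
  have i2 := HasRep.inv hC (HasRep.mul hC (HasRep.mul hC g tr) J)
    ⟨cG * cT * cJ, by positivity, fun P hP => by
      rw [abs_mul, abs_mul]
      exact mul_le_mul (mul_le_mul (hG P hP) (hT P hP) hcT.le (abs_nonneg _)) (hJ P hP) hcJ.le
        (by positivity)⟩
  exact HasRep.sub hC (HasRep.mul hC (HasRep.mul hC (hx 3) n1) i1)
    (HasRep.mul hC (HasRep.add hC (HasRep.sub hC (HasRep.mul hC E (HasRep.mul hC nn nn))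
      (HasRep.cmul hC 2 (HasRep.mul hC F (HasRep.mul hC M nn)))) (HasRep.mul hC g
      (HasRep.mul hC M M))) i2)

/-- The derivative of the nonlinearity, with the classes of its coefficients. -/
theorem exists_coeffs (hC : FnAlg U C) (hC₀ : FnAlg U C₀)
    (hω : ∀ f, C f → C₀ (fun t q => fr t q 16 1 * f t q))
    (hΞ₀ : ∀ i < 3, C₀ (fun t q => Ξ t q i)) (hΞ : ∀ i, C (fun t q => Ξ t q i))
    (hfr₀ : ∀ j ∈ ({0, 1, 4, 5, 6, 7, 10} : Set (Fin 17)), ∀ i, C₀ (fun t q => fr t q j i))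
    (hfr : ∀ j i, C (fun t q => fr t q j i))
    (hJ : ∃ c, 0 < c ∧ ∀ P ∈ U, c ≤ |nfJ (fr P.1 P.2) (Ξ P.1 P.2)|)
    (hG : ∃ c, 0 < c ∧ ∀ P ∈ U, c ≤ |nfG (fr P.1 P.2) (Ξ P.1 P.2)|)
    (hT : ∃ c, 0 < c ∧ ∀ P ∈ U, c ≤ |nfTr (fr P.1 P.2) (Ξ P.1 P.2)|) :
    ∃ A : LinCoeff, (C A.a11 ∧ C A.a12 ∧ C A.b1) ∧ (C₀ A.a22 ∧ C₀ A.b2 ∧ C₀ A.c) ∧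
      ∀ P ∈ U, ∀ η : Jet, HasDerivAt (fun s : ℝ => nfVal (fr P.1 P.2) (Ξ P.1 P.2 + s • η))
        (A.c P.1 P.2 * η 0 + A.b2 P.1 P.2 * η 1 + A.a22 P.1 P.2 * η 2
          + fr P.1 P.2 16 1 * (A.b1 P.1 P.2 * η 3 + 2 * A.a12 P.1 P.2 * η 4
            + A.a11 P.1 P.2 * η 5)) 0 := by
  obtain ⟨-, g, hg, -, hd⟩ := hasRep_nfVal1 hC hΞ hfr hJ hG hT
  -- `nfVal0` involves only the first three jet entries and the seven frame entries known to lie in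
  -- the better class `C₀`. Its gradient thus belongs to `C₀` and has no component in the normal
  -- directions.
  obtain ⟨-, -, n0, G, J⟩ := hasRep_tangential hC₀ (Z := {3, 4, 5}) (by simp) hΞ₀ hfr₀
  obtain ⟨cJ, hcJ, hJ⟩ := hJ
  obtain ⟨cG, hcG, hG⟩ := hG
  obtain ⟨cT, hcT, hT⟩ := hT
  obtain ⟨-, g₀, hg₀, hz, hd₀⟩ := HasRep.mul hC₀ n0 (HasRep.inv hC₀ (HasRep.mul hC₀ G J)
    ⟨cG * cJ, by positivity, fun P hP => by
      rw [abs_mul]; exact mul_le_mul (hG P hP) (hJ P hP) hcJ.le (abs_nonneg _)⟩)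
  -- Normal coefficients come from `nfVal1` alone, the prefactor `ω` staying outside. Tangential
  -- ones combine the gradient of `nfVal0` with `ω` times that of `nfVal1`, hence remain in `C₀`.
  -- The factor `1/2` matches the convention `2 a₁₂ w₁₂`.
  refine ⟨⟨g 5, fun t q => 1 / 2 * g 4 t q, fun t q => g₀ 2 t q + fr t q 16 1 * g 2 t q, g 3,
    fun t q => g₀ 1 t q + fr t q 16 1 * g 1 t q, fun t q => g₀ 0 t q + fr t q 16 1 * g 0 t q⟩,
    ⟨hg 5, hC.mul (hC.const _) (hg 4), hg 3⟩, ⟨hC₀.add (hg₀ 2) (hω _ (hg 2)),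
    hC₀.add (hg₀ 1) (hω _ (hg 1)), hC₀.add (hg₀ 0) (hω _ (hg 0))⟩, fun P hP η => ?_⟩
  have hc : Continuous fun s : ℝ => (Ξ P.1 P.2 + s • η, fr P.1 P.2) := by fun_prop
  have e0 : Ξ P.1 P.2 + (0 : ℝ) • η = Ξ P.1 P.2 := by simp
  have nG : ∀ᶠ s : ℝ in 𝓝 0, nfG (fr P.1 P.2) (Ξ P.1 P.2 + s • η) ≠ 0 :=
    (continuous_nfG.comp hc).continuousAt.eventually_ne
      (by simpa [e0] using abs_pos.1 (hcG.trans_le (hG P hP)))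
  have nT : ∀ᶠ s : ℝ in 𝓝 0, nfTr (fr P.1 P.2) (Ξ P.1 P.2 + s • η) ≠ 0 :=
    (continuous_nfTr.comp hc).continuousAt.eventually_ne
      (by simpa [e0] using abs_pos.1 (hcT.trans_le (hT P hP)))
  have nJ : ∀ᶠ s : ℝ in 𝓝 0, nfJ (fr P.1 P.2) (Ξ P.1 P.2 + s • η) ≠ 0 :=
    (continuous_nfJ.comp hc).continuousAt.eventually_ne
      (by simpa [e0] using abs_pos.1 (hcJ.trans_le (hJ P hP)))
  have key : HasDerivAt (fun s : ℝ => nfVal0 (fr P.1 P.2) (Ξ P.1 P.2 + s • η)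
      + fr P.1 P.2 16 1 * nfVal1 (fr P.1 P.2) (Ξ P.1 P.2 + s • η))
      ((∑ i, g₀ i P.1 P.2 * η i) + fr P.1 P.2 16 1 * ∑ i, g i P.1 P.2 * η i) 0 :=
    (hd₀ P hP η).add ((hd P hP η).const_mul _)
  refine (key.congr_of_eventuallyEq ?_).congr_deriv ?_
  · filter_upwards [nG, nT, nJ] with s h1 h2 h3
    exact nfVal_eq h1 h2 h3
  · simp only [Fin.sum_univ_six, hz 3 (by simp), hz 4 (by simp), hz 5 (by simp)]
    ring

end Linearized

/-! ### Partial derivatives of `C²` maps of two variables -/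

section PartialCalculus

variable {E : Type*} [NormedAddCommGroup E] [NormedSpace ℝ E] {f g : ℝ × ℝ → E} {q : ℝ × ℝ}

theorem Filter.EventuallyEq.pd1 (h : f =ᶠ[𝓝 q] g) : pd1 f =ᶠ[𝓝 q] pd1 g := by
  filter_upwards [h.eventually_nhds] with q' h'
  have hc : Tendsto (fun s : ℝ => (s, q'.2)) (𝓝 q'.1) (𝓝 q') :=
    Continuous.tendsto (f := fun s : ℝ => (s, q'.2)) (by fun_prop) q'.1
  exact Filter.EventuallyEq.deriv_eq (hc.eventually h')

theorem Filter.EventuallyEq.pd2 (h : f =ᶠ[𝓝 q] g) : pd2 f =ᶠ[𝓝 q] pd2 g := by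
  filter_upwards [h.eventually_nhds] with q' h'
  have hc : Tendsto (fun s : ℝ => (q'.1, s)) (𝓝 q'.2) (𝓝 q') :=
    Continuous.tendsto (f := fun s : ℝ => (q'.1, s)) (by fun_prop) q'.2
  exact Filter.EventuallyEq.deriv_eq (hc.eventually h')

theorem ContDiffAt.eventually_differentiableAt (h : ContDiffAt ℝ 1 f q) :
    ∀ᶠ q' in 𝓝 q, DifferentiableAt ℝ f q' :=
  (h.eventually (by simp)).mono fun _ h' => h'.differentiableAt one_ne_zero

theorem ContDiffAt.pd1 (h : ContDiffAt ℝ 2 f q) : ContDiffAt ℝ 1 (pd1 f) q :=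
  ((h.fderiv_right (m := 1) (by norm_num)).clm_apply contDiffAt_const).congr_of_eventuallyEq
    ((h.of_le (by norm_num)).eventually_differentiableAt.mono fun _ h' => h'.pd1_eq)

theorem ContDiffAt.pd2 (h : ContDiffAt ℝ 2 f q) : ContDiffAt ℝ 1 (pd2 f) q :=
  ((h.fderiv_right (m := 1) (by norm_num)).clm_apply contDiffAt_const).congr_of_eventuallyEq
    ((h.of_le (by norm_num)).eventually_differentiableAt.mono fun _ h' => h'.pd2_eq)

theorem pd1_pd2_comm (h : ContDiffAt ℝ 2 f q) :
    pd1 (pd2 f) q = pd2 (pd1 f) q := by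
  have h1 : ContDiffAt ℝ 1 (fderiv ℝ f) q := h.fderiv_right (by norm_num)
  have hd := h1.differentiableAt one_ne_zero
  have he := (h.of_le (show (1 : WithTop ℕ∞) ≤ 2 by norm_num)).eventually_differentiableAt
  have e2 : pd2 f =ᶠ[𝓝 q] fun q' => fderiv ℝ f q' (0, 1) := he.mono fun _ h' => h'.pd2_eq
  have e1 : pd1 f =ᶠ[𝓝 q] fun q' => fderiv ℝ f q' (1, 0) := he.mono fun _ h' => h'.pd1_eq
  rw [e2.pd1.self_of_nhds, e1.pd2.self_of_nhds]
  have d2 := hd.hasFDerivAt.clm_apply (hasFDerivAt_const ((0, 1) : ℝ × ℝ) q)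
  have d1 := hd.hasFDerivAt.clm_apply (hasFDerivAt_const ((1, 0) : ℝ × ℝ) q)
  have s := (h.isSymmSndFDerivAt (by simp)).eq (1, 0) (0, 1)
  have r2 := (hasDerivAt_pd1_of_hasFDerivAt d2).deriv
  have r1 := (hasDerivAt_pd2_of_hasFDerivAt d1).deriv
  refine (r2.trans ?_).trans r1.symm
  simpa using s

theorem pd1_add (hf : DifferentiableAt ℝ f q) (hg : DifferentiableAt ℝ g q) :
    pd1 (fun q => f q + g q) q = pd1 f q + pd1 g q :=
  (hf.hasDerivAt_pd1.add hg.hasDerivAt_pd1).deriv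

theorem pd2_add (hf : DifferentiableAt ℝ f q) (hg : DifferentiableAt ℝ g q) :
    pd2 (fun q => f q + g q) q = pd2 f q + pd2 g q :=
  (hf.hasDerivAt_pd2.add hg.hasDerivAt_pd2).deriv

theorem pd1_smul {a : ℝ × ℝ → ℝ} (ha : DifferentiableAt ℝ a q) (hf : DifferentiableAt ℝ f q) :
    pd1 (fun q => a q • f q) q = a q • pd1 f q + pd1 a q • f q :=
  (ha.hasDerivAt_pd1.smul hf.hasDerivAt_pd1).deriv

theorem pd2_smul {a : ℝ × ℝ → ℝ} (ha : DifferentiableAt ℝ a q) (hf : DifferentiableAt ℝ f q) :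
    pd2 (fun q => a q • f q) q = a q • pd2 f q + pd2 a q • f q :=
  (ha.hasDerivAt_pd2.smul hf.hasDerivAt_pd2).deriv

theorem fderiv_apply_eq (hf : DifferentiableAt ℝ f q) (v : ℝ × ℝ) :
    fderiv ℝ f q v = v.1 • pd1 f q + v.2 • pd2 f q := by
  rw [hf.pd1_eq, hf.pd2_eq, ← map_smul, ← map_smul, ← map_add]
  simp

section Comp

variable {φ : ℝ × ℝ → ℝ × ℝ}

theorem pd1_comp (hf : DifferentiableAt ℝ f (φ q)) (hφ : DifferentiableAt ℝ φ q) :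
    pd1 (fun q => f (φ q)) q = (pd1 φ q).1 • pd1 f (φ q)
      + (pd1 φ q).2 • pd2 f (φ q) := by
  rw [← fderiv_apply_eq hf]
  exact (hf.hasFDerivAt.comp_hasDerivAt q.1 hφ.hasDerivAt_pd1).deriv

theorem pd2_comp (hf : DifferentiableAt ℝ f (φ q)) (hφ : DifferentiableAt ℝ φ q) :
    pd2 (fun q => f (φ q)) q = (pd2 φ q).1 • pd1 f (φ q)
      + (pd2 φ q).2 • pd2 f (φ q) := by
  rw [← fderiv_apply_eq hf]
  exact (hf.hasFDerivAt.comp_hasDerivAt q.2 hφ.hasDerivAt_pd2).deriv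

/-- Second derivatives of a composition. -/
theorem exists_pd_comp_second (hf : ContDiffAt ℝ 2 f (φ q)) (hφ : ContDiffAt ℝ 2 φ q) :
    let a := (pd1 φ q).1
    let b := (pd1 φ q).2
    let c := (pd2 φ q).1
    let d := (pd2 φ q).2
    let Xu := pd1 f (φ q)
    let Xv := pd2 f (φ q)
    let Xuu := pd1 (pd1 f) (φ q)
    let Xuv := pd1 (pd2 f) (φ q)
    let Xvv := pd2 (pd2 f) (φ q)
    ∃ e₁ e₂ f₁ f₂ g₁ g₂ : ℝ,
      pd1 (pd1 fun q => f (φ q)) q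
        = a ^ 2 • Xuu + (2 * a * b) • Xuv + b ^ 2 • Xvv + (e₁ • Xu + e₂ • Xv) ∧
      pd1 (pd2 fun q => f (φ q)) q
        = (a * c) • Xuu + (a * d + b * c) • Xuv + (b * d) • Xvv + (f₁ • Xu + f₂ • Xv) ∧
      pd2 (pd2 fun q => f (φ q)) q
        = c ^ 2 • Xuu + (2 * c * d) • Xuv + d ^ 2 • Xvv + (g₁ • Xu + g₂ • Xv) := by
  intro a b c d Xu Xv Xuu Xuv Xvv
  have h12 : (1 : WithTop ℕ∞) ≤ 2 := by norm_num
  have hf1 := hφ.continuousAt.eventually (hf.of_le h12).eventually_differentiableAt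
  have hφ1 := (hφ.of_le h12).eventually_differentiableAt
  have dφ := hφ.differentiableAt two_ne_zero
  have e1 : (pd1 fun q => f (φ q)) =ᶠ[𝓝 q] fun q => (pd1 φ q).1 • pd1 f (φ q)
      + (pd1 φ q).2 • pd2 f (φ q) := by
    filter_upwards [hf1, hφ1] with q' h h' using pd1_comp h h'
  have e2 : (pd2 fun q => f (φ q)) =ᶠ[𝓝 q] fun q => (pd2 φ q).1 • pd1 f (φ q)
      + (pd2 φ q).2 • pd2 f (φ q) := by
    filter_upwards [hf1, hφ1] with q' h h' using pd2_comp h h'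
  have du := hf.pd1.differentiableAt one_ne_zero
  have dv := hf.pd2.differentiableAt one_ne_zero
  have cu : DifferentiableAt ℝ (fun q => pd1 f (φ q)) q := du.comp q dφ
  have cv : DifferentiableAt ℝ (fun q => pd2 f (φ q)) q := dv.comp q dφ
  have p1 := hφ.pd1.differentiableAt one_ne_zero
  have p2 := hφ.pd2.differentiableAt one_ne_zero
  have hs : pd2 (pd1 f) (φ q) = Xuv := (pd1_pd2_comm hf).symm
  refine ⟨pd1 (fun q => (pd1 φ q).1) q, pd1 (fun q => (pd1 φ q).2) q,
    pd1 (fun q => (pd2 φ q).1) q, pd1 (fun q => (pd2 φ q).2) q,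
    pd2 (fun q => (pd2 φ q).1) q, pd2 (fun q => (pd2 φ q).2) q,
    ?_, ?_, ?_⟩
  · rw [e1.pd1.self_of_nhds, pd1_add (p1.fst.fun_smul cu) (p1.snd.fun_smul cv), pd1_smul p1.fst cu,
      pd1_smul p1.snd cv, pd1_comp du dφ, pd1_comp dv dφ, hs]
    module
  · rw [e2.pd1.self_of_nhds, pd1_add (p2.fst.fun_smul cu) (p2.snd.fun_smul cv), pd1_smul p2.fst cu,
      pd1_smul p2.snd cv, pd1_comp du dφ, pd1_comp dv dφ, hs]
    module
  · rw [e2.pd2.self_of_nhds, pd2_add (p2.fst.fun_smul cu) (p2.snd.fun_smul cv), pd2_smul p2.fst cu,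
      pd2_smul p2.snd cv, pd2_comp du dφ, pd2_comp dv dφ, hs]
    module

end Comp

/-- Derivatives of a graph `S + f T`. -/
theorem pd_graph {S T : ℝ × ℝ → E} {w : ℝ × ℝ → ℝ} (hS : ContDiffAt ℝ 2 S q)
    (hT : ContDiffAt ℝ 2 T q) (hw : ContDiffAt ℝ 2 w q) :
    let X := fun q => S q + w q • T q
    pd1 X q = pd1 S q + w q • pd1 T q + pd1 w q • T q ∧
    pd2 X q = pd2 S q + w q • pd2 T q + pd2 w q • T q ∧
    pd1 (pd1 X) q = pd1 (pd1 S) q + w q • pd1 (pd1 T) q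
      + (2 * pd1 w q) • pd1 T q + pd1 (pd1 w) q • T q ∧
    pd1 (pd2 X) q = pd1 (pd2 S) q + w q • pd1 (pd2 T) q
      + pd1 w q • pd2 T q + pd2 w q • pd1 T q
      + pd1 (pd2 w) q • T q ∧
    pd2 (pd2 X) q = pd2 (pd2 S) q + w q • pd2 (pd2 T) q
      + (2 * pd2 w q) • pd2 T q + pd2 (pd2 w) q • T q := by
  intro X
  have h12 : (1 : WithTop ℕ∞) ≤ 2 := by norm_num
  have hS1 := (hS.of_le h12).eventually_differentiableAt
  have hT1 := (hT.of_le h12).eventually_differentiableAt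
  have hw1 := (hw.of_le h12).eventually_differentiableAt
  have e1 : pd1 X =ᶠ[𝓝 q] fun q =>
      pd1 S q + w q • pd1 T q + pd1 w q • T q := by
    filter_upwards [hS1, hT1, hw1] with q' h h' h''
    rw [pd1_add h (h''.fun_smul h'), pd1_smul h'' h', add_assoc]
  have e2 : pd2 X =ᶠ[𝓝 q] fun q =>
      pd2 S q + w q • pd2 T q + pd2 w q • T q := by
    filter_upwards [hS1, hT1, hw1] with q' h h' h''
    rw [pd2_add h (h''.fun_smul h'), pd2_smul h'' h', add_assoc]
  have dT := hT.differentiableAt two_ne_zero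
  have dw := hw.differentiableAt two_ne_zero
  have S1 := hS.pd1.differentiableAt one_ne_zero
  have S2 := hS.pd2.differentiableAt one_ne_zero
  have T1 := hT.pd1.differentiableAt one_ne_zero
  have T2 := hT.pd2.differentiableAt one_ne_zero
  have w1 := hw.pd1.differentiableAt one_ne_zero
  have w2 := hw.pd2.differentiableAt one_ne_zero
  refine ⟨e1.self_of_nhds, e2.self_of_nhds, ?_, ?_, ?_⟩
  · rw [e1.pd1.self_of_nhds, pd1_add (S1.fun_add (dw.fun_smul T1)) (w1.fun_smul dT),
      pd1_add S1 (dw.fun_smul T1), pd1_smul dw T1, pd1_smul w1 dT]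
    module
  · rw [e2.pd1.self_of_nhds, pd1_add (S2.fun_add (dw.fun_smul T2)) (w2.fun_smul dT),
      pd1_add S2 (dw.fun_smul T2), pd1_smul dw T2, pd1_smul w2 dT]
    module
  · rw [e2.pd2.self_of_nhds, pd2_add (S2.fun_add (dw.fun_smul T2)) (w2.fun_smul dT),
      pd2_add S2 (dw.fun_smul T2), pd2_smul dw T2, pd2_smul w2 dT]
    module

end PartialCalculus

/-! ### Spatial smoothness at fixed time. -/

section ParabolicSlices

variable {E : Type*} [NormedAddCommGroup E] [NormedSpace ℝ E] {U : Set (ℝ × ℝ × ℝ)}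
  {f : ℝ → ℝ × ℝ → E}

theorem IsParabolicC.contDiffAt_one (hU : IsOpen U) (h : IsParabolicC 1 U f) {P : ℝ × ℝ × ℝ}
    (hP : P ∈ U) : ContDiffAt ℝ 1 (f P.1) P.2 := by
  have hs : (fun q => (P.1, q)) ⁻¹' U ∈ 𝓝 P.2 := hU.eventually_slice_space hP
  have hc : ∀ {g : ℝ → ℝ × ℝ → E}, IsParabolicC 0 U g → ContDiffAt ℝ 0 (g P.1) P.2 := by
    intro g hg
    refine contDiffAt_zero.2 ⟨_, hs, ?_⟩
    exact hg.continuousOn.comp (f := fun q : ℝ × ℝ => (P.1, q)) (by fun_prop) fun q hq => hq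
  have := (contDiffAt_succ_iff_hasFDerivAt (n := 0) (f := f P.1) (x := P.2)).2
    ⟨fun q => (ContinuousLinearMap.toSpanSingleton ℝ (_root_.D1 f P.1 q)).coprod
      (ContinuousLinearMap.toSpanSingleton ℝ (_root_.D2 f P.1 q)), ⟨_, hs, fun q hq =>
        h.hasFDerivAt_space (m := 0) hU (P := (P.1, q)) hq⟩, ?_⟩
  · simpa using this
  · have e : (fun q => (ContinuousLinearMap.toSpanSingleton ℝ (_root_.D1 f P.1 q)).coprod
      (ContinuousLinearMap.toSpanSingleton ℝ (_root_.D2 f P.1 q))) = fun q =>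
        (ContinuousLinearMap.fst ℝ ℝ ℝ).smulRight (_root_.D1 f P.1 q)
          + (ContinuousLinearMap.snd ℝ ℝ ℝ).smulRight (_root_.D2 f P.1 q) := by
      funext q; ext <;> simp
    rw [e]
    exact (contDiffAt_const.smulRight (hc (h.D1 (m := 0)))).add
      (contDiffAt_const.smulRight (hc (h.D2 (m := 0))))

/-- The Fréchet derivative of a time slice is assembled from `D1 f` and `D2 f`, whose slices are
`C¹` by the preceding lemma. -/
theorem IsParabolicC.contDiffAt_two (hU : IsOpen U) (h : IsParabolicC 2 U f) {P : ℝ × ℝ × ℝ}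
    (hP : P ∈ U) : ContDiffAt ℝ 2 (f P.1) P.2 := by
  have hs : (fun q => (P.1, q)) ⁻¹' U ∈ 𝓝 P.2 := hU.eventually_slice_space hP
  have := (contDiffAt_succ_iff_hasFDerivAt (n := 1) (f := f P.1) (x := P.2)).2
    ⟨fun q => (ContinuousLinearMap.toSpanSingleton ℝ (_root_.D1 f P.1 q)).coprod
      (ContinuousLinearMap.toSpanSingleton ℝ (_root_.D2 f P.1 q)), ⟨_, hs, fun q hq =>
        h.hasFDerivAt_space (m := 1) hU (P := (P.1, q)) hq⟩, ?_⟩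
  · have e : (2 : WithTop ℕ∞) = ((1 : ℕ) : WithTop ℕ∞) + 1 := by norm_num
    rw [e]; exact this
  · have e : (fun q => (ContinuousLinearMap.toSpanSingleton ℝ (_root_.D1 f P.1 q)).coprod
      (ContinuousLinearMap.toSpanSingleton ℝ (_root_.D2 f P.1 q))) = fun q =>
        (ContinuousLinearMap.fst ℝ ℝ ℝ).smulRight (_root_.D1 f P.1 q)
          + (ContinuousLinearMap.snd ℝ ℝ ℝ).smulRight (_root_.D2 f P.1 q) := by
      funext q; ext <;> simp
    rw [e]
    exact (contDiffAt_const.smulRight ((h.D1 (m := 1)).contDiffAt_one hU hP)).add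
      (contDiffAt_const.smulRight ((h.D2 (m := 1)).contDiffAt_one hU hP))

end ParabolicSlices

/-! ### Parametrized surfaces -/

/-- `K / H` divided by `⟨T, N⟩` for the surface `X` at `q`. -/
def geoAt (T : R3) (X : ℝ × ℝ → R3) (q : ℝ × ℝ) : ℝ :=
  geoVal T (pd1 X q) (pd2 X q) (pd1 (pd1 X) q) (pd1 (pd2 X) q) (pd2 (pd2 X) q)

/-- `secDet` of the surface `X` at `q`. -/
def secDetAt (X : ℝ × ℝ → R3) (q : ℝ × ℝ) : ℝ :=
  secDet (pd1 X q) (pd2 X q) (pd1 (pd1 X) q) (pd1 (pd2 X) q) (pd2 (pd2 X) q)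

/-- `secTr` of the surface `X` at `q`. -/
def secTrAt (X : ℝ × ℝ → R3) (q : ℝ × ℝ) : ℝ :=
  secTr (pd1 X q) (pd2 X q) (pd1 (pd1 X) q) (pd1 (pd2 X) q) (pd2 (pd2 X) q)

/-- The Jacobian determinant of a map of the plane. -/
def jacAt (φ : ℝ × ℝ → ℝ × ℝ) (q : ℝ × ℝ) : ℝ :=
  (pd1 φ q).1 * (pd2 φ q).2 - (pd1 φ q).2 * (pd2 φ q).1

section Surfaces

variable {X : ℝ × ℝ → R3} {φ : ℝ × ℝ → ℝ × ℝ} {q : ℝ × ℝ}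

theorem cross_comp (hX : DifferentiableAt ℝ X (φ q)) (hφ : DifferentiableAt ℝ φ q) :
    pd1 (fun q => X (φ q)) q ⨯₃ pd2 (fun q => X (φ q)) q
      = jacAt φ q • (pd1 X (φ q) ⨯₃ pd2 X (φ q)) := by
  rw [pd1_comp hX hφ, pd2_comp hX hφ, cross_reparam, jacAt]

theorem secAt_comp (hX : ContDiffAt ℝ 2 X (φ q)) (hφ : ContDiffAt ℝ 2 φ q) :
    secDetAt (fun q => X (φ q)) q = jacAt φ q ^ 4 * secDetAt X (φ q) ∧
    secTrAt (fun q => X (φ q)) q = jacAt φ q ^ 3 * secTrAt X (φ q) := by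
  obtain ⟨e₁, e₂, f₁, f₂, g₁, g₂, h1, h2, h3⟩ := exists_pd_comp_second hX hφ
  have dX := hX.differentiableAt two_ne_zero
  have dφ := hφ.differentiableAt two_ne_zero
  unfold secDetAt secTrAt jacAt
  rw [h1, h2, h3, pd1_comp dX dφ, pd2_comp dX dφ, secDet_reparam, secTr_reparam]
  exact ⟨rfl, rfl⟩

theorem geoAt_comp (T : R3) (hX : ContDiffAt ℝ 2 X (φ q)) (hφ : ContDiffAt ℝ 2 φ q)
    (hj : jacAt φ q ≠ 0) : geoAt T (fun q => X (φ q)) q = geoAt T X (φ q) := by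
  obtain ⟨e₁, e₂, f₁, f₂, g₁, g₂, h1, h2, h3⟩ := exists_pd_comp_second hX hφ
  have dX := hX.differentiableAt two_ne_zero
  have dφ := hφ.differentiableAt two_ne_zero
  unfold geoAt
  rw [h1, h2, h3, pd1_comp dX dφ, pd2_comp dX dφ]
  exact geoVal_reparam T hj

end Surfaces

/-! ### Frames and jets of surfaces -/

/-- A vector whose third component is divided by `z`. -/
def hat (z : ℝ) (v : R3) : R3 := ![v 0, v 1, v 2 / z]

theorem unhat_hat {z : ℝ} (hz : z ≠ 0) (v : R3) : unhat z (hat z v) = v := by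
  ext i
  fin_cases i <;> simp [unhat, hat]
  field_simp

/-- The frame of `S`, `T` with the weights `ρ = (z, ω, ω')`. -/
def mkFrame (S T : ℝ × ℝ → R3) (ρ : R3) (q : ℝ × ℝ) : Frame :=
  ![pd1 S q, pd2 S q, pd1 (pd1 S) q, pd1 (pd2 S) q, pd2 (pd2 S) q,
    T q, pd1 T q, pd2 T q, pd1 (pd1 T) q, pd1 (pd2 T) q, pd2 (pd2 T) q,
    hat (ρ 0) (pd2 S q), hat (ρ 0) (pd2 (pd2 S) q), hat (ρ 0) (T q), hat (ρ 0) (pd2 T q),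
    hat (ρ 0) (pd2 (pd2 T) q), ρ]

/-- The jet of a function with the weights `ρ = (z, ω, ω')`. -/
def jetOf (ρ : R3) (w : ℝ × ℝ → ℝ) (q : ℝ × ℝ) : Jet :=
  ![w q, pd2 w q, pd2 (pd2 w) q, ρ 2 * pd1 w q, ρ 2 * pd1 (pd2 w) q,
    ρ 0 * ρ 2 * pd1 (pd1 w) q]

section FrameJet

variable {S T : ℝ × ℝ → R3} {ρ : R3} {q : ℝ × ℝ} {w v : ℝ × ℝ → ℝ}

theorem mkFrame_valid (h : ρ 0 = ρ 1 * ρ 2) (h0 : ρ 0 ≠ 0) : (mkFrame S T ρ q).Valid :=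
  ⟨h, (unhat_hat h0 _).symm, (unhat_hat h0 _).symm, (unhat_hat h0 _).symm, (unhat_hat h0 _).symm,
    (unhat_hat h0 _).symm⟩

theorem jetOf_add_smul (hw : ContDiffAt ℝ 2 w q) (hv : ContDiffAt ℝ 2 v q) (s : ℝ) :
    jetOf ρ (fun q => w q + s * v q) q = jetOf ρ w q + s • jetOf ρ v q := by
  have h := pd_graph hw hv (contDiffAt_const (c := s))
  have c1 : pd1 (fun _ : ℝ × ℝ => s) = fun _ => 0 := by funext q; simp [pd1]
  have c2 : pd2 (fun _ : ℝ × ℝ => s) = fun _ => 0 := by funext q; simp [pd2]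
  have c3 : pd1 (fun _ : ℝ × ℝ => (0 : ℝ)) = fun _ => 0 := by funext q; simp [pd1]
  have c4 : pd2 (fun _ : ℝ × ℝ => (0 : ℝ)) = fun _ => 0 := by funext q; simp [pd2]
  simp only [smul_eq_mul, c1, c2, c3, c4, mul_zero, zero_mul, add_zero] at h
  obtain ⟨h1, h2, h3, h4, h5⟩ := h
  unfold jetOf
  rw [h1, h2, h3, h4, h5]
  ext i
  fin_cases i <;> simp <;> ring

variable (hS : ContDiffAt ℝ 2 S q) (hT : ContDiffAt ℝ 2 T q) (hw : ContDiffAt ℝ 2 w q)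
include hS hT hw

theorem nf_mkFrame (h : ρ 0 = ρ 1 * ρ 2) (h0 : ρ 0 ≠ 0) :
    let F := mkFrame S T ρ q
    let x := jetOf ρ w q
    let X := fun q => S q + w q • T q
    nfDet F x = ρ 0 * ρ 2 * secDetAt X q ∧ nfTr F x = ρ 0 * ρ 2 * secTrAt X q ∧
    nfJ F x = T q ⬝ᵥ (pd1 X q ⨯₃ pd2 X q) ∧ ρ 2 • pd1 X q = nfXz F x ∧ pd2 X q = nfXy F x := by
  intro F x X
  obtain ⟨h1, h2, h3, h4, h5⟩ := pd_graph hS hT hw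
  have hv := mkFrame_valid (S := S) (T := T) (q := q) h h0
  obtain ⟨hD, hTr⟩ := nfDet_eq_secDet (w := w q) (wz := pd1 w q) (wy := pd2 w q)
    (wzz := pd1 (pd1 w) q) (wzy := pd1 (pd2 w) q) (wyy := pd2 (pd2 w) q) hv
  obtain ⟨-, -, -, hXz, hXy, hJ⟩ := geo_eq_nf (w := w q) (wz := pd1 w q) (wy := pd2 w q)
    (wzz := pd1 (pd1 w) q) (wzy := pd1 (pd2 w) q) (wyy := pd2 (pd2 w) q) hv
  refine ⟨?_, ?_, ?_, ?_, ?_⟩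
  · rw [secDetAt, h1, h2, h3, h4, h5]; exact hD
  · rw [secTrAt, h1, h2, h3, h4, h5]; exact hTr
  · rw [h1, h2]; exact hJ.symm
  · rw [h1]; exact hXz
  · rw [h2]; exact hXy

theorem nfVal_mkFrame (h : ρ 0 = ρ 1 * ρ 2) (h0 : ρ 0 ≠ 0) :
    nfVal (mkFrame S T ρ q) (jetOf ρ w q) = geoAt (T q) (fun q => S q + w q • T q) q := by
  obtain ⟨h1, h2, h3, h4, h5⟩ := pd_graph hS hT hw
  have h2' : ρ 2 ≠ 0 := fun e => h0 (by rw [h, e, mul_zero])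
  rw [geoAt, h1, h2, h3, h4, h5]
  exact nfVal_eq_geoVal (F := mkFrame S T ρ q) (mkFrame_valid h h0) h0 h2'

theorem mem_nfGood_mkFrame (h : ρ 0 = ρ 1 * ρ 2) (h0 : ρ 0 ≠ 0)
    (hJ : (pd1 (fun q => S q + w q • T q) q ⨯₃ pd2 (fun q => S q + w q • T q) q) ⬝ᵥ T q ≠ 0)
    (hK : 0 < secDetAt (fun q => S q + w q • T q) q) :
    (jetOf ρ w q, mkFrame S T ρ q) ∈ nfGood := by
  have h2' : ρ 2 ≠ 0 := fun e => h0 (by rw [h, e, mul_zero])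
  obtain ⟨h1, h2, h3, h4, h5⟩ := nf_mkFrame hS hT hw h h0
  have hn : pd1 (fun q => S q + w q • T q) q ⨯₃ pd2 (fun q => S q + w q • T q) q ≠ 0 := by
    intro e; rw [e] at hJ; simp at hJ
  refine ⟨?_, ?_, ?_, ?_⟩
  · simp only [h3]; rwa [dotProduct_comm]
  · simp only [h2]
    exact mul_ne_zero (mul_ne_zero h0 h2') (secTr_ne_zero hn hK)
  · simp only [h1]
    exact mul_ne_zero (mul_ne_zero h0 h2') hK.ne'
  · simp only [nfE, nfF, nfG]
    rw [← cross_dot_cross_self, ← h4, ← h5, map_smul, LinearMap.smul_apply, smul_dotProduct,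
      dotProduct_smul]
    have := (dotProduct_self_pos_R3 hn).ne'
    simp only [smul_eq_mul]
    exact mul_ne_zero h2' (mul_ne_zero h2' this)

end FrameJet

/-- With all weights equal to one the normalized formula is the Cartesian one, so a single function
`nfVal` serves both charts. -/
theorem hmcfNonlinearity_eq (S T : ℝ × ℝ → R3) (t : ℝ) (q : ℝ × ℝ) (w : ℝ) (d : ℝ × ℝ)
    (e : ℝ × ℝ × ℝ) : hmcfNonlinearity S T t q w d e
      = nfVal (mkFrame S T 1 q) ![w, d.2, e.2.2, d.1, e.2.1, e.1] := by
  have hv : (mkFrame S T 1 q).Valid := mkFrame_valid (by simp) (by simp)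
  have h := nfVal_eq_geoVal (F := mkFrame S T 1 q) (w := w) (wz := d.1) (wy := d.2)
    (wzz := e.1) (wzy := e.2.1) (wyy := e.2.2) hv one_ne_zero one_ne_zero
  have hj : mkJet (mkFrame S T 1 q) w d.1 d.2 e.1 e.2.1 e.2.2
      = ![w, d.2, e.2.2, d.1, e.2.1, e.1] := by
    have e0 : mkFrame S T 1 q 16 = 1 := rfl
    simp [mkJet, e0]
  rw [← hj, h]
  exact geoVal_eq _ _ _ _ _ _

theorem jetOf_one (w : ℝ × ℝ → ℝ) (q : ℝ × ℝ) :
    jetOf 1 w q = ![w q, pd2 w q, pd2 (pd2 w) q, pd1 w q, pd1 (pd2 w) q, pd1 (pd1 w) q] := by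
  simp [jetOf]

/-- The weights `(z, z^p, z^{1-p})` of the flattened coordinates. -/
def polarWeights (p : ℝ) (q : ℝ × ℝ) : R3 := ![q.1, q.1 ^ p, q.1 ^ (1 - p)]

theorem polarWeights_eq {p : ℝ} {q : ℝ × ℝ} (h : 0 < q.1) :
    polarWeights p q 0 = polarWeights p q 1 * polarWeights p q 2 := by
  change q.1 = q.1 ^ p * q.1 ^ (1 - p)
  rw [← Real.rpow_add h]; simp

/-- The frame in flattened coordinates. -/
def polarFrame (p : ℝ) (S T : ℝ × ℝ → R3) (q : ℝ × ℝ) : Frame :=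
  mkFrame (fun q => S (polarChart q)) (fun q => T (polarChart q)) (polarWeights p q) q

theorem jacAt_polarChart (q : ℝ × ℝ) : jacAt polarChart q = -(1 - q.1) := by
  have h1 : pd1 polarChart q = _ := (hasDerivAt_polarChart_fst q).deriv
  have h2 : pd2 polarChart q = _ := (hasDerivAt_polarChart_snd q).deriv
  rw [jacAt, h1, h2]
  linear_combination (-(1 - q.1)) * Real.sin_sq_add_cos_sq q.2

theorem ContDiffAt.comp_polarChart {E : Type*} [NormedAddCommGroup E] [NormedSpace ℝ E]
    {f : ℝ × ℝ → E} {q : ℝ × ℝ} (hf : ContDiffAt ℝ 2 f (polarChart q)) :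
    ContDiffAt ℝ 2 (fun q => f (polarChart q)) q :=
  ContDiffAt.comp q hf (contDiff_polarChart.of_le (by norm_cast)).contDiffAt

theorem ContDiff.contDiffAt_two {E F : Type*} [NormedAddCommGroup E] [NormedSpace ℝ E]
    [NormedAddCommGroup F] [NormedSpace ℝ F] {f : F → E} (hf : ContDiff ℝ ∞ f) (q : F) :
    ContDiffAt ℝ 2 f q :=
  (hf.of_le (by norm_cast)).contDiffAt

section Polar

variable {p : ℝ} {S T : ℝ × ℝ → R3} {w : ℝ × ℝ → ℝ} {q : ℝ × ℝ}

/-- The nonlinearity in Cartesian and in flattened coordinates. -/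
theorem nfVal_polarFrame (hS : ContDiff ℝ ∞ S) (hT : ContDiff ℝ ∞ T) (hq : 0 < q.1) (hq' : q.1 < 1)
    (hw : ContDiffAt ℝ 2 w (polarChart q)) :
    nfVal (mkFrame S T 1 (polarChart q)) (jetOf 1 w (polarChart q))
      = nfVal (polarFrame p S T q) (jetOf (polarWeights p q) (fun q => w (polarChart q)) q) := by
  have hS' := hS.contDiffAt_two (polarChart q)
  have hT' := hT.contDiffAt_two (polarChart q)
  rw [nfVal_mkFrame hS' hT' hw (by simp) (by simp), polarFrame,
    nfVal_mkFrame hS'.comp_polarChart hT'.comp_polarChart hw.comp_polarChart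
      (polarWeights_eq hq) hq.ne']
  refine (geoAt_comp _ (hS'.add (hw.smul hT'))
    (contDiff_polarChart.contDiffAt_two q) ?_).symm
  rw [jacAt_polarChart]
  intro h; linarith

/-- Comparison of the determinants in Cartesian and in flattened coordinates. -/
theorem nf_polarFrame (hS : ContDiff ℝ ∞ S) (hT : ContDiff ℝ ∞ T) (hq : 0 < q.1)
    (hw : ContDiffAt ℝ 2 w (polarChart q)) :
    let F := polarFrame p S T q
    let x := jetOf (polarWeights p q) (fun q => w (polarChart q)) q
    let F' := mkFrame S T 1 (polarChart q)
    let x' := jetOf 1 w (polarChart q)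
    nfJ F x = -(1 - q.1) * nfJ F' x' ∧
    nfTr F x = q.1 * q.1 ^ (1 - p) * ((-(1 - q.1)) ^ 3 * nfTr F' x') := by
  intro F x F' x'
  have hS' := hS.contDiffAt_two (polarChart q)
  have hT' := hT.contDiffAt_two (polarChart q)
  have hX := hS'.add (hw.smul hT')
  obtain ⟨-, h2, h3, -, -⟩ := nf_mkFrame hS' hT' hw (ρ := 1) (by simp) (by simp)
  obtain ⟨-, k2, k3, -, -⟩ := nf_mkFrame hS'.comp_polarChart hT'.comp_polarChart
    hw.comp_polarChart (polarWeights_eq (p := p) hq) hq.ne'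
  simp only [F, x, F', x', polarFrame]
  rw [h2, h3, k2, k3]
  have hφ := contDiff_polarChart.contDiffAt_two q
  have c := cross_comp (hX.differentiableAt two_ne_zero) (hφ.differentiableAt two_ne_zero)
  have d := (secAt_comp hX hφ).2
  rw [jacAt_polarChart] at c d
  constructor
  · refine (congrArg (T (polarChart q) ⬝ᵥ ·) c).trans ?_
    simp only [dotProduct_smul, smul_eq_mul]
    rfl
  · refine (congrArg (polarWeights p q 0 * polarWeights p q 2 * ·) d).trans ?_
    simp only [Pi.one_apply, one_mul, mul_one]
    rfl

end Polar

/-! ### Ellipticity -/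

/-- Uniqueness of derivatives identifies the abstractly obtained leading coefficients with the
explicit form, for Cartesian and flattened weights alike. -/
theorem principal_eq_nfForm {F : Frame} {x : Jet} (hω : F 16 1 ≠ 0) (he : (x, F) ∈ nfGood)
    {a11 a12 a22 b1 b2 c : ℝ}
    (h : ∀ η : Jet, HasDerivAt (fun s : ℝ => nfVal F (x + s • η))
      (c * η 0 + b2 * η 1 + a22 * η 2 + F 16 1 * (b1 * η 3 + 2 * a12 * η 4 + a11 * η 5)) 0)
    (ξ₁ ξ₂ : ℝ) :
    a11 * ξ₁ ^ 2 + 2 * a12 * (ξ₁ * ξ₂) + a22 * ξ₂ ^ 2 = nfForm F x ξ₁ ξ₂ / nfTr F x ^ 2 := by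
  have h1 := hasDerivAt_nfVal_second ξ₁ ξ₂ hω he.2.1 he.1
  have h2 := (h ![0, 0, ξ₂ ^ 2, 0, ξ₁ * ξ₂ / F 16 1, ξ₁ ^ 2 / F 16 1]).unique h1
  rw [← h2]
  simp
  field_simp
  ring

/-- By homogeneity it is enough to treat unit covectors, which with `K` form a compact family on
which the form is continuous and positive. -/
theorem exists_ellipticity {K : Set (Jet × Frame)} (hK : IsCompact K) (hK' : K ⊆ nfGood) :
    ∃ lam : ℝ, 0 < lam ∧ ∀ e ∈ K, ∀ ξ₁ ξ₂ : ℝ,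
      lam * (ξ₁ ^ 2 + ξ₂ ^ 2) ≤ nfForm e.2 e.1 ξ₁ ξ₂ / nfTr e.2 e.1 ^ 2 := by
  have hE := continuous_nfE
  have hF := continuous_nfF
  have hG := continuous_nfG
  have hL := continuous_nfL
  have hM := continuous_nfM
  have hN := continuous_nfN
  have hT := continuous_nfTr
  have hc : ContinuousOn (fun z : (Jet × Frame) × ℝ =>
      nfForm z.1.2 z.1.1 (Real.cos z.2) (Real.sin z.2) / nfTr z.1.2 z.1.1 ^ 2)
      (K ×ˢ Icc (-Real.pi) Real.pi) := by
    refine ContinuousOn.div (Continuous.continuousOn ?_) (Continuous.continuousOn ?_) ?_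
    · unfold nfForm
      have hE' : Continuous fun z : (Jet × Frame) × ℝ => nfE z.1.2 z.1.1 := hE.comp continuous_fst
      have hF' : Continuous fun z : (Jet × Frame) × ℝ => nfF z.1.2 z.1.1 := hF.comp continuous_fst
      have hG' : Continuous fun z : (Jet × Frame) × ℝ => nfG z.1.2 z.1.1 := hG.comp continuous_fst
      have hL' : Continuous fun z : (Jet × Frame) × ℝ => nfL z.1.2 z.1.1 := hL.comp continuous_fst
      have hM' : Continuous fun z : (Jet × Frame) × ℝ => nfM z.1.2 z.1.1 := hM.comp continuous_fst
      have hN' : Continuous fun z : (Jet × Frame) × ℝ => nfN z.1.2 z.1.1 := hN.comp continuous_fst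
      fun_prop
    · exact (hT.comp continuous_fst).pow 2
    · rintro z ⟨hz, -⟩
      exact pow_ne_zero 2 (hK' hz).2.1
  obtain ⟨lam, hlam, hl⟩ : ∃ lam : ℝ, 0 < lam ∧ ∀ z ∈ K ×ˢ Icc (-Real.pi) Real.pi,
      lam ≤ nfForm z.1.2 z.1.1 (Real.cos z.2) (Real.sin z.2) / nfTr z.1.2 z.1.1 ^ 2 := by
    refine (hK.prod isCompact_Icc).exists_forall_le' hc ?_
    rintro z ⟨hz, -⟩
    have := (hK' hz).2.1
    refine div_pos (nfForm_pos (hK' hz) ?_) (by positivity)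
    by_contra! h0
    have := Real.sin_sq_add_cos_sq z.2
    rw [h0.1, h0.2] at this
    norm_num at this
  refine ⟨lam, hlam, fun e he ξ₁ ξ₂ => ?_⟩
  obtain ⟨r, y, hy, h1, h2⟩ : ∃ r y : ℝ, y ∈ Icc (-Real.pi) Real.pi ∧ ξ₁ = r * Real.cos y ∧
      ξ₂ = r * Real.sin y := by
    refine ⟨‖(⟨ξ₁, ξ₂⟩ : ℂ)‖, Complex.arg ⟨ξ₁, ξ₂⟩, ⟨(Complex.neg_pi_lt_arg _).le,
      Complex.arg_le_pi _⟩, ?_, ?_⟩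
    · rw [Complex.norm_mul_cos_arg]
    · rw [Complex.norm_mul_sin_arg]
  have key := hl (e, y) ⟨he, hy⟩
  have e1 : nfForm e.2 e.1 ξ₁ ξ₂ = r ^ 2 * nfForm e.2 e.1 (Real.cos y) (Real.sin y) := by
    rw [h1, h2]; unfold nfForm; ring
  rw [e1, mul_div_assoc, h1, h2]
  have := mul_le_mul_of_nonneg_left key (sq_nonneg r)
  have hs := Real.sin_sq_add_cos_sq y
  calc lam * ((r * Real.cos y) ^ 2 + (r * Real.sin y) ^ 2)
      = r ^ 2 * lam := by linear_combination lam * r ^ 2 * hs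
    _ ≤ _ := this

/-! ### Function classes of frames and jets -/

theorem ContDiff.pd1_apply {V : ℝ × ℝ → R3} (hV : ContDiff ℝ ∞ V) (q : ℝ × ℝ) (i : Fin 3) :
    _root_.pd1 V q i = _root_.pd1 (fun q => V q i) q :=
  ((hasDerivAt_pi.1 (hV.hasDerivAt_pd1 q) i).deriv).symm

theorem ContDiff.pd2_apply {V : ℝ × ℝ → R3} (hV : ContDiff ℝ ∞ V) (q : ℝ × ℝ) (i : Fin 3) :
    _root_.pd2 V q i = _root_.pd2 (fun q => V q i) q :=
  ((hasDerivAt_pi.1 (hV.hasDerivAt_pd2 q) i).deriv).symm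

/-- Smooth vector functions of the flattened coordinates which are periodic in the angle. -/
structure IsChartVec (V : ℝ × ℝ → R3) : Prop where
  smooth : ContDiff ℝ ∞ V
  comp : ∀ i, IsChartFn fun q => V q i

namespace IsChartVec

variable {V : ℝ × ℝ → R3}

theorem pd1 (h : IsChartVec V) : IsChartVec (pd1 V) :=
  ⟨h.smooth.pd1, fun i => by simp only [h.smooth.pd1_apply]; exact (h.comp i).pd1⟩

theorem pd2 (h : IsChartVec V) : IsChartVec (pd2 V) :=
  ⟨h.smooth.pd2, fun i => by simp only [h.smooth.pd2_apply]; exact (h.comp i).pd2⟩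

theorem pd2_two_eq_zero (h : IsChartVec V) (h0 : ∀ y, V (0, y) 2 = 0) (y : ℝ) :
    _root_.pd2 V (0, y) 2 = 0 := by
  rw [h.smooth.pd2_apply, _root_.pd2]
  simp [h0]

end IsChartVec

theorem isChartVec_polar {S : ℝ × ℝ → R3} (hS : ContDiff ℝ ∞ S) :
    IsChartVec fun q => S (polarChart q) :=
  ⟨hS.comp contDiff_polarChart, fun i => isChartFn_comp_polarChart
    (g := fun q => S q i) ((contDiff_apply ℝ ℝ i).comp hS)⟩

section Classes

variable {k : ℕ} {α p τ : ℝ} {S T : ℝ × ℝ → R3}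

theorem cls_hat (hα : 0 < α) (hα' : α ≤ 1) {V : ℝ × ℝ → R3} (hV : IsChartVec V)
    (h0 : ∀ y, V (0, y) 2 = 0) (i : Fin 3) :
    Cls Prod.fst (collar τ) (HB hyperbolicDist α (collar τ)) k
      fun _ q => hat q.1 (V q) i := by
  fin_cases i
  · exact (hV.comp 0).cls_hb hα hα' τ k
  · exact (hV.comp 1).cls_hb hα hα' τ k
  · exact (hV.comp 2).cls_div hα hα' τ k h0

/-- The entries divided by `z` are harmless because the third components of `S` and `T` vanish on
the circle, and so do those of their angular derivatives. -/
theorem cls_polarFrame (hα : 0 < α) (hα' : α ≤ 1) (hp : 0 < p) (hp' : p < 1)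
    (hS : ContDiff ℝ ∞ S) (hT : ContDiff ℝ ∞ T) (hS0 : ∀ y, S (polarChart (0, y)) 2 = 0)
    (hT0 : ∀ y, T (polarChart (0, y)) 2 = 0) (j : Fin 17) (i : Fin 3) :
    Cls Prod.fst (collar τ) (HB hyperbolicDist α (collar τ)) k
      fun _ q => polarFrame p S T q j i := by
  have s := isChartVec_polar hS
  have t := isChartVec_polar hT
  have r : ∀ {V : ℝ × ℝ → R3}, IsChartVec V → Cls Prod.fst (collar τ)
    (HB hyperbolicDist α (collar τ)) k fun _ q => V q i := fun h => (h.comp i).cls_hb hα hα' τ k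
  have s2 := s.pd2_two_eq_zero hS0
  have t2 := t.pd2_two_eq_zero hT0
  fin_cases j
  · exact r s.pd1
  · exact r s.pd2
  · exact r s.pd1.pd1
  · exact r s.pd2.pd1
  · exact r s.pd2.pd2
  · exact r t
  · exact r t.pd1
  · exact r t.pd2
  · exact r t.pd1.pd1
  · exact r t.pd2.pd1
  · exact r t.pd2.pd2
  · exact cls_hat hα hα' s.pd2 s2 i
  · exact cls_hat hα hα' s.pd2.pd2 (s.pd2.pd2_two_eq_zero s2) i
  · exact cls_hat hα hα' t hT0 i
  · exact cls_hat hα hα' t.pd2 t2 i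
  · exact cls_hat hα hα' t.pd2.pd2 (t.pd2.pd2_two_eq_zero t2) i
  · fin_cases i
    · exact IsChartFn.fst.cls_hb hα hα' τ k
    · exact cls_rpow hα hα' τ hp.le k
    · exact cls_rpow hα hα' τ (sub_nonneg.2 hp'.le) k

theorem clsP_polarFrame (hα : 0 < α) (hα' : α ≤ 1) (hp : 0 < p) (hp' : p < 1)
    (hS : ContDiff ℝ ∞ S) (hT : ContDiff ℝ ∞ T) (j : Fin 17)
    (hj : j ∈ ({0, 1, 4, 5, 6, 7, 10} : Set (Fin 17))) (i : Fin 3) :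
    Cls Prod.fst (collar τ) (HBP p α τ) k fun _ q => polarFrame p S T q j i := by
  have s := isChartVec_polar hS
  have t := isChartVec_polar hT
  have r : ∀ {V : ℝ × ℝ → R3}, IsChartVec V → Cls Prod.fst (collar τ)
    (HBP p α τ) k fun _ q => V q i := fun h => (h.comp i).cls_hbp hα hα' hp hp' τ k
  rcases hj with rfl | rfl | rfl | rfl | rfl | rfl | rfl
  · exact r s.pd1
  · exact r s.pd2
  · exact r s.pd2.pd2
  · exact r t
  · exact r t.pd1
  · exact r t.pd2
  · exact r t.pd2.pd2

/-- The jet of a function of the class `C_s^{k+2+α,p}` in flattened coordinates. -/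
theorem cls_polarJet (hα : 0 < α) (hα' : α ≤ 1) (hp : 0 < p) {w : STFn}
    (hw : Cls Prod.fst (collar τ) (HBP p α τ) (k + 2) w) :
    (∀ i < 3, Cls Prod.fst (collar τ) (HBP p α τ) k
      fun t q => jetOf (polarWeights p q) (w t) q i) ∧
    ∀ i, Cls Prod.fst (collar τ) (HB hyperbolicDist α (collar τ)) k
      fun t q => jetOf (polarWeights p q) (w t) q i := by
  have hU := isOpen_collar τ
  have hA := fnAlg_HB (U := collar τ) (α := α) hyperbolicDist_nonneg
  have hC : FnAlg (collar τ) (Cls Prod.fst (collar τ) (HB hyperbolicDist α (collar τ)) k) :=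
    hA.cls hU k
  have h0 := (hw.of_succ).of_succ
  have h1 := hw.D2.of_succ
  have h2 := hw.D2.D2
  have hz := hw.D1
  -- `z^{1-p} w_z` is written as `z^{-p}` times `z w_z`, whose boundary value vanishes; the same is
  -- done for `w_y` and for `z w_z` in place of `w`.
  have k3 := hw.rpow_neg_mul_D1 hp
  have k4 := hw.D2.rpow_neg_mul_D1 hp
  have k5 := hz.rpow_neg_mul_D1 hp
  have e : ∀ z : ℝ, 0 < z → z ^ (1 - p) = z ^ (-p) * z := fun z hz => by
    rw [sub_eq_add_neg, add_comm, Real.rpow_add hz, Real.rpow_one]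
  have h3 : Cls Prod.fst (collar τ) (HB hyperbolicDist α (collar τ)) k
      fun t q => q.1 ^ (1 - p) * D1 w t q :=
    hC.congr (fun P hP => by rw [e _ (collar_pos P hP)]; ring) k3.of_succ
  have h4 : Cls Prod.fst (collar τ) (HB hyperbolicDist α (collar τ)) k
      fun t q => q.1 ^ (1 - p) * D1 (D2 w) t q :=
    hC.congr (fun P hP => by rw [e _ (collar_pos P hP)]; ring) k4
  -- `z z^{1-p} w_zz = z^{-p} z D_z (z w_z) - z^{-p} z w_z`.
  have h5 : Cls Prod.fst (collar τ) (HB hyperbolicDist α (collar τ)) k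
      fun t q => q.1 * q.1 ^ (1 - p) * D1 (D1 w) t q := by
    refine hC.congr (fun P hP => ?_) (hC.sub k5 k3.of_succ)
    have hpar := hw.isParabolicC hU (isWeight_fst hU collar_pos)
    have d : HasDerivAt (fun s => s * D1 w P.1 (s, P.2.2))
        (1 * D1 w P.1 P.2 + P.2.1 * D1 (D1 w) P.1 P.2) P.2.1 :=
      (hasDerivAt_id P.2.1).mul (hpar.D1.diff1 hP).hasDerivAt
    have d' : D1 (fun t q => q.1 * D1 w t q) P.1 P.2 = _ := d.deriv
    rw [d', e _ (collar_pos P hP)]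
    ring
  constructor
  · intro i hi
    fin_cases i
    · exact h0
    · exact h1
    · exact h2
    all_goals exact absurd hi (by decide)
  · intro i
    fin_cases i
    · exact h0.toHB hα hα' hp
    · exact h1.toHB hα hα' hp
    · exact h2.toHB hα hα' hp
    · exact h3
    · exact h4
    · exact h5

theorem cls_cartJet {U : Set (ℝ × ℝ × ℝ)} {B : STFn → Prop} (hU : IsOpen U) (hB : FnAlg U B)
    {w : STFn} (hw : Cls (fun _ => 1) U B (k + 2) w) (i : Fin 6) :
    Cls (fun _ => 1) U B k fun t q => jetOf 1 (w t) q i := by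
  have hC : FnAlg U (Cls (fun _ : ℝ × ℝ => (1 : ℝ)) U B k) := hB.cls hU k
  have e1 : ∀ {m : ℕ} {g : STFn}, Cls (fun _ => 1) U B (m + 1) g →
    Cls (fun _ => 1) U B m (D1 g) := fun h => by simpa only [one_mul] using h.D1
  simp only [jetOf_one]
  fin_cases i
  · exact hw.of_succ.of_succ
  · exact hw.D2.of_succ
  · exact hw.D2.D2
  · exact (e1 hw).of_succ
  · exact e1 hw.D2
  · exact e1 (e1 hw)

theorem cls_cartFrame (hα : 0 < α) (hα' : α ≤ 1) {r : ℝ} (hr : r ^ 2 ≤ 1)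
    (hS : ContDiff ℝ ∞ S) (hT : ContDiff ℝ ∞ T) (j : Fin 17) (i : Fin 3) :
    Cls (fun _ => 1) (Ioo 0 τ ×ˢ openDisc r) (HB euclideanDist α (Ioo 0 τ ×ˢ openDisc r)) k
      fun _ q => mkFrame S T 1 q j i := by
  have f : ∀ {V : ℝ × ℝ → R3}, ContDiff ℝ ∞ V → ∀ i, Cls (fun _ => 1) (Ioo 0 τ ×ˢ openDisc r)
      (HB euclideanDist α (Ioo 0 τ ×ˢ openDisc r)) k fun _ q => V q i := fun h i =>
    ContDiff.cls_disc hα hα' hr ((contDiff_apply ℝ ℝ i).comp h) k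
  have f' : ∀ {V : ℝ × ℝ → R3}, ContDiff ℝ ∞ V → Cls (fun _ => 1) (Ioo 0 τ ×ˢ openDisc r)
      (HB euclideanDist α (Ioo 0 τ ×ˢ openDisc r)) k
      fun _ q => hat ((1 : R3) 0) (V q) i := fun {V} h => by
    have e : ∀ q, hat ((1 : R3) 0) (V q) = V q := fun q => by
      ext i; fin_cases i <;> simp [hat]
    simp only [e]
    exact f h i
  fin_cases j
  · exact f hS.pd1 i
  · exact f hS.pd2 i
  · exact f hS.pd1.pd1 i
  · exact f hS.pd2.pd1 i
  · exact f hS.pd2.pd2 i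
  · exact f hT i
  · exact f hT.pd1 i
  · exact f hT.pd2 i
  · exact f hT.pd1.pd1 i
  · exact f hT.pd2.pd1 i
  · exact f hT.pd2.pd2 i
  · exact f' hS.pd2
  · exact f' hS.pd2.pd2
  · exact f' hT
  · exact f' hT.pd2
  · exact f' hT.pd2.pd2
  · exact f (V := fun _ => 1) contDiff_const i

end Classes

/-! ### The linearization at a function with good jets -/

section Bounds

theorem exists_abs_lower_bound {X : Type*} [TopologicalSpace X] {K : Set X} (hK : IsCompact K)
    {f : X → ℝ} (hf : Continuous f) (h : ∀ e ∈ K, f e ≠ 0) : ∃ c : ℝ, 0 < c ∧ ∀ e ∈ K, c ≤ |f e| :=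
  hK.exists_forall_le' hf.abs.continuousOn fun e he => abs_pos.2 (h e he)

theorem exists_abs_bound {X : Type*} [TopologicalSpace X] {K : Set X} (hK : IsCompact K)
    {f : X → ℝ} (hf : Continuous f) : ∃ c : ℝ, 0 < c ∧ ∀ e ∈ K, |f e| ≤ c := by
  obtain ⟨c, hc⟩ := hK.exists_bound_of_continuousOn hf.continuousOn
  exact ⟨max c 1, by positivity, fun e he => (hc e he).trans (le_max_left _ _)⟩

theorem sq_dotProduct_le (a b : R3) : (a ⬝ᵥ b) ^ 2 ≤ (a ⬝ᵥ a) * (b ⬝ᵥ b) := by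
  have := dotProduct_self_nonneg_R3 (a ⨯₃ b)
  rw [cross_dot_cross_self] at this
  linarith

theorem cross_dot_cross_le (a b : R3) : (a ⨯₃ b) ⬝ᵥ (a ⨯₃ b) ≤ (a ⬝ᵥ a) * (b ⬝ᵥ b) := by
  rw [cross_dot_cross_self]; nlinarith [sq_nonneg (a ⬝ᵥ b)]

theorem exists_mem_closedBall {d : ℝ × ℝ × ℝ → ℝ × ℝ × ℝ → ℝ} {α : ℝ} {U : Set (ℝ × ℝ × ℝ)}
    {Ξ : ℝ → ℝ × ℝ → Jet} {fr : ℝ → ℝ × ℝ → Frame}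
    (hΞ : ∀ i, HB d α U fun t q => Ξ t q i) (hfr : ∀ j i, HB d α U fun t q => fr t q j i) :
    ∃ R : ℝ, ∀ P ∈ U, (Ξ P.1 P.2, fr P.1 P.2) ∈ Metric.closedBall (0 : Jet × Frame) R := by
  choose C hC using hΞ
  choose C' hC' using hfr
  refine ⟨(∑ i, |C i|) + ∑ j, ∑ i, |C' j i|, fun P hP => ?_⟩
  have n1 : 0 ≤ ∑ i, |C i| := Finset.sum_nonneg fun _ _ => abs_nonneg _
  have n2 : 0 ≤ ∑ j, ∑ i, |C' j i| :=
    Finset.sum_nonneg fun _ _ => Finset.sum_nonneg fun _ _ => abs_nonneg _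
  rw [mem_closedBall_zero_iff, Prod.norm_def]
  refine max_le ?_ ?_
  · refine (pi_norm_le_iff_of_nonneg (by positivity)).2 fun i => ?_
    have := Finset.single_le_sum (f := fun i => |C i|) (fun _ _ => abs_nonneg _) (Finset.mem_univ i)
    exact ((hC i).2.1 P hP).trans ((le_abs_self _).trans (this.trans (by linarith)))
  · refine (pi_norm_le_iff_of_nonneg (by positivity)).2 fun j => ?_
    refine (pi_norm_le_iff_of_nonneg (by positivity)).2 fun i => ?_
    have h1 := Finset.single_le_sum (f := fun i => |C' j i|) (fun _ _ => abs_nonneg _)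
      (Finset.mem_univ i)
    have h2 := Finset.single_le_sum (f := fun j => ∑ i, |C' j i|)
      (fun _ _ => Finset.sum_nonneg fun _ _ => abs_nonneg _) (Finset.mem_univ j)
    exact ((hC' j i).2.1 P hP).trans ((le_abs_self _).trans (h1.trans (h2.trans (by linarith))))

/-- A lower bound for `G` from a lower bound for the Jacobian. -/
theorem exists_nfG_lower_bound {U : Set (ℝ × ℝ × ℝ)} {Ξ : ℝ → ℝ × ℝ → Jet}
    {fr : ℝ → ℝ × ℝ → Frame} {R : ℝ}
    (hR : ∀ P ∈ U, (Ξ P.1 P.2, fr P.1 P.2) ∈ Metric.closedBall (0 : Jet × Frame) R)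
    (hJ : ∃ c, 0 < c ∧ ∀ P ∈ U, c ≤ |nfJ (fr P.1 P.2) (Ξ P.1 P.2)|) :
    ∃ c, 0 < c ∧ ∀ P ∈ U, c ≤ |nfG (fr P.1 P.2) (Ξ P.1 P.2)| := by
  obtain ⟨c, hc, hJ⟩ := hJ
  have hf : Continuous fun e : Jet × Frame => (e.2 5 ⬝ᵥ e.2 5) * (nfC e.2 e.1 ⬝ᵥ nfC e.2 e.1) :=
    (Continuous.dotProduct (by fun_prop) (by fun_prop)).mul
      (continuous_nfC.dotProduct continuous_nfC)
  obtain ⟨M, hM, hb⟩ := exists_abs_bound (isCompact_closedBall (0 : Jet × Frame) R) hf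
  refine ⟨c ^ 2 / M, by positivity, fun P hP => ?_⟩
  have h1 := hb _ (hR P hP)
  have h2 := hJ P hP
  simp only at h1
  set F := fr P.1 P.2
  set x := Ξ P.1 P.2
  -- Cauchy–Schwarz for the triple product: with `T` and `S_z + w T_z` bounded, a Jacobian bounded
  -- below keeps `X_y` away from zero.
  have h3 : nfJ F x ^ 2 ≤ (F 5 ⬝ᵥ F 5) * ((nfC F x ⬝ᵥ nfC F x) * nfG F x) :=
    (sq_dotProduct_le _ _).trans (mul_le_mul_of_nonneg_left (cross_dot_cross_le _ _)
      (dotProduct_self_nonneg_R3 _))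
  have hG : 0 ≤ nfG F x := dotProduct_self_nonneg_R3 _
  rw [abs_of_nonneg hG, div_le_iff₀ hM]
  have h4 : c ^ 2 ≤ nfJ F x ^ 2 := by rw [← sq_abs (nfJ F x)]; gcongr
  have h5 := mul_le_mul_of_nonneg_right ((le_abs_self _).trans h1) hG
  nlinarith

end Bounds

/-! ### The linearized operator in both charts. -/

section Linearization

variable {k : ℕ} {α p τ : ℝ} {S T : ℝ × ℝ → R3} {w : STFn}

theorem MemDisc.cls_three_quarters (hw : MemDisc k α p τ w) :
    Cls (fun _ => 1) (Ioo 0 τ ×ˢ openDisc (3 / 4))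
      (HB euclideanDist α (Ioo 0 τ ×ˢ openDisc (3 / 4))) k w :=
  (memClassical_iff_cls (isOpen_stDisc τ _)).1
    ⟨hw.2.1.mono (prod_mono_right (openDisc_mono (by norm_num))),
      (ENNReal.add_lt_top.1 hw.2.2).1⟩

theorem MemDisc.cls_collar (hα : 0 < α) (hα' : α ≤ 1) (hp : 0 < p) (hw : MemDisc k α p τ w) :
    Cls Prod.fst (collar τ) (HBP p α τ) k (flatten w) :=
  (memSP_iff_cls hα hα' hp).1
    ⟨(isParabolicC_flatten hw.2.1).mono (collar_subset_wideCollar τ),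
      (ENNReal.add_lt_top.1 hw.2.2).2⟩

theorem MemDisc.cls_disc (hα : 0 < α) (hα' : α ≤ 1) (hp : 0 < p) (hw : MemDisc k α p τ w) {r : ℝ}
    (hr0 : 3 / 4 ≤ r) (hr : r < 1) :
    Cls (fun _ => 1) (Ioo 0 τ ×ˢ openDisc r) (HB euclideanDist α (Ioo 0 τ ×ˢ openDisc r)) k w :=
  cls_disc_of_collar hα hα' hr0 hr hw.2.1 hw.cls_three_quarters
    ((hw.cls_collar hα hα' hp).toHB hα hα' hp)

theorem MemDisc.contDiffAt (hw : MemDisc (k + 2) α p τ w) {t : ℝ} (ht : t ∈ Ioo 0 τ) {q : ℝ × ℝ}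
    (hq : q ∈ openDisc 1) : ContDiffAt ℝ 2 (w t) q :=
  IsParabolicC.contDiffAt_two (isOpen_stDisc τ 1) (hw.2.1.of_le (by omega)) (P := (t, q)) ⟨ht, hq⟩

theorem exists_polarChart_eq {q : ℝ × ℝ} (hq : q ∈ openDisc 1) (hq' : q ∉ openDisc (3 / 4)) :
    ∃ q' : ℝ × ℝ, polarChart q' = q ∧ 0 < q'.1 ∧ q'.1 < 1 / 2 := by
  simp only [openDisc, mem_ofPred_eq] at hq hq'
  have h : (1 / 2 : ℝ) ^ 2 < q.1 ^ 2 + q.2 ^ 2 := by linarith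
  obtain ⟨z, y, -, -, hz, -, h1, -⟩ := exists_polar_pair_annulus h h
  refine ⟨(z, y), h1.symm, ?_, ?_⟩
  · rw [hz, sub_pos, Real.sqrt_lt' one_pos]; exact hq
  · have : 1 / 2 < Real.sqrt (q.1 ^ 2 + q.2 ^ 2) := Real.lt_sqrt_of_sq_lt h
    change z < 1 / 2
    linarith

theorem nonlinearOp_hmcf (S T : ℝ × ℝ → R3) (w : STFn) (t : ℝ) (q : ℝ × ℝ) :
    nonlinearOp (hmcfNonlinearity S T) w t q
      = Dt w t q - nfVal (mkFrame S T 1 q) (jetOf 1 (w t) q) := by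
  rw [nonlinearOp, hmcfNonlinearity_eq, jetOf_one]
  rfl

/-- The coefficients of the linearization. -/
def linCoeff (S T : ℝ × ℝ → R3) (w : STFn) : LinCoeff :=
  let d : Fin 6 → STFn := fun i t q =>
    deriv (fun s : ℝ => nfVal (mkFrame S T 1 q) (jetOf 1 (w t) q + s • Pi.single i 1)) 0
  ⟨d 5, fun t q => 1 / 2 * d 4 t q, d 2, d 3, d 1, d 0⟩

/-- The action of the coefficients on a normalized jet. -/
def LinCoeff.act (A : LinCoeff) (o t : ℝ) (q : ℝ × ℝ) (η : Jet) : ℝ :=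
  A.c t q * η 0 + A.b2 t q * η 1 + A.a22 t q * η 2
    + o * (A.b1 t q * η 3 + 2 * A.a12 t q * η 4 + A.a11 t q * η 5)

/-- All the coefficients belong to the class `C`. -/
def LinCoeff.All (A : LinCoeff) (C : STFn → Prop) : Prop :=
  C A.a11 ∧ C A.a12 ∧ C A.a22 ∧ C A.b1 ∧ C A.b2 ∧ C A.c

/-- Lower bounds in Cartesian coordinates from lower bounds in both charts. -/
theorem nf_cart_lower_bound (hp' : p < 1) (hS : ContDiff ℝ ∞ S) (hT : ContDiff ℝ ∞ T)
    {K : Set (Jet × Frame)} {cJ cT : ℝ} (hJ : ∀ x F, (x, F) ∈ K → cJ ≤ |nfJ F x|)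
    (hTr : ∀ x F, (x, F) ∈ K → cT ≤ |nfTr F x|) (hw : MemDisc (k + 2) α p τ w)
    (hcol : ∀ P ∈ collar τ,
      (jetOf (polarWeights p P.2) (flatten w P.1) P.2, polarFrame p S T P.2) ∈ K)
    (hdisc : ∀ P ∈ Ioo 0 τ ×ˢ openDisc (3 / 4),
      (jetOf 1 (w P.1) P.2, mkFrame S T 1 P.2) ∈ K) :
    ∀ P ∈ Ioo 0 τ ×ˢ openDisc 1, cJ ≤ |nfJ (mkFrame S T 1 P.2) (jetOf 1 (w P.1) P.2)| ∧
      cT ≤ |nfTr (mkFrame S T 1 P.2) (jetOf 1 (w P.1) P.2)| := by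
  rintro ⟨t, q⟩ ⟨ht, hq⟩
  by_cases h34 : q ∈ openDisc (3 / 4)
  · exact ⟨hJ _ _ (hdisc (t, q) ⟨ht, h34⟩), hTr _ _ (hdisc (t, q) ⟨ht, h34⟩)⟩
  · obtain ⟨q', rfl, h0, h1⟩ := exists_polarChart_eq hq h34
    have hP : (t, q') ∈ collar τ := ⟨ht, ⟨h0, h1⟩, mem_univ _⟩
    -- A point outside the disc of radius `3/4` comes from the collar. The flattened quantities are
    -- the Cartesian ones times factors of modulus at most one, so lower bounds in the collar carry
    -- over to Cartesian coordinates.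
    obtain ⟨e1, e2⟩ := nf_polarFrame (p := p) hS hT h0 (hw.contDiffAt ht hq)
    have b1 := hJ _ _ (hcol _ hP)
    have b2 := hTr _ _ (hcol _ hP)
    change cJ ≤ |nfJ (polarFrame p S T q')
      (jetOf (polarWeights p q') (fun q => w t (polarChart q)) q')| at b1
    change cT ≤ |nfTr (polarFrame p S T q')
      (jetOf (polarWeights p q') (fun q => w t (polarChart q)) q')| at b2
    rw [e1, abs_mul] at b1
    rw [e2, abs_mul, abs_mul (_ ^ 3)] at b2
    have l1 : |-(1 - q'.1)| ≤ 1 := by rw [abs_neg, abs_of_pos] <;> linarith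
    have l2 : |(-(1 - q'.1)) ^ 3| ≤ 1 := by rw [abs_pow]; exact pow_le_one₀ (abs_nonneg _) l1
    have l3 : |q'.1 * q'.1 ^ (1 - p)| ≤ 1 := by
      have h2 := Real.rpow_nonneg h0.le (1 - p)
      rw [abs_of_nonneg (by positivity)]
      exact mul_le_one₀ (by linarith) h2
        (Real.rpow_le_one h0.le (by linarith) (by linarith))
    refine ⟨b1.trans (mul_le_of_le_one_left (abs_nonneg _) l1),
      b2.trans ((mul_le_of_le_one_left (by positivity) l3).trans
        (mul_le_of_le_one_left (abs_nonneg _) l2))⟩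

/-- The classes of the coefficients of the linearization in Cartesian coordinates. -/
theorem linCoeff_spec (hα : 0 < α) (hα' : α ≤ 1) (hp : 0 < p) (hS : ContDiff ℝ ∞ S)
    (hT : ContDiff ℝ ∞ T) {cJ cT : ℝ} (hcJ : 0 < cJ) (hcT : 0 < cT)
    (hw : MemDisc (k + 2) α p τ w)
    (hbound : ∀ P ∈ Ioo 0 τ ×ˢ openDisc 1,
      cJ ≤ |nfJ (mkFrame S T 1 P.2) (jetOf 1 (w P.1) P.2)| ∧
      cT ≤ |nfTr (mkFrame S T 1 P.2) (jetOf 1 (w P.1) P.2)|)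
    {r : ℝ} (hr0 : 3 / 4 ≤ r) (hr : r < 1) :
    (linCoeff S T w).All (Cls (fun _ => 1) (Ioo 0 τ ×ˢ openDisc r)
      (HB euclideanDist α (Ioo 0 τ ×ˢ openDisc r)) k) ∧
    ∀ P ∈ Ioo 0 τ ×ˢ openDisc r, ∀ η : Jet,
      HasDerivAt (fun s : ℝ => nfVal (mkFrame S T 1 P.2) (jetOf 1 (w P.1) P.2 + s • η))
        ((linCoeff S T w).act 1 P.1 P.2 η) 0 := by
  have hr2 : r ^ 2 ≤ 1 := by nlinarith
  have hsub : Ioo 0 τ ×ˢ openDisc r ⊆ Ioo 0 τ ×ˢ openDisc 1 :=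
    prod_mono_right (openDisc_mono (by linarith))
  have hV := isOpen_stDisc τ r
  have hC : FnAlg (Ioo 0 τ ×ˢ openDisc r) (Cls (fun _ => 1) (Ioo 0 τ ×ˢ openDisc r)
      (HB euclideanDist α (Ioo 0 τ ×ˢ openDisc r)) k) := (fnAlg_HB euclideanDist_nonneg).cls hV k
  have hx := cls_cartJet hV (fnAlg_HB euclideanDist_nonneg) (hw.cls_disc hα hα' hp hr0 hr)
  have hf := fun j i => cls_cartFrame (k := k) (τ := τ) hα hα' hr2 hS hT j i
  obtain ⟨R, hR⟩ := exists_mem_closedBall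
    (Ξ := fun t q => jetOf 1 (w t) q) (fr := fun _ q => mkFrame S T 1 q) (fun i => (hx i).base)
    (fun j i => (hf j i).base)
  have hJ' : ∃ c, 0 < c ∧ ∀ P ∈ Ioo 0 τ ×ˢ openDisc r,
      c ≤ |nfJ (mkFrame S T 1 P.2) (jetOf 1 (w P.1) P.2)| :=
    ⟨cJ, hcJ, fun P hP => (hbound P (hsub hP)).1⟩
  have hG' := exists_nfG_lower_bound
    (Ξ := fun t q => jetOf 1 (w t) q) (fr := fun _ q => mkFrame S T 1 q) hR hJ'
  have hT' : ∃ c, 0 < c ∧ ∀ P ∈ Ioo 0 τ ×ˢ openDisc r,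
      c ≤ |nfTr (mkFrame S T 1 P.2) (jetOf 1 (w P.1) P.2)| :=
    ⟨cT, hcT, fun P hP => (hbound P (hsub hP)).2⟩
  -- In Cartesian coordinates `ω = 1`, so both classes may be taken equal.
  obtain ⟨A, ⟨d11, d12, db1⟩, ⟨d22, db2, dc⟩, hd⟩ := exists_coeffs
    (Ξ := fun t q => jetOf 1 (w t) q) (fr := fun _ q => mkFrame S T 1 q) hC hC
    (fun f hf' => hC.mul (hf 16 1) hf') (fun i _ => hx i) hx (fun j _ => hf j) hf hJ'
    hG' hT'
  have e16 : ∀ q, mkFrame S T 1 q 16 1 = 1 := fun q => rfl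
  simp only [e16] at hd
  -- The coefficients are determined by the derivatives in the coordinate directions. Those found on
  -- the disc of radius `r` therefore agree with the globally defined ones, which do not depend on
  -- `r`.
  have hs : ∀ P ∈ Ioo 0 τ ×ˢ openDisc r, ∀ i, deriv (fun s : ℝ => nfVal (mkFrame S T 1 P.2)
      (jetOf 1 (w P.1) P.2 + s • Pi.single i 1)) 0 = _ :=
    fun P hP i => (hd P hP (Pi.single i 1)).deriv
  have g5 : ∀ P ∈ Ioo 0 τ ×ˢ openDisc r, A.a11 P.1 P.2 = (linCoeff S T w).a11 P.1 P.2 :=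
    fun P hP => by simp [linCoeff, hs P hP]
  have g4 : ∀ P ∈ Ioo 0 τ ×ˢ openDisc r, A.a12 P.1 P.2 = (linCoeff S T w).a12 P.1 P.2 :=
    fun P hP => by simp [linCoeff, hs P hP]
  have g3 : ∀ P ∈ Ioo 0 τ ×ˢ openDisc r, A.b1 P.1 P.2 = (linCoeff S T w).b1 P.1 P.2 :=
    fun P hP => by simp [linCoeff, hs P hP]
  have g2 : ∀ P ∈ Ioo 0 τ ×ˢ openDisc r, A.a22 P.1 P.2 = (linCoeff S T w).a22 P.1 P.2 :=
    fun P hP => by simp [linCoeff, hs P hP]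
  have g1 : ∀ P ∈ Ioo 0 τ ×ˢ openDisc r, A.b2 P.1 P.2 = (linCoeff S T w).b2 P.1 P.2 :=
    fun P hP => by simp [linCoeff, hs P hP]
  have g0 : ∀ P ∈ Ioo 0 τ ×ˢ openDisc r, A.c P.1 P.2 = (linCoeff S T w).c P.1 P.2 :=
    fun P hP => by simp [linCoeff, hs P hP]
  refine ⟨⟨hC.congr g5 d11, hC.congr g4 d12, hC.congr g2 d22, hC.congr g3 db1,
    hC.congr g1 db2, hC.congr g0 dc⟩, fun P hP η => ?_⟩
  rw [LinCoeff.act, ← g5 P hP, ← g4 P hP, ← g3 P hP, ← g2 P hP, ← g1 P hP, ← g0 P hP]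
  exact hd P hP η

/-- Every point of the open disc lies in a disc of radius between `3/4` and 1. -/
theorem linCoeff_hasDerivAt (hα : 0 < α) (hα' : α ≤ 1) (hp : 0 < p) (hS : ContDiff ℝ ∞ S)
    (hT : ContDiff ℝ ∞ T) {cJ cT : ℝ} (hcJ : 0 < cJ) (hcT : 0 < cT)
    (hw : MemDisc (k + 2) α p τ w)
    (hbound : ∀ P ∈ Ioo 0 τ ×ˢ openDisc 1,
      cJ ≤ |nfJ (mkFrame S T 1 P.2) (jetOf 1 (w P.1) P.2)| ∧
      cT ≤ |nfTr (mkFrame S T 1 P.2) (jetOf 1 (w P.1) P.2)|) :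
    ∀ P ∈ Ioo 0 τ ×ˢ openDisc 1, ∀ η : Jet,
      HasDerivAt (fun s : ℝ => nfVal (mkFrame S T 1 P.2) (jetOf 1 (w P.1) P.2 + s • η))
        ((linCoeff S T w).act 1 P.1 P.2 η) 0 := by
  rintro P ⟨ht, hq⟩
  have h1 : Real.sqrt (P.2.1 ^ 2 + P.2.2 ^ 2) < 1 := by
    rw [Real.sqrt_lt' one_pos]; exact hq
  obtain ⟨r, hr, hr1⟩ := exists_between (max_lt h1 (show (3 / 4 : ℝ) < 1 by norm_num))
  have hr0 := (le_max_right _ _).trans hr.le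
  refine (linCoeff_spec hα hα' hp hS hT hcJ hcT hw hbound hr0 hr1).2 P ⟨ht, ?_⟩
  exact (Real.sqrt_lt' (by linarith)).1 ((le_max_left _ _).trans_lt hr)

theorem linCoeff_isLinearizationAt (hw : MemDisc (k + 2) α p τ w)
    (hder : ∀ P ∈ Ioo 0 τ ×ˢ openDisc 1, ∀ η : Jet,
      HasDerivAt (fun s : ℝ => nfVal (mkFrame S T 1 P.2) (jetOf 1 (w P.1) P.2 + s • η))
        ((linCoeff S T w).act 1 P.1 P.2 η) 0) :
    IsLinearizationAt (k + 2) α p τ (hmcfNonlinearity S T) w (linCoeff S T w) := by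
  intro v hv t ht q hq
  have hwp := hw.2.1.difft (P := (t, q)) ⟨ht, hq⟩
  have hvp := hv.2.1.difft (P := (t, q)) ⟨ht, hq⟩
  have e : ∀ s : ℝ, nonlinearOp (hmcfNonlinearity S T) (fun t' q' => w t' q' + s * v t' q') t q
      = (Dt w t q + s * Dt v t q)
        - nfVal (mkFrame S T 1 q) (jetOf 1 (w t) q + s • jetOf 1 (v t) q) := fun s => by
    rw [nonlinearOp_hmcf, ← jetOf_add_smul (hw.contDiffAt ht hq) (hv.contDiffAt ht hq)]
    congr 1
    exact (hwp.hasDerivAt.add (hvp.hasDerivAt.const_mul s)).deriv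
  simp only [e]
  have d1 : HasDerivAt (fun s : ℝ => Dt w t q + s * Dt v t q) (Dt v t q) 0 := by
    simpa using ((hasDerivAt_id (0 : ℝ)).mul_const (Dt v t q)).const_add (Dt w t q)
  refine (d1.sub (hder (t, q) ⟨ht, hq⟩ (jetOf 1 (v t) q))).congr_deriv ?_
  rw [jetOf_one, LinCoeff.spatial, LinCoeff.act]
  simp only [D1, D2]
  simp
  ring

/-- The linearized operator in Cartesian and in flattened coordinates. -/
theorem spatial_eq_degenerate (hS : ContDiff ℝ ∞ S) (hT : ContDiff ℝ ∞ T)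
    (hw : MemDisc (k + 2) α p τ w) {A A' : LinCoeff}
    (hder : ∀ P ∈ Ioo 0 τ ×ˢ openDisc 1, ∀ η : Jet,
      HasDerivAt (fun s : ℝ => nfVal (mkFrame S T 1 P.2) (jetOf 1 (w P.1) P.2 + s • η))
        (A.act 1 P.1 P.2 η) 0)
    (hd' : ∀ P ∈ collar τ, ∀ η : Jet, HasDerivAt (fun s : ℝ => nfVal (polarFrame p S T P.2)
      (jetOf (polarWeights p P.2) (flatten w P.1) P.2 + s • η))
        (A'.act (polarWeights p P.2 1) P.1 P.2 η) 0)
    {v : ℝ × ℝ → ℝ} (hv : ContDiffOn ℝ 2 v (openDisc 1)) {P : ℝ × ℝ × ℝ} (hP : P ∈ collar τ) :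
    A.spatial (fun _ => v) P.1 (polarChart P.2)
      = A'.degenerate (flatten fun _ => v) P.1 P.2 := by
  have hP1 : (P.1, polarChart P.2) ∈ Ioo 0 τ ×ˢ openDisc 1 :=
    polarChart_mem (collar_subset_wideCollar τ hP)
  have hvq : ContDiffAt ℝ 2 v (polarChart P.2) :=
    hv.contDiffAt ((isOpen_openDisc 1).mem_nhds hP1.2)
  have hwq := hw.contDiffAt hP1.1 hP1.2
  have d1 := hder _ hP1 (jetOf 1 v (polarChart P.2))
  have d2 := hd' P hP (jetOf (polarWeights p P.2) (fun q => v (polarChart q)) P.2)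
  -- Both charts compute the same number for `w + s v`, so the two derivatives at `s = 0` agree; the
  -- transformation law of the coefficients never has to be written out.
  have e : ∀ s : ℝ, nfVal (mkFrame S T 1 (polarChart P.2))
      (jetOf 1 (w P.1) (polarChart P.2) + s • jetOf 1 v (polarChart P.2))
      = nfVal (polarFrame p S T P.2) (jetOf (polarWeights p P.2) (flatten w P.1) P.2
        + s • jetOf (polarWeights p P.2) (fun q => v (polarChart q)) P.2) := fun s => by
    rw [← jetOf_add_smul hwq hvq, nfVal_polarFrame (p := p) hS hT (collar_pos P hP)
      (collar_lt_one hP) (hwq.add (contDiffAt_const.mul hvq))]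
    congr 1
    exact jetOf_add_smul hwq.comp_polarChart hvq.comp_polarChart s
  simp only [e] at d1
  have key := d1.unique d2
  have ew := polarWeights_eq (p := p) (collar_pos P hP)
  have e0 : polarWeights p P.2 0 = P.2.1 := rfl
  rw [e0] at ew
  rw [jetOf_one, LinCoeff.act, LinCoeff.act] at key
  simp only [jetOf, e0] at key
  simp only [LinCoeff.spatial, LinCoeff.degenerate, D1, D2]
  simp at key
  unfold flatten
  linear_combination key - (A'.b1 P.1 P.2 * pd1 (fun q => v (polarChart q)) P.2
    + 2 * A'.a12 P.1 P.2 * pd1 (pd2 (fun q => v (polarChart q))) P.2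
    + A'.a11 P.1 P.2 * P.2.1 * pd1 (pd1 (fun q => v (polarChart q))) P.2) * ew

/-- The ellipticity constant is attached to the compact set `K`, not to `w` or `τ`; any `w` whose
jets stay in `K` in both charts inherits it. -/
theorem exists_linearization (hα : 0 < α) (hα' : α ≤ 1) (hp : 0 < p) (hp' : p < 1)
    (hS : ContDiff ℝ ∞ S) (hT : ContDiff ℝ ∞ T) (hS0 : ∀ y, S (polarChart (0, y)) 2 = 0)
    (hT0 : ∀ y, T (polarChart (0, y)) 2 = 0) {K : Set (Jet × Frame)} (hK : IsCompact K)
    (hK' : K ⊆ nfGood) {lam : ℝ} (hlam : ∀ e ∈ K, ∀ ξ₁ ξ₂ : ℝ,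
      lam * (ξ₁ ^ 2 + ξ₂ ^ 2) ≤ nfForm e.2 e.1 ξ₁ ξ₂ / nfTr e.2 e.1 ^ 2)
    (hw : MemDisc (k + 2) α p τ w)
    (hcol : ∀ P ∈ collar τ,
      (jetOf (polarWeights p P.2) (flatten w P.1) P.2, polarFrame p S T P.2) ∈ K)
    (hdisc : ∀ P ∈ Ioo 0 τ ×ˢ openDisc (3 / 4),
      (jetOf 1 (w P.1) P.2, mkFrame S T 1 P.2) ∈ K) :
    ∃ A : LinCoeff, IsLinearizationAt (k + 2) α p τ (hmcfNonlinearity S T) w A ∧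
      IsDegenerateParabolic k α p τ lam A := by
  obtain ⟨cJ, hcJ, hJ⟩ : ∃ c : ℝ, 0 < c ∧ ∀ x F, (x, F) ∈ K → c ≤ |nfJ F x| :=
    (exists_abs_lower_bound hK continuous_nfJ fun e he => (hK' he).1).imp
      fun c h => ⟨h.1, fun x F hx => h.2 (x, F) hx⟩
  obtain ⟨cT, hcT, hTr⟩ : ∃ c : ℝ, 0 < c ∧ ∀ x F, (x, F) ∈ K → c ≤ |nfTr F x| :=
    (exists_abs_lower_bound hK continuous_nfTr fun e he => (hK' he).2.1).imp
      fun c h => ⟨h.1, fun x F hx => h.2 (x, F) hx⟩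
  obtain ⟨cG, hcG, hG⟩ : ∃ c : ℝ, 0 < c ∧ ∀ x F, (x, F) ∈ K → c ≤ |nfG F x| :=
    (exists_abs_lower_bound hK continuous_nfG fun e he => (nfG_pos (hK' he)).ne').imp
      fun c h => ⟨h.1, fun x F hx => h.2 (x, F) hx⟩
  -- the degenerate operator
  have hU := isOpen_collar τ
  have hA : FnAlg (collar τ) (Cls Prod.fst (collar τ) (HB hyperbolicDist α (collar τ)) k) :=
    (fnAlg_HB hyperbolicDist_nonneg).cls hU k
  have hA₀ : FnAlg (collar τ) (Cls Prod.fst (collar τ) (HBP p α τ) k) :=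
    (fnAlg_HBP hα hα' hp).cls hU k
  have hjet := cls_polarJet hα hα' hp (hw.cls_collar hα hα' hp)
  obtain ⟨A', ⟨c11, c12, cb1⟩, ⟨c22, cb2, cc⟩, hd'⟩ := exists_coeffs
    (Ξ := fun t q => jetOf (polarWeights p q) (flatten w t) q)
    (fr := fun _ q => polarFrame p S T q) hA hA₀
    (fun f hf => hf.rpow_mul hα hα' hp) hjet.1 hjet.2
    (fun j hj i => clsP_polarFrame hα hα' hp hp' hS hT j hj i)
    (fun j i => cls_polarFrame hα hα' hp hp' hS hT hS0 hT0 j i)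
    ⟨cJ, hcJ, fun P hP => hJ _ _ (hcol P hP)⟩ ⟨cG, hcG, fun P hP => hG _ _ (hcol P hP)⟩
    ⟨cT, hcT, fun P hP => hTr _ _ (hcol P hP)⟩
  have hbound := nf_cart_lower_bound hp' hS hT hJ hTr hw hcol hdisc
  have hder := linCoeff_hasDerivAt hα hα' hp hS hT hcJ hcT hw hbound
  refine ⟨linCoeff S T w, linCoeff_isLinearizationAt hw hder, ?_, ?_, A',
    fun v hv P hP => spatial_eq_degenerate hS hT hw hder hd' hv hP, ?_⟩
  · intro r hr0 hr
    obtain ⟨⟨d11, d12, d22, db1, db2, dc⟩, -⟩ := linCoeff_spec hα hα' hp hS hT hcJ hcT hw hbound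
      (r := max r (3 / 4)) (le_max_right _ _) (max_lt hr (by norm_num))
    have hsub : Ioo 0 τ ×ˢ openDisc r ⊆ Ioo 0 τ ×ˢ openDisc (max r (3 / 4)) :=
      prod_mono_right (openDisc_mono (by gcongr; exact le_max_left _ _))
    have hm : ∀ f : STFn, Cls (fun _ => 1) (Ioo 0 τ ×ˢ openDisc (max r (3 / 4)))
        (HB euclideanDist α (Ioo 0 τ ×ˢ openDisc (max r (3 / 4)))) k f →
        MemClassical k α (Ioo 0 τ ×ˢ openDisc r) f := fun f hf =>
      (memClassical_iff_cls (isOpen_stDisc τ r)).2 (hf.mono hsub fun _ hb => hb.mono hsub)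
    exact ⟨hm _ d11, hm _ d12, hm _ d22, hm _ db1, hm _ db2, hm _ dc⟩
  · rintro P ⟨ht, hq⟩ ξ₁ ξ₂
    have hP1 : P ∈ Ioo 0 τ ×ˢ openDisc 1 := ⟨ht, openDisc_mono (by norm_num) hq⟩
    have he := hdisc P ⟨ht, hq⟩
    rw [principal_eq_nfForm (F := mkFrame S T 1 P.2) one_ne_zero (hK' he) (hder P hP1) ξ₁ ξ₂]
    exact hlam _ he ξ₁ ξ₂
  · have ms : ∀ {f : STFn}, Cls Prod.fst (collar τ) (HB hyperbolicDist α (collar τ)) k f →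
        MemS k α (collar τ) f := fun h => (memS_iff_cls hU collar_pos).2 h
    have mp : ∀ {f : STFn}, Cls Prod.fst (collar τ) (HBP p α τ) k f →
        MemSP k α p (collar τ) f := fun h => (memSP_iff_cls hα hα' hp).2 h
    refine ⟨ms c11, ms c12, ms (c22.toHB hα hα' hp), ms cb1, ms (cb2.toHB hα hα' hp),
      ms (cc.toHB hα hα' hp), mp c22, mp cb2, mp cc, ?_⟩
    intro P hP ξ₁ ξ₂
    have he := hcol P hP
    have hω : polarFrame p S T P.2 16 1 ≠ 0 := (Real.rpow_pos_of_pos (collar_pos P hP) p).ne'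
    rw [principal_eq_nfForm hω (hK' he) (hd' P hP) ξ₁ ξ₂]
    exact hlam _ he ξ₁ ξ₂

end Linearization

/-! ### Convex bodies with a flat side -/

section ConvexBody

variable {B : Set R3}

theorem continuous_vec3 : Continuous fun z : (ℝ × ℝ) × ℝ => (![z.1.1, z.1.2, z.2] : R3) := by
  refine continuous_pi fun i => ?_
  fin_cases i <;> simp <;> fun_prop

theorem isClosed_flatSide (hB : IsConvexBodyWithFlatSide B) : IsClosed (flatSide B) :=
  hB.isCompact.isClosed.preimage
    (continuous_vec3.comp (g := fun z : (ℝ × ℝ) × ℝ => (![z.1.1, z.1.2, z.2] : R3))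
      (f := fun q : ℝ × ℝ => (q, (0 : ℝ))) (by fun_prop))

/-- Near the flat side, the points of the boundary at small height lie on the lower graph. -/
theorem eventually_lower (hB : IsConvexBodyWithFlatSide B) {U : Set (ℝ × ℝ)} (hU : IsOpen U)
    (hUB : U ⊆ shadow B) {x₀ : ℝ × ℝ} (hx₀ : x₀ ∈ U) :
    ∃ c : ℝ, 0 < c ∧ ∀ᶠ x in 𝓝 x₀, ∀ ζ < c, ![x.1, x.2, ζ] ∈ frontier B →
      ∀ z : ℝ, ![x.1, x.2, z] ∈ B → ζ ≤ z := by
  obtain ⟨b, hb⟩ := hB.interior_nonempty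
  -- a point beyond `x₀`, seen from `b`
  have hc : Continuous fun ε : ℝ => x₀ + ε • (x₀ - (b 0, b 1)) := by fun_prop
  have hU' : ∀ᶠ ε : ℝ in 𝓝[>] 0, x₀ + ε • (x₀ - (b 0, b 1)) ∈ U :=
    (hc.tendsto' 0 x₀ (by simp)).mono_left nhdsWithin_le_nhds |>.eventually (hU.mem_nhds hx₀)
  obtain ⟨ε, hε, hε0⟩ := (hU'.and self_mem_nhdsWithin).exists
  have hε0' : 0 < ε := hε0
  obtain ⟨z₁, hz₁⟩ := hUB hε
  set P₁ : R3 := ![(x₀ + ε • (x₀ - (b 0, b 1))).1, (x₀ + ε • (x₀ - (b 0, b 1))).2, z₁] with hP₁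
  have hε1 : (1 + ε)⁻¹ + ε * (1 + ε)⁻¹ = 1 := by field_simp
  have hb3 : 0 < b 2 := by
    have hcb : Continuous fun s : ℝ => (b - s • ![0, 0, 1] : R3) := by fun_prop
    have hn : ∀ᶠ s : ℝ in 𝓝[>] 0, (b - s • ![0, 0, 1] : R3) ∈ interior B :=
      (hcb.tendsto' 0 b (by simp)).mono_left nhdsWithin_le_nhds |>.eventually
        (isOpen_interior.mem_nhds hb)
    obtain ⟨s, hs, hs0⟩ := (hn.and self_mem_nhdsWithin).exists
    have h1 := hB.half_space _ (interior_subset hs)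
    have hs0' : 0 < s := hs0
    simp at h1
    linarith
  -- The segment from `P₁` to the interior point `b` crosses the vertical line over `x₀`; the
  -- crossing point is interior, and its height is the constant `c`.
  have hQ : (1 + ε)⁻¹ • P₁ + (ε * (1 + ε)⁻¹) • b ∈ interior B :=
    hB.convex.combo_self_interior_mem_interior hz₁ hb (by positivity) (by positivity) hε1
  set c := (1 + ε)⁻¹ * z₁ + ε * (1 + ε)⁻¹ * b 2 with hcdef
  have hz10 : 0 ≤ z₁ := by simpa [hP₁] using hB.half_space _ hz₁
  have hQ' : (1 + ε)⁻¹ • P₁ + (ε * (1 + ε)⁻¹) • b = ![x₀.1, x₀.2, c] := by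
    ext i
    fin_cases i
    · simp [hP₁]; field_simp; ring
    · simp [hP₁]; field_simp; ring
    · simp [hP₁, hcdef]
  rw [hQ'] at hQ
  refine ⟨c, by positivity, ?_⟩
  have hcx : Continuous fun x : ℝ × ℝ => (![x.1, x.2, c] : R3) :=
    continuous_vec3.comp (g := fun z : (ℝ × ℝ) × ℝ => (![z.1.1, z.1.2, z.2] : R3))
      (f := fun q : ℝ × ℝ => (q, c)) (by fun_prop)
  filter_upwards [hcx.continuousAt.eventually (isOpen_interior.mem_nhds hQ)] with x hx ζ hζ hf z hz
  by_contra! hlt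
  have hzc : 0 < c - z := by linarith
  -- If `B` had a point lower than `ζ` over `x`, then height `ζ` would lie strictly between it and
  -- the interior point at height `c`, and would itself be interior.
  have hm : ((c - ζ) / (c - z)) • (![x.1, x.2, z] : R3) + ((ζ - z) / (c - z)) • ![x.1, x.2, c]
      ∈ interior B :=
    hB.convex.combo_self_interior_mem_interior hz hx (by apply div_nonneg <;> linarith)
      (by apply div_pos <;> linarith) (by field_simp; ring)
  have he : ((c - ζ) / (c - z)) • (![x.1, x.2, z] : R3) + ((ζ - z) / (c - z)) • ![x.1, x.2, c]
      = ![x.1, x.2, ζ] := by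
    ext i
    fin_cases i <;> simp <;> field_simp <;> ring
  rw [he] at hm
  exact hf.2 hm

theorem lowerGraph_eq {x : ℝ × ℝ} {ζ : ℝ} (h : ![x.1, x.2, ζ] ∈ B)
    (h' : ∀ z : ℝ, ![x.1, x.2, z] ∈ B → ζ ≤ z) : lowerGraph B x = ζ :=
  IsLeast.csInf_eq ⟨h, h'⟩

end ConvexBody

/-! ### Level sets -/

/-- The first and second derivatives of the identity `g(x(q)) = ζ(q)^p`. -/
theorem level_identities {g x₁ x₂ ζ : ℝ × ℝ → ℝ} {p : ℝ} {q : ℝ × ℝ}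
    (hg : ContDiffAt ℝ 2 g (x₁ q, x₂ q)) (h₁ : ContDiffAt ℝ 2 x₁ q) (h₂ : ContDiffAt ℝ 2 x₂ q)
    (hζ : ContDiffAt ℝ 2 ζ q) (h0 : 0 < ζ q)
    (he : ∀ᶠ q' in 𝓝 q, g (x₁ q', x₂ q') = ζ q' ^ p) :
    (pd1 g (x₁ q, x₂ q) * pd1 x₁ q + pd2 g (x₁ q, x₂ q) * pd1 x₂ q
      = p * ζ q ^ (p - 1) * pd1 ζ q) ∧
    (pd1 g (x₁ q, x₂ q) * pd2 x₁ q + pd2 g (x₁ q, x₂ q) * pd2 x₂ q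
      = p * ζ q ^ (p - 1) * pd2 ζ q) ∧
    ∀ c : ℝ, pd2 ζ q = c * pd1 ζ q → pd1 g (x₁ q, x₂ q) ^ 2 + pd2 g (x₁ q, x₂ q) ^ 2 ≠ 0 →
      ((pd2 x₁ q - c * pd1 x₁ q) ^ 2 + (pd2 x₂ q - c * pd1 x₂ q) ^ 2)
        * tangentialSecondDeriv g (x₁ q, x₂ q)
      + (pd1 g (x₁ q, x₂ q)
          * (pd2 (pd2 x₁) q - 2 * c * pd1 (pd2 x₁) q + c ^ 2 * pd1 (pd1 x₁) q)
        + pd2 g (x₁ q, x₂ q)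
          * (pd2 (pd2 x₂) q - 2 * c * pd1 (pd2 x₂) q + c ^ 2 * pd1 (pd1 x₂) q))
      = p * ζ q ^ (p - 1) * (pd2 (pd2 ζ) q - 2 * c * pd1 (pd2 ζ) q + c ^ 2 * pd1 (pd1 ζ) q) := by
  have h12 : (1 : WithTop ℕ∞) ≤ 2 := by norm_num
  set φ : ℝ × ℝ → ℝ × ℝ := fun q => (x₁ q, x₂ q) with hφdef
  have hφ : ContDiffAt ℝ 2 φ q := h₁.prodMk h₂
  have d1 : ∀ q', DifferentiableAt ℝ x₁ q' → DifferentiableAt ℝ x₂ q' →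
      pd1 φ q' = (pd1 x₁ q', pd1 x₂ q') := fun q' h h' =>
    (h.hasDerivAt_pd1.prodMk h'.hasDerivAt_pd1).deriv
  have d2 : ∀ q', DifferentiableAt ℝ x₁ q' → DifferentiableAt ℝ x₂ q' →
      pd2 φ q' = (pd2 x₁ q', pd2 x₂ q') := fun q' h h' =>
    (h.hasDerivAt_pd2.prodMk h'.hasDerivAt_pd2).deriv
  have ev1 := (h₁.of_le h12).eventually_differentiableAt
  have ev2 := (h₂.of_le h12).eventually_differentiableAt
  have evζ := (hζ.of_le h12).eventually_differentiableAt
  have evg := hφ.continuousAt.eventually (hg.of_le h12).eventually_differentiableAt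
  have evp : ∀ᶠ q' in 𝓝 q, 0 < ζ q' := hζ.continuousAt.eventually (lt_mem_nhds h0)
  have he' : (fun q => g (φ q)) =ᶠ[𝓝 q] fun q => ζ q ^ p := he
  have r1 : ∀ {r : ℝ} {q'}, 0 < ζ q' → DifferentiableAt ℝ ζ q' →
      pd1 (fun q => ζ q ^ r) q' = r * ζ q' ^ (r - 1) * pd1 ζ q' := fun {r q'} h h' => by
    have := (h'.hasDerivAt_pd1.rpow_const (p := r) (Or.inl h.ne')).deriv
    exact this.trans (by ring)
  have r2 : ∀ {r : ℝ} {q'}, 0 < ζ q' → DifferentiableAt ℝ ζ q' →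
      pd2 (fun q => ζ q ^ r) q' = r * ζ q' ^ (r - 1) * pd2 ζ q' := fun {r q'} h h' => by
    have := (h'.hasDerivAt_pd2.rpow_const (p := r) (Or.inl h.ne')).deriv
    exact this.trans (by ring)
  have I1 : (fun q => pd1 x₁ q • pd1 g (φ q) + pd1 x₂ q • pd2 g (φ q))
      =ᶠ[𝓝 q] fun q => (p * ζ q ^ (p - 1)) • pd1 ζ q := by
    filter_upwards [he'.pd1, ev1, ev2, evζ, evg, evp] with q' e a1 a2 a3 a4 a5
    rw [pd1_comp a4 (a1.prodMk a2), d1 q' a1 a2, r1 a5 a3] at e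
    exact e
  have I2 : (fun q => pd2 x₁ q • pd1 g (φ q) + pd2 x₂ q • pd2 g (φ q))
      =ᶠ[𝓝 q] fun q => (p * ζ q ^ (p - 1)) • pd2 ζ q := by
    filter_upwards [he'.pd2, ev1, ev2, evζ, evg, evp] with q' e a1 a2 a3 a4 a5
    rw [pd2_comp a4 (a1.prodMk a2), d2 q' a1 a2, r2 a5 a3] at e
    exact e
  have e1 := I1.self_of_nhds
  have e2 := I2.self_of_nhds
  simp only [smul_eq_mul] at e1 e2
  refine ⟨by linear_combination e1, by linear_combination e2, fun c hc hne => ?_⟩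
  have a1 := ev1.self_of_nhds
  have a2 := ev2.self_of_nhds
  have a3 := evζ.self_of_nhds
  have dφ : DifferentiableAt ℝ φ q := a1.prodMk a2
  have g1 : DifferentiableAt ℝ (pd1 g) (φ q) := hg.pd1.differentiableAt one_ne_zero
  have g2 : DifferentiableAt ℝ (pd2 g) (φ q) := hg.pd2.differentiableAt one_ne_zero
  have cg1 : DifferentiableAt ℝ (fun q => pd1 g (φ q)) q := g1.comp q dφ
  have cg2 : DifferentiableAt ℝ (fun q => pd2 g (φ q)) q := g2.comp q dφ
  have x11 := h₁.pd1.differentiableAt one_ne_zero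
  have x12 := h₁.pd2.differentiableAt one_ne_zero
  have x21 := h₂.pd1.differentiableAt one_ne_zero
  have x22 := h₂.pd2.differentiableAt one_ne_zero
  have ζ1 := hζ.pd1.differentiableAt one_ne_zero
  have ζ2 := hζ.pd2.differentiableAt one_ne_zero
  have dZ : DifferentiableAt ℝ (fun q => p * ζ q ^ (p - 1)) q :=
    (a3.rpow_const (Or.inl h0.ne')).const_mul p
  have Z1 : pd1 (fun q => p * ζ q ^ (p - 1)) q
      = p * ((p - 1) * ζ q ^ (p - 1 - 1)) * pd1 ζ q := by
    have := ((a3.rpow_const (p := p - 1) (Or.inl h0.ne')).hasDerivAt_pd1.const_mul p).deriv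
    refine Eq.trans this ?_
    rw [r1 h0 a3]; ring
  have Z2 : pd2 (fun q => p * ζ q ^ (p - 1)) q
      = p * ((p - 1) * ζ q ^ (p - 1 - 1)) * pd2 ζ q := by
    have := ((a3.rpow_const (p := p - 1) (Or.inl h0.ne')).hasDerivAt_pd2.const_mul p).deriv
    refine Eq.trans this ?_
    rw [r2 h0 a3]; ring
  have hs : pd2 (pd1 g) (φ q) = pd1 (pd2 g) (φ q) := (pd1_pd2_comm hg).symm
  have zz := I1.pd1.self_of_nhds
  have zy := I2.pd1.self_of_nhds
  have yy := I2.pd2.self_of_nhds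
  rw [pd1_add (x11.fun_smul cg1) (x21.fun_smul cg2), pd1_smul x11 cg1, pd1_smul x21 cg2,
    pd1_comp g1 dφ, pd1_comp g2 dφ, pd1_smul dZ ζ1, hs, d1 q a1 a2] at zz
  rw [pd1_add (x12.fun_smul cg1) (x22.fun_smul cg2), pd1_smul x12 cg1, pd1_smul x22 cg2,
    pd1_comp g1 dφ, pd1_comp g2 dφ, pd1_smul dZ ζ2, hs, d1 q a1 a2] at zy
  rw [pd2_add (x12.fun_smul cg1) (x22.fun_smul cg2), pd2_smul x12 cg1, pd2_smul x22 cg2,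
    pd2_comp g1 dφ, pd2_comp g2 dφ, pd2_smul dZ ζ2, hs, d2 q a1 a2] at yy
  simp only [smul_eq_mul] at zz zy yy
  rw [Z1] at zz zy
  rw [Z2] at yy
  rw [tangentialSecondDeriv]
  change pd1 g (φ q) ^ 2 + pd2 g (φ q) ^ 2 ≠ 0 at hne
  change ((pd2 x₁ q - c * pd1 x₁ q) ^ 2 + (pd2 x₂ q - c * pd1 x₂ q) ^ 2)
        * ((pd1 (pd1 g) (φ q) * pd2 g (φ q) ^ 2 - 2 * pd1 (pd2 g) (φ q) * pd1 g (φ q)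
          * pd2 g (φ q) + pd2 (pd2 g) (φ q) * pd1 g (φ q) ^ 2)
          / (pd1 g (φ q) ^ 2 + pd2 g (φ q) ^ 2))
      + (pd1 g (φ q) * (pd2 (pd2 x₁) q - 2 * c * pd1 (pd2 x₁) q + c ^ 2 * pd1 (pd1 x₁) q)
        + pd2 g (φ q) * (pd2 (pd2 x₂) q - 2 * c * pd1 (pd2 x₂) q + c ^ 2 * pd1 (pd1 x₂) q)) = _
  set G11 := pd1 (pd1 g) (φ q)
  set G12 := pd1 (pd2 g) (φ q)
  set G22 := pd2 (pd2 g) (φ q)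
  set G1 := pd1 g (φ q)
  set G2 := pd2 g (φ q)
  set V1 := pd2 x₁ q - c * pd1 x₁ q with hV1
  set V2 := pd2 x₂ q - c * pd1 x₂ q with hV2
  -- By the choice of `c`, the vector `V = x_y - c x_z` is tangent to the level curve of the height.
  -- Hence it is orthogonal to `Dg`, and `D²g(V, V) = |V|² g_ττ`.
  have hV : G1 * V1 + G2 * V2 = 0 := by
    rw [hV1, hV2]; linear_combination e2 - c * e1 + (p * ζ q ^ (p - 1)) * hc
  have key : (V1 ^ 2 + V2 ^ 2) * ((G11 * G2 ^ 2 - 2 * G12 * G1 * G2 + G22 * G1 ^ 2)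
      / (G1 ^ 2 + G2 ^ 2)) = G11 * V1 ^ 2 + 2 * G12 * (V1 * V2) + G22 * V2 ^ 2 := by
    rw [mul_div_assoc', div_eq_iff hne]
    linear_combination (-(G11 * (G1 * V1 - G2 * V2)) - 2 * G12 * (G1 * V2 + G2 * V1)
      + G22 * (G1 * V1 - G2 * V2)) * hV
  rw [key, hV1, hV2]
  -- This is the operator `D_yy - 2c D_zy + c² D_zz` applied to the identity, with `c` frozen. The
  -- terms quadratic in the first derivatives of the height cancel because `ζ_y = c ζ_z`.
  linear_combination yy - 2 * c * zy + c ^ 2 * zz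
    + (p * ((p - 1) * ζ q ^ (p - 1 - 1))) * (pd2 ζ q - c * pd1 ζ q) * hc

/-- A smooth function that vanishes for `z = 0`, divided by `z`. -/
theorem tendsto_div_fst {f : ℝ × ℝ → ℝ} (hf : ContDiff ℝ ∞ f) (h0 : ∀ y, f (0, y) = 0) (y₀ : ℝ) :
    Tendsto (fun q : ℝ × ℝ => f q / q.1) (𝓝[{q | 0 < q.1}] (0, y₀)) (𝓝 (pd1 f (0, y₀))) := by
  have hs := (hf.contDiffAt (x := ((0 : ℝ), y₀))).hasStrictFDerivAt (by simp)
  have h2 : Tendsto (fun q : ℝ × ℝ => (q, ((0 : ℝ), q.2))) (𝓝[{q | 0 < q.1}] (0, y₀))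
      (𝓝 (((0 : ℝ), y₀), ((0 : ℝ), y₀))) :=
    (Continuous.tendsto' (by fun_prop) _ _ rfl).mono_left nhdsWithin_le_nhds
  have h3 : (fun q : ℝ × ℝ => f q - fderiv ℝ f (0, y₀) (q.1, 0)) =o[𝓝[{q | 0 < q.1}] (0, y₀)]
      fun q => q.1 := by
    refine ((hs.isLittleO.comp_tendsto h2).congr_left fun q => ?_).trans_isBigO
      (Asymptotics.IsBigO.of_bound 1 (Eventually.of_forall fun q => ?_))
    · have e : q - (0, q.2) = (q.1, 0) := by ext <;> simp
      simp only [Function.comp_apply, h0, sub_zero, e]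
    · have e : q - (0, q.2) = (q.1, 0) := by ext <;> simp
      simp [e]
  have h4 := h3.tendsto_div_nhds_zero.add_const (pd1 f (0, y₀))
  rw [zero_add] at h4
  refine h4.congr' ?_
  filter_upwards [self_mem_nhdsWithin] with q hq
  have hq' : q.1 ≠ 0 := ne_of_gt hq
  have hd := (hf.contDiffAt (x := ((0 : ℝ), y₀))).differentiableAt (by simp)
  rw [fderiv_apply_eq hd]
  simp
  field_simp
  ring

/-! ### Behaviour at the boundary -/

/-- Points approaching the boundary point `(0, y₀)` of the half plane from inside. -/
def bdryFilter (y₀ : ℝ) : Filter (ℝ × ℝ) := 𝓝[{q | 0 < q.1}] (0, y₀)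

theorem bdryFilter_le_nhds (y₀ : ℝ) : bdryFilter y₀ ≤ 𝓝 (0, y₀) := nhdsWithin_le_nhds

theorem tendsto_bdryFilter_scale (y₀ : ℝ) {a : ℝ} (ha : 0 < a) :
    Tendsto (fun q : ℝ × ℝ => (q.1 * a, q.2)) (bdryFilter y₀) (bdryFilter y₀) := by
  refine tendsto_nhdsWithin_iff.2 ⟨?_, ?_⟩
  · exact (Continuous.tendsto' (by fun_prop) _ _ (by simp)).mono_left (bdryFilter_le_nhds y₀)
  · filter_upwards [self_mem_nhdsWithin] with q hq
    exact mul_pos hq ha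

theorem eventually_bdryFilter (y₀ : ℝ) {δ : ℝ} (hδ : 0 < δ) :
    ∀ᶠ q in bdryFilter y₀, 0 < q.1 ∧ q.1 < δ := by
  have h1 : ∀ᶠ q : ℝ × ℝ in bdryFilter y₀, q.1 < δ :=
    (Continuous.tendsto' continuous_fst _ _ rfl).mono_left (bdryFilter_le_nhds y₀)
      |>.eventually (gt_mem_nhds hδ)
  exact (eventually_mem_nhdsWithin.mono fun q hq => hq).and h1

instance (y₀ : ℝ) : (bdryFilter y₀).NeBot := by
  refine mem_closure_iff_nhdsWithin_neBot.1 ?_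
  have : Tendsto (fun n : ℕ => ((1 : ℝ) / ((n : ℝ) + 1), y₀)) atTop (𝓝 (0, y₀)) :=
    tendsto_one_div_add_atTop_nhds_zero_nat.prodMk_nhds tendsto_const_nhds
  refine mem_closure_of_tendsto this (Eventually.of_forall fun n => ?_)
  simp only [mem_ofPred_eq]
  positivity

/-- If `P` converges at the boundary and `z P_z` is Hölder continuous with respect to `ln z`, then
`z P_z` converges to zero. -/
theorem tendsto_zero_of_log_holder {P β : ℝ × ℝ → ℝ} {L C α y₀ : ℝ} (hα : 0 < α) (hC : 0 ≤ C)
    (hd : ∀ q : ℝ × ℝ, 0 < q.1 → q.1 < 1 / 2 → HasDerivAt (fun s => P (s, q.2)) (β q / q.1) q.1)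
    (hP : Tendsto P (bdryFilter y₀) (𝓝 L))
    (hβ : ∀ z z' y : ℝ, 0 < z → z < 1 / 2 → 0 < z' → z' < 1 / 2 →
      |β (z, y) - β (z', y)| ≤ C * |Real.log z - Real.log z'| ^ α) :
    Tendsto β (bdryFilter y₀) (𝓝 0) := by
  refine Metric.tendsto_nhds.2 fun ε hε => ?_
  obtain ⟨h, hh0, hh⟩ : ∃ h : ℝ, 0 < h ∧ C * h ^ α < ε / 2 := by
    have hc : Tendsto (fun h : ℝ => C * h ^ α) (𝓝[>] 0) (𝓝 0) := by
      have : ContinuousAt (fun h : ℝ => C * h ^ α) 0 :=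
        continuousAt_const.mul (Real.continuousAt_rpow_const _ _ (Or.inr hα.le))
      have h0 := this.tendsto
      simp only [Real.zero_rpow hα.ne', mul_zero] at h0
      exact h0.mono_left nhdsWithin_le_nhds
    obtain ⟨h, h1, h2⟩ := ((hc.eventually (gt_mem_nhds (half_pos hε))).and
      self_mem_nhdsWithin).exists
    exact ⟨h, h2, h1⟩
  have e1 := Real.exp_pos h
  -- Convergence of `P` makes its increment from `z` to `z e^h` tend to zero. By the mean value
  -- theorem in `ln z`, `β` is small at some point at logarithmic distance less than `h`, and the
  -- Hölder bound moves this back to `z`.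
  have hP' := (hP.comp (tendsto_bdryFilter_scale y₀ e1)).sub hP
  rw [sub_self] at hP'
  have hev := Metric.tendsto_nhds.1 hP' (ε / 2 * h) (by positivity)
  filter_upwards [hev, eventually_bdryFilter y₀ (show 0 < 1 / 2 * Real.exp (-h) by positivity)]
    with q hq hz
  obtain ⟨hz0, hz1⟩ := hz
  have hlt : ∀ r ≤ h, q.1 * Real.exp r < 1 / 2 := fun r hr => by
    have h2 : Real.exp r ≤ Real.exp h := Real.exp_le_exp.2 hr
    have h3 : Real.exp (-h) * Real.exp h = 1 := by rw [← Real.exp_add]; simp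
    calc q.1 * Real.exp r ≤ q.1 * Real.exp h := by gcongr
      _ < 1 / 2 * Real.exp (-h) * Real.exp h := by gcongr
      _ = 1 / 2 := by rw [mul_assoc, h3, mul_one]
  have hder : ∀ r ≤ h, HasDerivAt (fun r => P (q.1 * Real.exp r, q.2))
      (β (q.1 * Real.exp r, q.2)) r := fun r hr => by
    have hpos : 0 < q.1 * Real.exp r := by positivity
    have a := (hd (q.1 * Real.exp r, q.2) hpos (hlt r hr)).comp r
      ((Real.hasDerivAt_exp r).const_mul q.1)
    exact a.congr_deriv (by simp only; field_simp)
  obtain ⟨r, hr, he⟩ := exists_hasDerivAt_eq_slope (fun r => P (q.1 * Real.exp r, q.2))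
    (fun r => β (q.1 * Real.exp r, q.2)) hh0
    (fun r hr => (hder r hr.2).continuousAt.continuousWithinAt) fun r hr => hder r hr.2.le
  simp only [Real.exp_zero, mul_one, sub_zero] at he
  rw [Real.dist_eq, sub_zero] at hq ⊢
  simp only [Function.comp_apply] at hq
  have h1 : |β (q.1 * Real.exp r, q.2)| < ε / 2 := by
    rw [he, abs_div, abs_of_pos hh0, div_lt_iff₀ hh0]; exact hq
  have h2 := hβ q.1 (q.1 * Real.exp r) q.2 hz0 (by simpa using hlt 0 hh0.le)
    (by positivity) (hlt r hr.2.le)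
  rw [Real.log_mul hz0.ne' (Real.exp_pos r).ne', Real.log_exp,
    show Real.log q.1 - (Real.log q.1 + r) = -r by ring, abs_neg, abs_of_pos hr.1] at h2
  have h3 : C * r ^ α ≤ C * h ^ α := by
    have := Real.rpow_le_rpow hr.1.le hr.2.le hα.le
    gcongr
  calc |β q| = |(β (q.1, q.2) - β (q.1 * Real.exp r, q.2)) + β (q.1 * Real.exp r, q.2)| := by
        rw [sub_add_cancel]
    _ ≤ _ := abs_add_le _ _
    _ < ε := by linarith

theorem tendsto_zero_mul_of_bdd {X : Type*} {l : Filter X} {f g : X → ℝ} {C : ℝ}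
    (hf : Tendsto f l (𝓝 0)) (hg : ∀ᶠ x in l, |g x| ≤ C) :
    Tendsto (fun x => f x * g x) l (𝓝 0) := by
  have h0 := hf.abs.mul_const C
  rw [abs_zero, zero_mul] at h0
  refine squeeze_zero_norm' ?_ h0
  filter_upwards [hg] with x hx
  rw [Real.norm_eq_abs, abs_mul]
  gcongr

/-- The data at a point `(0, y₀)` of the boundary: a surface `s + w t` in the coordinates `(z, y)`,
whose height is `s₂`, whose horizontal part is mapped by `g` to the `p`-th power of the height. -/
structure BoundaryPoint (s t : ℝ × ℝ → R3) (w g : ℝ × ℝ → ℝ) (p α δ C y₀ d₁ d₂ e : ℝ) : Prop where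
  α_pos : 0 < α
  p_pos : 0 < p
  p_lt : p < 1
  smooth_s : ContDiff ℝ ∞ s
  smooth_t : ContDiff ℝ ∞ t
  s_zero : ∀ y, s (0, y) 2 = 0
  δ_pos : 0 < δ
  t_zero : ∀ q : ℝ × ℝ, 0 ≤ q.1 → q.1 < δ → t q 2 = 0
  smooth_w : ∀ q : ℝ × ℝ, 0 < q.1 → q.1 < 1 / 2 → ContDiffAt ℝ 2 w q
  C_nonneg : 0 ≤ C
  bound : ∀ q : ℝ × ℝ, 0 < q.1 → q.1 < 1 / 2 → ∀ i, |jetOf (polarWeights p q) w q i| ≤ C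
  holder : ∀ z z' y : ℝ, 0 < z → z < 1 / 2 → 0 < z' → z' < 1 / 2 →
    |(jetOf (polarWeights p (z, y)) w (z, y) 5 + (1 - p) * jetOf (polarWeights p (z, y)) w (z, y) 3)
      - (jetOf (polarWeights p (z', y)) w (z', y) 5
        + (1 - p) * jetOf (polarWeights p (z', y)) w (z', y) 3)|
      ≤ C * |Real.log z - Real.log z'| ^ α
  graph : ∀ᶠ q in bdryFilter y₀,
    ContDiffAt ℝ 2 g (s q 0 + w q * t q 0, s q 1 + w q * t q 1) ∧ 0 < s q 2 ∧
    ∀ᶠ q' in 𝓝 q, g (s q' 0 + w q' * t q' 0, s q' 1 + w q' * t q' 1) = s q' 2 ^ p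
  tendsto₁ : Tendsto (fun q => pd1 g (s q 0 + w q * t q 0, s q 1 + w q * t q 1))
    (bdryFilter y₀) (𝓝 d₁)
  tendsto₂ : Tendsto (fun q => pd2 g (s q 0 + w q * t q 0, s q 1 + w q * t q 1))
    (bdryFilter y₀) (𝓝 d₂)
  tendsto_e : Tendsto
    (fun q => tangentialSecondDeriv g (s q 0 + w q * t q 0, s q 1 + w q * t q 1))
    (bdryFilter y₀) (𝓝 e)
  d_ne : d₁ ^ 2 + d₂ ^ 2 ≠ 0
  e_pos : 0 < e

namespace BoundaryPoint

variable {s t : ℝ × ℝ → R3} {w g : ℝ × ℝ → ℝ} {p α δ C y₀ d₁ d₂ e : ℝ}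

theorem pd1_comp_eq {V : ℝ × ℝ → R3} (hV : ContDiff ℝ ∞ V) (i : Fin 3) :
    (fun q => pd1 V q i) = pd1 fun q => V q i := funext fun q => hV.pd1_apply q i

theorem pd2_comp_eq {V : ℝ × ℝ → R3} (hV : ContDiff ℝ ∞ V) (i : Fin 3) :
    (fun q => pd2 V q i) = pd2 fun q => V q i := funext fun q => hV.pd2_apply q i

variable (h : BoundaryPoint s t w g p α δ C y₀ d₁ d₂ e)
include h

/-- First and second derivatives of a component of the surface, in the normalized form. -/
theorem comp_eq {q : ℝ × ℝ} (hq : 0 < q.1) (hq' : q.1 < 1 / 2) (i : Fin 3) :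
    let F := mkFrame s t (polarWeights p q) q
    let x := jetOf (polarWeights p q) w q
    let X := fun q => s q i + w q * t q i
    ContDiffAt ℝ 2 X q ∧ q.1 ^ (1 - p) * pd1 X q = nfXz F x i ∧ q.1 * pd1 X q = q.1 ^ p * nfXz F x i ∧
      pd2 X q = nfXy F x i ∧
      q.1 ^ 2 * pd1 (pd1 X) q = q.1 ^ 2 * nfl F x i
        + q.1 ^ p * (2 * q.1 * x 3 * F 6 i + x 5 * F 5 i) ∧
      q.1 * pd1 (pd2 X) q = q.1 * nfm F x i + q.1 ^ p * (x 3 * F 7 i + x 4 * F 5 i) ∧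
      pd2 (pd2 X) q = nfXyy F x i := by
  intro F x X
  have hw := h.smooth_w q hq hq'
  have cs : ContDiff ℝ ∞ fun q => s q i := (contDiff_apply ℝ ℝ i).comp h.smooth_s
  have ct : ContDiff ℝ ∞ fun q => t q i := (contDiff_apply ℝ ℝ i).comp h.smooth_t
  obtain ⟨k1, k2, k3, k4, k5⟩ := pd_graph (cs.contDiffAt_two q) (ct.contDiffAt_two q) hw
  simp only [← pd1_comp_eq h.smooth_s, ← pd2_comp_eq h.smooth_s, ← pd1_comp_eq h.smooth_t,
    ← pd2_comp_eq h.smooth_t, ← pd1_comp_eq h.smooth_s.pd1, ← pd1_comp_eq h.smooth_s.pd2,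
    ← pd2_comp_eq h.smooth_s.pd2, ← pd1_comp_eq h.smooth_t.pd1, ← pd1_comp_eq h.smooth_t.pd2,
    ← pd2_comp_eq h.smooth_t.pd2, smul_eq_mul] at k1 k2 k3 k4 k5
  have e : q.1 = q.1 ^ p * q.1 ^ (1 - p) := by
    rw [← Real.rpow_add hq]; simp
  have x0 : x 0 = w q := rfl
  have x1 : x 1 = pd2 w q := rfl
  have x2 : x 2 = pd2 (pd2 w) q := rfl
  have x3 : x 3 = q.1 ^ (1 - p) * pd1 w q := rfl
  have x4 : x 4 = q.1 ^ (1 - p) * pd1 (pd2 w) q := rfl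
  have x5 : x 5 = q.1 * q.1 ^ (1 - p) * pd1 (pd1 w) q := rfl
  have f : F 16 2 = q.1 ^ (1 - p) := rfl
  have hz : q.1 ^ (1 - p) * pd1 X q = nfXz F x i := by
    rw [k1]
    change _ = x 3 * t q i + F 16 2 * (pd1 s q i + x 0 * pd1 t q i)
    rw [x3, f, x0]; ring
  refine ⟨(cs.contDiffAt_two q).add (hw.mul (ct.contDiffAt_two q)), hz, ?_, ?_, ?_, ?_, ?_⟩
  · rw [← hz]; linear_combination (pd1 X q) * e
  · rw [k2]; rfl
  · rw [k3]
    change _ = q.1 ^ 2 * (pd1 (pd1 s) q i + x 0 * pd1 (pd1 t) q i)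
        + q.1 ^ p * (2 * q.1 * x 3 * pd1 t q i + x 5 * t q i)
    rw [x0, x3, x5]
    linear_combination (q.1 * (2 * pd1 w q * pd1 t q i + pd1 (pd1 w) q * t q i)) * e
  · rw [k4]
    change _ = q.1 * (pd1 (pd2 s) q i + x 0 * pd1 (pd2 t) q i + x 1 * pd1 t q i)
        + q.1 ^ p * (x 3 * pd2 t q i + x 4 * t q i)
    rw [x0, x1, x3, x4]
    linear_combination (pd1 w q * pd2 t q i + pd1 (pd2 w) q * t q i) * e
  · rw [k5]; rfl

/-- The third components of the derivatives of `t` vanish near the boundary. -/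
theorem t_deriv_zero {q : ℝ × ℝ} (hq : 0 < q.1) (hq' : q.1 < δ) :
    pd1 t q 2 = 0 ∧ pd2 t q 2 = 0 ∧ pd2 (pd2 t) q 2 = 0 := by
  have hn : ∀ᶠ q' : ℝ × ℝ in 𝓝 q, 0 < q'.1 ∧ q'.1 < δ :=
    (continuous_fst.continuousAt.eventually (lt_mem_nhds hq)).and
      (continuous_fst.continuousAt.eventually (gt_mem_nhds hq'))
  have h0 : (fun q => t q 2) =ᶠ[𝓝 q] fun _ => 0 := hn.mono fun q' hq' => h.t_zero q' hq'.1.le hq'.2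
  have c1 : pd1 (fun _ : ℝ × ℝ => (0 : ℝ)) = fun _ => 0 := by funext q; simp [pd1]
  have c2 : pd2 (fun _ : ℝ × ℝ => (0 : ℝ)) = fun _ => 0 := by funext q; simp [pd2]
  have h2 := h0.pd2
  have h22 := h0.pd2.pd2.self_of_nhds
  rw [c2, c2] at h22
  rw [c2] at h2
  refine ⟨?_, ?_, ?_⟩
  · rw [h.smooth_t.pd1_apply, h0.pd1.self_of_nhds, c1]
  · rw [h.smooth_t.pd2_apply]; exact h2.self_of_nhds
  · rw [h.smooth_t.pd2.pd2_apply, pd2_comp_eq h.smooth_t]; exact h22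

end BoundaryPoint

theorem tendsto_rpow_bdryFilter {r : ℝ} (hr : 0 < r) (y₀ : ℝ) :
    Tendsto (fun q : ℝ × ℝ => q.1 ^ r) (bdryFilter y₀) (𝓝 0) := by
  have h : ContinuousAt (fun q : ℝ × ℝ => q.1 ^ r) (0, y₀) :=
    continuousAt_fst.rpow_const (Or.inr hr.le)
  have := h.tendsto.mono_left (bdryFilter_le_nhds y₀)
  simpa [Real.zero_rpow hr.ne'] using this

theorem ContDiff.tendsto_bdryFilter {E : Type*} [NormedAddCommGroup E] [NormedSpace ℝ E]
    {f : ℝ × ℝ → E} (hf : ContDiff ℝ ∞ f) (y₀ : ℝ) :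
    Tendsto f (bdryFilter y₀) (𝓝 (f (0, y₀))) :=
  hf.continuous.continuousAt.tendsto.mono_left (bdryFilter_le_nhds y₀)

namespace BoundaryPoint

variable {s t : ℝ × ℝ → R3} {w g : ℝ × ℝ → ℝ} {p α δ C y₀ d₁ d₂ e : ℝ}
  (h : BoundaryPoint s t w g p α δ C y₀ d₁ d₂ e)
include h

theorem smooth_height : ContDiff ℝ ∞ fun q => s q 2 := (contDiff_apply ℝ ℝ 2).comp h.smooth_s

/-- The level set identities, in the normalized form. -/
theorem eventually_level : ∀ᶠ q in bdryFilter y₀,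
    (0 < q.1 ∧ q.1 < 1 / 2) ∧ q.1 < δ ∧ 0 < s q 2 ∧
    let F := mkFrame s t (polarWeights p q) q
    let x := jetOf (polarWeights p q) w q
    let a : ℝ × ℝ := (s q 0 + w q * t q 0, s q 1 + w q * t q 1)
    (pd1 g a * nfXz F x 0 + pd2 g a * nfXz F x 1
      = p * (s q 2 / q.1) ^ (p - 1) * pd1 (fun q => s q 2) q) ∧
    ∀ c : ℝ, pd2 (fun q => s q 2) q / q.1 = c * pd1 (fun q => s q 2) q →
      pd1 g a ^ 2 + pd2 g a ^ 2 ≠ 0 →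
      (pd1 g a * (nfXy F x 0 - c * (q.1 ^ p * nfXz F x 0))
        + pd2 g a * (nfXy F x 1 - c * (q.1 ^ p * nfXz F x 1)) = 0) ∧
      ((nfXy F x 0 - c * (q.1 ^ p * nfXz F x 0)) ^ 2 + (nfXy F x 1 - c * (q.1 ^ p * nfXz F x 1)) ^ 2)
        * tangentialSecondDeriv g a
      + (pd1 g a * (nfXyy F x 0
            - 2 * c * (q.1 * nfm F x 0 + q.1 ^ p * (x 3 * F 7 0 + x 4 * F 5 0))
            + c ^ 2 * (q.1 ^ 2 * nfl F x 0 + q.1 ^ p * (2 * q.1 * x 3 * F 6 0 + x 5 * F 5 0)))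
        + pd2 g a * (nfXyy F x 1
            - 2 * c * (q.1 * nfm F x 1 + q.1 ^ p * (x 3 * F 7 1 + x 4 * F 5 1))
            + c ^ 2 * (q.1 ^ 2 * nfl F x 1 + q.1 ^ p * (2 * q.1 * x 3 * F 6 1 + x 5 * F 5 1))))
      = p * (s q 2 / q.1) ^ (p - 1) * q.1 ^ p * (pd2 (pd2 fun q => s q 2) q / q.1
          - 2 * c * pd1 (pd2 fun q => s q 2) q + c ^ 2 * q.1 * pd1 (pd1 fun q => s q 2) q) := by
  filter_upwards [h.graph, eventually_bdryFilter y₀ (lt_min h.δ_pos (show (0 : ℝ) < 1 / 2 by norm_num))]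
    with q ⟨hg, h0, he⟩ ⟨hq, hq'⟩
  have hq1 := lt_of_lt_of_le hq' (min_le_right _ _)
  refine ⟨⟨hq, hq1⟩, lt_of_lt_of_le hq' (min_le_left _ _), h0, ?_⟩
  intro F x a
  obtain ⟨c0, z0, zz0, y0, l0, m0, n0⟩ := h.comp_eq hq hq1 0
  obtain ⟨c1, z1, zz1, y1, l1, m1, n1⟩ := h.comp_eq hq hq1 1
  obtain ⟨i1, i2, i3⟩ := level_identities (ζ := fun q => s q 2) hg c0 c1
    (h.smooth_height.contDiffAt_two q) h0 he
  have hz : (s q 2 / q.1) ^ (p - 1) = s q 2 ^ (p - 1) * q.1 ^ (1 - p) := by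
    rw [Real.div_rpow h0.le hq.le, div_eq_mul_inv, ← Real.rpow_neg hq.le, neg_sub]
  have hz1 : (s q 2 / q.1) ^ (p - 1) * q.1 ^ p = s q 2 ^ (p - 1) * q.1 := by
    rw [hz, mul_assoc, ← Real.rpow_add hq]; simp
  refine ⟨?_, fun c hc hne => ⟨?_, ?_⟩⟩
  · rw [← z0, ← z1, hz]
    linear_combination q.1 ^ (1 - p) * i1
  · rw [← y0, ← y1, ← zz0, ← zz1]
    rw [div_eq_iff hq.ne'] at hc
    linear_combination i2 - c * q.1 * i1 + p * s q 2 ^ (p - 1) * hc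
  · have k := i3 (c * q.1) (by rw [div_eq_iff hq.ne'] at hc; linear_combination hc) hne
    rw [mul_assoc p, hz1, ← y0, ← y1, ← zz0, ← zz1, ← l0, ← l1, ← m0, ← m1, ← n0, ← n1]
    have e1 : q.1 * (pd2 (pd2 fun q => s q 2) q / q.1) = pd2 (pd2 fun q => s q 2) q :=
      mul_div_cancel₀ _ hq.ne'
    linear_combination k - p * s q 2 ^ (p - 1) * e1

theorem tendsto_height_div : Tendsto (fun q => s q 2 / q.1) (bdryFilter y₀)
    (𝓝 (pd1 (fun q => s q 2) (0, y₀))) :=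
  tendsto_div_fst h.smooth_height h.s_zero y₀

theorem tendsto_rpow_mul_w : Tendsto (fun q => q.1 ^ (1 - p) * w q) (bdryFilter y₀) (𝓝 0) := by
  refine tendsto_zero_mul_of_bdd (C := C)
    (tendsto_rpow_bdryFilter (sub_pos.2 h.p_lt) y₀) ?_
  filter_upwards [eventually_bdryFilter y₀ (show (0 : ℝ) < 1 / 2 by norm_num)] with q hq
  exact h.bound q hq.1 hq.2 0

/-- The normalized normal derivative of `w` has a positive multiple as limit. -/
theorem tendsto_jet_three (hσ : 0 < pd1 (fun q => s q 2) (0, y₀)) :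
    ∃ L : ℝ, L ≠ 0 ∧
      Tendsto (fun q => jetOf (polarWeights p q) w q 3) (bdryFilter y₀) (𝓝 L) := by
  set σ := pd1 (fun q => s q 2) (0, y₀) with hσd
  set D : ℝ × ℝ → ℝ := fun q => pd1 g (s q 0 + w q * t q 0, s q 1 + w q * t q 1)
  set E : ℝ × ℝ → ℝ := fun q => pd2 g (s q 0 + w q * t q 0, s q 1 + w q * t q 1)
  have tt : ∀ i, Tendsto (fun q => t q i) (bdryFilter y₀) (𝓝 (t (0, y₀) i)) := fun i =>
    tendsto_pi_nhds.1 (h.smooth_t.tendsto_bdryFilter y₀) i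
  have tt1 : ∀ i, Tendsto (fun q => pd1 t q i) (bdryFilter y₀) (𝓝 (pd1 t (0, y₀) i)) := fun i =>
    tendsto_pi_nhds.1 (h.smooth_t.pd1.tendsto_bdryFilter y₀) i
  have ts1 : ∀ i, Tendsto (fun q => pd1 s q i) (bdryFilter y₀) (𝓝 (pd1 s (0, y₀) i)) := fun i =>
    tendsto_pi_nhds.1 (h.smooth_s.pd1.tendsto_bdryFilter y₀) i
  have hr := tendsto_rpow_bdryFilter (sub_pos.2 h.p_lt) y₀
  have hC : ∀ i, Tendsto (fun q => q.1 ^ (1 - p) * pd1 s q i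
      + (q.1 ^ (1 - p) * w q) * pd1 t q i) (bdryFilter y₀) (𝓝 0) := fun i => by
    simpa using (hr.mul (ts1 i)).add (h.tendsto_rpow_mul_w.mul (tt1 i))
  have hR : Tendsto (fun q => p * (s q 2 / q.1) ^ (p - 1) * pd1 (fun q => s q 2) q)
      (bdryFilter y₀) (𝓝 (p * σ ^ (p - 1) * σ)) :=
    ((h.tendsto_height_div.rpow_const (Or.inl hσ.ne')).const_mul p).mul
      (h.smooth_height.pd1.tendsto_bdryFilter y₀)
  have ha : Tendsto (fun q => D q * t q 0 + E q * t q 1) (bdryFilter y₀)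
      (𝓝 (d₁ * t (0, y₀) 0 + d₂ * t (0, y₀) 1)) :=
    (h.tendsto₁.mul (tt 0)).add (h.tendsto₂.mul (tt 1))
  have hκ : 0 < p * σ ^ (p - 1) * σ := by have := h.p_pos; positivity
  -- In the first-order level identity `z^{1-p} X_z = x₃ t + z^{1-p} (s_z + w t_z)`, and the last
  -- summand tends to zero. So `⟨Dg, t⟩ x₃` tends to `p σ^{p-1} σ > 0`.
  have hx : Tendsto (fun q => (D q * t q 0 + E q * t q 1) * jetOf (polarWeights p q) w q 3)
      (bdryFilter y₀) (𝓝 (p * σ ^ (p - 1) * σ)) := by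
    have k := hR.sub ((h.tendsto₁.mul (hC 0)).add (h.tendsto₂.mul (hC 1)))
    simp only [mul_zero, add_zero, sub_zero] at k
    refine k.congr' ?_
    filter_upwards [h.eventually_level] with q ⟨_, _, _, hl, _⟩
    rw [← hl]
    change D q * (jetOf (polarWeights p q) w q 3 * t q 0 + q.1 ^ (1 - p) * (pd1 s q 0 + w q * pd1 t q 0))
      + E q * (jetOf (polarWeights p q) w q 3 * t q 1 + q.1 ^ (1 - p) * (pd1 s q 1 + w q * pd1 t q 1))
      - (D q * _ + E q * _) = _
    ring
  have hb : ∀ᶠ q in bdryFilter y₀, |jetOf (polarWeights p q) w q 3| ≤ C := by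
    filter_upwards [eventually_bdryFilter y₀ (show (0 : ℝ) < 1 / 2 by norm_num)] with q hq
    exact h.bound q hq.1 hq.2 3
  -- Otherwise, `x₃` being bounded, the product would tend to zero.
  have ha0 : d₁ * t (0, y₀) 0 + d₂ * t (0, y₀) 1 ≠ 0 := by
    intro h0
    rw [h0] at ha
    exact hκ.ne' (tendsto_nhds_unique hx (tendsto_zero_mul_of_bdd ha hb))
  refine ⟨_, div_ne_zero hκ.ne' ha0, (hx.div ha ha0).congr' ?_⟩
  filter_upwards [ha.eventually_ne ha0] with q hq
  exact mul_div_cancel_left₀ _ hq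

/-- The limits of the normalized normal derivatives of `w`. -/
theorem tendsto_jet_five {L : ℝ}
    (hL : Tendsto (fun q => jetOf (polarWeights p q) w q 3) (bdryFilter y₀) (𝓝 L)) :
    Tendsto (fun q => jetOf (polarWeights p q) w q 5) (bdryFilter y₀) (𝓝 (-((1 - p) * L))) := by
  -- `z D_z` of the entry `x₃ = z^{1-p} w_z` is `x₅ + (1 - p) x₃`.
  have hβ := tendsto_zero_of_log_holder (P := fun q => jetOf (polarWeights p q) w q 3)
    (β := fun q => jetOf (polarWeights p q) w q 5 + (1 - p) * jetOf (polarWeights p q) w q 3)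
    h.α_pos h.C_nonneg (fun q hq hq' => ?_) hL h.holder
  · have := hβ.sub (hL.const_mul (1 - p))
    simpa using this
  · have hw := h.smooth_w q hq hq'
    have e1 := (hw.pd1.differentiableAt one_ne_zero).hasDerivAt_pd1
    have e2 := (Real.hasDerivAt_rpow_const (p := 1 - p) (Or.inl hq.ne')).mul e1
    refine e2.congr_deriv ?_
    change _ = (q.1 * q.1 ^ (1 - p) * pd1 (pd1 w) q + (1 - p) * (q.1 ^ (1 - p) * pd1 w q)) / q.1
    rw [Real.rpow_sub_one hq.ne']
    field_simp
    ring

/-- The limit of the identities for the second derivatives along the level sets. -/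
theorem limit_relations (hσ : 0 < pd1 (fun q => s q 2) (0, y₀)) {u : ℕ → ℝ × ℝ}
    (hu : Tendsto u atTop (bdryFilter y₀)) {x : Jet} {F : Frame}
    (hx : Tendsto (fun n => jetOf (polarWeights p (u n)) w (u n)) atTop (𝓝 x))
    (hF : Tendsto (fun n => mkFrame s t (polarWeights p (u n)) (u n)) atTop (𝓝 F)) :
    d₁ * nfXy F x 0 + d₂ * nfXy F x 1 = 0 ∧
    (nfXy F x 0 ^ 2 + nfXy F x 1 ^ 2) * e + (d₁ * nfXyy F x 0 + d₂ * nfXyy F x 1) = 0 := by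
  have hFi : ∀ j i, Tendsto (fun n => mkFrame s t (polarWeights p (u n)) (u n) j i) atTop
      (𝓝 (F j i)) := fun j i => tendsto_pi_nhds.1 (tendsto_pi_nhds.1 hF j) i
  have hxi : ∀ j, Tendsto (fun n => jetOf (polarWeights p (u n)) w (u n) j) atTop (𝓝 (x j)) :=
    fun j => tendsto_pi_nhds.1 hx j
  have hz : Tendsto (fun n => (u n).1) atTop (𝓝 0) :=
    (continuous_fst.tendsto' _ _ rfl).comp (hu.mono_right (bdryFilter_le_nhds y₀))
  have hzp : Tendsto (fun n => (u n).1 ^ p) atTop (𝓝 0) :=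
    (tendsto_rpow_bdryFilter h.p_pos y₀).comp hu
  have cont : ∀ (f : Jet × Frame → ℝ), Continuous f → Tendsto (fun n =>
      f (jetOf (polarWeights p (u n)) w (u n), mkFrame s t (polarWeights p (u n)) (u n))) atTop
      (𝓝 (f (x, F))) := fun f hf => (hf.tendsto (x, F)).comp (hx.prodMk_nhds hF)
  have gap : ∀ {f : ℝ × ℝ → ℝ}, ContDiff ℝ ∞ f → Tendsto (fun n => f (u n)) atTop
      (𝓝 (f (0, y₀))) := fun hf => (hf.tendsto_bdryFilter y₀).comp hu
  have t1 := h.tendsto₁.comp hu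
  have t2 := h.tendsto₂.comp hu
  have te := h.tendsto_e.comp hu
  simp only [Function.comp_def] at t1 t2 te
  have c1 := gap h.smooth_height.pd1
  -- The direction `D_y - z b D_z` is tangent to the level curves of the height. Since the angular
  -- derivative of the height vanishes at `z = 0`, `b` has a finite limit; the corrections to `X_y`
  -- and `X_yy` carry positive powers of `z` and disappear.
  set b : ℕ → ℝ := fun n => pd2 (fun q => s q 2) (u n) / (u n).1 / pd1 (fun q => s q 2) (u n)
  have y2 : ∀ y, pd2 (fun q => s q 2) (0, y) = 0 := fun y => by simp [pd2, h.s_zero]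
  have y22 : ∀ y, pd2 (pd2 fun q => s q 2) (0, y) = 0 := fun y => by
    rw [pd2]; simp only [y2, deriv_const]
  have c2 := (tendsto_div_fst h.smooth_height.pd2 y2 y₀).comp hu
  have c22 := (tendsto_div_fst h.smooth_height.pd2.pd2 y22 y₀).comp hu
  simp only [Function.comp_def] at c2 c22
  have hb := c2.div c1 hσ.ne'
  have hXz : ∀ i, Tendsto (fun n => nfXz (mkFrame s t (polarWeights p (u n)) (u n))
      (jetOf (polarWeights p (u n)) w (u n)) i) atTop (𝓝 (nfXz F x i)) := fun i =>
    cont (fun e => nfXz e.2 e.1 i) ((continuous_apply i).comp continuous_nfXz)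
  have hXy : ∀ i, Tendsto (fun n => nfXy (mkFrame s t (polarWeights p (u n)) (u n))
      (jetOf (polarWeights p (u n)) w (u n)) i) atTop (𝓝 (nfXy F x i)) := fun i =>
    cont (fun e => nfXy e.2 e.1 i) ((continuous_apply i).comp continuous_nfXy)
  have hXyy : ∀ i, Tendsto (fun n => nfXyy (mkFrame s t (polarWeights p (u n)) (u n))
      (jetOf (polarWeights p (u n)) w (u n)) i) atTop (𝓝 (nfXyy F x i)) := fun i =>
    cont (fun e => nfXyy e.2 e.1 i) (by simp only [nfXyy, Pi.add_apply, Pi.smul_apply]; fun_prop)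
  have hm : ∀ i, Tendsto (fun n => nfm (mkFrame s t (polarWeights p (u n)) (u n))
      (jetOf (polarWeights p (u n)) w (u n)) i) atTop (𝓝 (nfm F x i)) := fun i =>
    cont (fun e => nfm e.2 e.1 i) (by simp only [nfm, Pi.add_apply, Pi.smul_apply]; fun_prop)
  have hl : ∀ i, Tendsto (fun n => nfl (mkFrame s t (polarWeights p (u n)) (u n))
      (jetOf (polarWeights p (u n)) w (u n)) i) atTop (𝓝 (nfl F x i)) := fun i =>
    cont (fun e => nfl e.2 e.1 i) (by simp only [nfl, Pi.add_apply, Pi.smul_apply]; fun_prop)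
  have hV : ∀ i, Tendsto (fun n => nfXy (mkFrame s t (polarWeights p (u n)) (u n))
      (jetOf (polarWeights p (u n)) w (u n)) i - b n * ((u n).1 ^ p *
        nfXz (mkFrame s t (polarWeights p (u n)) (u n))
      (jetOf (polarWeights p (u n)) w (u n)) i)) atTop (𝓝 (nfXy F x i)) := fun i => by
    simpa using (hXy i).sub (hb.mul (hzp.mul (hXz i)))
  have hW : ∀ i, Tendsto (fun n => nfXyy (mkFrame s t (polarWeights p (u n)) (u n))
        (jetOf (polarWeights p (u n)) w (u n)) i
      - 2 * b n * ((u n).1 * nfm (mkFrame s t (polarWeights p (u n)) (u n))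
        (jetOf (polarWeights p (u n)) w (u n)) i
        + (u n).1 ^ p * (jetOf (polarWeights p (u n)) w (u n) 3
            * mkFrame s t (polarWeights p (u n)) (u n) 7 i
          + jetOf (polarWeights p (u n)) w (u n) 4
            * mkFrame s t (polarWeights p (u n)) (u n) 5 i))
      + b n ^ 2 * ((u n).1 ^ 2 * nfl (mkFrame s t (polarWeights p (u n)) (u n))
        (jetOf (polarWeights p (u n)) w (u n)) i
        + (u n).1 ^ p * (2 * (u n).1 * jetOf (polarWeights p (u n)) w (u n) 3
            * mkFrame s t (polarWeights p (u n)) (u n) 6 i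
          + jetOf (polarWeights p (u n)) w (u n) 5
            * mkFrame s t (polarWeights p (u n)) (u n) 5 i))) atTop (𝓝 (nfXyy F x i)) := fun i => by
    have k := ((hXyy i).sub ((hb.const_mul 2).mul ((hz.mul (hm i)).add (hzp.mul
      (((hxi 3).mul (hFi 7 i)).add ((hxi 4).mul (hFi 5 i))))))).add
      ((hb.pow 2).mul (((hz.pow 2).mul (hl i)).add (hzp.mul
      ((((hz.const_mul 2).mul (hxi 3)).mul (hFi 6 i)).add ((hxi 5).mul (hFi 5 i))))))
    simpa using k
  -- All factors converge, and `z^p` converges to zero.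
  have hR : Tendsto (fun n => p * (s (u n) 2 / (u n).1) ^ (p - 1) * (u n).1 ^ p
      * (pd2 (pd2 fun q => s q 2) (u n) / (u n).1
        - 2 * b n * pd1 (pd2 fun q => s q 2) (u n)
        + b n ^ 2 * (u n).1 * pd1 (pd1 fun q => s q 2) (u n))) atTop (𝓝 0) := by
    have k := ((((h.tendsto_height_div.comp hu).rpow_const (p := p - 1)
      (Or.inl hσ.ne')).const_mul p).mul hzp).mul ((c22.sub ((hb.const_mul 2).mul
        (gap h.smooth_height.pd2.pd1))).add (((hb.pow 2).mul hz).mul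
        (gap h.smooth_height.pd1.pd1)))
    simpa using k
  constructor
  · refine tendsto_nhds_unique ((t1.mul (hV 0)).add (t2.mul (hV 1)))
      (tendsto_const_nhds.congr' ?_)
    filter_upwards [hu.eventually h.eventually_level, c1.eventually_ne hσ.ne',
      (((t1.pow 2).add (t2.pow 2)).eventually_ne h.d_ne)] with n ⟨_, _, _, _, k⟩ k1 k2
    exact (k (b n) (div_mul_cancel₀ _ k1).symm k2).1.symm
  · refine tendsto_nhds_unique (((((hV 0).pow 2).add ((hV 1).pow 2)).mul te).add
      ((t1.mul (hW 0)).add (t2.mul (hW 1)))) (hR.congr' ?_)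
    filter_upwards [hu.eventually h.eventually_level, c1.eventually_ne hσ.ne',
      (((t1.pow 2).add (t2.pow 2)).eventually_ne h.d_ne)] with n ⟨_, _, _, _, k⟩ k1 k2
    exact (k (b n) (div_mul_cancel₀ _ k1).symm k2).2.symm

/-- The limits of the normalized jets at the boundary are non-degenerate. -/
theorem mem_nfGood {u : ℕ → ℝ × ℝ} (hu : Tendsto u atTop (bdryFilter y₀)) {x : Jet} {F : Frame}
    (hx : Tendsto (fun n => jetOf (polarWeights p (u n)) w (u n)) atTop (𝓝 x))
    (hF : Tendsto (fun n => mkFrame s t (polarWeights p (u n)) (u n)) atTop (𝓝 F))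
    (hJ : nfJ F x ≠ 0) : (x, F) ∈ nfGood := by
  set σ := pd1 (fun q => s q 2) (0, y₀) with hσd
  -- the limits of the entries of the frame
  have hFi : ∀ j i, Tendsto (fun n => mkFrame s t (polarWeights p (u n)) (u n) j i) atTop
      (𝓝 (F j i)) := fun j i => tendsto_pi_nhds.1 (tendsto_pi_nhds.1 hF j) i
  have hxi : ∀ j, Tendsto (fun n => jetOf (polarWeights p (u n)) w (u n) j) atTop (𝓝 (x j)) :=
    fun j => tendsto_pi_nhds.1 hx j
  have lim : ∀ {f : ℝ × ℝ → ℝ} {a b : ℝ}, Tendsto (fun n => f (u n)) atTop (𝓝 a) →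
      Tendsto f (bdryFilter y₀) (𝓝 b) → a = b := fun ha hb =>
    tendsto_nhds_unique ha (hb.comp hu)
  have lim' : ∀ {V : ℝ × ℝ → R3} {a : ℝ} (_ : ContDiff ℝ ∞ V),
      Tendsto (fun n => V (u n) 2) atTop (𝓝 a) → a = V (0, y₀) 2 := fun hV ha =>
    lim ha (tendsto_pi_nhds.1 (hV.tendsto_bdryFilter y₀) 2)
  have zero_of : ∀ {f : ℝ × ℝ → ℝ} {a : ℝ}, Tendsto (fun n => f (u n)) atTop (𝓝 a) →
      (∀ q : ℝ × ℝ, 0 < q.1 → q.1 < δ → f q = 0) → a = 0 := fun {f a} ha hf =>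
    lim ha (tendsto_const_nhds.congr' (((eventually_bdryFilter y₀ h.δ_pos).mono
      fun q hq => (hf q hq.1 hq.2).symm)))
  have F0 : F 0 2 = σ := by
    rw [lim' h.smooth_s.pd1 (hFi 0 2), h.smooth_s.pd1_apply]
  have F1 : F 1 2 = 0 := by
    rw [lim' h.smooth_s.pd2 (hFi 1 2), h.smooth_s.pd2_apply, pd2]; simp [h.s_zero]
  have F4 : F 4 2 = 0 := by
    rw [lim' h.smooth_s.pd2.pd2 (hFi 4 2), h.smooth_s.pd2.pd2_apply, pd2_comp_eq h.smooth_s, pd2]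
    simp only [pd2, h.s_zero, deriv_const]
  have F5 : F 5 2 = 0 := zero_of (hFi 5 2) fun q h1 h2 => h.t_zero q h1.le h2
  have F6 : F 6 2 = 0 := zero_of (hFi 6 2) fun q h1 h2 => (h.t_deriv_zero h1 h2).1
  have F7 : F 7 2 = 0 := zero_of (hFi 7 2) fun q h1 h2 => (h.t_deriv_zero h1 h2).2.1
  have F10 : F 10 2 = 0 := zero_of (hFi 10 2) fun q h1 h2 => (h.t_deriv_zero h1 h2).2.2
  have hz : Tendsto (fun n => (u n).1) atTop (𝓝 0) :=
    (continuous_fst.tendsto' _ _ rfl).comp (hu.mono_right (bdryFilter_le_nhds y₀))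
  have hzp : Tendsto (fun n => (u n).1 ^ p) atTop (𝓝 0) :=
    (tendsto_rpow_bdryFilter h.p_pos y₀).comp hu
  have W0 : F 16 0 = 0 := tendsto_nhds_unique (hFi 16 0) hz
  have W1 : F 16 1 = 0 := tendsto_nhds_unique (hFi 16 1) hzp
  have W2 : F 16 2 = 0 := lim (hFi 16 2) (tendsto_rpow_bdryFilter (sub_pos.2 h.p_lt) y₀)
  have Xy2 : nfXy F x 2 = 0 := by simp [nfXy, F1, F5, F7]
  have Xyy2 : nfXyy F x 2 = 0 := by simp [nfXyy, F4, F5, F7, F10]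
  have C2 : nfC F x 2 = σ := by simp [nfC, F0, F6]
  -- In the limit `T`, `X_y` and `X_yy` are horizontal, so the triple products reduce to `σ` times
  -- planar determinants. In particular a nonzero Jacobian forces `σ ≠ 0`, and positivity of the
  -- height gives the sign.
  have hJ' : nfJ F x = σ * (F 5 1 * nfXy F x 0 - F 5 0 * nfXy F x 1) := by
    simp [nfJ, cross_apply, dotProduct, Fin.sum_univ_three, F5, Xy2, C2]; ring
  have hN' : nfN0 F x = σ * (nfXyy F x 1 * nfXy F x 0 - nfXyy F x 0 * nfXy F x 1) := by
    simp [nfN0, cross_apply, dotProduct, Fin.sum_univ_three, Xyy2, Xy2, C2]; ring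
  have hσ : 0 < σ := by
    refine lt_of_le_of_ne (ge_of_tendsto h.tendsto_height_div ?_)
      fun e0 => hJ (by rw [hJ', ← e0, zero_mul])
    filter_upwards [h.eventually_level] with q ⟨hq, _, h0, _⟩
    exact (div_pos h0 hq.1).le
  obtain ⟨L, hL0, hL⟩ := h.tendsto_jet_three hσ
  have hL5 := h.tendsto_jet_five hL
  have x3 : x 3 = L := lim (hxi 3) hL
  have x5 : x 5 = -((1 - p) * L) := lim (hxi 5) hL5
  have x3' : x 3 ≠ 0 := x3 ▸ hL0
  have x5' : x 5 ≠ 0 := by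
    rw [x5]; exact neg_ne_zero.2 (mul_ne_zero (sub_pos.2 h.p_lt).ne' hL0)
  have hN0 : nfN0 F x ≠ 0 := by
    obtain ⟨A1, A2⟩ := h.limit_relations hσ hu hx hF
    intro h0
    rw [hN'] at h0
    have h0' := (mul_eq_zero.1 h0).resolve_left hσ.ne'
    have hV0 : 0 < nfXy F x 0 ^ 2 + nfXy F x 1 ^ 2 := by
      by_contra! hc
      have k0 := sq_nonneg (nfXy F x 0)
      have k1 := sq_nonneg (nfXy F x 1)
      have a : nfXy F x 0 = 0 := pow_eq_zero_iff two_ne_zero |>.1 (by linarith)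
      have b : nfXy F x 1 = 0 := pow_eq_zero_iff two_ne_zero |>.1 (by linarith)
      rw [hJ', a, b] at hJ; simp at hJ
    -- If the planar determinant of `X_yy` and `X_y` vanished, `X_yy` would be parallel to `X_y`,
    -- hence orthogonal to the limit of `Dg`. The second-order relation would then read `|X_y|² e =
    -- 0`, contradicting `e > 0`.
    have A3 : (nfXy F x 0 ^ 2 + nfXy F x 1 ^ 2) * (d₁ * nfXyy F x 0 + d₂ * nfXyy F x 1) = 0 := by
      linear_combination (nfXy F x 0 * nfXyy F x 0 + nfXy F x 1 * nfXyy F x 1) * A1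
        + (d₂ * nfXy F x 0 - d₁ * nfXy F x 1) * h0'
    have A4 := (mul_eq_zero.1 A3).resolve_left hV0.ne'
    rw [A4, add_zero] at A2
    exact (mul_pos hV0 h.e_pos).ne' A2
  have hXy : nfXy F x ≠ 0 := fun e => hJ (by simp [nfJ, e])
  have hG : nfG F x ≠ 0 := (dotProduct_self_pos_R3 hXy).ne'
  -- At the boundary all weights vanish: the entries become `L = x₅ J` and `N = N₀`, the trace is `G
  -- L`, and the determinant is `L N`.
  have hLv : nfL F x = x 5 * nfJ F x := by
    simp [nfL, W0, W1, nfJ]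
  have hNv : nfN F x = nfN0 F x := by simp [nfN, W1]
  have hXz : nfXz F x = x 3 • F 5 := by simp [nfXz, W2]
  refine ⟨hJ, ?_, ?_, ?_⟩
  · simp only [nfTr, W1, zero_mul, add_zero, hLv]
    exact mul_ne_zero hG (mul_ne_zero x5' hJ)
  · simp only [nfDet, W1, zero_mul, sub_zero, hLv, hNv]
    exact mul_ne_zero (mul_ne_zero x5' hJ) hN0
  · have hc : F 5 ⨯₃ nfXy F x ≠ 0 := fun e0 => hJ (by
      rw [nfJ, triple_product_permutation, ← cross_anticomm, e0]; simp)
    simp only [nfE, nfF, nfG, hXz]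
    rw [← cross_dot_cross_self, map_smul, LinearMap.smul_apply, smul_dotProduct, dotProduct_smul]
    exact mul_ne_zero x3' (mul_ne_zero x3' (dotProduct_self_pos_R3 hc).ne')

end BoundaryPoint

/-! ### The initial surface at the boundary -/

theorem MemDisc.continuousOn_closedDisc {k : ℕ} {α p τ : ℝ} {w : STFn} (hw : MemDisc k α p τ w)
    {t : ℝ} (ht : t ∈ Icc 0 τ) : ContinuousOn (w t) closedDisc :=
  hw.1.comp (f := fun q : ℝ × ℝ => (t, q)) (by fun_prop) fun _ hq => ⟨ht, hq⟩

theorem tendsto_comp_polarChart {E : Type*} [TopologicalSpace E] {f : ℝ × ℝ → E}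
    (hf : ContinuousOn f closedDisc) (y₀ : ℝ) :
    Tendsto (fun q => f (polarChart q)) (bdryFilter y₀) (𝓝 (f (polarChart (0, y₀)))) := by
  have h0 : polarChart (0, y₀) ∈ closedDisc := polarChart_mem_closedDisc le_rfl zero_le_one
  refine (hf _ h0).tendsto.comp (tendsto_nhdsWithin_iff.2 ⟨?_, ?_⟩)
  · exact contDiff_polarChart.continuous.continuousAt.tendsto.mono_left (bdryFilter_le_nhds y₀)
  · filter_upwards [eventually_bdryFilter y₀ one_pos] with q hq
    exact polarChart_mem_closedDisc hq.1.le hq.2.le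

theorem vec3_eta (P : R3) : ![P 0, P 1, P 2] = P := by
  ext i; fin_cases i <;> rfl

section InitialSurface

variable {k : ℕ} {α p η : ℝ} {B : Set R3} {S T : ℝ × ℝ → R3} {w₀ : ℝ × ℝ → ℝ}

theorem IsCoordChange.boundary_zero (hΦ : IsCoordChange S T η) (y : ℝ) :
    S (polarChart (0, y)) 2 = 0 :=
  (hΦ.boundary _ (polarChart_mem_closedDisc le_rfl zero_le_one)).2 (by
    rw [polarChart_sq]; norm_num)

theorem IsCoordChange.exists_horizontal (hΦ : IsCoordChange S T η) :
    ∃ δ : ℝ, 0 < δ ∧ ∀ q : ℝ × ℝ, 0 ≤ q.1 → q.1 < δ → T (polarChart q) 2 = 0 := by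
  obtain ⟨δ, h0, h1, h⟩ := hΦ.horizontal
  refine ⟨δ, h0, fun q hq hq' => h _ ⟨polarChart_mem_closedDisc hq (hq'.trans h1).le, ?_⟩⟩
  rw [openDisc, mem_ofPred_eq, polarChart_sq, not_lt]
  exact pow_le_pow_left₀ (by linarith) (by linarith) 2

/-- Condition `(⋆)` is stated for the graph function over the plane. Near the circle the
parametrized surface lies on that lower graph, and its horizontal projection approaches the boundary
of the flat side from outside, so the limits in `(⋆)` become limits along the surface. -/
theorem IsOfHolderClass.exists_boundaryPoint (hα : 0 < α) (hα' : α ≤ 1) (hp : 0 < p) (hp' : p < 1)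
    (hB : IsConvexBodyWithFlatSide B) (hΦ : IsCoordChange S T η)
    (hw₀ : IsOfHolderClass (k + 2) α p B S T η w₀) (hstar : NonDegenerate p B) (y₀ : ℝ) :
    ∃ δ C d₁ d₂ e : ℝ, BoundaryPoint (fun q => S (polarChart q)) (fun q => T (polarChart q))
      (fun q => w₀ (polarChart q)) (pressure p B) p α δ C y₀ d₁ d₂ e := by
  obtain ⟨U, hU, hfU, hUB, hg, lam, hlam, hd⟩ := hstar
  obtain ⟨δ, hδ, hTδ⟩ := hΦ.exists_horizontal
  have hreg := hw₀.regular
  have half : (1 / 2 : ℝ) ∈ Ioo (0 : ℝ) 1 := by constructor <;> norm_num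
  -- the surface and its limit
  set X : ℝ × ℝ → R3 := fun q => coordChange S T (polarChart q) (w₀ (polarChart q)) with hX
  have hcw : ContinuousOn w₀ closedDisc :=
    hreg.continuousOn_closedDisc (t := 0) ⟨le_rfl, zero_le_one⟩
  have hXt : Tendsto X (bdryFilter y₀) (𝓝 (X (0, y₀))) :=
    tendsto_comp_polarChart (f := fun q => coordChange S T q (w₀ q))
      (hΦ.smooth_S.continuous.continuousOn.add
        (hcw.smul hΦ.smooth_T.continuous.continuousOn)) y₀
  have hXB : ∀ᶠ q in bdryFilter y₀, X q ∈ upperPart B := by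
    filter_upwards [eventually_bdryFilter y₀ one_pos] with q hq
    rw [← hw₀.graph]
    exact ⟨_, polarChart_mem_openDisc hq.1 hq.2, rfl⟩
  have hX2 : X (0, y₀) 2 = 0 := by
    simp [hX, coordChange, hΦ.boundary_zero, hTδ (0, y₀) le_rfl hδ]
  have hXi : ∀ i, Tendsto (fun q => X q i) (bdryFilter y₀) (𝓝 (X (0, y₀) i)) := fun i =>
    tendsto_pi_nhds.1 hXt i
  have hfr : X (0, y₀) ∈ frontier B :=
    isClosed_frontier.mem_of_tendsto hXt (hXB.mono fun q hq => hq.1)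
  have hcl : IsClosed B := hB.isCompact.isClosed
  set x : ℝ × ℝ → ℝ × ℝ := fun q => (X q 0, X q 1) with hx
  have hxt : Tendsto x (bdryFilter y₀) (𝓝 (x (0, y₀))) := (hXi 0).prodMk_nhds (hXi 1)
  have hflat : IsClosed (flatSide B) := isClosed_flatSide hB
  have hx0 : x (0, y₀) ∈ flatSide B := by
    have := hcl.frontier_subset hfr
    rw [← vec3_eta (X (0, y₀)), hX2] at this
    exact this
  -- the surface near the limit is the graph of `h`
  obtain ⟨c, hc, hlow⟩ := eventually_lower hB hU hUB (hfU hx0)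
  -- Points of small height are the lowest ones of `B` on their vertical line. Their height is
  -- positive, so the line cannot meet the flat side at height zero.
  have hlow' : ∀ᶠ q in bdryFilter y₀, lowerGraph B (x q) = X q 2 ∧ x q ∉ flatSide B := by
    filter_upwards [hxt.eventually hlow, hXB, (hXi 2).eventually (gt_mem_nhds (hX2.trans_lt hc))]
      with q h1 h2 h3
    have h4 : ![(x q).1, (x q).2, X q 2] = X q := vec3_eta (X q)
    have h5 := h1 (X q 2) h3 (by rw [h4]; exact h2.1)
    exact ⟨lowerGraph_eq (by rw [h4]; exact hcl.frontier_subset h2.1) h5,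
      fun h => absurd (h5 0 h) (not_le.2 h2.2)⟩
  have hxw : Tendsto x (bdryFilter y₀) (𝓝[(flatSide B)ᶜ] (x (0, y₀))) :=
    tendsto_nhdsWithin_iff.2 ⟨hxt, hlow'.mono fun q hq => hq.2⟩
  have hfront : x (0, y₀) ∈ frontier (flatSide B) := by
    rw [frontier_eq_closure_inter_closure, hflat.closure_eq]
    exact ⟨hx0, mem_closure_of_tendsto hxt (hlow'.mono fun q hq => hq.2)⟩
  obtain ⟨d₁, d₂, e, t₁, t₂, te, hl, he⟩ := hd _ hfront
  -- bounds for the jets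
  have hjet := (cls_polarJet hα hα' hp (MemDisc.cls_collar hα hα' hp hreg)).2
  choose C hC0 hCb hCh using fun i => (hjet i).base
  have hCs : ∀ i, C i ≤ ∑ i, C i := fun i =>
    Finset.single_le_sum (f := C) (fun j _ => hC0 j) (Finset.mem_univ i)
  have hCn : 0 ≤ ∑ i, C i := Finset.sum_nonneg fun i _ => hC0 i
  -- The factor 2 covers the combination `x₅ + (1 - p) x₃`, since `1 - p < 1`.
  refine ⟨δ, 2 * ∑ i, C i, d₁, d₂, e, hα, hp, hp', hΦ.smooth_S.comp contDiff_polarChart,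
    hΦ.smooth_T.comp contDiff_polarChart, hΦ.boundary_zero, hδ, hTδ, fun q hq hq' => ?_,
    by positivity, fun q hq hq' i => ?_, fun z z' y hz hz2 hz' hz2' => ?_, ?_,
    t₁.comp hxw, t₂.comp hxw, te.comp hxw, fun h0 => ?_, hlam.trans_le he⟩
  · exact (hreg.contDiffAt half (polarChart_mem_openDisc hq (by linarith))).comp_polarChart
  · have := hCb i (1 / 2, q) ⟨half, ⟨hq, hq'⟩, trivial⟩
    exact this.trans ((hCs i).trans (by linarith))
  · have h3 := hCh 3 (1 / 2, z, y) (mem_collar.2 ⟨half, hz, hz2⟩) (1 / 2, z', y)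
      (mem_collar.2 ⟨half, hz', hz2'⟩)
    have h5 := hCh 5 (1 / 2, z, y) (mem_collar.2 ⟨half, hz, hz2⟩) (1 / 2, z', y)
      (mem_collar.2 ⟨half, hz', hz2'⟩)
    simp only [hyperbolicDist, sub_self, abs_zero, Real.sqrt_zero, add_zero, ne_eq,
      OfNat.ofNat_ne_zero, not_false_eq_true, zero_pow, Real.sqrt_sq_eq_abs] at h3 h5
    have hr := Real.rpow_nonneg (abs_nonneg (Real.log z - Real.log z')) α
    have k3 := h3.trans (mul_le_mul_of_nonneg_right (hCs 3) hr)
    have k5 := h5.trans (mul_le_mul_of_nonneg_right (hCs 5) hr)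
    refine le_trans (b := _ + (1 - p) * _) ?_ (le_trans (add_le_add k5
      (mul_le_mul_of_nonneg_left k3 (sub_pos.2 hp').le)) ?_)
    · rw [← abs_of_pos (sub_pos.2 hp'), ← abs_mul]
      refine le_trans (le_of_eq ?_) (abs_add_le _ _)
      congr 1
      rw [abs_of_pos (sub_pos.2 hp')]
      change _ = (jetOf (polarWeights p (z, y)) (fun q => w₀ (polarChart q)) (z, y) 5
        - jetOf (polarWeights p (z', y)) (fun q => w₀ (polarChart q)) (z', y) 5) + (1 - p) *
        (jetOf (polarWeights p (z, y)) (fun q => w₀ (polarChart q)) (z, y) 3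
        - jetOf (polarWeights p (z', y)) (fun q => w₀ (polarChart q)) (z', y) 3)
      ring
    · have := mul_nonneg hCn hr
      nlinarith
  · have hev : ∀ᶠ q in bdryFilter y₀, (lowerGraph B (x q) = X q 2 ∧ X q ∈ upperPart B ∧
        x q ∈ U \ flatSide B) ∧ q.1 < δ := by
      filter_upwards [hlow', hXB, hxt.eventually (hU.mem_nhds (hfU hx0)),
        eventually_bdryFilter y₀ hδ] with q h1 h2 h3 h4
      exact ⟨⟨h1.1, h2, h3, h1.2⟩, h4.2⟩
    filter_upwards [hev, eventually_eventually_nhdsWithin.2 hev, self_mem_nhdsWithin]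
      with q ⟨⟨_, h2, h3⟩, h4⟩ hn hq
    have hq0 : 0 < q.1 := hq
    have hX2 : ∀ q : ℝ × ℝ, 0 < q.1 → q.1 < δ → X q 2 = S (polarChart q) 2 := fun q h h' => by
      simp [hX, coordChange, hTδ q h.le h']
    refine ⟨(hg _ h3).contDiffAt ((hU.sdiff hflat).mem_nhds h3), ?_, ?_⟩
    · rw [← hX2 q hq0 h4]; exact h2.2
    · rw [(isOpen_lt continuous_const continuous_fst).nhdsWithin_eq hq] at hn
      filter_upwards [hn, (isOpen_lt continuous_const continuous_fst).mem_nhds hq]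
        with q' ⟨⟨h1, _⟩, h5⟩ hq'
      rw [← hX2 q' hq' h5, ← h1]
      rfl
  · rw [h0, Real.sqrt_zero] at hl
    linarith

end InitialSurface

/-! ### The jets of the initial surface -/

section Jets

variable {S T : ℝ × ℝ → R3} {ρ : ℝ × ℝ → R3} {q : ℝ × ℝ} {w : ℝ × ℝ → ℝ} {η : ℝ}

theorem cross_add_smul_dot (a b v : R3) (r s : ℝ) :
    ((a + r • v) ⨯₃ (b + s • v)) ⬝ᵥ v = (a ⨯₃ b) ⬝ᵥ v := by
  simp [cross_apply, dotProduct, Fin.sum_univ_three]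
  ring

/-- The Jacobian of the change of coordinates along a graph. -/
theorem cross_graph_dot (hS : ContDiff ℝ ∞ S) (hT : ContDiff ℝ ∞ T) (hw : ContDiffAt ℝ 2 w q) :
    (pd1 (fun q => S q + w q • T q) q ⨯₃ pd2 (fun q => S q + w q • T q) q) ⬝ᵥ T q
      = (pd1 (fun q' => coordChange S T q' (w q)) q ⨯₃ pd2 (fun q' => coordChange S T q' (w q)) q)
        ⬝ᵥ T q := by
  obtain ⟨h1, h2, -⟩ := pd_graph (hS.contDiffAt_two q) (hT.contDiffAt_two q) hw
  obtain ⟨k1, k2, -⟩ := pd_graph (hS.contDiffAt_two q) (hT.contDiffAt_two q)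
    (contDiffAt_const (c := w q))
  have c1 : pd1 (fun _ : ℝ × ℝ => w q) q = 0 := by simp [pd1]
  have c2 : pd2 (fun _ : ℝ × ℝ => w q) q = 0 := by simp [pd2]
  rw [c1, zero_smul, add_zero] at k1
  rw [c2, zero_smul, add_zero] at k2
  unfold coordChange
  rw [h1, h2, cross_add_smul_dot, k1, k2]

theorem IsCoordChange.cross_graph_dot_ne (hΦ : IsCoordChange S T η) (hq : q ∈ closedDisc)
    (hw : ContDiffAt ℝ 2 w q) (hb : |w q| ≤ η) :
    (pd1 (fun q => S q + w q • T q) q ⨯₃ pd2 (fun q => S q + w q • T q) q) ⬝ᵥ T q ≠ 0 := by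
  rw [cross_graph_dot hΦ.smooth_S hΦ.smooth_T hw]
  exact hΦ.jacobian q hq _ (abs_le.1 hb)

theorem continuousAt_hat {f : ℝ × ℝ → ℝ} {V : ℝ × ℝ → R3} (hf : ContinuousAt f q) (h0 : f q ≠ 0)
    (hV : ContinuousAt V q) : ContinuousAt (fun q => hat (f q) (V q)) q := by
  have hVi := fun i => continuousAt_pi.1 hV i
  refine continuousAt_pi.2 fun i => ?_
  fin_cases i
  · exact hVi 0
  · exact hVi 1
  · exact (hVi 2).div hf h0

theorem continuousAt_mkFrame (hS : ContDiff ℝ ∞ S) (hT : ContDiff ℝ ∞ T) (hρ : ContinuousAt ρ q)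
    (h0 : ρ q 0 ≠ 0) : ContinuousAt (fun q => mkFrame S T (ρ q) q) q := by
  have c : ∀ {V : ℝ × ℝ → R3}, ContDiff ℝ ∞ V → ContinuousAt V q := fun h => h.continuous.continuousAt
  have c' : ∀ {V : ℝ × ℝ → R3}, ContDiff ℝ ∞ V → ContinuousAt (fun q => hat (ρ q 0) (V q)) q :=
    fun h => continuousAt_hat (continuousAt_pi.1 hρ 0) h0 (c h)
  refine continuousAt_pi.2 fun j => ?_
  fin_cases j
  exacts [c hS.pd1, c hS.pd2, c hS.pd1.pd1, c hS.pd2.pd1, c hS.pd2.pd2, c hT, c hT.pd1, c hT.pd2,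
    c hT.pd1.pd1, c hT.pd2.pd1, c hT.pd2.pd2, c' hS.pd2, c' hS.pd2.pd2, c' hT, c' hT.pd2,
    c' hT.pd2.pd2, hρ]

theorem continuousAt_jetOf (hw : ContDiffAt ℝ 2 w q) (hρ : ContinuousAt ρ q) :
    ContinuousAt (fun q => jetOf (ρ q) w q) q := by
  have r := fun i => continuousAt_pi.1 hρ i
  have h0 := hw.continuousAt
  have h1 := hw.pd1.continuousAt
  have h2 := hw.pd2.continuousAt
  have c1 : ∀ {f : ℝ × ℝ → ℝ}, ContDiffAt ℝ 1 f q → ContinuousAt (pd1 f) q ∧ ContinuousAt (pd2 f) q :=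
    fun {f} hf => by
      have hd := hf.eventually_differentiableAt
      have hc : ContinuousAt (fderiv ℝ f) q := (hf.fderiv_right (m := 0) le_rfl).continuousAt
      exact ⟨((hc.clm_apply continuousAt_const).congr (hd.mono fun _ h => h.pd1_eq.symm)),
        ((hc.clm_apply continuousAt_const).congr (hd.mono fun _ h => h.pd2_eq.symm))⟩
  have h11 := (c1 hw.pd1).1
  have h12 := (c1 hw.pd2).1
  have h22 := (c1 hw.pd2).2
  refine continuousAt_pi.2 fun j => ?_
  fin_cases j
  exacts [h0, h2, h22, (r 2).mul h1, (r 2).mul h12, ((r 0).mul (r 2)).mul h11]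

theorem continuousAt_polarWeights {p : ℝ} (hq : 0 < q.1) : ContinuousAt (polarWeights p) q := by
  refine continuousAt_pi.2 fun j => ?_
  fin_cases j
  exacts [continuousAt_fst, continuousAt_fst.rpow_const (Or.inl hq.ne'),
    continuousAt_fst.rpow_const (Or.inl hq.ne')]

theorem pd1_add_periodic {E : Type*} [NormedAddCommGroup E] [NormedSpace ℝ E] {f : ℝ × ℝ → E}
    {c : ℝ} (hf : ∀ z y, f (z, y + c) = f (z, y)) (z y : ℝ) : pd1 f (z, y + c) = pd1 f (z, y) := by
  simp only [pd1, hf]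

theorem pd2_add_periodic {E : Type*} [NormedAddCommGroup E] [NormedSpace ℝ E] {f : ℝ × ℝ → E}
    {c : ℝ} (hf : ∀ z y, f (z, y + c) = f (z, y)) (z y : ℝ) : pd2 f (z, y + c) = pd2 f (z, y) := by
  simp only [pd2]
  rw [← deriv_comp_add_const]
  simp only [hf]

theorem jetOf_add_periodic {c : ℝ} (hw : ∀ z y, w (z, y + c) = w (z, y))
    (hρ : ∀ z y, ρ (z, y + c) = ρ (z, y)) (z y : ℝ) :
    jetOf (ρ (z, y + c)) w (z, y + c) = jetOf (ρ (z, y)) w (z, y) := by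
  simp only [jetOf, hρ, hw, pd1_add_periodic hw, pd2_add_periodic hw,
    pd2_add_periodic (pd2_add_periodic hw), pd1_add_periodic (pd2_add_periodic hw),
    pd1_add_periodic (pd1_add_periodic hw)]

theorem mkFrame_add_periodic {c : ℝ} (hS : ∀ z y, S (z, y + c) = S (z, y))
    (hT : ∀ z y, T (z, y + c) = T (z, y)) (hρ : ∀ z y, ρ (z, y + c) = ρ (z, y)) (z y : ℝ) :
    mkFrame S T (ρ (z, y + c)) (z, y + c) = mkFrame S T (ρ (z, y)) (z, y) := by
  simp only [mkFrame, hρ, hT, pd1_add_periodic hS, pd2_add_periodic hS,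
    pd2_add_periodic (pd2_add_periodic hS), pd1_add_periodic (pd2_add_periodic hS),
    pd1_add_periodic (pd1_add_periodic hS), pd1_add_periodic hT, pd2_add_periodic hT,
    pd2_add_periodic (pd2_add_periodic hT), pd1_add_periodic (pd2_add_periodic hT),
    pd1_add_periodic (pd1_add_periodic hT)]

end Jets

section InitialJets

variable {k : ℕ} {α p η : ℝ} {B : Set R3} {S T : ℝ × ℝ → R3} {w₀ : ℝ × ℝ → ℝ}

/-- The normalized jet and frame of the surface in flattened coordinates. -/
def polarJet (p : ℝ) (S T : ℝ × ℝ → R3) (w : ℝ × ℝ → ℝ) (q : ℝ × ℝ) : Jet × Frame :=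
  (jetOf (polarWeights p q) (fun q => w (polarChart q)) q, polarFrame p S T q)

/-- Needed to extract convergent sequences of base points: the angle may be taken in one period. -/
theorem polarJet_periodic (p : ℝ) (S T : ℝ × ℝ → R3) (w : ℝ × ℝ → ℝ) (z : ℝ) :
    Function.Periodic (fun y => polarJet p S T w (z, y)) (2 * Real.pi) := by
  intro y
  change polarJet p S T w (z, y + 2 * Real.pi) = polarJet p S T w (z, y)
  refine Prod.ext (jetOf_add_periodic (w := fun q => w (polarChart q)) (ρ := polarWeights p) (fun z y => ?_) (fun _ _ => rfl) z y)
    (mkFrame_add_periodic (S := fun q => S (polarChart q)) (T := fun q => T (polarChart q))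
      (ρ := polarWeights p) (fun z y => ?_) (fun z y => ?_)
      (fun _ _ => rfl) z y)
  all_goals simp only [polarChart_periodic]

theorem IsOfHolderClass.contDiffAt (hw₀ : IsOfHolderClass (k + 2) α p B S T η w₀) {q : ℝ × ℝ}
    (hq : q ∈ openDisc 1) : ContDiffAt ℝ 2 w₀ q :=
  MemDisc.contDiffAt (w := fun _ => w₀) hw₀.regular (t := 1 / 2) ⟨by norm_num, by norm_num⟩ hq

theorem openDisc_one_subset : openDisc 1 ⊆ closedDisc := fun q hq => by
  simp only [openDisc, closedDisc, mem_ofPred_eq] at hq ⊢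
  linarith

theorem IsOfHolderClass.secDetAt_pos (hw₀ : IsOfHolderClass (k + 2) α p B S T η w₀) {q : ℝ × ℝ}
    (hq : q ∈ openDisc 1) : 0 < secDetAt (fun q => S q + w₀ q • T q) q := by
  have h := hw₀.strictlyConvex q hq
  exact (gaussCurv_pos_iff (cross_ne_zero_of_gaussCurv_pos h)).1 h

theorem IsOfHolderClass.cart_mem_nfGood (hΦ : IsCoordChange S T η)
    (hw₀ : IsOfHolderClass (k + 2) α p B S T η w₀) {q : ℝ × ℝ} (hq : q ∈ openDisc 1) :
    (jetOf 1 w₀ q, mkFrame S T 1 q) ∈ nfGood :=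
  mem_nfGood_mkFrame (hΦ.smooth_S.contDiffAt_two q) (hΦ.smooth_T.contDiffAt_two q)
    (hw₀.contDiffAt hq) (by simp) (by simp)
    (hΦ.cross_graph_dot_ne (openDisc_one_subset hq) (hw₀.contDiffAt hq)
      (hw₀.bound q (openDisc_one_subset hq))) (hw₀.secDetAt_pos hq)

/-- Passing to polar coordinates multiplies the Jacobian of `Φ` and the determinant of the second
fundamental form by powers of `-(1 - z)`, the fourth power in the latter case, so nonvanishing and
positivity survive. -/
theorem IsOfHolderClass.polarJet_mem_nfGood (hΦ : IsCoordChange S T η)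
    (hw₀ : IsOfHolderClass (k + 2) α p B S T η w₀) {q : ℝ × ℝ} (hq : 0 < q.1) (hq' : q.1 < 1) :
    polarJet p S T w₀ q ∈ nfGood := by
  have hm := polarChart_mem_openDisc hq hq'
  have hw := hw₀.contDiffAt hm
  have hS := hΦ.smooth_S.contDiffAt_two (polarChart q)
  have hT := hΦ.smooth_T.contDiffAt_two (polarChart q)
  have hX := hS.add (hw.smul hT)
  have hφ := contDiff_polarChart.contDiffAt_two q
  have hj : jacAt polarChart q ≠ 0 := by rw [jacAt_polarChart]; linarith
  refine mem_nfGood_mkFrame hS.comp_polarChart hT.comp_polarChart hw.comp_polarChart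
    (polarWeights_eq hq) hq.ne' ?_ ?_
  · have c := cross_comp (hX.differentiableAt two_ne_zero) (hφ.differentiableAt two_ne_zero)
    refine (congrArg (· ⬝ᵥ T (polarChart q)) c).trans_ne ?_
    simp only [smul_dotProduct]
    exact smul_ne_zero hj (hΦ.cross_graph_dot_ne (openDisc_one_subset hm) hw
      (hw₀.bound _ (openDisc_one_subset hm)))
  · refine lt_of_lt_of_eq ?_ (secAt_comp hX hφ).1.symm
    have := hw₀.secDetAt_pos hm
    exact mul_pos (by positivity) this

theorem IsOfHolderClass.continuousAt_polarJet (hΦ : IsCoordChange S T η)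
    (hw₀ : IsOfHolderClass (k + 2) α p B S T η w₀) {q : ℝ × ℝ} (hq : 0 < q.1) (hq' : q.1 < 1) :
    ContinuousAt (polarJet p S T w₀) q :=
  (continuousAt_jetOf (hw₀.contDiffAt (polarChart_mem_openDisc hq hq')).comp_polarChart
    (continuousAt_polarWeights hq)).prodMk
    (continuousAt_mkFrame (hΦ.smooth_S.comp contDiff_polarChart)
      (hΦ.smooth_T.comp contDiff_polarChart) (continuousAt_polarWeights hq) hq.ne')

/-- The limits of the normalized jets of the initial surface are non-degenerate. -/
theorem IsOfHolderClass.mem_nfGood_of_tendsto (hα : 0 < α) (hα' : α ≤ 1) (hp : 0 < p) (hp' : p < 1)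
    (hB : IsConvexBodyWithFlatSide B) (hΦ : IsCoordChange S T η)
    (hw₀ : IsOfHolderClass (k + 2) α p B S T η w₀) (hstar : NonDegenerate p B)
    {u : ℕ → ℝ × ℝ} {y : ℝ} (hu : Tendsto u atTop (bdryFilter y)) {e : Jet × Frame}
    (he : Tendsto (fun n => polarJet p S T w₀ (u n)) atTop (𝓝 e)) : e ∈ nfGood := by
  obtain ⟨δ, C, d₁, d₂, b, hbp⟩ := hw₀.exists_boundaryPoint hα hα' hp hp' hB hΦ hstar y
  obtain ⟨x, F⟩ := e
  have hx := (continuous_fst.tendsto _).comp he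
  have hF := (continuous_snd.tendsto _).comp he
  refine hbp.mem_nfGood hu hx hF ?_
  have hS : ContDiff ℝ ∞ fun q => S (polarChart q) := hΦ.smooth_S.comp contDiff_polarChart
  have hT : ContDiff ℝ ∞ fun q => T (polarChart q) := hΦ.smooth_T.comp contDiff_polarChart
  have hFj : ∀ j, Tendsto (fun n => mkFrame (fun q => S (polarChart q)) (fun q => T (polarChart q))
      (polarWeights p (u n)) (u n) j) atTop (𝓝 (F j)) := fun j => tendsto_pi_nhds.1 hF j
  have lim : ∀ {V : ℝ × ℝ → R3} {a : R3}, ContDiff ℝ ∞ V →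
      Tendsto (fun n => V (u n)) atTop (𝓝 a) → a = V (0, y) := fun hV ha =>
    tendsto_nhds_unique ha ((hV.tendsto_bdryFilter y).comp hu)
  have F0 := lim hS.pd1 (hFj 0)
  have F1 := lim hS.pd2 (hFj 1)
  have F5 := lim hT (hFj 5)
  have F6 := lim hT.pd1 (hFj 6)
  have F7 := lim hT.pd2 (hFj 7)
  have h0 : polarChart (0, y) ∈ closedDisc := polarChart_mem_closedDisc le_rfl zero_le_one
  have hcw : ContinuousOn w₀ closedDisc :=
    MemDisc.continuousOn_closedDisc hw₀.regular (t := 0) ⟨le_rfl, zero_le_one⟩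
  have x0 : x 0 = w₀ (polarChart (0, y)) :=
    tendsto_nhds_unique (tendsto_pi_nhds.1 hx 0) ((tendsto_comp_polarChart hcw y).comp hu)
  set c := w₀ (polarChart (0, y)) with hc
  have hX : ContDiff ℝ ∞ fun q => coordChange S T q c :=
    hΦ.smooth_S.add (hΦ.smooth_T.const_smul c)
  have hφ := contDiff_polarChart.contDiffAt_two (0, y)
  have cc := cross_comp (φ := polarChart) (q := (0, y))
    ((hX.contDiffAt_two _).differentiableAt two_ne_zero) (hφ.differentiableAt two_ne_zero)
  obtain ⟨h1, h2, -⟩ := pd_graph (hS.contDiffAt_two (0, y)) (hT.contDiffAt_two (0, y))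
    (contDiffAt_const (c := c))
  have c1 : pd1 (fun _ : ℝ × ℝ => c) (0, y) = 0 := by simp [pd1]
  have c2 : pd2 (fun _ : ℝ × ℝ => c) (0, y) = 0 := by simp [pd2]
  rw [c1, zero_smul, add_zero] at h1
  rw [c2, zero_smul, add_zero] at h2
  have hj : jacAt polarChart (0, y) ≠ 0 := by rw [jacAt_polarChart]; norm_num
  have key := smul_ne_zero hj (hΦ.jacobian _ h0 c (abs_le.1 (hw₀.bound _ h0)))
  rw [← smul_dotProduct, ← cc] at key
  unfold coordChange at key
  -- The limit of `X_y` contains the term `x₁ T`, which does not change the triple product with `T`.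
  -- Thus the limiting Jacobian is that of `Φ` at the boundary point.
  rw [h1, h2, ← cross_add_smul_dot _ _ _ 0 (x 1)] at key
  rw [nfJ, dotProduct_comm, nfC, nfXy, F0, F1, F5, F6, F7, x0]
  simpa only [zero_smul, add_zero] using key

/-- The normalized jets of the initial surface lie in a compact set of non-degenerate jets. -/
theorem IsOfHolderClass.exists_isCompact (hα : 0 < α) (hα' : α ≤ 1) (hp : 0 < p) (hp' : p < 1)
    (hB : IsConvexBodyWithFlatSide B) (hΦ : IsCoordChange S T η)
    (hw₀ : IsOfHolderClass (k + 2) α p B S T η w₀) (hstar : NonDegenerate p B)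
    (hT0 : ∀ y, T (polarChart (0, y)) 2 = 0) :
    ∃ K : Set (Jet × Frame), IsCompact K ∧ K ⊆ nfGood ∧
      (∀ q : ℝ × ℝ, 0 < q.1 → q.1 < 1 / 2 → polarJet p S T w₀ q ∈ K) ∧
      ∀ q ∈ openDisc (3 / 4), (jetOf 1 w₀ q, mkFrame S T 1 q) ∈ K := by
  have hsub : {q : ℝ × ℝ | q.1 ^ 2 + q.2 ^ 2 ≤ (3 / 4) ^ 2} ⊆ openDisc 1 := fun q hq => by
    simp only [openDisc, mem_ofPred_eq] at hq ⊢
    linarith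
  have hcd : IsCompact {q : ℝ × ℝ | q.1 ^ 2 + q.2 ^ 2 ≤ (3 / 4) ^ 2} := by
    refine (isCompact_Icc.prod isCompact_Icc : IsCompact (Icc (-1 : ℝ) 1 ×ˢ Icc (-1 : ℝ) 1))
      |>.of_isClosed_subset (isClosed_le (by fun_prop) (by fun_prop)) fun q hq => ?_
    simp only [mem_ofPred_eq] at hq
    exact ⟨abs_le.1 (abs_le_of_sq_le_sq (by nlinarith [sq_nonneg q.2]) zero_le_one),
      abs_le.1 (abs_le_of_sq_le_sq (by nlinarith [sq_nonneg q.1]) zero_le_one)⟩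
  set K₁ := (fun q => (jetOf 1 w₀ q, mkFrame S T 1 q)) ''
    {q : ℝ × ℝ | q.1 ^ 2 + q.2 ^ 2 ≤ (3 / 4) ^ 2}
  have hK₁ : IsCompact K₁ := hcd.image_of_continuousOn fun q hq =>
    ((continuousAt_jetOf (ρ := fun _ => 1) (hw₀.contDiffAt (hsub hq)) continuousAt_const).prodMk
      (continuousAt_mkFrame (ρ := fun _ => 1) hΦ.smooth_S hΦ.smooth_T continuousAt_const
        (by simp))).continuousWithinAt
  set I := polarJet p S T w₀ '' {q : ℝ × ℝ | 0 < q.1 ∧ q.1 < 1 / 2} with hI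
  obtain ⟨R, hR⟩ := exists_mem_closedBall (d := hyperbolicDist) (α := α) (U := collar 1)
    (Ξ := fun t q => jetOf (polarWeights p q) (flatten (fun _ => w₀) t) q)
    (fr := fun _ q => polarFrame p S T q)
    (fun i => ((cls_polarJet hα hα' hp (MemDisc.cls_collar hα hα' hp hw₀.regular)).2 i).base)
    (fun j i => (cls_polarFrame (k := 0) hα hα' hp hp' hΦ.smooth_S hΦ.smooth_T hΦ.boundary_zero
      hT0 j i).base)
  have hIR : I ⊆ Metric.closedBall 0 R := by
    rintro - ⟨q, hq, rfl⟩
    exact hR (1 / 2, q) ⟨⟨by norm_num, by norm_num⟩, hq, trivial⟩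
  have hK₂ : IsCompact (closure I) := (isCompact_closedBall _ R).of_isClosed_subset isClosed_closure
    (closure_minimal hIR Metric.isClosed_closedBall)
  refine ⟨closure I ∪ K₁, hK₂.union hK₁, union_subset (fun e he => ?_) ?_,
    fun q hq hq' => Or.inl (subset_closure ⟨q, ⟨hq, hq'⟩, rfl⟩),
    fun q hq => Or.inr ⟨q, (show q.1 ^ 2 + q.2 ^ 2 < (3 / 4) ^ 2 from hq).le, rfl⟩⟩
  -- Base points of an approximating sequence, with angles reduced to one period, accumulate at some
  -- `(z, y)`. If `z = 0` the boundary analysis applies; if `z > 0`, continuity identifies the limit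
  -- with the jet there, `z = 1/2` included.
  · obtain ⟨v, hv, hve⟩ := mem_closure_iff_seq_limit.1 he
    have hpi : 0 < 2 * Real.pi := by positivity
    have hq : ∀ n, ∃ q : ℝ × ℝ, (0 < q.1 ∧ q.1 < 1 / 2) ∧ q.2 ∈ Icc 0 (2 * Real.pi) ∧
        polarJet p S T w₀ q = v n := fun n => by
      obtain ⟨⟨z, y⟩, hq, hqv⟩ := hv n
      obtain ⟨y', hy', hyy⟩ := (polarJet_periodic p S T w₀ z).exists_mem_Ico₀ hpi y
      exact ⟨(z, y'), hq, ⟨hy'.1, hy'.2.le⟩, hyy.symm.trans hqv⟩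
    choose u hu1 hu2 huv using hq
    obtain ⟨⟨z, y⟩, hzy, φ, hφ, hlim⟩ :=
      (isCompact_Icc.prod isCompact_Icc : IsCompact (Icc (0 : ℝ) (1 / 2) ×ˢ Icc 0 (2 * Real.pi)))
        |>.tendsto_subseq (x := u) fun n => ⟨⟨(hu1 n).1.le, (hu1 n).2.le⟩, hu2 n⟩
    have hlim' : Tendsto (fun n => polarJet p S T w₀ (u (φ n))) atTop (𝓝 e) := by
      simp only [huv]; exact hve.comp hφ.tendsto_atTop
    rcases hzy.1.1.eq_or_lt with h0 | h0
    · simp only at h0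
      subst h0
      exact hw₀.mem_nfGood_of_tendsto hα hα' hp hp' hB hΦ hstar (u := fun n => u (φ n)) (y := y)
        (tendsto_nhdsWithin_iff.2 ⟨hlim, Eventually.of_forall fun n => (hu1 _).1⟩) hlim'
    · have h1 : z < 1 := lt_of_le_of_lt hzy.1.2 (by norm_num)
      have := tendsto_nhds_unique hlim'
        ((hw₀.continuousAt_polarJet hΦ (q := (z, y)) h0 h1).tendsto.comp hlim)
      rw [this]
      exact hw₀.polarJet_mem_nfGood hΦ h0 h1
  · rintro - ⟨q, hq, rfl⟩
    exact hw₀.cart_mem_nfGood hΦ (hsub hq)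

end InitialJets

/-! ### Perturbations of the initial surface -/

/-- Functions that do not depend on time: the time interval does not matter. -/
theorem isParabolicC_stationary {m : ℕ} {I J : Set ℝ} (hI : I.Nonempty) {V : Set (ℝ × ℝ)}
    {f : ℝ × ℝ → ℝ} (h : IsParabolicC m (I ×ˢ V) fun _ => f) :
    IsParabolicC m (J ×ˢ V) fun _ => f := by
  obtain ⟨t₀, ht₀⟩ := hI
  induction m generalizing f with
  | zero =>
    exact h.continuousOn.comp (f := fun P : ℝ × ℝ × ℝ => (t₀, P.2)) (by fun_prop)
      fun P hP => ⟨ht₀, hP.2⟩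
  | succ m ih =>
    obtain ⟨h1, h2, h3, h4, h5, -⟩ := isParabolicC_succ.1 h
    refine isParabolicC_succ.2 ⟨h1.comp (f := fun P : ℝ × ℝ × ℝ => (t₀, P.2)) (by fun_prop)
      fun P hP => ⟨ht₀, hP.2⟩, fun P hP => h2 (t₀, P.2) ⟨ht₀, hP.2⟩,
      fun P hP => h3 (t₀, P.2) ⟨ht₀, hP.2⟩, ih h4, ih h5, fun n _ =>
      ⟨fun P _ => differentiableAt_const _, ?_⟩⟩
    have : Dt (fun _ => f) = fun _ _ => (0 : ℝ) := by
      funext t q; simp [Dt]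
    rw [this]
    exact isParabolicC_iff_cls.2 (Cls.const' (FnAlg.trivial _) 0)

section Perturbation

variable {k : ℕ} {α p τ μ : ℝ}

/-- The normalized jets of a function of small norm, in flattened coordinates. -/
theorem abs_polarJet_le (hα : 0 < α) (hα' : α ≤ 1) (hp : 0 < p) (hμ : 0 ≤ μ) {f : STFn}
    (hf : IsParabolicC (k + 2) (Ioo 0 τ ×ˢ openDisc 1) f)
    (hn : discNorm (k + 2) α p τ f ≤ ENNReal.ofReal μ) {P : ℝ × ℝ × ℝ} (hP : P ∈ collar τ)
    (i : Fin 6) : |jetOf (polarWeights p P.2) (flatten f P.1) P.2 i| ≤ 2 * μ := by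
  have hsp : spNorm (k + 2) α p (collar τ) (flatten f) ≤ ENNReal.ofReal μ := le_add_self.trans hn
  have hcls : Cls Prod.fst (collar τ) (HBP p α τ) (k + 2) (flatten f) :=
    (memSP_iff_cls hα hα' hp).1 ⟨(isParabolicC_flatten hf).mono (collar_subset_wideCollar τ),
      hsp.trans_lt ENNReal.ofReal_lt_top⟩
  have hjet := (cls_polarJet hα hα' hp hcls).2
  have hz : ∀ P ∈ collar τ, 0 < P.2.1 := fun P hP => hP.2.1.1
  have hN : ∀ i j, i + j ≤ 2 → holderNormP p α (collar τ)
      (fun t q => q.1 ^ i * mixedD i j 0 (flatten f) t q) ≤ ENNReal.ofReal μ := fun i j hij =>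
    (le_sumMultiIndex (m := k + 2) (N := fun i j l => holderNormP p α (collar τ)
      (fun t q => q.1 ^ i * mixedD i j l (flatten f) t q)) (i := i) (j := j) (l := 0)
      (by omega)).trans hsp
  -- derivatives without `D_z`
  have h0 : ∀ j, j ≤ 2 → |mixedD 0 j 0 (flatten f) P.1 P.2| ≤ 2 * μ := fun j hj => by
    have h := hN 0 j (by omega)
    have a := abs_le_of_holderNorm_le hμ (le_self_add.trans h) hP
    have b := abs_le_of_holderNorm_le hμ (le_add_self.trans h) hP
    simp only [pow_zero, one_mul] at a b
    set g : STFn := fun t q => mixedD 0 j 0 (flatten f) t q with hg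
    have hz0 := hz P hP
    -- The norm bounds the boundary value and the weighted remainder separately, each by `μ`; this
    -- is the origin of the constant `2 μ`.
    have e : mixedD 0 j 0 (flatten f) P.1 P.2 = boundaryValue g P.1 P.2
        + P.2.1 ^ p * (P.2.1 ^ (-p) * (mixedD 0 j 0 (flatten f) P.1 P.2
          - boundaryValue g P.1 P.2)) := by
      rw [← mul_assoc, ← Real.rpow_add hz0, add_neg_cancel, Real.rpow_zero]; ring
    have hp1 : P.2.1 ^ p ≤ 1 := Real.rpow_le_one hz0.le (collar_lt_one hP).le hp.le
    have hp0 : 0 ≤ P.2.1 ^ p := Real.rpow_nonneg hz0.le _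
    rw [e]
    refine (abs_add_le _ _).trans ?_
    rw [abs_mul, abs_of_nonneg hp0]
    have := mul_le_mul hp1 b (abs_nonneg _) zero_le_one
    linarith
  -- derivatives with `D_z`
  have h1 : ∀ i j (l : Fin 6), 1 ≤ i → i + j ≤ 2 → (∀ P ∈ collar τ,
      P.2.1 ^ i * mixedD i j 0 (flatten f) P.1 P.2
        = P.2.1 ^ p * jetOf (polarWeights p P.2) (flatten f P.1) P.2 l) →
      |jetOf (polarWeights p P.2) (flatten f P.1) P.2 l| ≤ 2 * μ := fun i j l hi hij he => by
    obtain ⟨C, -, hC, -⟩ := (hjet l).base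
    -- The weighted derivative is `z^p` times a bounded jet entry, so its boundary value is zero and
    -- the remainder controlled by the norm is precisely that entry.
    have hb := boundaryValue_of_eq_add_rpow (τ := τ) (f := fun t q =>
      q.1 ^ i * mixedD i j 0 (flatten f) t q) hp (a := fun _ _ => 0)
      (b := fun t q => jetOf (polarWeights p q) (flatten f t) q l) hC (fun _ _ _ _ => rfl)
      (fun P hP => by rw [zero_add]; exact he P hP) P hP
    have b := abs_le_of_holderNorm_le hμ (le_add_self.trans (hN i j hij)) hP
    simp only at b hb
    rw [hb, sub_zero, he P hP, ← mul_assoc, ← Real.rpow_add (hz P hP), neg_add_cancel,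
      Real.rpow_zero, one_mul] at b
    linarith
  have hpow : ∀ P ∈ collar τ, P.2.1 = P.2.1 ^ p * P.2.1 ^ (1 - p) := fun P hP => by
    rw [← Real.rpow_add (hz P hP)]; simp
  fin_cases i
  · exact h0 0 (by norm_num)
  · exact h0 1 (by norm_num)
  · exact h0 2 le_rfl
  · refine h1 1 0 3 le_rfl (by norm_num) fun P hP => ?_
    change P.2.1 ^ 1 * pd1 (flatten f P.1) P.2
      = P.2.1 ^ p * (P.2.1 ^ (1 - p) * pd1 (flatten f P.1) P.2)
    linear_combination (pd1 (flatten f P.1) P.2) * hpow P hP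
  · refine h1 1 1 4 le_rfl (by norm_num) fun P hP => ?_
    change P.2.1 ^ 1 * pd1 (pd2 (flatten f P.1)) P.2
      = P.2.1 ^ p * (P.2.1 ^ (1 - p) * pd1 (pd2 (flatten f P.1)) P.2)
    linear_combination (pd1 (pd2 (flatten f P.1)) P.2) * hpow P hP
  · refine h1 2 0 5 (by norm_num) le_rfl fun P hP => ?_
    change P.2.1 ^ 2 * pd1 (pd1 (flatten f P.1)) P.2
      = P.2.1 ^ p * (P.2.1 * P.2.1 ^ (1 - p) * pd1 (pd1 (flatten f P.1)) P.2)
    linear_combination (P.2.1 * pd1 (pd1 (flatten f P.1)) P.2) * hpow P hP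

/-- The jets of a function of small norm, in the interior. -/
theorem abs_cartJet_le (hμ : 0 ≤ μ) {f : STFn}
    (hn : discNorm (k + 2) α p τ f ≤ ENNReal.ofReal μ) {P : ℝ × ℝ × ℝ}
    (hP : P ∈ Ioo 0 τ ×ˢ openDisc (3 / 4)) (i : Fin 6) : |jetOf 1 (f P.1) P.2 i| ≤ μ := by
  have hc : classicalNorm (k + 2) α (Ioo 0 τ ×ˢ openDisc (3 / 4)) f ≤ ENNReal.ofReal μ :=
    le_self_add.trans hn
  have h : ∀ i j, i + j ≤ 2 → |mixedD i j 0 f P.1 P.2| ≤ μ := fun i j hij =>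
    abs_le_of_holderNorm_le hμ ((le_sumMultiIndex (m := k + 2)
      (N := fun i j l => holderNorm euclideanDist α (Ioo 0 τ ×ˢ openDisc (3 / 4))
        (mixedD i j l f)) (i := i) (j := j) (l := 0) (by omega)).trans hc) hP
  rw [jetOf_one]
  fin_cases i
  exacts [h 0 0 (by norm_num), h 0 1 (by norm_num), h 0 2 le_rfl, h 1 0 (by norm_num),
    h 1 1 le_rfl, h 2 0 le_rfl]

end Perturbation

theorem dist_jetOf_le {ρ : R3} {w w₀ : ℝ × ℝ → ℝ} {q : ℝ × ℝ} {ε : ℝ} (hε : 0 ≤ ε)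
    (hw : ContDiffAt ℝ 2 w q) (hw₀ : ContDiffAt ℝ 2 w₀ q)
    (h : ∀ i, |jetOf ρ (fun q => w q - w₀ q) q i| ≤ ε) (F : Frame) :
    dist (jetOf ρ w q, F) (jetOf ρ w₀ q, F) ≤ ε := by
  have e := jetOf_add_smul (ρ := ρ) hw₀ (hw.sub hw₀) 1
  simp only [one_mul, add_sub_cancel, one_smul] at e
  have e' : jetOf ρ w q = jetOf ρ w₀ q + jetOf ρ (fun q => w q - w₀ q) q := e
  rw [Prod.dist_eq, dist_self, e', dist_self_add_left]
  exact max_le ((pi_norm_le_iff_of_nonneg hε).2 h) hε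

/-! ### Uniform constants for the linearization near the initial surface. -/

section Admissible

variable {k : ℕ} {α p η : ℝ} {B : Set R3} {S T : ℝ × ℝ → R3} {w₀ : ℝ × ℝ → ℝ}

theorem IsOfHolderClass.exists_linearizationAdmissible (hα : 0 < α) (hα' : α ≤ 1) (hp : 0 < p)
    (hp' : p < 1) (hB : IsConvexBodyWithFlatSide B) (hΦ : IsCoordChange S T η)
    (hw₀ : IsOfHolderClass (k + 2) α p B S T η w₀) (hstar : NonDegenerate p B) :
    ∃ lam μ : ℝ, 0 < lam ∧ 0 < μ ∧ ∀ τ : ℝ, 0 < τ →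
      LinearizationAdmissible k α p τ lam μ (hmcfNonlinearity S T) w₀ := by
  have hT0 : ∀ y, T (polarChart (0, y)) 2 = 0 := fun y => by
    obtain ⟨δ, hδ, h⟩ := hΦ.exists_horizontal
    exact h (0, y) le_rfl hδ
  obtain ⟨K₀, hK₀, hgood, hcol, hdisc⟩ := hw₀.exists_isCompact hα hα' hp hp' hB hΦ hstar hT0
  -- A perturbation changes only the jets, the frames being fixed. Jets move by at most twice the
  -- norm, hence `μ = ε / 2`; the thickened set determines `λ` before `τ` is chosen.
  obtain ⟨ε, hε, hεg⟩ := hK₀.exists_cthickening_subset_open isOpen_nfGood hgood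
  have hK : IsCompact (Metric.cthickening ε K₀) := hK₀.cthickening
  obtain ⟨lam, hlam, hell⟩ := exists_ellipticity hK hεg
  refine ⟨lam, ε / 2, hlam, half_pos hε, fun τ hτ w hw hn => ?_⟩
  have hpar : IsParabolicC (k + 2) (Ioo 0 τ ×ˢ openDisc 1) fun t q => w t q - w₀ q := by
    have h1 : IsParabolicC (k + 2) (Ioo 0 τ ×ˢ openDisc 1) fun _ => w₀ :=
      isParabolicC_stationary (nonempty_Ioo.2 one_pos) hw₀.regular.2.1
    have h2 : IsParabolicC (k + 2) (Ioo 0 τ ×ˢ openDisc 1) fun _ _ => (-1 : ℝ) :=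
      isParabolicC_iff_cls.2 (Cls.const' (FnAlg.trivial _) (-1))
    have hU := isOpen_stDisc τ 1
    have := isParabolicC_add hU hw.2.1 (isParabolicC_mul hU h2 h1)
    simpa only [neg_one_mul, ← sub_eq_add_neg] using this
  have hε2 : 0 ≤ ε / 2 := (half_pos hε).le
  refine exists_linearization hα hα' hp hp' hΦ.smooth_S hΦ.smooth_T hΦ.boundary_zero hT0 hK hεg
    hell hw (fun P hP => ?_) fun P hP => ?_
  · have hm := polarChart_mem_openDisc (hP.2.1.1) (collar_lt_one hP)
    refine Metric.mem_cthickening_of_dist_le _ _ _ _ (hcol P.2 hP.2.1.1 hP.2.1.2)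
      (dist_jetOf_le hε.le (hw.contDiffAt hP.1 hm).comp_polarChart
        (hw₀.contDiffAt hm).comp_polarChart (fun i => ?_) _)
    have := abs_polarJet_le hα hα' hp hε2 hpar hn hP i
    rwa [mul_div_cancel₀ _ (two_ne_zero' ℝ)] at this
  · have hm : P.2 ∈ openDisc 1 := openDisc_mono (by norm_num) hP.2
    refine Metric.mem_cthickening_of_dist_le _ _ _ _ (hdisc P.2 hP.2)
      (dist_jetOf_le hε.le (hw.contDiffAt hP.1 hm) (hw₀.contDiffAt hm) (fun i => ?_) _)
    exact (abs_cartJet_le hε2 hn hP i).trans (half_le_self hε.le)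

end Admissible

/-! ### The flow in the coordinates -/

/-- Joint differentiability in space and time. -/
theorem IsParabolicC.hasFDerivAt {E : Type*} [NormedAddCommGroup E] [NormedSpace ℝ E]
    {U : Set (ℝ × ℝ × ℝ)} {f : ℝ → ℝ × ℝ → E} (hU : IsOpen U) (h : IsParabolicC 2 U f)
    {P : ℝ × ℝ × ℝ} (hP : P ∈ U) :
    HasFDerivAt (fun P : ℝ × ℝ × ℝ => f P.1 P.2)
      ((ContinuousLinearMap.toSpanSingleton ℝ (_root_.Dt f P.1 P.2)).coprod
        ((ContinuousLinearMap.toSpanSingleton ℝ (_root_.D1 f P.1 P.2)).coprod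
          (ContinuousLinearMap.toSpanSingleton ℝ (_root_.D2 f P.1 P.2)))) P := by
  have hc : ∀ {k : ℝ → ℝ × ℝ → E}, IsParabolicC 0 U k →
      ContinuousAt (fun P : ℝ × ℝ × ℝ => ContinuousLinearMap.toSpanSingleton ℝ (k P.1 P.2)) P :=
    fun {k} hk => ((ContinuousLinearMap.toSpanSingletonCLE (𝕜 := ℝ) (E := E)).continuous.continuousAt).comp
      (hk.continuousOn.continuousAt (hU.mem_nhds hP))
  have e : ∀ a b : ℝ →L[ℝ] E, a.coprod b = a.comp (ContinuousLinearMap.fst ℝ ℝ ℝ)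
      + b.comp (ContinuousLinearMap.snd ℝ ℝ ℝ) := fun a b => by ext <;> simp
  refine (hasStrictFDerivAt_uncurry_coprod (𝕜 := ℝ) (u := P) (f := f)
    (f₁ := fun t q => ContinuousLinearMap.toSpanSingleton ℝ (_root_.Dt f t q))
    (f₂ := fun t q => (ContinuousLinearMap.toSpanSingleton ℝ (_root_.D1 f t q)).coprod
          (ContinuousLinearMap.toSpanSingleton ℝ (_root_.D2 f t q))) ?_ ?_ (hc h.Dt) ?_).hasFDerivAt
  · filter_upwards [hU.mem_nhds hP] with v hv
    exact (h.difft (m := 0) hv).hasDerivAt.hasFDerivAt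
  · filter_upwards [hU.mem_nhds hP] with v hv
    exact h.hasFDerivAt_space (m := 1) hU hv
  · change ContinuousAt (fun v : ℝ × ℝ × ℝ =>
      (ContinuousLinearMap.toSpanSingleton ℝ (_root_.D1 f v.1 v.2)).coprod
          (ContinuousLinearMap.toSpanSingleton ℝ (_root_.D2 f v.1 v.2))) P
    simp only [e]
    exact ((hc (h.D1 (m := 1)).of_succ).clm_comp continuousAt_const).add
      ((hc (h.D2 (m := 1)).of_succ).clm_comp continuousAt_const)

theorem closedDisc_subset_closure : closedDisc ⊆ closure (openDisc 1) := fun q hq => by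
  have h : Tendsto (fun n : ℕ => (1 - 1 / ((n : ℝ) + 1)) • q) atTop (𝓝 q) := by
    simpa using ((tendsto_const_nhds (x := (1 : ℝ))).sub (tendsto_one_div_add_atTop_nhds_zero_nat (𝕜 := ℝ))).smul_const q
  refine mem_closure_of_tendsto h (Eventually.of_forall fun n => ?_)
  simp only [closedDisc, openDisc, mem_ofPred_eq, Prod.smul_fst, Prod.smul_snd, smul_eq_mul] at hq ⊢
  have h1 : 0 < 1 / ((n : ℝ) + 1) := by positivity
  have h2 : 1 / ((n : ℝ) + 1) ≤ 1 := by
    rw [div_le_one (by positivity)]; linarith [n.cast_nonneg (α := ℝ)]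
  have h3 : (1 - 1 / ((n : ℝ) + 1)) ^ 2 < 1 := by nlinarith
  have h4 := mul_le_mul_of_nonneg_left hq (sq_nonneg (1 - 1 / ((n : ℝ) + 1)))
  linarith

/-! ### Local inversion of the change of coordinates. -/

section CoordChange

variable {S T : ℝ × ℝ → R3} {η : ℝ}

theorem IsCoordChange.contDiff (hΦ : IsCoordChange S T η) :
    ContDiff ℝ ∞ fun z : (ℝ × ℝ) × ℝ => coordChange S T z.1 z.2 :=
  (hΦ.smooth_S.comp contDiff_fst).add (contDiff_snd.smul (hΦ.smooth_T.comp contDiff_fst))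

/-- The change of coordinates has a continuous inverse. -/
theorem IsCoordChange.eventually_mem (hΦ : IsCoordChange S T η) {z₀ : (ℝ × ℝ) × ℝ}
    (hz₀ : z₀ ∈ closedDisc ×ˢ Icc (-η) η) {V : Set ((ℝ × ℝ) × ℝ)} (hV : V ∈ 𝓝 z₀) :
    ∀ᶠ P in 𝓝 (coordChange S T z₀.1 z₀.2), ∀ z ∈ closedDisc ×ˢ Icc (-η) η,
      coordChange S T z.1 z.2 = P → z ∈ V := by
  -- The image of this compact set is closed, and by injectivity it misses the image of `z₀`.
  have hc : IsCompact ((closedDisc ×ˢ Icc (-η) η) \ interior V) :=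
    (isCompact_closedDisc.prod isCompact_Icc).diff isOpen_interior
  have hi := (hc.image hΦ.contDiff.continuous).isClosed.isOpen_compl
  have hm : coordChange S T z₀.1 z₀.2
      ∉ (fun z : (ℝ × ℝ) × ℝ => coordChange S T z.1 z.2) '' ((closedDisc ×ˢ Icc (-η) η) \ interior V) := by
    rintro ⟨z, ⟨hz, hz'⟩, he⟩
    rw [hΦ.injective hz hz₀ he] at hz'
    exact hz' (mem_interior_iff_mem_nhds.2 hV)
  filter_upwards [hi.mem_nhds hm] with P hP z hz hzP
  by_contra hv
  exact hP ⟨z, ⟨hz, fun h => hv (interior_subset h)⟩, hzP⟩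

/-- The change of coordinates has a smooth local inverse. -/
theorem IsCoordChange.exists_inverse (hΦ : IsCoordChange S T η) {z₀ : (ℝ × ℝ) × ℝ}
    (hz₀ : z₀ ∈ closedDisc ×ˢ Icc (-η) η) :
    ∃ G : R3 → (ℝ × ℝ) × ℝ, ContDiffAt ℝ 2 G (coordChange S T z₀.1 z₀.2) ∧
      ∀ᶠ z in 𝓝 z₀, G (coordChange S T z.1 z.2) = z := by
  set Φ : (ℝ × ℝ) × ℝ → R3 := fun z => coordChange S T z.1 z.2
  have hΦ2 : ContDiffAt ℝ 2 Φ z₀ := hΦ.contDiff.contDiffAt_two z₀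
  have hd : HasFDerivAt Φ (fderiv ℝ Φ z₀) z₀ := (hΦ2.differentiableAt two_ne_zero).hasFDerivAt
  set L := fderiv ℝ Φ z₀
  set A := pd1 (fun q' => coordChange S T q' z₀.2) z₀.1
  set B := pd2 (fun q' => coordChange S T q' z₀.2) z₀.1
  have hA : L ((1, 0), 0) = A := by
    have h1 : HasDerivAt (fun s : ℝ => ((s, z₀.1.2), z₀.2)) (((1 : ℝ), (0 : ℝ)), (0 : ℝ)) z₀.1.1 :=
      ((hasDerivAt_id _).prodMk (hasDerivAt_const _ _)).prodMk (hasDerivAt_const _ _)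
    exact ((hd.comp_hasDerivAt z₀.1.1 h1).deriv).symm
  have hB : L ((0, 1), 0) = B := by
    have h1 : HasDerivAt (fun s : ℝ => ((z₀.1.1, s), z₀.2)) (((0 : ℝ), (1 : ℝ)), (0 : ℝ)) z₀.1.2 :=
      ((hasDerivAt_const _ _).prodMk (hasDerivAt_id _)).prodMk (hasDerivAt_const _ _)
    exact ((hd.comp_hasDerivAt z₀.1.2 h1).deriv).symm
  have hC : L ((0, 0), 1) = T z₀.1 := by
    have h1 : HasDerivAt (fun s : ℝ => (z₀.1, s)) ((0 : ℝ × ℝ), (1 : ℝ)) z₀.2 :=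
      (hasDerivAt_const _ _).prodMk (hasDerivAt_id _)
    have h2 : HasDerivAt (fun s : ℝ => S z₀.1 + s • T z₀.1) (T z₀.1) z₀.2 := by
      simpa using ((hasDerivAt_id z₀.2).smul_const (T z₀.1)).const_add (S z₀.1)
    exact HasDerivAt.unique (f := fun s => S z₀.1 + s • T z₀.1) (hd.comp_hasDerivAt z₀.2 h1) h2
  have hL : ∀ x : (ℝ × ℝ) × ℝ, L x = x.1.1 • A + x.1.2 • B + x.2 • T z₀.1 := fun x => by
    have e : x = x.1.1 • (((1 : ℝ), (0 : ℝ)), (0 : ℝ)) + x.1.2 • (((0 : ℝ), (1 : ℝ)), (0 : ℝ))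
        + x.2 • (((0 : ℝ), (0 : ℝ)), (1 : ℝ)) := by
      ext <;> simp
    conv_lhs => rw [e]
    rw [map_add, map_add, map_smul, map_smul, map_smul, hA, hB, hC]
  have hJ : (A ⨯₃ B) ⬝ᵥ T z₀.1 ≠ 0 := hΦ.jacobian z₀.1 hz₀.1 z₀.2 hz₀.2
  have hinj : Function.Injective L := by
    refine (injective_iff_map_eq_zero L).2 fun x hx => ?_
    rw [hL] at hx
    have key : ∀ V : R3, V ⬝ᵥ (x.1.1 • A + x.1.2 • B + x.2 • T z₀.1) = 0 := fun V => by
      rw [hx, dotProduct_zero]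
    -- Cramer's rule: pairing with the three cross products isolates each coordinate times the
    -- Jacobian.
    have k1 := key (B ⨯₃ T z₀.1)
    have k2 := key (T z₀.1 ⨯₃ A)
    have k3 := key (A ⨯₃ B)
    have e1 : x.1.1 * ((A ⨯₃ B) ⬝ᵥ T z₀.1) = 0 := by
      rw [← k1]; simp [cross_apply, dotProduct, Fin.sum_univ_three]; ring
    have e2 : x.1.2 * ((A ⨯₃ B) ⬝ᵥ T z₀.1) = 0 := by
      rw [← k2]; simp [cross_apply, dotProduct, Fin.sum_univ_three]; ring
    have e3 : x.2 * ((A ⨯₃ B) ⬝ᵥ T z₀.1) = 0 := by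
      rw [← k3]; simp [cross_apply, dotProduct, Fin.sum_univ_three]; ring
    exact Prod.ext (Prod.ext ((mul_eq_zero.1 e1).resolve_right hJ)
      ((mul_eq_zero.1 e2).resolve_right hJ)) ((mul_eq_zero.1 e3).resolve_right hJ)
  let L' : ((ℝ × ℝ) × ℝ) ≃L[ℝ] R3 :=
    (LinearEquiv.ofInjectiveOfFinrankEq (L : ((ℝ × ℝ) × ℝ) →ₗ[ℝ] R3) hinj
      (by simp)).toContinuousLinearEquiv
  have hd' : HasFDerivAt Φ (L' : ((ℝ × ℝ) × ℝ) →L[ℝ] R3) z₀ := by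
    refine hd.congr_fderiv ?_
    ext x <;> rfl
  exact ⟨hΦ2.localInverse hd' two_ne_zero, hΦ2.to_localInverse hd' two_ne_zero,
    (hΦ2.hasStrictFDerivAt' hd' two_ne_zero).eventually_left_inverse⟩

end CoordChange

/-! ### Normal velocity -/

theorem secAt_congr {X Y : ℝ × ℝ → R3} {q : ℝ × ℝ} (h : X =ᶠ[𝓝 q] Y) :
    secDetAt X q = secDetAt Y q ∧ secTrAt X q = secTrAt Y q := by
  unfold secDetAt secTrAt
  rw [h.pd1.self_of_nhds, h.pd2.self_of_nhds, h.pd1.pd1.self_of_nhds, h.pd2.pd1.self_of_nhds,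
    h.pd2.pd2.self_of_nhds]
  exact ⟨rfl, rfl⟩

/-- The equation of the flow at a point does not depend on the parametrization. -/
theorem normal_velocity_reparam {X Y : ℝ → ℝ × ℝ → R3} {ψ : ℝ → ℝ × ℝ → ℝ × ℝ} {t : ℝ} {q : ℝ × ℝ}
    {U : Set (ℝ × ℝ × ℝ)} (hU : IsOpen U) (hX : IsParabolicC 2 U X) (hm : (t, ψ t q) ∈ U)
    (hψ : ContDiffAt ℝ 2 (ψ t) q) (hψt : DifferentiableAt ℝ (fun s => ψ s q) t)
    (he : ∀ᶠ z : ℝ × ℝ × ℝ in 𝓝 (t, q), Y z.1 z.2 = X z.1 (ψ z.1 z.2))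
    (hn : D1 Y t q ⨯₃ D2 Y t q ≠ 0)
    (hv : Dt Y t q ⬝ᵥ unitNormal (D1 Y t q) (D2 Y t q) = gaussCurvAt Y t q / meanCurvAt Y t q) :
    Dt X t (ψ t q) ⬝ᵥ unitNormal (D1 X t (ψ t q)) (D2 X t (ψ t q))
      = gaussCurvAt X t (ψ t q) / meanCurvAt X t (ψ t q) := by
  have hXs : ContDiffAt ℝ 2 (X t) (ψ t q) := hX.contDiffAt_two hU hm
  have hes : Y t =ᶠ[𝓝 q] fun q => X t (ψ t q) :=
    ((Continuous.prodMk_right t).tendsto q).eventually he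
  have het : (fun s => Y s q) =ᶠ[𝓝 t] fun s => X s (ψ s q) :=
    ((Continuous.prodMk_left q).tendsto t).eventually he
  have hc : D1 Y t q ⨯₃ D2 Y t q = jacAt (ψ t) q • (D1 X t (ψ t q) ⨯₃ D2 X t (ψ t q)) := by
    rw [D1, D2, hes.pd1.self_of_nhds, hes.pd2.self_of_nhds]
    exact cross_comp (hXs.differentiableAt two_ne_zero) (hψ.differentiableAt two_ne_zero)
  have hj : jacAt (ψ t) q ≠ 0 := fun h => hn (by rw [hc, h, zero_smul])
  have hnX : D1 X t (ψ t q) ⨯₃ D2 X t (ψ t q) ≠ 0 := fun h => hn (by rw [hc, h, smul_zero])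
  obtain ⟨a, ha⟩ : ∃ a : ℝ × ℝ, HasDerivAt (fun s => ψ s q) a t := ⟨_, hψt.hasDerivAt⟩
  -- Moving the parameters in time adds only tangential velocity, which does not contribute to the
  -- normal component.
  have hdt : Dt Y t q = Dt X t (ψ t q) + (a.1 • D1 X t (ψ t q) + a.2 • D2 X t (ψ t q)) := by
    have h1 := (hX.hasFDerivAt hU hm).comp_hasDerivAt (f := fun s => (s, ψ s q)) t
      ((hasDerivAt_id t).prodMk ha)
    have h2 := h1.congr_of_eventuallyEq (f := fun s => X s (ψ s q)) (f₁ := fun s => Y s q) het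
    rw [Dt, h2.deriv]
    simp
  have hdot : Dt Y t q ⬝ᵥ (D1 Y t q ⨯₃ D2 Y t q)
      = jacAt (ψ t) q * (Dt X t (ψ t q) ⬝ᵥ (D1 X t (ψ t q) ⨯₃ D2 X t (ψ t q))) := by
    rw [hc, hdt]
    simp [add_dotProduct, dotProduct_smul]
  obtain ⟨s1, s2⟩ := secAt_comp (φ := ψ t) hXs hψ
  obtain ⟨r1, r2⟩ := secAt_congr hes
  have hv' := (dot_unitNormal_eq_iff hn _).1 hv
  refine (dot_unitNormal_eq_iff hnX _).2 ?_
  change _ = secDetAt (Y t) q / secTrAt (Y t) q at hv'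
  change _ = secDetAt (X t) (ψ t q) / secTrAt (X t) (ψ t q)
  rw [hdot, r1, r2, s1, s2] at hv'
  -- The quotient of second-form quantities gains one Jacobian factor, the same as the unnormalized
  -- normal on the other side.
  have e : jacAt (ψ t) q ^ 4 * secDetAt (X t) (ψ t q) / (jacAt (ψ t) q ^ 3 * secTrAt (X t) (ψ t q))
      = jacAt (ψ t) q * (secDetAt (X t) (ψ t q) / secTrAt (X t) (ψ t q)) := by
    rw [show jacAt (ψ t) q ^ 4 = jacAt (ψ t) q ^ 3 * jacAt (ψ t) q by ring, mul_assoc,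
      mul_div_mul_left _ _ (pow_ne_zero 3 hj), mul_div_assoc]
  rw [e] at hv'
  exact mul_left_cancel₀ hj hv'

/-! ### The flow as an equation for the coordinate function. -/

section Flow

variable {k : ℕ} {α p η τ : ℝ} {B : Set R3} {S T : ℝ × ℝ → R3} {w : STFn}

theorem isParabolicC_graphMap {m : ℕ} (hS : ContDiff ℝ ∞ S) (hT : ContDiff ℝ ∞ T)
    {U : Set (ℝ × ℝ × ℝ)} (hU : IsOpen U) (hw : IsParabolicC m U w) :
    IsParabolicC m U (graphMap S T w) :=
  IsParabolicC.pi hU fun i => isParabolicC_add hU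
    (((contDiff_apply ℝ ℝ i).comp hS).isParabolicC hU m)
    (isParabolicC_mul hU hw (((contDiff_apply ℝ ℝ i).comp hT).isParabolicC hU m))

/-- The graph moves with velocity `w_t T`, and transversality `⟨T, N⟩ ≠ 0` allows the flow equation
to be divided by `⟨T, N⟩`. -/
theorem nonlinearOp_eq_zero_iff (hΦ : IsCoordChange S T η) (hw : MemDisc (k + 2) α p τ w) {t : ℝ}
    (ht : t ∈ Ioo 0 τ) {q : ℝ × ℝ} (hq : q ∈ openDisc 1) (hb : |w t q| ≤ η)
    (hK : 0 < gaussCurvAt (graphMap S T w) t q) :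
    nonlinearOp (hmcfNonlinearity S T) w t q = 0 ↔
      Dt (graphMap S T w) t q ⬝ᵥ
        unitNormal (D1 (graphMap S T w) t q) (D2 (graphMap S T w) t q)
        = gaussCurvAt (graphMap S T w) t q / meanCurvAt (graphMap S T w) t q := by
  have hwq := hw.contDiffAt ht hq
  have hn := cross_ne_zero_of_gaussCurv_pos hK
  have hdt : Dt (graphMap S T w) t q = Dt w t q • T q := by
    have hd : HasDerivAt (fun s => w s q) (Dt w t q) t :=
      (IsParabolicC.difft (m := k) hw.2.1 (P := (t, q)) ⟨ht, hq⟩).hasDerivAt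
    exact ((hd.smul_const (T q)).const_add (S q)).deriv
  have hJ := hΦ.cross_graph_dot_ne (openDisc_one_subset hq) hwq hb
  rw [dotProduct_comm] at hJ
  rw [nonlinearOp_hmcf, nfVal_mkFrame (hΦ.smooth_S.contDiffAt_two q) (hΦ.smooth_T.contDiffAt_two q)
    hwq (by simp) (by simp), sub_eq_zero]
  refine Iff.trans ?_ (dot_unitNormal_eq_iff hn _).symm
  rw [hdt, smul_dotProduct, smul_eq_mul, geoAt, geoVal, ← div_div, eq_div_iff hJ]
  rfl

/-- Injectivity of `Φ` recovers the coordinate function on the open disc from the surface;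
continuity extends the equality to the closed disc. -/
theorem eq_on_of_graphSurface_eq (hΦ : IsCoordChange S T η) {w₁ w₂ : STFn} {t : ℝ}
    (h₁ : ContinuousOn (w₁ t) closedDisc) (h₂ : ContinuousOn (w₂ t) closedDisc)
    (b₁ : ∀ q ∈ closedDisc, |w₁ t q| ≤ η) (b₂ : ∀ q ∈ closedDisc, |w₂ t q| ≤ η)
    (h : graphSurface S T w₁ t = graphSurface S T w₂ t) : EqOn (w₁ t) (w₂ t) closedDisc := by
  refine EqOn.of_subset_closure (fun q hq => ?_) h₁ h₂ openDisc_one_subset closedDisc_subset_closure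
  have hq1 : graphMap S T w₁ t q ∈ graphSurface S T w₂ t := h ▸ ⟨q, hq, rfl⟩
  obtain ⟨q', hq', he⟩ := hq1
  have hm := openDisc_one_subset hq
  have hm' := openDisc_one_subset hq'
  have := hΦ.injective (x₁ := (q', w₂ t q')) (x₂ := (q, w₁ t q)) ⟨hm', abs_le.1 (b₂ q' hm')⟩
    ⟨hm, abs_le.1 (b₁ q hm)⟩ he
  obtain ⟨rfl, e⟩ := Prod.mk.inj this
  exact e.symm

theorem solvesHMCF_iff (hΦ : IsCoordChange S T η) (hw : MemDisc (k + 2) α p τ w)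
    (hb : ∀ t ∈ Icc 0 τ, ∀ q ∈ closedDisc, |w t q| ≤ η)
    (hK : ∀ t ∈ Ioo 0 τ, ∀ q ∈ openDisc 1, 0 < gaussCurvAt (graphMap S T w) t q) :
    SolvesHMCF (graphSurface S T w) (Ioo 0 τ) ↔
      ∀ t ∈ Ioo 0 τ, ∀ q ∈ openDisc 1, nonlinearOp (hmcfNonlinearity S T) w t q = 0 := by
  have hU := isOpen_stDisc τ 1
  have hX : IsParabolicC 2 (Ioo 0 τ ×ˢ openDisc 1) (graphMap S T w) :=
    isParabolicC_graphMap hΦ.smooth_S hΦ.smooth_T hU (hw.2.1.of_le (by omega))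
  have hbd : ∀ t ∈ Ioo 0 τ, ∀ q ∈ openDisc 1, (q, w t q) ∈ closedDisc ×ˢ Icc (-η) η :=
    fun t ht q hq => ⟨openDisc_one_subset hq,
      abs_le.1 (hb t (Ioo_subset_Icc_self ht) q (openDisc_one_subset hq))⟩
  constructor
  · intro h t ht q hq
    obtain ⟨Y, q₁, hY0, hYA, -, ⟨V, hV, hVm, hYV⟩, hn, -, hv⟩ := h t ht _ ⟨q, hq, rfl⟩
    obtain ⟨G, hG, hGl⟩ := hΦ.exists_inverse (hbd t ht q hq)
    have hYc : ContinuousAt (fun z : ℝ × ℝ × ℝ => Y z.1 z.2) (t, q₁) :=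
      hYV.continuousOn.continuousAt (hV.mem_nhds hVm)
    have hYt : Tendsto (fun z : ℝ × ℝ × ℝ => Y z.1 z.2) (𝓝 (t, q₁))
        (𝓝 (coordChange S T q (w t q))) := by
      have := hYc.tendsto
      simp only [hY0] at this
      exact this
    have hGY : G (Y t q₁) = (q, w t q) := by rw [hY0]; exact hGl.self_of_nhds
    -- The points of `Y` lie on the moving graph, so `Y` is the graph map composed with the disc
    -- component of the local inverse of `Φ`. The continuity of the global inverse guarantees that
    -- the relevant preimages are those seen by the local one.
    have hnear : ∀ᶠ z : ℝ × ℝ × ℝ in 𝓝 (t, q₁),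
        Y z.1 z.2 = graphMap S T w z.1 (G (Y z.1 z.2)).1 := by
      filter_upwards [hYA, hYt.eventually (hΦ.eventually_mem (hbd t ht q hq) hGl),
        (continuous_fst.continuousAt (x := (t, q₁))).eventually (isOpen_Ioo.mem_nhds ht)]
        with z ⟨q', hq', he⟩ h2 h3
      have h4 : G (coordChange S T q' (w z.1 q')) = (q', w z.1 q') :=
        h2 (q', w z.1 q') (hbd z.1 h3 q' hq') he
      have h5 : G (Y z.1 z.2) = (q', w z.1 q') := by rw [← he]; exact h4
      rw [h5]
      exact he.symm
    have hGY2 : ContDiffAt ℝ 2 G (Y t q₁) := by rw [hY0]; exact hG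
    have key := normal_velocity_reparam (Y := Y) (ψ := fun t q => (G (Y t q)).1) (q := q₁) hU hX
      (by simp only [hGY]; exact ⟨ht, hq⟩)
      ((hGY2.comp q₁ (hYV.contDiffAt_two hV hVm)).fst)
      (((hGY2.differentiableAt two_ne_zero).comp t (hYV.difft (m := 0) hVm)).fst) hnear hn hv
    simp only [hGY] at key
    exact (nonlinearOp_eq_zero_iff hΦ hw ht hq
      (hb t (Ioo_subset_Icc_self ht) q (openDisc_one_subset hq)) (hK t ht q hq)).2 key
  · rintro h t ht - ⟨q, hq, rfl⟩
    have hm : Ioo 0 τ ×ˢ openDisc 1 ∈ 𝓝 (t, q) := hU.mem_nhds ⟨ht, hq⟩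
    -- The graph map itself serves as parametrization. That it covers the surface near the point
    -- with nearby parameters follows from the continuity of the inverse of `Φ`.
    refine ⟨graphMap S T w, q, rfl, ?_, fun V hV => ?_, ⟨_, hU, ⟨ht, hq⟩, hX⟩,
      cross_ne_zero_of_gaussCurv_pos (hK t ht q hq), hK t ht q hq,
      (nonlinearOp_eq_zero_iff hΦ hw ht hq
        (hb t (Ioo_subset_Icc_self ht) q (openDisc_one_subset hq)) (hK t ht q hq)).1 (h t ht q hq)⟩
    · filter_upwards [hm] with z hz
      exact ⟨z.2, hz.2, rfl⟩
    · have hV' : Prod.fst ⁻¹' V ∈ 𝓝 (q, w t q) := continuous_fst.continuousAt hV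
      filter_upwards [(continuous_snd.continuousAt (x := (t, graphMap S T w t q))).eventually
        (hΦ.eventually_mem (hbd t ht q hq) hV'),
        (continuous_fst.continuousAt (x := (t, graphMap S T w t q))).eventually
          (isOpen_Ioo.mem_nhds ht)] with z h1 h2 ⟨q', hq', he⟩
      exact ⟨q', h1 (q', w z.1 q') (hbd z.1 h2 q' hq') he, he⟩

end Flow

end

theorem mainTheorem5 (k : ℕ) (hk : 1 ≤ k) (α p : ℝ) (hα : 0 < α) (hα' : α ≤ 1)
    (hp : 0 < p) (hp' : p < 1)
    (B : Set R3) (hB : IsConvexBodyWithFlatSide B)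
    (S T : ℝ × ℝ → R3) (η : ℝ) (hΦ : IsCoordChange S T η)
    (w₀ : ℝ × ℝ → ℝ) (hw₀ : IsOfHolderClass (k + 2) α p B S T η w₀)
    (hstar : NonDegenerate p B) :
    -- in the coordinates `Φ`, the flow starting from `Σ₀` is the initial value problem for `w`
    (∀ τ : ℝ, 0 < τ → ∀ w : ℝ → ℝ × ℝ → ℝ, MemDisc (k + 2) α p τ w →
      (∀ t ∈ Icc 0 τ, ∀ q ∈ closedDisc, |w t q| ≤ η) →
      (∀ t ∈ Ioo 0 τ, ∀ q ∈ openDisc 1, 0 < gaussCurvAt (graphMap S T w) t q) →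
      ((SolvesHMCF (graphSurface S T w) (Ioo 0 τ) ∧ graphSurface S T w 0 = upperPart B) ↔
        ((∀ t ∈ Ioo 0 τ, ∀ q ∈ openDisc 1, nonlinearOp (hmcfNonlinearity S T) w t q = 0) ∧
          ∀ q ∈ closedDisc, w 0 q = w₀ q))) ∧
    MemDiscStationary (k + 2) α p w₀ ∧
    -- the linearization near `w₀` satisfies the conditions on linear degenerate operators
    ∃ lam μ : ℝ, 0 < lam ∧ 0 < μ ∧ ∀ τ : ℝ, 0 < τ →
      LinearizationAdmissible k α p τ lam μ (hmcfNonlinearity S T) w₀ := by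
  refine ⟨fun τ hτ w hw hb hK => ?_, hw₀.regular,
    hw₀.exists_linearizationAdmissible hα hα' hp hp' hB hΦ hstar⟩
  rw [solvesHMCF_iff hΦ hw hb hK, ← hw₀.graph]
  refine and_congr_right fun _ => ⟨fun h => ?_, fun h => ?_⟩
  · exact eq_on_of_graphSurface_eq (w₂ := fun _ => w₀) hΦ
      (hw.continuousOn_closedDisc ⟨le_rfl, hτ.le⟩)
      (MemDisc.continuousOn_closedDisc hw₀.regular (t := 0) ⟨le_rfl, zero_le_one⟩)
      (hb 0 ⟨le_rfl, hτ.le⟩) hw₀.bound h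
  · exact image_congr fun q hq => by
      simp only [graphMap, h q (openDisc_one_subset hq)]
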